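/- **Setting.** Let $p:(X,\mu)\to(Y,\nu)$ be the universal covering, by a translation map, of a translation surface $Y$ (a connected Hausdorff surface with an atlas whose transition maps are locally translations). Translation surfaces carry the length distance of the flat metric; $\overline{X}$, $\overline{Y}$ are the metric completions and $\partial X=\overline{X}\setminus X$, $\partial Y=\overline Y\setminus Y$ the frontiers. Assume that $Y$ is precompact (totally bounded), that $\partial Y$ is finite and nonempty, and that $\partial X$ is discrete. Let $\mathrm{dev}:X\to\mathbb{R}^2$ be a developing map, extended continuously to $\overline{X}$. A subset of $X$ is *convex* if any two of its points are joined by a geodesic segment in it; a subset $P\subset\overline{X}$ is convex if any two of its points lie in the closure of a convex subset of $X$. For a quadratic form $q$ on $\mathbb{R}^3$ put $U_q=\{(x_1,x_2): q(x_1,x_2,1)<0\}$; when $\emptyset\ne U_q\neq\mathbb{R}^2$ it is a (nontrivial) planar subconic, and the set of these carries the quotient topology from the space of quadratic forms. A *subconic* of $X$ is a convex $U\subset X$ such that $\mathrm{dev}(U)$ is a nontrivial planar subconic. The set $\mathcal{S}(X,\mu)$ of all subconics has the coarsest topology for which $U\mapsto\mathrm{dev}(U)$ is continuous and $\{U: x\in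 U\}$ is open for every $x\in X$. Let $\partial U$ be the boundary of $U$ in $\overline{X}$. Let $\mathcal{S}_n$ be the set of subconics $U$ such that $\partial U\cap\partial X$ has at least $n$ points and $A=\mathrm{dev}(\partial U\cap\partial X)$ has maximal span, i.e. for some $B\subset A$ the span of $\{b-b':b,b'\in B\}$ has dimension at least $2$ or at least $\mathrm{Card}(A)-1$. Elements of $\mathcal{S}_5$ are called *rigid*. For $Z\subset\partial X$ let $\mathcal{S}_Z$ be the set of subconics $U$ with $\partial U\cap\partial X=Z$ such that $Z$ meets each component of $\partial U$, and let $\overline{\mathcal{S}_Z}$ be its closure in $\mathcal{S}(X,\mu)$; $Z$ is *realizable* if $\mathcal{S}_Z\ne\emptyset$ and $\mathrm{Card}(Z)\geq 3$. We say that $Z\subset\partial X$ *defines a polygon* if there is a convex $P\subset\overline{X}$ with nonempty interior such that $\mathrm{dev}(P)$ is the convex hull of $\mathrm{dev}(Z)$; it defines a triangle (quadrilateral) if moreover $Z$ has $3$ ($4$) points and this convex hull has $3$ ($4$) vertices. Let $Z=\{z_1,z_2,z_3\}\subset\partial X$ define a triangle, and write $\hat z_i=(\mathrm{dev}(z_i),1)\in\mathbb{R}^3$.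 Let $d_1,d_2,d_3$ be quadratic forms on $\mathbb{R}^3$ vanishing at $\hat z_1,\hat z_2,\hat z_3$, such that $\hat z_i$ lies in the radical of $d_i$ and $d_i(x,1)<0$ for $x$ in the interior of the convex hull of $\mathrm{dev}(Z)$. Let $T=\{\sum t_id_i:\sum t_i=1\}$, and for $U\in\overline{\mathcal{S}_Z}$ let $f(U)$ be the form $q\in T$ with $U_q=\mathrm{dev}(U)$. **Theorem.** (1) The map $f$ is well defined on $\overline{\mathcal{S}_Z}$, and it is a homeomorphism from $\overline{\mathcal{S}_Z}$ onto a compact convex polygon in the plane $T$ with finitely many sides (the convex hull of finitely many points; it is empty if $\mathcal{S}_Z=\emptyset$). If $\mathcal{S}_Z\neq\emptyset$, this polygon has nonempty interior in $T$, its interior is $f(\mathcal{S}_Z)$, and $\overline{\mathcal{S}_Z}=\{U: Z\subset\partial U\cap\partial X\}$. The sides of $f(\overline{\mathcal{S}_Z})$ are exactly the sets $f(\overline{\mathcal{S}_{Z'}})$ where $Z\subset Z'\subset\partial X$, $Z'$ is realizable and defines a quadrilateral. The vertices of $f(\overline{\mathcal{S}_Z})$ are exactly the points $f(U)$ where $U\in\overline{\mathcal{S}_Z}$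 is rigid, and then $Z\subset\partial U\cap\partial X$. A vertex $f(U)$ belongs to a side $f(\overline{\mathcal{S}_{Z'}})$ if and only if $Z'\subset\partial U\cap\partial X$. (2) The space $\mathcal{S}_3$ and the cells $\mathcal{S}_Z$, $Z\subset\partial X$ realizable, constitute a $2$-dimensional polygonal cell complex with $1$-skeleton $\mathcal{S}_4$ and $0$-skeleton $\mathcal{S}_5$. That is: $\mathcal{S}_3$ is Hausdorff; the cells are nonempty and partition $\mathcal{S}_3$; they have dimensions at most $2$, and some cell has dimension $2$; the closure of a cell of dimension $n$ is homeomorphic to an $n$-dimensional convex polytope in $\mathbb{R}^n$ so that the cell corresponds to the interior and each $k$-dimensional face corresponds to the closure of a cell of dimension $k$; two closed cells that meet intersect in a closed cell; the union of the cells of dimension at most $1$ is $\mathcal{S}_4$ and the union of the cells of dimension $0$ is $\mathcal{S}_5$. (The topology of $\mathcal{S}_3$ is the one induced from $\mathcal{S}(X,\mu)$, not the weak topology of the cells.) -/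

import Mathlib

open Set Filter Topology
open scoped ENNReal

/-! ### Translation surfaces -/

namespace TranslationSurface

/-- The Euclidean plane. -/
abbrev Plane : Type := EuclideanSpace ℝ (Fin 2)

/-- The charts of `X` form a translation atlas: every change of charts is locally a translation
(hence a translation on each connected component of the overlap). -/
class TranslationAtlas (X : Type*) [TopologicalSpace X] [ChartedSpace Plane X] : Prop where
  transition : ∀ e ∈ atlas Plane X, ∀ e' ∈ atlas Plane X, ∀ x ∈ e.source ∩ e'.source,
    ∃ v : Plane, ∀ᶠ y in 𝓝 x, e' y = e y + v

/-- A translation map: continuous, and a translation when read in charts. -/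
def IsTranslationMap {X Y : Type*} [TopologicalSpace X] [ChartedSpace Plane X]
    [TopologicalSpace Y] [ChartedSpace Plane Y] (f : X → Y) : Prop :=
  Continuous f ∧ ∀ x : X, ∀ e ∈ atlas Plane X, x ∈ e.source →
    ∀ e' ∈ atlas Plane Y, f x ∈ e'.source → ∃ v : Plane, ∀ᶠ y in 𝓝 x, e' (f y) = e y + v

/-- A developing map: a translation map to the plane (with its standard translation structure).
On a simply connected translation surface it exists and is unique up to a translation. -/
def IsDevelopingMap {X : Type*} [TopologicalSpace X] [ChartedSpace Plane X]
    (dev : X → Plane) : Prop :=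
  IsTranslationMap dev

section Metric

variable {X : Type*} [TopologicalSpace X] [ChartedSpace Plane X]

/-- `γ : [0,1] → X` is a geodesic segment with constant velocity `v` in the charts. -/
def IsGeodesic (γ : unitInterval → X) (v : Plane) : Prop :=
  Continuous γ ∧ ∀ t : unitInterval, ∀ e ∈ atlas Plane X, γ t ∈ e.source →
    ∀ᶠ s in 𝓝 t, e (γ s) = e (γ t) + ((s : ℝ) - (t : ℝ)) • v

/-- `BrokenGeodesic x y ℓ`: a finite concatenation of geodesic segments of total length `ℓ`
leads from `x` to `y`. -/
inductive BrokenGeodesic : X → X → ℝ≥0∞ → Prop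
  | nil (x : X) : BrokenGeodesic x x 0
  | cons {z : X} {ℓ : ℝ≥0∞} (γ : unitInterval → X) (v : Plane) (hγ : IsGeodesic γ v)
      (h : BrokenGeodesic (γ 1) z ℓ) : BrokenGeodesic (γ 0) z (‖v‖ₑ + ℓ)

theorem BrokenGeodesic.trans {x y z : X} {a b : ℝ≥0∞} (h : BrokenGeodesic x y a)
    (h' : BrokenGeodesic y z b) : BrokenGeodesic x z (a + b) := by
  induction h with
  | nil x => simpa using h'
  | cons γ v hγ _ ih =>
    rw [add_assoc]
    exact .cons γ v hγ (ih h')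

theorem IsGeodesic.symm {γ : unitInterval → X} {v : Plane} (h : IsGeodesic γ v) :
    IsGeodesic (γ ∘ unitInterval.symm) (-v) := by
  refine ⟨h.1.comp unitInterval.continuous_symm, fun t e he ht => ?_⟩
  have h1 := h.2 (unitInterval.symm t) e he ht
  have h2 := (unitInterval.continuous_symm.tendsto t).eventually h1
  filter_upwards [h2] with s hs
  simp only [Function.comp_apply, hs, unitInterval.coe_symm_eq, smul_neg, ← neg_smul]
  congr 2
  ring

theorem BrokenGeodesic.symm {x y : X} {a : ℝ≥0∞} (h : BrokenGeodesic x y a) :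
    BrokenGeodesic y x a := by
  induction h with
  | nil x => exact .nil x
  | @cons z ℓ γ v hγ _ ih =>
    have h1 : BrokenGeodesic (γ 1) (γ 0) (‖v‖ₑ + 0) := by
      have := BrokenGeodesic.cons (γ ∘ unitInterval.symm) (-v) hγ.symm
        (.nil ((γ ∘ unitInterval.symm) 1))
      simpa using this
    rw [add_zero] at h1
    rw [add_comm]
    exact ih.trans h1

/-- A copy of `X` carrying the uniform structure of the length distance. -/
def MetricCopy (X : Type*) : Type _ := X

/-- The length distance of the flat metric: the infimum of the lengths of broken geodesics. -/
noncomputable instance : PseudoEMetricSpace (MetricCopy X) where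
  edist x y := ⨅ (ℓ : ℝ≥0∞) (_ : BrokenGeodesic (X := X) x y ℓ), ℓ
  edist_self x := le_antisymm (iInf₂_le 0 (BrokenGeodesic.nil (X := X) x)) zero_le
  edist_comm x y := le_antisymm
    (le_iInf₂ fun ℓ h => iInf₂_le ℓ h.symm) (le_iInf₂ fun ℓ h => iInf₂_le ℓ h.symm)
  edist_triangle x y z := by
    simp only [ENNReal.iInf_add, ENNReal.add_iInf]
    exact le_iInf₂ fun b hb => le_iInf₂ fun a ha => iInf₂_le _ (ha.trans hb)

variable (X) in
/-- The metric completion of `X`. -/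
abbrev Bar : Type _ := UniformSpace.Completion (MetricCopy X)

/-- The canonical map of `X` into its completion. -/
noncomputable def toBar (x : X) : Bar X :=
  (UniformSpace.Completion.coe' : MetricCopy X → Bar X) x

variable (X) in
/-- The frontier `∂X`: the points of the completion that do not belong to `X`. -/
def bdry : Set (Bar X) := (range (toBar : X → Bar X))ᶜ

variable (X) in
/-- `X` is precompact (totally bounded) for the length distance. -/
def Precompact : Prop := TotallyBounded (univ : Set (MetricCopy X))

/-- The continuous extension of the developing map to the completion. -/
noncomputable def devBar (dev : X → Plane) : Bar X → Plane :=
  UniformSpace.Completion.extension (show MetricCopy X → Plane from dev)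

/-- A subset of `X` is convex if any two of its points are joined by a geodesic segment in it. -/
def IsConvex (C : Set X) : Prop :=
  ∀ x ∈ C, ∀ y ∈ C, ∃ (γ : unitInterval → X) (v : Plane),
    IsGeodesic γ v ∧ γ 0 = y ∧ γ 1 = x ∧ range γ ⊆ C

/-- A subset of the completion is convex if any two of its points lie in the closure of
a convex subset of `X`. -/
def IsConvexBar (P : Set (Bar X)) : Prop :=
  ∀ y ∈ P, ∀ y' ∈ P, ∃ C : Set X, IsConvex C ∧ y ∈ closure (toBar '' C) ∧
    y' ∈ closure (toBar '' C)

end Metric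

/-! ### Quadratic forms and planar subconics -/

/-- Real quadratic forms on `ℝ³`. -/
abbrev Q3 : Type := QuadraticForm ℝ (Fin 3 → ℝ)

/-- The topology of the finite-dimensional space `Q3` (pointwise convergence). -/
instance : TopologicalSpace Q3 :=
  TopologicalSpace.induced (fun (q : Q3) (v : Fin 3 → ℝ) => q v) inferInstance

/-- The point `(x₁, x₂, 1)`. -/
def hat (x : Plane) : Fin 3 → ℝ := ![x 0, x 1, 1]

/-- The subconic of the plane associated to `q`. -/
def sublevel (q : Q3) : Set Plane := {x | q (hat x) < 0}

/-- Nontrivial planar subconics, i.e. those that are neither empty nor the whole plane. -/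
def PlaneSubconic : Type :=
  {V : Set Plane // ∃ q : Q3, V = sublevel q ∧ V.Nonempty ∧ V ≠ univ}

/-- A set of planar subconics is open iff the set of the corresponding forms is open. -/
instance : TopologicalSpace PlaneSubconic :=
  TopologicalSpace.coinduced
    (fun q : {q : Q3 // (sublevel q).Nonempty ∧ sublevel q ≠ univ} =>
      (⟨sublevel q.1, q.1, rfl, q.2⟩ : PlaneSubconic)) inferInstance

/-- `d` is a negative natural basis of the space of the forms vanishing at the three points
`hat (w i)`: the point `hat (w i)` lies in the radical of `d i`, and each `d i` is negative
on the interior of the triangle. -/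
def IsNegativeNaturalBasis (w : Fin 3 → Plane) (d : Fin 3 → Q3) : Prop :=
  ∀ i, (∀ j, d i (hat (w j)) = 0) ∧ (∀ v, QuadraticMap.polar (d i) (hat (w i)) v = 0) ∧
    ∀ x ∈ interior (convexHull ℝ (range w)), d i (hat x) < 0

/-- The plane of the forms `∑ tᵢ dᵢ` with `∑ tᵢ = 1`. -/
def formPlane (d : Fin 3 → Q3) : AffineSubspace ℝ Q3 := affineSpan ℝ (range d)

/-- A subset of the plane has maximal span. -/
def HasMaximalSpan (A : Set Plane) : Prop :=
  ∃ B ⊆ A, 2 ≤ Module.finrank ℝ (vectorSpan ℝ B) ∨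
    A.encard ≤ (Module.finrank ℝ (vectorSpan ℝ B) : ℕ∞) + 1

/-! ### Subconics in a simply connected translation surface -/

section Subconics

variable {X : Type*} [TopologicalSpace X] [ChartedSpace Plane X]

/-- The subconics in `X`: convex subsets developing onto a nontrivial planar subconic. -/
def Subconic (dev : X → Plane) : Type _ :=
  {U : Set X // IsConvex U ∧ ∃ q : Q3, dev '' U = sublevel q ∧ (dev '' U).Nonempty ∧
    dev '' U ≠ univ}

variable (dev : X → Plane)

/-- The planar subconic onto which a subconic in `X` develops. -/
def develop (U : Subconic dev) : PlaneSubconic := ⟨dev '' U.1, U.2.2⟩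

/-- The topology that makes `develop` a local embedding: the coarsest topology for which `develop`
is continuous and the set of the subconics containing a given point of `X` is open.
(`develop` is injective on the subconics containing a given point, but not globally.) -/
instance : TopologicalSpace (Subconic dev) :=
  TopologicalSpace.induced (develop dev) inferInstance ⊓
    TopologicalSpace.generateFrom (range fun x : X => {U : Subconic dev | x ∈ U.1})

variable {dev}

/-- The boundary `∂U` in the completion of `X`. -/
def Subconic.boundary (U : Subconic dev) : Set (Bar X) := frontier (toBar '' U.1)

/-- The set `∂U ∩ ∂X` of the cone points met by `U`. -/
def Subconic.conePoints (U : Subconic dev) : Set (Bar X) := U.boundary ∩ bdry X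

variable (dev)

/-- `𝒮_Z`: the subconics `U` with `∂U ∩ ∂X = Z` such that `Z` meets each component of `∂U`. -/
def cell (Z : Set (Bar X)) : Set (Subconic dev) :=
  {U | U.conePoints = Z ∧
    ∀ b ∈ U.boundary, (connectedComponentIn U.boundary b ∩ Z).Nonempty}

/-- The stratum `𝒮_n`. -/
def stratum (n : ℕ) : Set (Subconic dev) :=
  {U | (n : ℕ∞) ≤ U.conePoints.encard ∧ HasMaximalSpan (devBar dev '' U.conePoints)}

/-- Rigid subconics. -/
def IsRigid (U : Subconic dev) : Prop := U ∈ stratum dev 5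

/-- `Z ⊆ ∂X` defines a polygon. -/
def DefinesPolygon (Z : Set (Bar X)) : Prop :=
  Z ⊆ bdry X ∧ ∃ P : Set (Bar X), IsConvexBar P ∧ (interior P).Nonempty ∧
    devBar dev '' P = convexHull ℝ (devBar dev '' Z)

/-- `Z ⊆ ∂X` has `n` points and defines a polygon with `n` vertices. -/
def DefinesNGon (n : ℕ) (Z : Set (Bar X)) : Prop :=
  DefinesPolygon dev Z ∧ Z.encard = n ∧
    (extremePoints ℝ (convexHull ℝ (devBar dev '' Z))).encard = n

/-- The map `f`: it sends `U` to the form `q` in the plane of forms `formPlane d` that satisfies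
`U_q = dev(U)`. -/
noncomputable def cellMap (d : Fin 3 → Q3) (U : Subconic dev) : Q3 :=
  Function.invFunOn sublevel (formPlane d : Set Q3) (dev '' U.1)

end Subconics

/-! ### Polygons and polygonal cell complexes -/

/-- `P` is a convex polytope: the convex hull of finitely many points. -/
def IsPolytope {V : Type*} [AddCommGroup V] [Module ℝ V] (P : Set V) : Prop :=
  ∃ F : Set V, F.Finite ∧ P = convexHull ℝ F

/-- `G` is a nonempty face of `P` of dimension `k`. -/
def IsFace {V : Type*} [AddCommGroup V] [Module ℝ V] (k : ℕ) (P G : Set V) : Prop :=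
  G.Nonempty ∧ Convex ℝ G ∧ IsExtreme ℝ P G ∧ Module.finrank ℝ (vectorSpan ℝ G) = k

/-- A polygonal cell complex structure of dimension `2` on a Hausdorff space `K`: a partition of
`K` into (open) cells of dimension at most `2`, such that each closed cell is a convex polytope
whose faces are closed cells, and any two closed cells are disjoint or meet in a closed cell.
(The topology of `K` need not be the weak topology defined by the closed cells.) -/
structure PolygonalComplex (K : Type*) [TopologicalSpace K] where
  /-- The open cells. -/
  cells : Set (Set K)
  /-- The dimension of a cell. -/
  dim : Set K → ℕ
  t2 : T2Space K
  cell_nonempty : ∀ e ∈ cells, e.Nonempty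
  pairwiseDisjoint : cells.PairwiseDisjoint id
  cover : ⋃₀ cells = univ
  dim_le : ∀ e ∈ cells, dim e ≤ 2
  exists_dim : ∃ e ∈ cells, dim e = 2
  /-- The closed cell is homeomorphic to a polytope of full dimension in `ℝ^(dim e)`, in such
  a way that the open cell is the interior and that the faces are the closures of cells of the
  same dimension. -/
  polytope : ∀ e ∈ cells, ∃ (P : Set (EuclideanSpace ℝ (Fin (dim e)))) (φ : closure e ≃ₜ P),
    IsPolytope P ∧ (interior P).Nonempty ∧
    (∀ u : closure e, (u : K) ∈ e ↔ (φ u : EuclideanSpace ℝ (Fin (dim e))) ∈ interior P) ∧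
    ∀ (k : ℕ) (G : Set (EuclideanSpace ℝ (Fin (dim e)))), IsFace k P G →
      ∃ e' ∈ cells, dim e' = k ∧
        closure e' = (↑) '' {u : closure e | (φ u : EuclideanSpace ℝ (Fin (dim e))) ∈ G}
  inter : ∀ e ∈ cells, ∀ e' ∈ cells, (closure e ∩ closure e').Nonempty →
    ∃ e'' ∈ cells, closure e ∩ closure e' = closure e''

/-- The `k`-skeleton: the union of the cells of dimension at most `k`. -/
def PolygonalComplex.skeleton {K : Type*} [TopologicalSpace K] (C : PolygonalComplex K) (k : ℕ) :
    Set K :=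
  ⋃₀ {e | e ∈ C.cells ∧ C.dim e ≤ k}

end TranslationSurface

set_option linter.unusedSectionVars false

namespace TranslationSurface

open AffineMap (lineMap)

/-! ### Lifting segments through a local homeomorphism to the plane -/

/-! A point `x` of `X` turns the problem into one about the plane. Following straight segments from
`x` gives a partial inverse `devExp` of `dev`. A segment that cannot be followed to its end runs
into a visible cone point, and the images of these points form the set `obst dev x`. A convex open
region around `dev x` lifts exactly when it contains no obstacle. Hence the subconics containing `x`
are, up to a positive factor, the forms in `admissible dev x`: convex, negative at `dev x`,
nonnegative at every obstacle. The cone points of a subconic correspond to the obstacles where its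
form vanishes (`conePoints_eq`).

The global hypotheses enter as follows. Since `Y` is precompact with nonempty frontier, immersed
discs have bounded radius (`exists_radius_bound`); this excludes parabolas and half-planes, so an
admissible form defines an ellipse or a strip. For strips, recurrence in `Y` produces a deck
transformation that preserves the obstacles on the boundary lines (`exists_symmetry`). Discreteness
of the frontier of `X` makes obstacles isolated. These facts make up `Tame`, established in
`tame_obst`. Simple connectedness is also used for uniqueness: two subconics through the same three
noncollinear cone points contain the same points of `X` over the interior of the triangle
(`mem_of_conePoints`). Otherwise a nowhere vanishing complex function on `X` would have a logarithm
with two different increments between the same two points.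

Consequently the subconics through a triangle are parametrized by `faceAt`, the admissible forms
vanishing at the three vertices, normalized by one linear equation (`exists_homeomorph_faceAt`).
This is a compact convex set in a plane, cut out by possibly infinitely many inequalities. It is a
polygon because it looks like a cone near each of its forms `q₀`: the segment from `q₀` to a nearby
member can be prolonged a little (`Tame.eventually_extend`), so extreme points cannot accumulate.
Near an ellipse only its zeros among the obstacles matter; near a strip the inequalities that matter
come from neighbouring obstacles on the boundary lines.

Two forms that are nonnegative on the obstacles have a sum vanishing only where both vanish. Faces
are therefore labelled by sets of zeros (`exists_eq_faceAt`), and three, four, or at least five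
zeros give dimension 2, 1, 0 (`finrank_tangent`), the last because five points determine an ellipse.
Closed cells become the conditions that the cone points contain a given set (`closure_cell`), and
intersecting closed cells corresponds to taking unions of these sets; this gives the complex. A cell
of dimension 2 exists by an extremal argument on circles without obstacles inside
(`Tame.exists_circle`), followed by a perturbation that keeps only three contacts. -/

section Star

variable {X : Type*} [TopologicalSpace X]

/-- `γ` is the lift to `X`, starting at `x`, of the segment from `dev x` to `a`. -/
def IsLiftSeg (dev : X → Plane) (x : X) (a : Plane) (γ : C(unitInterval, X)) : Prop :=
  γ 0 = x ∧ ∀ t : unitInterval, dev (γ t) = lineMap (dev x) a (t : ℝ)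

/-- The points `a` of the plane such that the segment from `dev x` to `a` lifts to `X`. -/
def star (dev : X → Plane) (x : X) : Set Plane := {a | ∃ γ, IsLiftSeg dev x a γ}

open Classical in
/-- The endpoint of the lift of the segment from `dev x` to `a`. -/
noncomputable def devExp (dev : X → Plane) (x : X) (a : Plane) : X :=
  if h : a ∈ star dev x then h.choose 1 else x

variable {dev : X → Plane} {x y : X} {a b c : Plane} {V : Set Plane}

theorem mem_star_self : dev x ∈ star dev x :=
  ⟨ContinuousMap.const _ x, rfl, fun t => by simp⟩

theorem dev_devExp (ha : a ∈ star dev x) : dev (devExp dev x a) = a := by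
  rw [devExp, dif_pos ha]
  simpa using ha.choose_spec.2 1

theorem lineMap_mem_star (ha : a ∈ star dev x) {t : ℝ} (ht : t ∈ Icc (0 : ℝ) 1) :
    lineMap (dev x) a t ∈ star dev x := by
  obtain ⟨γ, h0, h1⟩ := ha
  refine ⟨⟨fun s => γ (⟨t, ht⟩ * s), by fun_prop⟩, by simpa using h0, fun s => ?_⟩
  simp only [ContinuousMap.coe_mk, h1, AffineMap.lineMap_apply, vsub_eq_sub, vadd_eq_add]
  simp [smul_smul, mul_comm]

theorem segment_subset_star (ha : a ∈ star dev x) : segment ℝ (dev x) a ⊆ star dev x := by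
  intro b hb
  rw [segment_eq_image_lineMap] at hb
  obtain ⟨t, ht, rfl⟩ := hb
  exact lineMap_mem_star ha ht

section
variable [T2Space X] (hl : IsLocalHomeomorph dev)
include hl

theorem IsLiftSeg.eq {γ γ' : C(unitInterval, X)} (h : IsLiftSeg dev x a γ)
    (h' : IsLiftSeg dev x a γ') : γ = γ' := by
  ext t
  refine congr_fun ((T2Space.isSeparatedMap dev).eq_of_comp_eq hl.isLocallyInjective
    γ.continuous γ'.continuous ?_ 0 (h.1.trans h'.1.symm)) t
  ext1 t
  exact (h.2 t).trans (h'.2 t).symm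

theorem IsLiftSeg.devExp_eq {γ : C(unitInterval, X)} (h : IsLiftSeg dev x a γ) :
    devExp dev x a = γ 1 := by
  have ha : a ∈ star dev x := ⟨γ, h⟩
  rw [devExp, dif_pos ha, ha.choose_spec.eq hl h]

theorem devExp_self : devExp dev x (dev x) = x :=
  IsLiftSeg.devExp_eq hl (γ := ContinuousMap.const _ x) ⟨rfl, fun t => by simp⟩

theorem IsLiftSeg.devExp_lineMap {γ : C(unitInterval, X)} (h : IsLiftSeg dev x a γ)
    (t : unitInterval) : devExp dev x (lineMap (dev x) a (t : ℝ)) = γ t := by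
  have : IsLiftSeg dev x (lineMap (dev x) a (t : ℝ))
      ⟨fun s => γ (t * s), by fun_prop⟩ := by
    refine ⟨by simpa using h.1, fun s => ?_⟩
    simp only [ContinuousMap.coe_mk, h.2, AffineMap.lineMap_apply, vsub_eq_sub, vadd_eq_add]
    simp [smul_smul, mul_comm]
  rw [this.devExp_eq hl]
  simp

/-- A continuous local inverse of `dev` on a star-shaped set is given by `devExp`. -/
theorem section_eq_devExp (hV : StarConvex ℝ (dev x) V) {S : Plane → X} (hS : ContinuousOn S V)
    (hdS : ∀ a ∈ V, dev (S a) = a) (hx : S (dev x) = x) (ha : a ∈ V) :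
    a ∈ star dev x ∧ devExp dev x a = S a := by
  have hmem : ∀ t : unitInterval, lineMap (dev x) a (t : ℝ) ∈ V := by
    intro t
    rw [AffineMap.lineMap_apply_module]
    exact hV ha (by linarith [t.2.2]) t.2.1 (by ring)
  have h : IsLiftSeg dev x a ⟨fun t => S (lineMap (dev x) a (t : ℝ)),
      hS.comp_continuous (by fun_prop) hmem⟩ :=
    ⟨by simpa using hx, fun t => hdS _ (hmem t)⟩
  exact ⟨⟨_, h⟩, by rw [h.devExp_eq hl]; simp⟩

/-- Segments close to a liftable segment are liftable, and the endpoints of the lifts depend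
continuously on the endpoints of the segments. -/
theorem exists_nhds_star (ha : a ∈ star dev x) :
    ∃ N ∈ 𝓝 a, N ⊆ star dev x ∧ ContinuousOn (devExp dev x) N := by
  obtain ⟨γ, h0, h1⟩ := ha
  -- The lifting lemma asks for a lift `g` of the whole family of segments, continuous only along `t
  -- = 0` and along the segment to `a`. The extra copy of the plane supplies values of `g` at the
  -- parameters where no lift to `X` is known yet.
  let p : X ⊕ Plane → Plane := Sum.elim dev id
  have hp : IsLocalHomeomorph p := by
    have h1 : IsLocalHomeomorphOn p (range Sum.inl) := by
      rw [← image_univ]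
      exact IsLocalHomeomorphOn.of_comp_right (hl.isLocalHomeomorphOn (s := univ))
        (IsOpenEmbedding.inl.isLocalHomeomorph.isLocalHomeomorphOn)
    have h2 : IsLocalHomeomorphOn p (range Sum.inr) := by
      rw [← image_univ]
      exact IsLocalHomeomorphOn.of_comp_right
        ((Homeomorph.refl Plane).isLocalHomeomorph.isLocalHomeomorphOn (s := univ))
        (IsOpenEmbedding.inr.isLocalHomeomorph.isLocalHomeomorphOn)
    rintro (z | z)
    · exact h1 _ ⟨z, rfl⟩
    · exact h2 _ ⟨z, rfl⟩
  let f : C(unitInterval × Plane, Plane) :=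
    ⟨fun s => lineMap (dev x) s.2 (s.1 : ℝ), by
      simp only [AffineMap.lineMap_apply_module]; fun_prop⟩
  classical
  let g : unitInterval × Plane → X ⊕ Plane := fun s =>
    if s.1 = 0 then Sum.inl x else if s.2 = a then Sum.inl (γ s.1) else Sum.inr (f s)
  have hg0 : ∀ b, g (0, b) = Sum.inl x := fun b => by simp [g]
  have hga : ∀ t, g (t, a) = Sum.inl (γ t) := fun t => by
    by_cases ht : t = 0
    · simp [g, ht, h0]
    · simp [g, ht]
  obtain ⟨N, hN, g', hg'c, hg'f, hg'0, hg'a⟩ := hp.exists_lift_nhds (f := f) (g := g) (by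
    ext1 ⟨t, b⟩
    by_cases ht : t = 0
    · simp [g, ht, p, f]
    · by_cases hb : b = a
      · subst hb; simp [g, ht, p, f, h1]
      · simp [g, ht, hb, p]) (by simp only [hg0]; exact continuous_const) a (by
    simp only [hga]; fun_prop)
  have key : ∀ b ∈ N, ∃ γ' : C(unitInterval, X), IsLiftSeg dev x b γ' ∧
      ∀ t, g' (t, b) = Sum.inl (γ' t) := by
    intro b hb
    have hc : Continuous fun t => g' (t, b) :=
      hg'c.comp_continuous (by fun_prop) fun t => ⟨mem_univ _, hb⟩
    -- The path starts in the summand `X`, which is open and closed, so it never enters the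
    -- auxiliary copy of the plane.
    have hr : range (fun t => g' (t, b)) ⊆ range Sum.inl := by
      apply (isPreconnected_range hc).subset_isClopen isClopen_range_inl
      exact ⟨_, ⟨0, rfl⟩, x, ((hg'0 b).trans (hg0 b)).symm⟩
    choose δ hδ using fun t => hr ⟨t, rfl⟩
    have hδc : Continuous δ := by
      refine (IsEmbedding.inl (X := X) (Y := Plane)).continuous_iff.2 ?_
      convert hc using 1
      ext1 t; exact hδ t
    refine ⟨⟨δ, hδc⟩, ⟨?_, fun t => ?_⟩, fun t => (hδ t).symm⟩
    · have := (hδ 0).trans ((hg'0 b).trans (hg0 b))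
      exact Sum.inl_injective this
    · have := congr_fun hg'f (t, b)
      simp only [Function.comp_apply, ← hδ t] at this
      exact this
  refine ⟨N, hN, fun b hb => ?_, ?_⟩
  · obtain ⟨γ', h', -⟩ := key b hb
    exact ⟨γ', h'⟩
  · have h2 : ContinuousOn (fun b => g' (1, b)) N :=
      hg'c.comp (by fun_prop) fun b hb => ⟨mem_univ _, hb⟩
    rw [(IsEmbedding.inl (X := X) (Y := Plane)).continuousOn_iff]
    refine h2.congr fun b hb => ?_
    obtain ⟨γ', h', h''⟩ := key b hb
    simp [h'.devExp_eq hl, h'']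

theorem isOpen_star : IsOpen (star dev x) := by
  rw [isOpen_iff_mem_nhds]
  intro a ha
  obtain ⟨N, hN, h, -⟩ := exists_nhds_star hl ha
  exact mem_of_superset hN h

theorem continuousOn_devExp : ContinuousOn (devExp dev x) (star dev x) := by
  intro a ha
  obtain ⟨N, hN, -, h⟩ := exists_nhds_star hl ha
  exact (h.continuousAt hN).continuousWithinAt

/-- `devExp` is a continuous section of a local homeomorphism. Near one of its values `dev` is
injective, so a nearby point `z` must be the value of the section at `dev z`. -/
theorem isOpen_image_devExp (hV : IsOpen V) (hVs : V ⊆ star dev x) :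
    IsOpen (devExp dev x '' V) := by
  rw [isOpen_iff_mem_nhds]
  rintro _ ⟨a, ha, rfl⟩
  obtain ⟨e, he, rfl⟩ := hl (devExp dev x a)
  have h1 : ∀ᶠ b in 𝓝 a, devExp e x b ∈ e.source :=
    (continuousOn_devExp hl).continuousAt ((isOpen_star hl).mem_nhds (hVs ha))
      |>.eventually (e.open_source.mem_nhds he)
  have h2 : ∀ᶠ z in 𝓝 (devExp e x a), e z ∈ V ∧ devExp e x (e z) ∈ e.source := by
    have h3 := e.continuousAt he
    have h4 : ∀ᶠ b in 𝓝 a, b ∈ V ∧ devExp e x b ∈ e.source :=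
      Filter.Eventually.and (hV.mem_nhds ha) h1
    rw [ContinuousAt, dev_devExp (hVs ha)] at h3
    exact h3.eventually h4
  filter_upwards [h2, e.open_source.mem_nhds he] with z hz hz'
  exact ⟨e z, hz.1, e.injOn hz.2 hz' (dev_devExp (hVs hz.1))⟩

/-- Change of the base point on a convex set. -/
theorem devExp_base_change (hV : Convex ℝ V) (hVs : V ⊆ star dev x)
    (hb : b ∈ V) (ha : a ∈ V) :
    a ∈ star dev (devExp dev x b) ∧ devExp dev (devExp dev x b) a = devExp dev x a := by
  have hd := dev_devExp (hVs hb)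
  refine section_eq_devExp hl (V := V) ?_ ((continuousOn_devExp hl).mono hVs)
    (fun c hc => dev_devExp (hVs hc)) ?_ ha
  · rw [hd]; exact hV.starConvex hb
  · rw [hd]

theorem devExp_symm (ha : a ∈ star dev x) :
    dev x ∈ star dev (devExp dev x a) ∧ devExp dev (devExp dev x a) (dev x) = x := by
  have := devExp_base_change hl (convex_segment (dev x) a) (segment_subset_star ha)
    (right_mem_segment _ _ _) (left_mem_segment _ _ _)
  rwa [devExp_self hl] at this

/-- Concatenation of two lifted segments of the same line. -/
theorem devExp_concat (ha : a ∈ star dev x) (hb : b ∈ star dev (devExp dev x a))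
    (hab : a ∈ segment ℝ (dev x) b) :
    b ∈ star dev x ∧ devExp dev x b = devExp dev (devExp dev x a) b := by
  classical
  set y := devExp dev x a with hy
  have hdy : dev y = a := dev_devExp ha
  have h1 := segment_subset_star ha
  have h2 := segment_subset_star hb
  rw [hdy] at h2
  have hcl : ∀ u v : Plane, IsClosed (segment ℝ u v) := fun u v => by
    rw [segment_eq_image_lineMap]
    exact (isCompact_Icc.image (by fun_prop)).isClosed
  have hun : segment ℝ (dev x) a ∪ segment ℝ a b = segment ℝ (dev x) b := by
    apply subset_antisymm
    · refine union_subset ?_ ?_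
      · exact (convex_segment _ _).segment_subset (left_mem_segment _ _ _) hab
      · exact (convex_segment _ _).segment_subset hab (right_mem_segment _ _ _)
    · rw [segment_eq_image_lineMap] at hab
      obtain ⟨s, hs, rfl⟩ := hab
      intro z hz
      rw [segment_eq_image_lineMap] at hz
      obtain ⟨t, ht, rfl⟩ := hz
      rcases le_total t s with hts | hts
      · left
        rw [segment_eq_image_lineMap]
        rcases hs.1.eq_or_lt with h | h
        · have : t = 0 := le_antisymm (h ▸ hts) ht.1
          exact ⟨0, by simp, by simp [this]⟩
        · exact ⟨t / s, ⟨by have := ht.1; positivity, by rw [div_le_one h]; exact hts⟩, by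
            simp only [AffineMap.lineMap_apply, vsub_eq_sub, vadd_eq_add, add_sub_cancel_right,
              smul_smul, div_mul_cancel₀ t h.ne']⟩
      · right
        rw [segment_eq_image_lineMap]
        rcases hs.2.eq_or_lt with h | h
        · have : t = 1 := le_antisymm ht.2 (h ▸ hts)
          exact ⟨1, by simp, by simp [this]⟩
        · have h' : 0 < 1 - s := by linarith
          refine ⟨(t - s) / (1 - s), ⟨by have := sub_nonneg.2 hts; positivity, by
            rw [div_le_one h']; linarith [ht.2]⟩, ?_⟩
          simp only [AffineMap.lineMap_apply_module]
          have e : (t - s) / (1 - s) * (1 - s) = t - s := div_mul_cancel₀ _ h'.ne'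
          set k := (t - s) / (1 - s)
          simp only [smul_add, smul_smul]
          rw [add_assoc, ← add_smul]
          congr 2
          · linear_combination -e
          · linear_combination e
  -- The two lifts are glued along the common point `a`; continuity holds because the two closed
  -- segments cover the long one and the lifts agree on the overlap.
  let S : Plane → X := fun z => if z ∈ segment ℝ (dev x) a then devExp dev x z else devExp dev y z
  have hS1 : ∀ z ∈ segment ℝ (dev x) a, S z = devExp dev x z := fun z hz => if_pos hz
  have hS2 : ∀ z ∈ segment ℝ a b, S z = devExp dev y z := by
    intro z hz
    by_cases hz' : z ∈ segment ℝ (dev x) a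
    · rw [hS1 z hz']
      exact (devExp_base_change hl (convex_segment (dev x) a) h1 (right_mem_segment _ _ _) hz').2.symm
    · exact if_neg hz'
  have hSc : ContinuousOn S (segment ℝ (dev x) b) := by
    rw [← hun]
    refine ContinuousOn.union_of_isClosed ?_ ?_ (hcl _ _) (hcl _ _)
    · exact ((continuousOn_devExp hl).mono h1).congr hS1
    · exact ((continuousOn_devExp hl).mono h2).congr hS2
  have := section_eq_devExp hl (x := x) ((convex_segment _ _).starConvex (left_mem_segment _ _ _)) hSc
    (fun z hz => by
      rw [← hun] at hz
      rcases hz with hz | hz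
      · rw [hS1 z hz, dev_devExp (h1 hz)]
      · rw [hS2 z hz, dev_devExp (h2 hz)])
    (by rw [hS1 _ (left_mem_segment _ _ _), devExp_self hl]) (right_mem_segment ℝ (dev x) b)
  rw [hS2 b (right_mem_segment _ _ _)] at this
  exact this

theorem exists_ball_subset_star (x : X) : ∃ r > 0, Metric.ball (dev x) r ⊆ star dev x :=
  Metric.isOpen_iff.1 (isOpen_star hl) _ mem_star_self

theorem image_devExp_mem_nhds (hV : IsOpen V) (hVs : V ⊆ star dev x) (hx : dev x ∈ V) :
    devExp dev x '' V ∈ 𝓝 x :=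
  (isOpen_image_devExp hl hV hVs).mem_nhds ⟨_, hx, devExp_self hl⟩

end

end Star

end TranslationSurface

namespace TranslationSurface

open AffineMap (lineMap)

/-! ### Developing maps, geodesics and the length distance -/

section Developing

variable {X : Type*} [TopologicalSpace X] [ChartedSpace Plane X] {dev : X → Plane}

theorem IsDevelopingMap.eventually (hd : IsDevelopingMap dev) {x : X}
    {e : OpenPartialHomeomorph X Plane} (he : e ∈ atlas Plane X) (hx : x ∈ e.source) :
    ∃ v : Plane, ∀ᶠ y in 𝓝 x, dev y = e y + v := by
  obtain ⟨v, hv⟩ := hd.2 x e he hx (OpenPartialHomeomorph.refl Plane)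
    (by simp [chartedSpaceSelf_atlas]) (by simp)
  exact ⟨v, hv.mono fun y hy => by simpa using hy⟩

theorem IsDevelopingMap.isLocalHomeomorph (hd : IsDevelopingMap dev) : IsLocalHomeomorph dev := by
  refine IsLocalHomeomorph.mk _ fun x => ?_
  obtain ⟨v, hv⟩ := hd.eventually (chart_mem_atlas Plane x) (mem_chart_source Plane x)
  obtain ⟨s, hs, hso, hxs⟩ := eventually_nhds_iff.1 hv
  refine ⟨((chartAt Plane x).trans (Homeomorph.addRight v).toOpenPartialHomeomorph).restrOpen s hso,
    ?_, ?_⟩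
  · simpa using hxs
  · rintro y hy
    have : y ∈ s := by
      have := hy
      simp at this
      exact this.2
    simpa using hs y this

/-- In charts the geodesic condition says that `dev (γ t) - t • v` is locally constant, hence
constant on the interval. Geodesics are thus the lifts of segments. -/
theorem IsDevelopingMap.isGeodesic_iff (hd : IsDevelopingMap dev) {γ : unitInterval → X}
    {v : Plane} : IsGeodesic γ v ↔
      Continuous γ ∧ ∀ t : unitInterval, dev (γ t) = dev (γ 0) + (t : ℝ) • v := by
  constructor
  · rintro ⟨hc, h⟩
    refine ⟨hc, ?_⟩
    have hlc : IsLocallyConstant fun t : unitInterval => dev (γ t) - (t : ℝ) • v := by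
      rw [IsLocallyConstant.iff_eventually_eq]
      intro t
      obtain ⟨w, hw⟩ := hd.eventually (chart_mem_atlas Plane (γ t)) (mem_chart_source Plane (γ t))
      filter_upwards [h t _ (chart_mem_atlas Plane (γ t)) (mem_chart_source Plane (γ t)),
        hc.continuousAt.eventually hw] with s h1 h2
      rw [h2, h1, hw.self_of_nhds, sub_smul]
      abel
    intro t
    have := hlc.apply_eq_of_preconnectedSpace t 0
    simp only [Icc.coe_zero, zero_smul, sub_zero] at this
    rw [← this]; abel
  · rintro ⟨hc, h⟩
    refine ⟨hc, fun t e he ht => ?_⟩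
    obtain ⟨w, hw⟩ := hd.eventually he ht
    filter_upwards [hc.continuousAt.eventually hw] with s hs
    have h1 := hw.self_of_nhds
    have e1 : e (γ s) = dev (γ 0) + (s : ℝ) • v - w := by rw [← h, hs]; abel
    have e2 : e (γ t) = dev (γ 0) + (t : ℝ) • v - w := by rw [← h, h1]; abel
    rw [e1, e2, sub_smul]
    abel

theorem IsDevelopingMap.isGeodesic_of_isLiftSeg (hd : IsDevelopingMap dev) {x : X} {a : Plane}
    {γ : C(unitInterval, X)} (h : IsLiftSeg dev x a γ) : IsGeodesic γ (a - dev x) := by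
  rw [hd.isGeodesic_iff]
  refine ⟨γ.continuous, fun t => ?_⟩
  rw [h.2, h.1, AffineMap.lineMap_apply]
  simp [add_comm]

theorem IsDevelopingMap.isLiftSeg_of_isGeodesic (hd : IsDevelopingMap dev) {γ : unitInterval → X}
    {v : Plane} (h : IsGeodesic γ v) : IsLiftSeg dev (γ 0) (dev (γ 0) + v) ⟨γ, h.1⟩ := by
  rw [hd.isGeodesic_iff] at h
  refine ⟨rfl, fun t => ?_⟩
  rw [AffineMap.lineMap_apply]
  simp [h.2 t, add_comm]

theorem IsDevelopingMap.lift_isGeodesic [T2Space X] (hd : IsDevelopingMap dev)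
    {γ : unitInterval → X} {v : Plane} (h : IsGeodesic γ v) (t : unitInterval) :
    dev (γ 0) + (t : ℝ) • v ∈ star dev (γ 0) ∧
      devExp dev (γ 0) (dev (γ 0) + (t : ℝ) • v) = γ t := by
  have h1 := hd.isLiftSeg_of_isGeodesic h
  have e : lineMap (dev (γ 0)) (dev (γ 0) + v) (t : ℝ) = dev (γ 0) + (t : ℝ) • v := by
    rw [AffineMap.lineMap_apply]
    simp [add_comm]
  rw [← e]
  exact ⟨lineMap_mem_star ⟨_, h1⟩ t.2, h1.devExp_lineMap hd.isLocalHomeomorph t⟩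

theorem IsDevelopingMap.brokenGeodesic_devExp [T2Space X] (hd : IsDevelopingMap dev) {x : X}
    {a : Plane} (ha : a ∈ star dev x) :
    BrokenGeodesic x (devExp dev x a) ‖a - dev x‖ₑ := by
  obtain ⟨γ, hγ⟩ := ha
  rw [hγ.devExp_eq hd.isLocalHomeomorph]
  have := BrokenGeodesic.cons γ _ (hd.isGeodesic_of_isLiftSeg hγ) (.nil (γ 1))
  rwa [add_zero, hγ.1] at this

/-- Points at distance less than `r` of the centre of an immersed disc of radius `r` lie in the
disc. -/
theorem IsDevelopingMap.mem_ball_of_brokenGeodesic [T2Space X] (hd : IsDevelopingMap dev) {x : X}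
    {r : ℝ} (hr : Metric.ball (dev x) r ⊆ star dev x) {y z : X} {ℓ : ℝ≥0∞}
    (h : BrokenGeodesic y z ℓ) (hy : y ∈ devExp dev x '' Metric.ball (dev x) r)
    (hℓ : edist (dev y) (dev x) + ℓ < ENNReal.ofReal r) :
    z ∈ devExp dev x '' Metric.ball (dev x) r ∧
      edist (dev z) (dev x) ≤ edist (dev y) (dev x) + ℓ := by
  have hl := hd.isLocalHomeomorph
  induction h with
  | nil w => exact ⟨hy, by simp⟩
  | @cons z ℓ γ v hγ _ ih =>
    have hd1 := (hd.isGeodesic_iff.1 hγ).2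
    have hstep : ∀ t : unitInterval, edist (dev (γ 0) + (t : ℝ) • v) (dev x) ≤
        edist (dev (γ 0)) (dev x) + ‖v‖ₑ := by
      intro t
      rw [add_comm (edist (dev (γ 0)) (dev x))]
      refine (edist_triangle _ (dev (γ 0)) _).trans ?_
      gcongr
      rw [edist_eq_enorm_sub, add_sub_cancel_left, enorm_smul]
      refine mul_le_of_le_one_left zero_le ?_
      rw [Real.enorm_eq_ofReal t.2.1]
      exact ENNReal.ofReal_le_one.2 t.2.2
    have hmem : ∀ t : unitInterval, dev (γ 0) + (t : ℝ) • v ∈ Metric.ball (dev x) r := by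
      intro t
      rw [← Metric.eball_ofReal]
      refine lt_of_le_of_lt (hstep t) (lt_of_le_of_lt ?_ hℓ)
      gcongr
      exact le_self_add
    obtain ⟨a, ha, hax⟩ := hy
    have ha' : a = dev (γ 0) := by rw [← hax, dev_devExp (hr ha)]
    have h1 := hmem 1
    have key := devExp_base_change hl (convex_ball (dev x) r) hr ha h1
    rw [hax] at key
    have key2 := (hd.lift_isGeodesic hγ 1).2
    have h2 : edist (dev (γ 1)) (dev x) ≤ edist (dev (γ 0)) (dev x) + ‖v‖ₑ := by
      rw [hd1 1]; exact hstep 1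
    have := ih ⟨_, h1, key.2.symm.trans key2⟩ (by
      refine lt_of_le_of_lt ?_ hℓ
      rw [← add_assoc]; gcongr)
    refine ⟨this.1, this.2.trans ?_⟩
    rw [← add_assoc]; gcongr

/-- The identity map of `X` to the copy that carries the length distance. -/
def toCopy (x : X) : MetricCopy X := x

theorem edist_toCopy_le_of_brokenGeodesic {x y : X} {ℓ : ℝ≥0∞} (h : BrokenGeodesic x y ℓ) :
    edist (toCopy x) (toCopy y) ≤ ℓ :=
  iInf₂_le ℓ h

theorem exists_brokenGeodesic_of_edist_lt {x y : X} {r : ℝ≥0∞}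
    (h : edist (toCopy x) (toCopy y) < r) : ∃ ℓ < r, BrokenGeodesic x y ℓ := by
  have h' : (⨅ (ℓ : ℝ≥0∞) (_ : BrokenGeodesic (X := X) x y ℓ), ℓ) < r := h
  simp only [iInf_lt_iff] at h'
  obtain ⟨ℓ, hℓ, h2⟩ := h'
  exact ⟨ℓ, h2, hℓ⟩

theorem IsDevelopingMap.edist_dev_le_of_brokenGeodesic (hd : IsDevelopingMap dev) {x y : X}
    {ℓ : ℝ≥0∞} (h : BrokenGeodesic x y ℓ) : edist (dev x) (dev y) ≤ ℓ := by
  induction h with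
  | nil x => simp
  | cons γ v hγ _ ih =>
    refine (edist_triangle _ (dev (γ 1)) _).trans ?_
    gcongr
    rw [(hd.isGeodesic_iff.1 hγ).2 1, edist_comm, edist_eq_enorm_sub]
    simp

theorem IsDevelopingMap.edist_dev_le (hd : IsDevelopingMap dev) (x y : X) :
    edist (dev x) (dev y) ≤ edist (toCopy x) (toCopy y) :=
  le_iInf₂ fun _ h => hd.edist_dev_le_of_brokenGeodesic h

theorem IsDevelopingMap.edist_devExp_le [T2Space X] (hd : IsDevelopingMap dev) {x : X}
    {V : Set Plane} (hV : Convex ℝ V) (hVs : V ⊆ star dev x) {a b : Plane} (ha : a ∈ V)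
    (hb : b ∈ V) :
    edist (toCopy (devExp dev x a)) (toCopy (devExp dev x b)) ≤ edist a b := by
  obtain ⟨h1, h2⟩ := devExp_base_change hd.isLocalHomeomorph hV hVs ha hb
  have := edist_toCopy_le_of_brokenGeodesic (hd.brokenGeodesic_devExp h1)
  rwa [h2, dev_devExp (hVs ha), ← edist_eq_enorm_sub, edist_comm b] at this

theorem IsDevelopingMap.uniformContinuous_dev (hd : IsDevelopingMap dev) :
    UniformContinuous (show MetricCopy X → Plane from dev) := by
  have : LipschitzWith 1 (show MetricCopy X → Plane from dev) := fun x y => by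
    rw [ENNReal.coe_one, one_mul]; exact hd.edist_dev_le x y
  exact this.uniformContinuous

/-- A broken geodesic shorter than `s` that starts at the centre of an immersed disc of radius `s`
cannot leave it. Together with `edist_devExp_le`, this identifies small length balls with immersed
Euclidean discs. -/
theorem IsDevelopingMap.nhds_basis [T2Space X] (hd : IsDevelopingMap dev) {x : X} {r : ℝ}
    (hr : Metric.ball (dev x) r ⊆ star dev x) {y : X} {s : ℝ} (hsr : s ≤ r)
    (h : edist (toCopy x) (toCopy y) < ENNReal.ofReal s) :
    ∃ a ∈ Metric.ball (dev x) s, devExp dev x a = y := by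
  obtain ⟨ℓ, hℓ, hb⟩ := exists_brokenGeodesic_of_edist_lt h
  have hs0 : 0 < s := by
    by_contra! h0
    rw [ENNReal.ofReal_of_nonpos h0] at h
    exact not_lt_zero h
  have hs : Metric.ball (dev x) s ⊆ star dev x := (Metric.ball_subset_ball hsr).trans hr
  have := (hd.mem_ball_of_brokenGeodesic hs hb
    ⟨dev x, Metric.mem_ball_self hs0, devExp_self hd.isLocalHomeomorph⟩ (by simpa using hℓ)).1
  exact this

theorem IsDevelopingMap.isHomeomorph_toCopy [T2Space X] (hd : IsDevelopingMap dev) :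
    IsHomeomorph (toCopy : X → MetricCopy X) := by
  have hl := hd.isLocalHomeomorph
  have hnhds : ∀ x : X, map toCopy (𝓝 x) = 𝓝 (toCopy x) := by
    intro x
    obtain ⟨r, hr0, hr⟩ := exists_ball_subset_star hl x
    apply le_antisymm
    · show Tendsto toCopy (𝓝 x) (𝓝 (toCopy x))
      rw [Metric.nhds_basis_eball.tendsto_right_iff]
      intro ε hε
      -- The radius `ε` may be infinite; it is capped at 1 before being read as a real number.
      set s := min r (min ε 1).toReal with hs
      have hε1 : 0 < (min ε 1).toReal := ENNReal.toReal_pos (by simp [hε.ne']) (by simp)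
      have hs0 : 0 < s := lt_min hr0 hε1
      have hsub : Metric.ball (dev x) s ⊆ star dev x :=
        (Metric.ball_subset_ball (min_le_left _ _)).trans hr
      filter_upwards [image_devExp_mem_nhds hl Metric.isOpen_ball hsub (Metric.mem_ball_self hs0)]
      rintro _ ⟨a, ha, rfl⟩
      have h1 := hd.edist_devExp_le (convex_ball _ _) hsub ha (Metric.mem_ball_self hs0)
      rw [devExp_self hl] at h1
      refine lt_of_le_of_lt h1 ?_
      have h2 : edist a (dev x) < ENNReal.ofReal s := by
        rw [← Metric.eball_ofReal] at ha; exact ha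
      refine lt_of_lt_of_le h2 ?_
      refine (ENNReal.ofReal_le_ofReal (min_le_right _ _)).trans ?_
      rw [ENNReal.ofReal_toReal (by simp)]
      exact min_le_left _ _
    · intro t ht
      rw [mem_map] at ht
      have hc := (continuousOn_devExp hl (x := x)).continuousAt
        ((isOpen_star hl).mem_nhds mem_star_self)
      rw [ContinuousAt, devExp_self hl] at hc
      obtain ⟨s, hs0, hs⟩ := Metric.mem_nhds_iff.1 (hc ht)
      refine EMetric.mem_nhds_iff.2 ⟨ENNReal.ofReal (min s r), by simp [hs0, hr0], ?_⟩
      intro y hy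
      rw [Metric.mem_eball, edist_comm] at hy
      obtain ⟨a, ha, hay⟩ := hd.nhds_basis hr (min_le_right _ _) hy
      have := hs (Metric.ball_subset_ball (min_le_left _ _) ha)
      rw [mem_preimage, mem_preimage, hay] at this
      exact this
  refine ⟨continuous_iff_continuousAt.2 fun x => (hnhds x).le, ?_, Function.bijective_id⟩
  exact isOpenMap_iff_nhds_le.2 fun x => (hnhds x).ge

end Developing

end TranslationSurface

namespace TranslationSurface

open AffineMap (lineMap)
open scoped Uniformity

/-! ### The completion -/

section Completion

variable {X : Type*} [TopologicalSpace X] [ChartedSpace Plane X] {dev : X → Plane}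

theorem mem_uniformity_bar {u : Set (Bar X × Bar X)} (hu : u ∈ 𝓤 (Bar X)) :
    ∃ ε > 0, ∀ x y : X, edist (toCopy x) (toCopy y) < ε → (toBar x, toBar y) ∈ u := by
  have h := (UniformSpace.Completion.uniformContinuous_coe (MetricCopy X)) hu
  obtain ⟨ε, hε, h'⟩ := mem_uniformity_edist.1 h
  exact ⟨ε, hε, fun x y hxy => h' (a := toCopy x) (b := toCopy y) hxy⟩

theorem exists_entourage_bar {ε : ℝ≥0∞} (hε : 0 < ε) :
    ∃ u ∈ 𝓤 (Bar X), ∀ x y : X, (toBar x, toBar y) ∈ u → edist (toCopy x) (toCopy y) < ε := by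
  have h : {p : MetricCopy X × MetricCopy X | edist p.1 p.2 < ε} ∈ 𝓤 (MetricCopy X) :=
    mem_uniformity_edist.2 ⟨ε, hε, fun h => h⟩
  rw [← (UniformSpace.Completion.isUniformInducing_coe (MetricCopy X)).comap_uniformity] at h
  obtain ⟨u, hu, hu'⟩ := h
  exact ⟨u, hu, fun x y hxy => hu' (show (_, _) ∈ _ from hxy)⟩

theorem denseRange_toBar : DenseRange (toBar : X → Bar X) :=
  UniformSpace.Completion.denseRange_coe (α := MetricCopy X)

variable [T2Space X] (hd : IsDevelopingMap dev)
include hd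

theorem IsDevelopingMap.devBar_toBar (x : X) : devBar dev (toBar x) = dev x :=
  UniformSpace.Completion.extension_coe hd.uniformContinuous_dev (toCopy x)

omit [T2Space X] hd in
theorem continuous_devBar : Continuous (devBar dev) :=
  UniformSpace.Completion.continuous_extension

theorem IsDevelopingMap.isEmbedding_toBar : IsEmbedding (toBar : X → Bar X) := by
  have h : IsInducing (toBar : X → Bar X) :=
    (UniformSpace.Completion.isUniformInducing_coe (MetricCopy X)).isInducing.comp
      hd.isHomeomorph_toCopy.homeomorph.isInducing
  exact ⟨h, h.injective⟩

/-- Local compactness is the reason: a small closed disc around a point of `X` is compact, hence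
closed in the completion, so the completion adds no point near the centre. -/
theorem IsDevelopingMap.isOpen_range_toBar : IsOpen (range (toBar : X → Bar X)) := by
  have hl := hd.isLocalHomeomorph
  have hemb := hd.isEmbedding_toBar
  rw [isOpen_iff_mem_nhds]
  rintro _ ⟨x, rfl⟩
  obtain ⟨r, hr0, hr⟩ := exists_ball_subset_star hl x
  have hsub : Metric.closedBall (dev x) (r / 2) ⊆ star dev x :=
    (Metric.closedBall_subset_ball (by linarith)).trans hr
  have hcomp : IsCompact (toBar '' (devExp dev x '' Metric.closedBall (dev x) (r / 2))) :=
    ((isCompact_closedBall _ _).image_of_continuousOn ((continuousOn_devExp hl).mono hsub)).image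
      hemb.continuous
  have hN : devExp dev x '' Metric.ball (dev x) (r / 2) ∈ 𝓝 x :=
    image_devExp_mem_nhds hl Metric.isOpen_ball (Metric.ball_subset_closedBall.trans hsub)
      (Metric.mem_ball_self (by linarith))
  rw [hemb.nhds_eq_comap, mem_comap] at hN
  obtain ⟨t, ht, htN⟩ := hN
  obtain ⟨O, hOt, hO, hxO⟩ := mem_nhds_iff.1 ht
  refine mem_of_superset (hO.mem_nhds hxO) ?_
  calc O ⊆ closure (O ∩ range toBar) := denseRange_toBar.open_subset_closure_inter hO
    _ ⊆ closure (toBar '' (devExp dev x '' Metric.closedBall (dev x) (r / 2))) := by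
      apply closure_mono
      rintro _ ⟨hy, y, rfl⟩
      refine mem_image_of_mem _ ?_
      exact image_mono Metric.ball_subset_closedBall (htN (hOt hy))
    _ = _ := hcomp.isClosed.closure_eq
    _ ⊆ range toBar := image_subset_range _ _

theorem IsDevelopingMap.isOpenEmbedding_toBar : IsOpenEmbedding (toBar : X → Bar X) :=
  ⟨hd.isEmbedding_toBar, hd.isOpen_range_toBar⟩

theorem IsDevelopingMap.isClosed_bdry : IsClosed (bdry X) :=
  hd.isOpen_range_toBar.isClosed_compl

end Completion

/-! ### Visible cone points -/

section Visible

variable {X : Type*} [TopologicalSpace X]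

/-- The points `a` such that the half-open segment from `dev x` to `a` lifts. -/
def halfStar (dev : X → Plane) (x : X) : Set Plane :=
  {a | ∀ t ∈ Ico (0 : ℝ) 1, lineMap (dev x) a t ∈ star dev x}

/-- The images of the cone points that are visible from `x`. -/
def obst (dev : X → Plane) (x : X) : Set Plane := halfStar dev x \ star dev x

variable [ChartedSpace Plane X] {dev : X → Plane} {x : X} {a b : Plane} {V : Set Plane}

open Classical in
/-- The endpoint in the completion of the lift of a half-open segment. -/
noncomputable def barExp (dev : X → Plane) (x : X) (a : Plane) : Bar X :=
  if h : ∃ u, Tendsto (fun t : ℝ => toBar (devExp dev x (lineMap (dev x) a t))) (𝓝[<] 1) (𝓝 u)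
  then h.choose else toBar x

omit [ChartedSpace Plane X] in
theorem star_subset_halfStar : star dev x ⊆ halfStar dev x :=
  fun _ ha _ ht => lineMap_mem_star ha ⟨ht.1, ht.2.le⟩

theorem eventually_mem_Ico : ∀ᶠ t in 𝓝[<] (1 : ℝ), t ∈ Ico (0 : ℝ) 1 :=
  Ico_mem_nhdsLT one_pos

theorem tendsto_lineMap_one (a b : Plane) :
    Tendsto (fun t : ℝ => lineMap a b t) (𝓝[<] 1) (𝓝 b) := by
  have : Continuous fun t : ℝ => lineMap a b t := by fun_prop
  have h := (this.tendsto 1).mono_left (nhdsWithin_le_nhds (s := Iio 1))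
  simpa using h

variable [T2Space X] (hd : IsDevelopingMap dev)
include hd

/-- The part of the lift between the parameters `s` and `t` has length at most `|s - t| * M`,
uniformly in the endpoint. Thus `barExp` is a locally uniform limit of continuous maps. -/
theorem IsDevelopingMap.uniformCauchy_barExp (M : ℝ) :
    UniformCauchySeqOn (fun (t : ℝ) a => toBar (devExp dev x (lineMap (dev x) a t))) (𝓝[<] 1)
      (halfStar dev x ∩ Metric.closedBall (dev x) M) := by
  intro u hu
  obtain ⟨ε, hε, h⟩ := mem_uniformity_bar hu
  have h1 : ∀ᶠ p : ℝ × ℝ in 𝓝[<] 1 ×ˢ 𝓝[<] 1, edist p.1 p.2 * ENNReal.ofReal M < ε := by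
    have : Tendsto (fun p : ℝ × ℝ => edist p.1 p.2 * ENNReal.ofReal M) (𝓝 (1, 1)) (𝓝 (edist (1 : ℝ) 1 * ENNReal.ofReal M)) :=
      ENNReal.Tendsto.mul_const (continuous_edist.tendsto (1, 1)) (by simp)
    rw [edist_self, zero_mul, nhds_prod_eq] at this
    exact (this.mono_left (prod_mono nhdsWithin_le_nhds nhdsWithin_le_nhds)).eventually
      (gt_mem_nhds hε)
  filter_upwards [h1, eventually_mem_Ico.prod_mk eventually_mem_Ico] with p hp hp' a ha
  refine h _ _ (lt_of_le_of_lt ?_ hp)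
  have hconv : Convex ℝ ((fun t => lineMap (dev x) a t) '' Ico (0 : ℝ) 1) :=
    (convex_Ico 0 1).affine_image (lineMap (dev x) a)
  refine (hd.edist_devExp_le hconv ?_ ⟨_, hp'.1, rfl⟩ ⟨_, hp'.2, rfl⟩).trans ?_
  · rintro _ ⟨t, ht, rfl⟩
    exact ha.1 t ht
  · rw [edist_dist, dist_lineMap_lineMap, ENNReal.ofReal_mul dist_nonneg, ← edist_dist]
    gcongr
    rw [dist_comm]
    exact ha.2

theorem IsDevelopingMap.tendsto_barExp (ha : a ∈ halfStar dev x) :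
    Tendsto (fun t : ℝ => toBar (devExp dev x (lineMap (dev x) a t))) (𝓝[<] 1)
      (𝓝 (barExp dev x a)) := by
  have h := (hd.uniformCauchy_barExp (x := x) (dist a (dev x))).cauchy_map
    ⟨ha, Metric.mem_closedBall.2 le_rfl⟩
  have h' : ∃ u, Tendsto (fun t : ℝ => toBar (devExp dev x (lineMap (dev x) a t)))
      (𝓝[<] 1) (𝓝 u) := CompleteSpace.complete h
  rw [barExp, dif_pos h']
  exact h'.choose_spec

theorem IsDevelopingMap.continuousOn_barExp : ContinuousOn (barExp dev x) (halfStar dev x) := by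
  have hl := hd.isLocalHomeomorph
  intro b hb
  set M := dist b (dev x) + 1
  have h1 : TendstoUniformlyOn (fun (t : ℝ) a => toBar (devExp dev x (lineMap (dev x) a t)))
      (barExp dev x) (𝓝[<] 1) (halfStar dev x ∩ Metric.closedBall (dev x) M) :=
    (hd.uniformCauchy_barExp M).tendstoUniformlyOn_of_tendsto fun a ha => hd.tendsto_barExp ha.1
  have h2 := h1.continuousOn (Eventually.frequently (by
    filter_upwards [eventually_mem_Ico] with t ht
    refine hd.isEmbedding_toBar.continuous.comp_continuousOn
      ((continuousOn_devExp hl).comp (Continuous.continuousOn ?_) fun a ha => ha.1 t ht)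
    simp only [AffineMap.lineMap_apply_module]
    fun_prop))
  have h3 := h2 b ⟨hb, Metric.mem_closedBall.2 (by simp [M])⟩
  refine h3.mono_of_mem_nhdsWithin ?_
  refine inter_mem self_mem_nhdsWithin (mem_nhdsWithin_of_mem_nhds ?_)
  exact mem_of_superset (Metric.ball_mem_nhds b one_pos) fun z hz => by
    rw [Metric.mem_closedBall]
    have := dist_triangle z b (dev x)
    rw [Metric.mem_ball] at hz
    simp only [M]; linarith

theorem IsDevelopingMap.barExp_eq (ha : a ∈ star dev x) :
    barExp dev x a = toBar (devExp dev x a) := by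
  have hl := hd.isLocalHomeomorph
  refine tendsto_nhds_unique (hd.tendsto_barExp (star_subset_halfStar ha)) ?_
  refine (hd.isEmbedding_toBar.continuous.tendsto _).comp ?_
  exact ((continuousOn_devExp hl).continuousAt ((isOpen_star hl).mem_nhds ha)).tendsto.comp
    (tendsto_lineMap_one _ _)

theorem IsDevelopingMap.devBar_barExp (ha : a ∈ halfStar dev x) :
    devBar dev (barExp dev x a) = a := by
  have h1 := (continuous_devBar (dev := dev)).continuousAt.tendsto.comp (hd.tendsto_barExp ha)
  refine tendsto_nhds_unique h1 ((tendsto_lineMap_one (dev x) a).congr' ?_)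
  filter_upwards [eventually_mem_Ico] with t ht
  simp only [Function.comp_apply, hd.devBar_toBar, dev_devExp (ha t ht)]

omit [ChartedSpace Plane X] hd in
theorem mem_segment_lineMap {c a : Plane} {s t : ℝ} (hs : 0 ≤ s) (hst : s ≤ t) :
    lineMap c a s ∈ segment ℝ c (lineMap c a t) := by
  rcases hs.eq_or_lt with h | h
  · rw [← h]; simp [left_mem_segment]
  · have ht : 0 < t := h.trans_le hst
    rw [segment_eq_image_lineMap]
    exact ⟨s / t, ⟨by positivity, by rw [div_le_one ht]; exact hst⟩, by
      simp only [AffineMap.lineMap_apply, vsub_eq_sub, vadd_eq_add, add_sub_cancel_right,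
        smul_smul, div_mul_cancel₀ s ht.ne']⟩

/-- If the endpoint is a point `y` of `X`, the lift enters an immersed disc around `y` before time 1
and can be continued inside this disc past `y`. -/
theorem IsDevelopingMap.exists_extension (ha : a ∈ halfStar dev x)
    (h : barExp dev x a ∈ range (toBar : X → Bar X)) :
    ∃ δ > 0, ∀ t ∈ Icc (0 : ℝ) (1 + δ), lineMap (dev x) a t ∈ star dev x := by
  have hl := hd.isLocalHomeomorph
  obtain ⟨y, hy⟩ := h
  have hya : dev y = a := by rw [← hd.devBar_toBar, hy, hd.devBar_barExp ha]
  have h1 := hd.tendsto_barExp ha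
  rw [← hy] at h1
  have h2 : Tendsto (fun t : ℝ => devExp dev x (lineMap (dev x) a t)) (𝓝[<] 1) (𝓝 y) := by
    rw [hd.isEmbedding_toBar.nhds_eq_comap, tendsto_comap_iff]; exact h1
  obtain ⟨r, hr0, hr⟩ := exists_ball_subset_star hl y
  have h3 := h2 (image_devExp_mem_nhds hl Metric.isOpen_ball hr (Metric.mem_ball_self hr0))
  obtain ⟨s, hs, hs'⟩ := (Filter.Eventually.and (mem_map.1 h3) eventually_mem_Ico).exists
  obtain ⟨b, hb, hbs⟩ := hs
  have hbs' : b = lineMap (dev x) a s := by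
    rw [← dev_devExp (hr hb), hbs, dev_devExp (ha s hs')]
  have hcont : Continuous fun t : ℝ => lineMap (dev x) a t := by fun_prop
  have h4 : ∀ᶠ t in 𝓝 (1 : ℝ), lineMap (dev x) a t ∈ Metric.ball (dev y) r := by
    have h5 : Tendsto (fun t : ℝ => lineMap (dev x) a t) (𝓝 1) (𝓝 (dev y)) := by
      have := hcont.tendsto 1
      rw [AffineMap.lineMap_apply_one] at this
      rwa [hya]
    exact h5.eventually (Metric.ball_mem_nhds _ hr0)
  obtain ⟨δ, hδ, h6⟩ := Metric.eventually_nhds_iff.1 h4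
  refine ⟨δ / 2, by positivity, ?_⟩
  have hmem : lineMap (dev x) a (1 + δ / 2) ∈ star dev x := by
    have h7 : lineMap (dev x) a (1 + δ / 2) ∈ Metric.ball (dev y) r :=
      h6 (by rw [Real.dist_eq, add_sub_cancel_left, abs_of_pos] <;> linarith)
    have h8 := (devExp_base_change hl (convex_ball (dev y) r) hr hb h7).1
    rw [hbs] at h8
    exact (devExp_concat hl (ha s hs') h8
      (mem_segment_lineMap hs'.1 (by linarith [hs'.2]))).1
  intro t ht
  exact segment_subset_star hmem (mem_segment_lineMap ht.1 ht.2)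

theorem IsDevelopingMap.mem_star_of_barExp (ha : a ∈ halfStar dev x)
    (h : barExp dev x a ∈ range (toBar : X → Bar X)) : a ∈ star dev x := by
  obtain ⟨δ, hδ, h1⟩ := hd.exists_extension ha h
  simpa using h1 1 ⟨zero_le_one, by linarith⟩

theorem IsDevelopingMap.mem_obst_iff :
    a ∈ obst dev x ↔ a ∈ halfStar dev x ∧ barExp dev x a ∈ bdry X := by
  refine and_congr_right fun h => not_congr ⟨fun h' => ?_, hd.mem_star_of_barExp h⟩
  exact ⟨_, (hd.barExp_eq h').symm⟩

/-- A segment that does not lift meets an obstacle. -/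
theorem IsDevelopingMap.exists_mem_obst (hb : b ∉ star dev x) :
    ∃ a ∈ segment ℝ (dev x) b, a ∈ obst dev x := by
  -- The obstacle sits at the supremum of the parameters up to which the segment lifts. Since `star`
  -- is open and does not contain `b`, this supremum is not attained.
  set T : Set ℝ := {t | t ∈ Icc (0 : ℝ) 1 ∧ lineMap (dev x) b t ∈ star dev x}
  have h0 : (0 : ℝ) ∈ T := ⟨by simp, by simpa using mem_star_self⟩
  have hbdd : BddAbove T := ⟨1, fun t ht => ht.1.2⟩
  set s := sSup T
  have hs0 : 0 ≤ s := le_csSup hbdd h0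
  have hs1 : s ≤ 1 := csSup_le ⟨0, h0⟩ fun t ht => ht.1.2
  have hlt : ∀ t, 0 ≤ t → t < s → lineMap (dev x) b t ∈ star dev x := by
    intro t ht hts
    obtain ⟨t', ht', htt'⟩ := exists_lt_of_lt_csSup ⟨0, h0⟩ hts
    exact segment_subset_star ht'.2 (mem_segment_lineMap ht htt'.le)
  have hmul : ∀ t, lineMap (dev x) (lineMap (dev x) b s) t = lineMap (dev x) b (t * s) := by
    intro t
    simp only [AffineMap.lineMap_apply, vsub_eq_sub, vadd_eq_add, add_sub_cancel_right, smul_smul]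
  have hhalf : lineMap (dev x) b s ∈ halfStar dev x := by
    intro t ht
    rw [hmul]
    rcases hs0.eq_or_lt with h | h
    · rw [← h]; simpa using mem_star_self
    · exact hlt _ (mul_nonneg ht.1 hs0) (by nlinarith [ht.2])
  refine ⟨lineMap (dev x) b s, ?_, hhalf, fun hstar => ?_⟩
  · simpa using mem_segment_lineMap (c := dev x) (a := b) hs0 hs1
  · have hs1' : s ≠ 1 := by
      rintro h
      rw [h] at hstar
      exact hb (by simpa using hstar)
    have hs : s < 1 := lt_of_le_of_ne hs1 hs1'
    have hopen : ∀ᶠ t in 𝓝 s, lineMap (dev x) b t ∈ star dev x := by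
      have hc : Continuous fun t : ℝ => lineMap (dev x) b t := by fun_prop
      exact hc.continuousAt.eventually ((isOpen_star hd.isLocalHomeomorph).mem_nhds hstar)
    obtain ⟨t, ⟨h1, h2⟩, h3, h4⟩ := ((hopen.filter_mono nhdsWithin_le_nhds).and
      (Ioo_mem_nhdsGT hs)).exists.imp fun t h => (⟨⟨h.1, h.2⟩, h.2.1, h.2.2⟩ : (_ ∧ _) ∧ _ ∧ _)
    have : t ∈ T := ⟨⟨hs0.trans h3.le, h4.le⟩, h1⟩
    exact absurd (le_csSup hbdd this) (not_le.2 h3)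

/-- The only thing that stops a segment from lifting is an obstacle on it. This is what reduces the
existence of subconics to inequalities at the obstacles. -/
theorem IsDevelopingMap.subset_star (hV : StarConvex ℝ (dev x) V)
    (h : ∀ a ∈ obst dev x, a ∉ V) : V ⊆ star dev x := by
  intro b hb
  by_contra hbs
  obtain ⟨a, ha, ha'⟩ := hd.exists_mem_obst hbs
  exact h a ha' (hV.segment_subset hb ha)

/-- Obstacles are locally finite. -/
theorem IsDevelopingMap.eventually_obst_eq (hdisc : DiscreteTopology (bdry X))
    (hb : b ∈ halfStar dev x) : ∀ᶠ a in 𝓝 b, a ∈ obst dev x → a = b := by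
  have hc := hd.continuousOn_barExp b hb
  by_cases hbb : barExp dev x b ∈ bdry X
  · obtain ⟨O, hO, hOb⟩ : ∃ O ∈ 𝓝 (barExp dev x b), O ∩ bdry X = {barExp dev x b} := by
      exact nhds_inter_eq_singleton_of_mem_discrete ⟨hdisc⟩ hbb
    have h1 := hc.eventually hO
    rw [eventually_nhdsWithin_iff] at h1
    filter_upwards [h1] with a ha ha'
    have h2 := hd.mem_obst_iff.1 ha'
    have h3 : barExp dev x a ∈ O ∩ bdry X := ⟨ha h2.1, h2.2⟩
    rw [hOb, mem_singleton_iff] at h3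
    rw [← hd.devBar_barExp h2.1, h3, hd.devBar_barExp hb]
  · have h1 := hc.eventually (hd.isClosed_bdry.isOpen_compl.mem_nhds hbb)
    rw [eventually_nhdsWithin_iff] at h1
    filter_upwards [h1] with a ha ha'
    have h2 := hd.mem_obst_iff.1 ha'
    exact absurd h2.2 (ha h2.1)

theorem IsDevelopingMap.closure_subset_halfStar (hV : Convex ℝ V) (hVo : IsOpen V)
    (hVs : V ⊆ star dev x) (hx : dev x ∈ V) : closure V ⊆ halfStar dev x := by
  intro a ha t ht
  apply hVs
  have := hV.combo_interior_closure_mem_interior (hVo.interior_eq.symm ▸ hx) ha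
    (a := 1 - t) (b := t) (by linarith [ht.2]) ht.1 (by ring)
  rw [hVo.interior_eq] at this
  rwa [AffineMap.lineMap_apply_module]

/-- The closure in the completion of the lift of a convex open set. -/
theorem IsDevelopingMap.closure_image_devExp (hV : Convex ℝ V) (hVo : IsOpen V)
    (hVs : V ⊆ star dev x) (hx : dev x ∈ V) :
    closure (toBar '' (devExp dev x '' V)) = barExp dev x '' closure V := by
  have hsub := hd.closure_subset_halfStar hV hVo hVs hx
  have hcont := hd.continuousOn_barExp.mono hsub
  have himg : barExp dev x '' V = toBar '' (devExp dev x '' V) := by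
    rw [image_image]
    exact image_congr fun a ha => hd.barExp_eq (hVs ha)
  apply subset_antisymm
  · intro u hu
    have hm : MapsTo (devBar dev) (toBar '' (devExp dev x '' V)) V := by
      rintro _ ⟨_, ⟨a, ha, rfl⟩, rfl⟩
      rwa [hd.devBar_toBar, dev_devExp (hVs ha)]
    have ha : devBar dev u ∈ closure V := hm.closure continuous_devBar hu
    refine ⟨_, ha, ?_⟩
    -- On the lift of `V` the maps `devBar` and `barExp` are inverse to each other, and the identity
    -- `barExp ∘ devBar = id` passes to limits.
    have hne : (𝓝[toBar '' (devExp dev x '' V)] u).NeBot := mem_closure_iff_nhdsWithin_neBot.1 hu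
    have h1 : Tendsto (fun v => barExp dev x (devBar dev v)) (𝓝[toBar '' (devExp dev x '' V)] u)
        (𝓝 (barExp dev x (devBar dev u))) := by
      refine (hcont _ ha).tendsto.comp ?_
      refine tendsto_nhdsWithin_iff.2 ⟨continuous_devBar.continuousAt.tendsto.mono_left
        nhdsWithin_le_nhds, ?_⟩
      filter_upwards [self_mem_nhdsWithin] with v hv
      exact subset_closure (hm hv)
    refine tendsto_nhds_unique h1 ((tendsto_id.mono_left nhdsWithin_le_nhds).congr' ?_)
    filter_upwards [self_mem_nhdsWithin]
    rintro _ ⟨_, ⟨a, ha, rfl⟩, rfl⟩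
    rw [hd.devBar_toBar, dev_devExp (hVs ha), hd.barExp_eq (hVs ha)]
    rfl
  · rw [← himg]
    exact hcont.image_closure

theorem IsDevelopingMap.barExp_base_change (hV : Convex ℝ V) (hVo : IsOpen V)
    (hVs : V ⊆ star dev x) (hx : dev x ∈ V) (hb : b ∈ V) (ha : a ∈ closure V) :
    barExp dev (devExp dev x b) a = barExp dev x a := by
  have hl := hd.isLocalHomeomorph
  have hVs' : V ⊆ star dev (devExp dev x b) := fun c hc =>
    (devExp_base_change hl hV hVs hb hc).1
  have hb' : dev (devExp dev x b) ∈ V := by rwa [dev_devExp (hVs hb)]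
  refine EqOn.of_subset_closure (s := V) (t := closure V) (fun c hc => ?_)
    (hd.continuousOn_barExp.mono (hd.closure_subset_halfStar hV hVo hVs' hb'))
    (hd.continuousOn_barExp.mono (hd.closure_subset_halfStar hV hVo hVs hx)) subset_closure
    subset_rfl ha
  rw [hd.barExp_eq (hVs hc), hd.barExp_eq (hVs' hc), (devExp_base_change hl hV hVs hb hc).2]

theorem IsDevelopingMap.obst_base_change (hV : Convex ℝ V) (hVo : IsOpen V)
    (hVs : V ⊆ star dev x) (hx : dev x ∈ V) (hb : b ∈ V) (ha : a ∈ closure V) :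
    a ∈ obst dev (devExp dev x b) ↔ a ∈ obst dev x := by
  have hVs' : V ⊆ star dev (devExp dev x b) := fun c hc =>
    (devExp_base_change hd.isLocalHomeomorph hV hVs hb hc).1
  have hb' : dev (devExp dev x b) ∈ V := by rwa [dev_devExp (hVs hb)]
  rw [hd.mem_obst_iff, hd.mem_obst_iff, hd.barExp_base_change hV hVo hVs hx hb ha]
  simp only [hd.closure_subset_halfStar hV hVo hVs' hb' ha,
    hd.closure_subset_halfStar hV hVo hVs hx ha]

end Visible

end TranslationSurface

namespace TranslationSurface

open AffineMap (lineMap)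
open scoped Uniformity

/-! ### Uniqueness of the position of a convex set with two given boundary points -/

/-- The signed area function whose zero set is the line through `c` in the direction `v`. -/
noncomputable def side (v c : Plane) (a : Plane) : ℝ := v 0 * (a 1 - c 1) - v 1 * (a 0 - c 0)

theorem continuous_side (v c : Plane) : Continuous (side v c) := by
  unfold side; fun_prop

theorem side_self (v c : Plane) : side v c c = 0 := by simp [side]

theorem side_lineMap (v c a b : Plane) (t : ℝ) :
    side v c (lineMap a b t) = (1 - t) * side v c a + t * side v c b := by
  simp only [side, AffineMap.lineMap_apply_module, PiLp.add_apply, PiLp.smul_apply, smul_eq_mul]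
  ring

theorem exists_smul_of_side_eq_zero {v c a : Plane} (hv : v ≠ 0) (h : side v c a = 0) :
    ∃ t : ℝ, a = c + t • v := by
  have hn : v 0 ^ 2 + v 1 ^ 2 ≠ 0 := by
    intro h0
    apply hv
    have h1 : v 0 = 0 := by nlinarith [sq_nonneg (v 0), sq_nonneg (v 1)]
    have h2 : v 1 = 0 := by nlinarith [sq_nonneg (v 0), sq_nonneg (v 1)]
    ext i; fin_cases i <;> simp [h1, h2]
  refine ⟨(v 0 * (a 0 - c 0) + v 1 * (a 1 - c 1)) / (v 0 ^ 2 + v 1 ^ 2), ?_⟩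
  unfold side at h
  ext i
  fin_cases i
  · simp only [Fin.zero_eta, PiLp.add_apply, PiLp.smul_apply, smul_eq_mul]
    field_simp
    linear_combination (-v 1) * h
  · simp only [Fin.mk_one, PiLp.add_apply, PiLp.smul_apply, smul_eq_mul]
    field_simp
    linear_combination (v 0) * h

theorem segment_trichotomy {v c : Plane} (hv : v ≠ 0) {a b : Plane} (ha : side v c a = 0)
    (hb : side v c b = 0) : a ∈ segment ℝ c b ∨ b ∈ segment ℝ c a ∨ c ∈ segment ℝ a b := by
  have h : Collinear ℝ ({c, a, b} : Set Plane) := by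
    rw [collinear_iff_exists_forall_eq_smul_vadd]
    refine ⟨c, v, ?_⟩
    rintro p (rfl | rfl | rfl)
    · exact ⟨0, by simp⟩
    · obtain ⟨t, ht⟩ := exists_smul_of_side_eq_zero hv ha
      exact ⟨t, by rw [ht, vadd_eq_add, add_comm]⟩
    · obtain ⟨t, ht⟩ := exists_smul_of_side_eq_zero hv hb
      exact ⟨t, by rw [ht, vadd_eq_add, add_comm]⟩
  rcases h.wbtw_or_wbtw_or_wbtw with h | h | h
  · exact Or.inl (mem_segment_iff_wbtw.2 h)
  · exact Or.inr (Or.inl (segment_symm ℝ a c ▸ mem_segment_iff_wbtw.2 h))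
  · exact Or.inr (Or.inr (segment_symm ℝ b a ▸ mem_segment_iff_wbtw.2 h))

section Crossing

variable {X : Type*} [TopologicalSpace X] [ChartedSpace Plane X] {dev : X → Plane}

/-- The leaf through `x` of the foliation of `X` by the lines of direction `v`. -/
def leaf (dev : X → Plane) (v : Plane) (x : X) : Set X :=
  {y | side v (dev x) (dev y) = 0 ∧ dev y ∈ star dev x ∧ devExp dev x (dev y) = y}

variable [T2Space X] (hd : IsDevelopingMap dev)
include hd

/-- The three developed points lie on one line. Whichever of them is between the other two, the lift
from `x` is obtained by concatenating or by restricting the given lifts. -/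
theorem IsDevelopingMap.devExp_mem_leaf {v : Plane} (hv : v ≠ 0) {x y : X} (hy : y ∈ leaf dev v x)
    {b : Plane} (hb : b ∈ star dev y) (hs : side v (dev x) b = 0) :
    devExp dev y b ∈ leaf dev v x := by
  have hl := hd.isLocalHomeomorph
  obtain ⟨h1, h2, h3⟩ := hy
  rw [leaf, mem_ofPred_eq, dev_devExp hb]
  refine ⟨hs, ?_⟩
  rcases segment_trichotomy hv h1 hs with h | h | h
  · have := devExp_concat hl h2 (h3.symm ▸ hb) h
    rwa [h3] at this
  · have h4 := segment_subset_star h2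
    have := devExp_base_change hl (convex_segment _ _) h4 (right_mem_segment _ _ _) h
    rw [h3] at this
    exact ⟨h4 h, this.2.symm⟩
  · have h4 := segment_subset_star hb
    have h5 := devExp_symm hl h2
    rw [h3] at h5
    have := devExp_base_change hl (convex_segment _ _) h4 h (right_mem_segment _ _ _)
    rwa [h5.2] at this

theorem IsDevelopingMap.devExp_mem_leaf_iff {v : Plane} (hv : v ≠ 0) {x y : X} 
    (hy : side v (dev x) (dev y) = 0)
    {b : Plane} (hb : b ∈ star dev y) (hs : side v (dev x) b = 0) :
    devExp dev y b ∈ leaf dev v x ↔ y ∈ leaf dev v x := by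
  refine ⟨fun h => ?_, fun h => hd.devExp_mem_leaf hv h hb hs⟩
  have h5 := devExp_symm hd.isLocalHomeomorph hb
  have := hd.devExp_mem_leaf hv h h5.1 hy
  rwa [h5.2] at this

/-- Within an immersed disc, two points over the line are joined by a lifted segment of that line.
Membership in the leaf is therefore locally constant on the preimage of the line. -/
theorem IsDevelopingMap.isClosed_leaf {v : Plane} (hv : v ≠ 0) (x : X) :
    IsClosed (leaf dev v x) ∧
      IsClosed ({y | side v (dev x) (dev y) = 0} \ leaf dev v x) := by
  have hl := hd.isLocalHomeomorph
  have hs : IsClosed {y | side v (dev x) (dev y) = 0} :=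
    isClosed_eq ((continuous_side _ _).comp hl.continuous) continuous_const
  have hloc : ∀ y, ∀ᶠ z in 𝓝 y, side v (dev x) (dev y) = 0 → side v (dev x) (dev z) = 0 →
      (z ∈ leaf dev v x ↔ y ∈ leaf dev v x) := by
    intro y
    obtain ⟨r, hr0, hr⟩ := exists_ball_subset_star hl y
    filter_upwards [image_devExp_mem_nhds hl Metric.isOpen_ball hr (Metric.mem_ball_self hr0)]
    rintro _ ⟨b, hb, rfl⟩ h1 h2
    rw [dev_devExp (hr hb)] at h2
    exact hd.devExp_mem_leaf_iff hv h1 (hr hb) h2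
  constructor
  · refine isClosed_of_closure_subset fun y hy => ?_
    have h1 : side v (dev x) (dev y) = 0 :=
      closure_minimal (fun z hz => hz.1) hs hy
    obtain ⟨z, hz, hz'⟩ := ((mem_closure_iff_frequently.1 hy).and_eventually (hloc y)).exists
    exact (hz' h1 hz.1).1 hz
  · refine isClosed_of_closure_subset fun y hy => ?_
    have h1 : side v (dev x) (dev y) = 0 :=
      closure_minimal (fun z hz => hz.1) hs hy
    obtain ⟨z, hz, hz'⟩ := ((mem_closure_iff_frequently.1 hy).and_eventually (hloc y)).exists
    exact ⟨h1, fun h => hz.2 ((hz' h1 hz.1).2 h)⟩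

theorem IsDevelopingMap.normalSpace : NormalSpace X := by
  have : TopologicalSpace.PseudoMetrizableSpace (MetricCopy X) := inferInstance
  exact hd.isHomeomorph_toCopy.homeomorph.isClosedEmbedding.normalSpace

/-- On a simply connected surface, the two sides of a leaf cannot be joined to one another
through a point outside the leaf. -/
theorem IsDevelopingMap.eq_of_preconnected [SimplyConnectedSpace X] {v : Plane} (hv : v ≠ 0)
    {x x' : X} (hxx : dev x' = dev x) {S T : Set X} (hS : IsPreconnected S) (hT : IsPreconnected T)
    (hxS : x ∈ S) (hxS' : x' ∈ S) (hxT : x ∈ T) (hxT' : x' ∈ T)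
    (hSs : ∀ y ∈ S, 0 ≤ side v (dev x) (dev y)) (hTs : ∀ y ∈ T, side v (dev x) (dev y) ≤ 0) :
    x' = x := by
  by_contra hne
  have hl := hd.isLocalHomeomorph
  have := hd.normalSpace
  have : LocallyPathConnectedSpace X := ChartedSpace.locallyPathConnectedSpace Plane X
  obtain ⟨h1, h2⟩ := hd.isClosed_leaf hv x
  -- A Urysohn function distinguishes the leaf of `x` from the other leaves over the same line; `x'`
  -- lies on one of the others.
  obtain ⟨f, hf0, hf1, -⟩ := exists_continuous_zero_one_of_isClosed h1 h2 disjoint_sdiff_right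
  have hxl : x ∈ leaf dev v x := ⟨side_self _ _, mem_star_self, devExp_self hl⟩
  have hxl' : x' ∈ {y | side v (dev x) (dev y) = 0} \ leaf dev v x := by
    refine ⟨by rw [mem_ofPred_eq, hxx, side_self], fun h => hne ?_⟩
    rw [← h.2.2, hxx, devExp_self hl]
  -- This function has no zero: over the line its imaginary part is 1 on the leaf of `x` and -1
  -- elsewhere. By simple connectedness it has a continuous logarithm `g` below.
  let φ : X → ℂ := fun y => ⟨side v (dev x) (dev y), 1 - 2 * f y⟩
  have hφc : Continuous φ := by
    have : φ = fun y => (side v (dev x) (dev y) : ℂ) + ((1 - 2 * f y : ℝ) : ℂ) * Complex.I := by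
      ext1 y
      apply Complex.ext <;> simp [φ]
    rw [this]
    have h3 : Continuous fun y => side v (dev x) (dev y) :=
      (continuous_side _ _).comp hl.continuous
    fun_prop
  have hφ0 : ∀ y, φ y ≠ 0 := by
    intro y h0
    have hre : side v (dev x) (dev y) = 0 := congrArg Complex.re h0
    have him : 1 - 2 * f y = 0 := congrArg Complex.im h0
    by_cases hy : y ∈ leaf dev v x
    · have := hf0 hy
      simp only [Pi.zero_apply] at this
      rw [this] at him; norm_num at him
    · have := hf1 (⟨hre, hy⟩ : y ∈ {y | side v (dev x) (dev y) = 0} \ leaf dev v x)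
      simp only [Pi.one_apply] at this
      rw [this] at him; norm_num at him
  have hφx : φ x = Complex.I := by
    have := hf0 hxl
    simp only [Pi.zero_apply] at this
    apply Complex.ext <;> simp [φ, side_self, this]
  have hφx' : φ x' = -Complex.I := by
    have := hf1 hxl'
    simp only [Pi.one_apply] at this
    apply Complex.ext
    · simp [φ, hxx, side_self]
    · simp [φ, this]; norm_num
  obtain ⟨g, ⟨-, hg⟩, -⟩ := Complex.isCoveringMap_exp.existsUnique_continuousMap_lifts
    (⟨fun y => ⟨φ y, hφ0 y⟩, hφc.subtype_mk _⟩ : C(X, {z : ℂ // z ≠ 0})) (a₀ := x)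
    (e₀ := Complex.log (φ x)) (Subtype.ext (Complex.exp_log (hφ0 x)))
  have hg' : ∀ y, Complex.exp (g y) = φ y := fun y => congrArg Subtype.val (congr_fun hg y)
  have hslit : ∀ z : ℂ, z ≠ 0 → 0 ≤ z.re → z ∈ Complex.slitPlane := by
    intro z hz hre
    rw [Complex.mem_slitPlane_iff]
    rcases hre.eq_or_lt with h | h
    · right; intro him; exact hz (Complex.ext h.symm him)
    · exact Or.inl h
  -- On a connected set where `ε * φ` has nonnegative real part, `g` differs from the principal
  -- logarithm of `ε * φ` by a constant. The increment of `g` from `x` to `x'` is then `-πi` along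
  -- `S` (with `ε = 1`) and `πi` along `T` (with `ε = -1`), a contradiction.
  have key : ∀ (W : Set X) (ε : ℂ), ε ≠ 0 → IsPreconnected W → x ∈ W → x' ∈ W →
      (∀ y ∈ W, 0 ≤ (ε * φ y).re) →
      g x' - g x = Complex.log (ε * φ x') - Complex.log (ε * φ x) := by
    intro W ε hε hW hx hx' hpos
    have hc : ContinuousOn (fun y => Complex.log (ε * φ y) + (g x - Complex.log (ε * φ x))) W := by
      refine ContinuousOn.add (ContinuousOn.clog (by fun_prop) fun y hy => ?_) continuousOn_const
      exact hslit _ (mul_ne_zero hε (hφ0 y)) (hpos y hy)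
    have := Complex.isCoveringMap_exp.eqOn_of_comp_eqOn hW g.continuous.continuousOn hc (by
      intro y hy
      apply Subtype.ext
      simp only [Function.comp_apply]
      rw [hg', Complex.exp_add, Complex.exp_sub, hg', Complex.exp_log (mul_ne_zero hε (hφ0 y)),
        Complex.exp_log (mul_ne_zero hε (hφ0 x))]
      field_simp [hφ0 x]) hx (by simp)
    have h3 := this hx'
    simp only at h3
    rw [h3]; ring
  have e1 := key S 1 one_ne_zero hS hxS hxS' fun y hy => by simpa [φ] using hSs y hy
  have e2 := key T (-1) (by simp) hT hxT hxT' fun y hy => by simpa [φ] using hTs y hy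
  rw [hφx, hφx', e1] at e2
  rw [hφx, hφx'] at e2
  have := congrArg Complex.im e2
  simp [Complex.log_im] at this
  linarith [Real.pi_pos]

theorem IsDevelopingMap.exists_preconnected_of_brokenGeodesic {y z : X} {ℓ : ℝ≥0∞}
    (h : BrokenGeodesic y z ℓ) :
    ∃ C : Set X, IsPreconnected C ∧ y ∈ C ∧ z ∈ C ∧ ∀ u ∈ C, edist (dev y) (dev u) ≤ ℓ := by
  induction h with
  | nil x => exact ⟨{x}, isPreconnected_singleton, rfl, rfl, by simp⟩
  | @cons z ℓ γ v hγ _ ih =>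
    obtain ⟨C, hC, h1, h2, h3⟩ := ih
    refine ⟨range γ ∪ C, (isPreconnected_range hγ.1).union (γ 1) ⟨1, rfl⟩ h1 hC,
      Or.inl ⟨0, rfl⟩, Or.inr h2, ?_⟩
    have h4 : ∀ t, edist (dev (γ 0)) (dev (γ t)) ≤ ‖v‖ₑ := by
      intro t
      rw [(hd.isGeodesic_iff.1 hγ).2 t, edist_comm, edist_eq_enorm_sub, add_sub_cancel_left,
        enorm_smul]
      refine mul_le_of_le_one_left zero_le ?_
      rw [Real.enorm_eq_ofReal t.2.1]
      exact ENNReal.ofReal_le_one.2 t.2.2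
    rintro _ (⟨t, rfl⟩ | hu)
    · exact (h4 t).trans le_self_add
    · exact (edist_triangle _ (dev (γ 1)) _).trans (add_le_add (h4 1) (h3 _ hu))

/-- Two subsets of `X` with a common limit point in the completion are joined by short paths. -/
theorem IsDevelopingMap.exists_preconnected_near {U U' : Set X} {z : Bar X}
    (hz : z ∈ closure (toBar '' U)) (hz' : z ∈ closure (toBar '' U')) {O : Set Plane}
    (hO : O ∈ 𝓝 (devBar dev z)) :
    ∃ y ∈ U, ∃ y' ∈ U', ∃ C : Set X, IsPreconnected C ∧ y ∈ C ∧ y' ∈ C ∧ ∀ u ∈ C, dev u ∈ O := by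
  obtain ⟨ε, hε, hεO⟩ := Metric.mem_nhds_iff.1 hO
  have hε2 : 0 < ENNReal.ofReal (ε / 2) := by simp [hε]
  obtain ⟨E, hE, hE'⟩ := exists_entourage_bar (X := X) hε2
  obtain ⟨W, hW, hWs, hWE⟩ := comp_symm_mem_uniformity_sets hE
  have hN : {w | (z, w) ∈ W} ∩ devBar dev ⁻¹' Metric.ball (devBar dev z) (ε / 2) ∈ 𝓝 z :=
    inter_mem (mem_nhds_left z hW)
      (continuous_devBar.continuousAt.preimage_mem_nhds (Metric.ball_mem_nhds _ (by linarith)))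
  obtain ⟨_, ⟨h1, h2⟩, y, hy, rfl⟩ := mem_closure_iff_nhds.1 hz _ hN
  obtain ⟨_, ⟨h3, h4⟩, y', hy', rfl⟩ := mem_closure_iff_nhds.1 hz' _ hN
  have h5 : edist (toCopy y) (toCopy y') < ENNReal.ofReal (ε / 2) := by
    refine hE' _ _ (hWE ⟨z, ?_, h3⟩)
    exact hWs.symm _ _ h1
  obtain ⟨ℓ, hℓ, hb⟩ := exists_brokenGeodesic_of_edist_lt h5
  obtain ⟨C, hC, hyC, hyC', hCℓ⟩ := hd.exists_preconnected_of_brokenGeodesic hb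
  refine ⟨y, hy, y', hy', C, hC, hyC, hyC', fun u hu => hεO ?_⟩
  have h6 : edist (dev y) (dev u) < ENNReal.ofReal (ε / 2) := (hCℓ u hu).trans_lt hℓ
  rw [edist_dist, ENNReal.ofReal_lt_ofReal_iff (by linarith), dist_comm] at h6
  rw [mem_preimage, hd.devBar_toBar, Metric.mem_ball] at h2
  rw [Metric.mem_ball]
  linarith [dist_triangle (dev u) (dev y) (devBar dev z)]

/-- Two convex sets with two common boundary points in the completion, whose developed images
have a common point that separates them, coincide near that point. -/
theorem IsDevelopingMap.eq_of_mem_closure [SimplyConnectedSpace X] {x x' : X}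
    (hxx : dev x' = dev x) {V V' : Set Plane} (hV : Convex ℝ V) (hV' : Convex ℝ V')
    (hVs : V ⊆ star dev x) (hVs' : V' ⊆ star dev x') (hxV : dev x ∈ V) (hxV' : dev x ∈ V')
    {z₁ z₂ : Bar X} (h₁ : z₁ ∈ closure (toBar '' (devExp dev x '' V)))
    (h₁' : z₁ ∈ closure (toBar '' (devExp dev x' '' V')))
    (h₂ : z₂ ∈ closure (toBar '' (devExp dev x '' V)))
    (h₂' : z₂ ∈ closure (toBar '' (devExp dev x' '' V'))) {v : Plane} 
    (hz₁ : side v (dev x) (devBar dev z₁) < 0) (hz₂ : 0 < side v (dev x) (devBar dev z₂)) :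
    x' = x := by
  have hl := hd.isLocalHomeomorph
  have hv : v ≠ 0 := by
    rintro rfl
    simp [side] at hz₁
  have hsc := continuous_side v (dev x)
  have hseg : ∀ (w : X) (Q : Set Plane), dev w = dev x → Convex ℝ Q → Q ⊆ star dev w → dev w ∈ Q → 
      ∀ a ∈ Q, IsPreconnected (devExp dev w '' segment ℝ (dev w) a) ∧
        w ∈ devExp dev w '' segment ℝ (dev w) a ∧
        devExp dev w a ∈ devExp dev w '' segment ℝ (dev w) a ∧
        (0 ≤ side v (dev x) a → ∀ u ∈ devExp dev w '' segment ℝ (dev w) a,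
          0 ≤ side v (dev x) (dev u)) ∧
        (side v (dev x) a ≤ 0 → ∀ u ∈ devExp dev w '' segment ℝ (dev w) a,
          side v (dev x) (dev u) ≤ 0) := by
    intro w Q hw hQ hQs hwQ a ha
    have hs := segment_subset_star (hQs ha)
    refine ⟨(convex_segment _ _).isPreconnected.image _ ((continuousOn_devExp hl).mono hs),
      ⟨_, left_mem_segment _ _ _, devExp_self hl⟩, ⟨_, right_mem_segment _ _ _, rfl⟩, ?_, ?_⟩
    all_goals
      rintro h _ ⟨b, hb, rfl⟩
      rw [dev_devExp (hs hb)]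
      rw [segment_eq_image_lineMap] at hb
      obtain ⟨t, ht, rfl⟩ := hb
      rw [side_lineMap, hw, side_self]
    · have := mul_nonneg ht.1 h; linarith
    · have := mul_nonpos_of_nonneg_of_nonpos ht.1 h; linarith
  obtain ⟨_, ⟨b₁, hb₁, rfl⟩, _, ⟨b₁', hb₁', rfl⟩, C₁, hC₁, hy₁, hy₁', hO₁⟩ :=
    hd.exists_preconnected_near h₁ h₁' (O := {a | side v (dev x) a < 0})
      ((isOpen_lt hsc continuous_const).mem_nhds hz₁)
  obtain ⟨_, ⟨b₂, hb₂, rfl⟩, _, ⟨b₂', hb₂', rfl⟩, C₂, hC₂, hy₂, hy₂', hO₂⟩ :=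
    hd.exists_preconnected_near h₂ h₂' (O := {a | 0 < side v (dev x) a})
      ((isOpen_lt continuous_const hsc).mem_nhds hz₂)
  obtain ⟨p1, p2, p3, -, p4⟩ := hseg x V rfl hV hVs hxV b₁ hb₁
  obtain ⟨q1, q2, q3, -, q4⟩ := hseg x' V' hxx hV' hVs' (hxx ▸ hxV') b₁' hb₁'
  obtain ⟨r1, r2, r3, r4, -⟩ := hseg x V rfl hV hVs hxV b₂ hb₂
  obtain ⟨s1, s2, s3, s4, -⟩ := hseg x' V' hxx hV' hVs' (hxx ▸ hxV') b₂' hb₂'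
  have k1 := hO₁ _ hy₁
  have k1' := hO₁ _ hy₁'
  have k2 := hO₂ _ hy₂
  have k2' := hO₂ _ hy₂'
  rw [dev_devExp (hVs hb₁)] at k1
  rw [dev_devExp (hVs' hb₁')] at k1'
  rw [dev_devExp (hVs hb₂)] at k2
  rw [dev_devExp (hVs' hb₂')] at k2'
  -- `S` goes from `x` towards `z₂` in the first convex set, crosses to the second along a short
  -- path near `z₂` and returns to `x'`, all on the positive side. `T` does the same near `z₁` on
  -- the negative side.
  refine hd.eq_of_preconnected hv hxx (S := _ ∪ C₂ ∪ _) (T := _ ∪ C₁ ∪ _)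
    ((r1.union _ r3 hy₂ hC₂).union _ (Or.inr hy₂') s3 s1)
    ((p1.union _ p3 hy₁ hC₁).union _ (Or.inr hy₁') q3 q1)
    (Or.inl (Or.inl r2)) (Or.inr s2) (Or.inl (Or.inl p2)) (Or.inr q2) ?_ ?_
  · rintro y ((hy | hy) | hy)
    · exact r4 (le_of_lt k2) y hy
    · exact le_of_lt (hO₂ y hy)
    · exact s4 (le_of_lt k2') y hy
  · rintro y ((hy | hy) | hy)
    · exact p4 (le_of_lt k1) y hy
    · exact le_of_lt (hO₁ y hy)
    · exact q4 (le_of_lt k1') y hy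

end Crossing

end TranslationSurface

namespace TranslationSurface

open AffineMap (lineMap)
open scoped Uniformity

/-! ### Coverings of precompact translation surfaces -/

section Covering

variable {X Y : Type*} [TopologicalSpace X] [ChartedSpace Plane X] [TopologicalSpace Y]
  [ChartedSpace Plane Y] {p : X → Y} {dev : X → Plane}

theorem IsTranslationMap.comp_isGeodesic (hp : IsTranslationMap p) {γ : unitInterval → X}
    {v : Plane} (h : IsGeodesic γ v) : IsGeodesic (p ∘ γ) v := by
  refine ⟨hp.1.comp h.1, fun t e' he' ht => ?_⟩
  obtain ⟨w, hw⟩ := hp.2 (γ t) _ (chart_mem_atlas Plane _) (mem_chart_source Plane _) e' he' ht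
  filter_upwards [h.2 t _ (chart_mem_atlas Plane _) (mem_chart_source Plane _),
    h.1.continuousAt.eventually hw] with s h1 h2
  simp only [Function.comp_apply]
  rw [h2, h1, hw.self_of_nhds]
  abel

theorem IsTranslationMap.isGeodesic_of_comp (hp : IsTranslationMap p) {γ : unitInterval → X}
    {v : Plane} (hc : Continuous γ) (h : IsGeodesic (p ∘ γ) v) : IsGeodesic γ v := by
  refine ⟨hc, fun t e he ht => ?_⟩
  obtain ⟨w, hw⟩ := hp.2 (γ t) e he ht _ (chart_mem_atlas Plane (p (γ t)))
    (mem_chart_source Plane _)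
  filter_upwards [h.2 t _ (chart_mem_atlas Plane _) (mem_chart_source Plane _),
    hc.continuousAt.eventually hw] with s h1 h2
  simp only [Function.comp_apply] at h1
  rw [h2, hw.self_of_nhds] at h1
  have : e (γ s) = e (γ t) + w + ((s : ℝ) - t) • v - w := by rw [← h1]; abel
  rw [this]; abel

theorem IsTranslationMap.brokenGeodesic (hp : IsTranslationMap p) {x x' : X} {ℓ : ℝ≥0∞}
    (h : BrokenGeodesic x x' ℓ) : BrokenGeodesic (p x) (p x') ℓ := by
  induction h with
  | nil x => exact .nil _
  | cons γ v hγ _ ih => exact .cons (p ∘ γ) v (hp.comp_isGeodesic hγ) ih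

theorem IsTranslationMap.edist_le (hp : IsTranslationMap p) (x x' : X) :
    edist (toCopy (p x)) (toCopy (p x')) ≤ edist (toCopy x) (toCopy x') :=
  le_iInf₂ fun _ h => edist_toCopy_le_of_brokenGeodesic (hp.brokenGeodesic h)

theorem IsTranslationMap.lift_brokenGeodesic (hp : IsTranslationMap p) (hcov : IsCoveringMap p)
    {y y' : Y} {ℓ : ℝ≥0∞} (h : BrokenGeodesic y y' ℓ) :
    ∀ x : X, p x = y → ∃ x', p x' = y' ∧ BrokenGeodesic x x' ℓ := by
  induction h with
  | nil y => exact fun x hx => ⟨x, hx, .nil x⟩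
  | @cons z ℓ γ v hγ _ ih =>
    intro x hx
    obtain ⟨Γ, hΓ, h0⟩ := hcov.exists_path_lifts ⟨γ, hγ.1⟩ x hx.symm
    have hΓ' : p ∘ Γ = γ := hΓ
    have hg : IsGeodesic Γ v := hp.isGeodesic_of_comp Γ.continuous (hΓ'.symm ▸ hγ)
    obtain ⟨x', hx', hb⟩ := ih (Γ 1) (congr_fun hΓ' 1)
    have := BrokenGeodesic.cons Γ v hg hb
    rw [h0] at this
    exact ⟨x', hx', this⟩

variable [T2Space X] (hd : IsDevelopingMap dev)

theorem IsDevelopingMap.edist_lt_top [PreconnectedSpace X] (hd : IsDevelopingMap dev) (x y : X) :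
    edist (toCopy x) (toCopy y) < ⊤ := by
  have hc := hd.isHomeomorph_toCopy.continuous
  have h : IsClopen (toCopy ⁻¹' Metric.eball (toCopy x) ⊤) := by
    refine ⟨IsClosed.preimage hc ?_, Metric.isOpen_eball.preimage hc⟩
    exact Metric.isClosed_eball_top
  have := h.eq_univ ⟨x, by simp⟩
  have hy : y ∈ toCopy ⁻¹' Metric.eball (toCopy x) ⊤ := this ▸ mem_univ y
  rw [mem_preimage, Metric.mem_eball, edist_comm] at hy
  exact hy

/-- Finitely many unit balls cover `Y`, and their centres are at finite distance from a base point
because `X` is connected and `p` does not increase distances. -/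
theorem exists_edist_lt_of_precompact [PreconnectedSpace X] [Nonempty X]
    (hd : IsDevelopingMap dev) (hp : IsTranslationMap p) (hsurj : Function.Surjective p)
    (hY : Precompact Y) :
    ∃ C : ℝ, ∀ y y' : Y, edist (toCopy y) (toCopy y') < ENNReal.ofReal C := by
  obtain ⟨x⟩ := ‹Nonempty X›
  obtain ⟨t, ht, htY⟩ := EMetric.totallyBounded_iff.1 hY 1 one_pos
  have hfin : ∀ y : MetricCopy Y, edist (toCopy (p x)) y < ⊤ := by
    intro y
    obtain ⟨x', rfl⟩ := hsurj y
    exact (hp.edist_le x x').trans_lt (hd.edist_lt_top x x')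
  set M := ∑ y ∈ ht.toFinset, edist (toCopy (p x)) y
  have hM : M < ⊤ := ENNReal.sum_lt_top.2 fun y _ => hfin y
  have h1 : ∀ y : Y, edist (toCopy (p x)) (toCopy y) < M + 1 := by
    intro y
    obtain ⟨c, hc, hyc⟩ := mem_iUnion₂.1 (htY (mem_univ (toCopy y)))
    rw [Metric.mem_eball, edist_comm] at hyc
    refine (edist_triangle _ c _).trans_lt ?_
    refine ENNReal.add_lt_add_of_le_of_lt (hfin c).ne ?_ hyc
    exact Finset.single_le_sum (f := fun y => edist (toCopy (p x)) y) (fun _ _ => zero_le)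
      (ht.mem_toFinset.2 hc)
  refine ⟨(M + 1 + (M + 1)).toReal, fun y y' => ?_⟩
  rw [ENNReal.ofReal_toReal (by simp [hM.ne])]
  refine (edist_triangle_left _ _ (toCopy (p x))).trans_lt ?_
  exact ENNReal.add_lt_add (h1 y) (h1 y')

/-- Immersed discs have bounded radius. -/
theorem exists_radius_bound [PreconnectedSpace X] [Nonempty X]
    (hd : IsDevelopingMap dev) (hp : IsTranslationMap p) (hcov : IsCoveringMap p)
    (hsurj : Function.Surjective p) (hY : Precompact Y) (hYne : (bdry Y).Nonempty) :
    ∃ C : ℝ, ∀ (x : X) (R : ℝ), Metric.ball (dev x) R ⊆ star dev x → R ≤ C := by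
  have hl := hd.isLocalHomeomorph
  obtain ⟨C, hC⟩ := exists_edist_lt_of_precompact hd hp hsurj hY
  refine ⟨C, fun x R hR => ?_⟩
  by_contra! hCR
  have hsub : Metric.closedBall (dev x) C ⊆ star dev x :=
    (Metric.closedBall_subset_ball hCR).trans hR
  -- An immersed disc of radius larger than the diameter bound `C` covers `Y`. Then `Y` is compact,
  -- hence closed in its completion, and its frontier is empty.
  have hcov' : ∀ y : Y, y ∈ p '' (devExp dev x '' Metric.closedBall (dev x) C) := by
    intro y
    obtain ⟨ℓ, hℓ, hb⟩ := exists_brokenGeodesic_of_edist_lt (hC (p x) y)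
    obtain ⟨x', hx', hb'⟩ := hp.lift_brokenGeodesic hcov hb x rfl
    obtain ⟨a, ha, hax⟩ := hd.nhds_basis (Metric.ball_subset_closedBall.trans hsub) le_rfl
      ((edist_toCopy_le_of_brokenGeodesic hb').trans_lt hℓ)
    exact ⟨x', ⟨a, Metric.ball_subset_closedBall ha, hax⟩, hx'⟩
  have hcont : Continuous fun z : X => toBar (p z) := by
    have h1 : LipschitzWith 1 (show MetricCopy X → MetricCopy Y from p) := fun z z' => by
      rw [ENNReal.coe_one, one_mul]; exact hp.edist_le z z'
    exact (UniformSpace.Completion.continuous_coe (MetricCopy Y)).comp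
      (h1.continuous.comp hd.isHomeomorph_toCopy.continuous)
  have hcomp : IsCompact ((fun z : X => toBar (p z)) '' (devExp dev x '' Metric.closedBall (dev x) C)) :=
    ((isCompact_closedBall _ _).image_of_continuousOn ((continuousOn_devExp hl).mono hsub)).image
      hcont
  have hrange : range (toBar : Y → Bar Y) =
      (fun z : X => toBar (p z)) '' (devExp dev x '' Metric.closedBall (dev x) C) := by
    apply subset_antisymm
    · rintro _ ⟨y, rfl⟩
      obtain ⟨z, hz, rfl⟩ := hcov' y
      exact ⟨z, hz, rfl⟩
    · rintro _ ⟨z, -, rfl⟩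
      exact ⟨_, rfl⟩
  have hclosed : IsClosed (range (toBar : Y → Bar Y)) := hrange ▸ hcomp.isClosed
  have huniv := (denseRange_toBar (X := Y)).closure_range
  rw [hclosed.closure_eq] at huniv
  obtain ⟨b, hb⟩ := hYne
  exact hb (huniv ▸ mem_univ b)

/-- Lift `p` through itself, starting at `y'`. Both `p` and `dev` are translations in charts, so
`dev ∘ F - dev` is locally constant, hence constant. -/
theorem exists_deck [SimplyConnectedSpace X] (hd : IsDevelopingMap dev) (hp : IsTranslationMap p)
    (hcov : IsCoveringMap p) {y y' : X} (hyy : p y' = p y) :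
    ∃ F : C(X, X), F y = y' ∧ ∀ z, dev (F z) = dev z + (dev y' - dev y) := by
  have : LocallyPathConnectedSpace X := ChartedSpace.locallyPathConnectedSpace Plane X
  obtain ⟨F, ⟨h0, hF⟩, -⟩ := hcov.existsUnique_continuousMap_lifts ⟨p, hp.1⟩ (a₀ := y) (e₀ := y') hyy
  refine ⟨F, h0, fun z => ?_⟩
  have hF' : ∀ z, p (F z) = p z := congr_fun hF
  have hlc : IsLocallyConstant fun z => dev (F z) - dev z := by
    rw [IsLocallyConstant.iff_eventually_eq]
    intro z
    have hz := mem_chart_source Plane (p z)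
    have hm := chart_mem_atlas Plane (p z)
    obtain ⟨v1, h1⟩ := hp.2 z _ (chart_mem_atlas Plane _) (mem_chart_source Plane _) _ hm hz
    obtain ⟨v2, h2⟩ := hp.2 (F z) _ (chart_mem_atlas Plane _) (mem_chart_source Plane _) _ hm
      (by rwa [hF'])
    obtain ⟨v3, h3⟩ := hd.eventually (chart_mem_atlas Plane z) (mem_chart_source Plane _)
    obtain ⟨v4, h4⟩ := hd.eventually (chart_mem_atlas Plane (F z)) (mem_chart_source Plane _)
    have hFc := F.continuous.continuousAt (x := z)
    have key : ∀ᶠ w in 𝓝 z, dev (F w) - dev w = v4 - v2 - v3 + v1 := by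
      filter_upwards [h1, hFc.eventually h2, h3, hFc.eventually h4] with w k1 k2 k3 k4
      rw [hF', k1] at k2
      rw [k3, k4, show chartAt Plane (F z) (F w) = chartAt Plane z w + v1 - v2 by rw [k2]; abel]
      abel
    filter_upwards [key] with w hw
    rw [hw, key.self_of_nhds]
  have := hlc.apply_eq_of_preconnectedSpace z y
  rw [h0] at this
  rw [← this]; abel

omit [ChartedSpace Plane X] [T2Space X] in
theorem mem_star_map {F : C(X, X)} {τ : Plane} (hF : ∀ z, dev (F z) = dev z + τ) {z : X}
    {a : Plane} (ha : a ∈ star dev z) : a + τ ∈ star dev (F z) := by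
  obtain ⟨γ, h0, h1⟩ := ha
  refine ⟨F.comp γ, by simp [h0], fun t => ?_⟩
  simp only [ContinuousMap.comp_apply, hF, h1, AffineMap.lineMap_apply_module]
  module

/-- Recurrence: a convex domain that is invariant under the translations in some direction has
a nontrivial symmetry. -/
theorem exists_symmetry [SimplyConnectedSpace X] (hd : IsDevelopingMap dev)
    (hp : IsTranslationMap p) (hcov : IsCoveringMap p) (hY : Precompact Y) {x : X} {V : Set Plane}
    (hV : Convex ℝ V) (hVo : IsOpen V) (hVs : V ⊆ star dev x) (hx : dev x ∈ V) {v : Plane}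
    (hv : v ≠ 0) (hinv : ∀ a ∈ V, ∀ t : ℝ, a + t • v ∈ V) :
    ∃ τ : Plane, τ ≠ 0 ∧ (∃ b ∈ V, b + τ ∈ V) ∧ ∀ a ∈ closure V, a ∈ obst dev x →
      (a + τ ∉ V ∧ a - τ ∉ V) ∧ (a + τ ∈ closure V → a + τ ∈ obst dev x) ∧
      (a - τ ∈ closure V → a - τ ∈ obst dev x) := by
  have hl := hd.isLocalHomeomorph
  obtain ⟨ρ, hρ, hρV⟩ := Metric.isOpen_iff.1 hVo _ hx
  have hvn : 0 < ‖v‖ := norm_pos_iff.2 hv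
  -- Infinitely many centres of discs of radius `ρ` inside `V`, at mutual distances at least `ρ`.
  set c : ℕ → Plane := fun n => dev x + (n * (ρ / ‖v‖)) • v with hc
  have hcball : ∀ n, Metric.ball (c n) ρ ⊆ V := by
    intro n a ha
    have h1 : a - (n * (ρ / ‖v‖)) • v ∈ V := by
      apply hρV
      rw [Metric.mem_ball, dist_eq_norm] at ha ⊢
      convert ha using 2
      simp only [hc]; abel
    simpa using hinv _ h1 (n * (ρ / ‖v‖))
  have hcV : ∀ n, c n ∈ V := fun n => hcball n (Metric.mem_ball_self hρ)
  have hcd : ∀ n m, n ≠ m → ρ ≤ dist (c m) (c n) := by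
    intro n m hnm
    rw [dist_eq_norm]
    have : c m - c n = (((m : ℝ) - n) * (ρ / ‖v‖)) • v := by
      simp only [hc]; module
    rw [this, norm_smul, norm_mul, mul_assoc, norm_div, norm_norm,
      div_mul_cancel₀ _ hvn.ne', Real.norm_of_nonneg hρ.le, Real.norm_eq_abs]
    have : (1 : ℝ) ≤ |(m : ℝ) - n| := by
      have h1 : ((m : ℤ) - n) ≠ 0 := by omega
      have := Int.one_le_abs h1
      exact_mod_cast this
    nlinarith
  obtain ⟨t, ht, htY⟩ := EMetric.totallyBounded_iff.1 hY (ENNReal.ofReal (ρ / 2)) (by simp [hρ])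
  have hsel : ∀ n : ℕ, ∃ s : t, edist (toCopy (p (devExp dev x (c n)))) s < ENNReal.ofReal (ρ / 2) := by
    intro n
    obtain ⟨s, hs, h⟩ := mem_iUnion₂.1 (htY (mem_univ (toCopy (p (devExp dev x (c n))))))
    exact ⟨⟨s, hs⟩, h⟩
  choose f hf using hsel
  have : Finite t := ht
  -- Pigeonhole in the precompact surface `Y`: two of the centres have images less than `ρ` apart.
  obtain ⟨n, m, hnm, hfnm⟩ := Finite.exists_ne_map_eq_of_infinite f
  have hnear : edist (toCopy (p (devExp dev x (c n)))) (toCopy (p (devExp dev x (c m)))) <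
      ENNReal.ofReal ρ := by
    refine (edist_triangle_right _ _ (f n : MetricCopy Y)).trans_lt ?_
    have h2 := hf m
    rw [← hfnm] at h2
    refine (ENNReal.add_lt_add (hf n) h2).trans_le ?_
    rw [← ENNReal.ofReal_add (by linarith) (by linarith)]
    simp
  obtain ⟨ℓ, hℓ, hb⟩ := exists_brokenGeodesic_of_edist_lt hnear
  obtain ⟨y', hy', hb'⟩ := hp.lift_brokenGeodesic hcov hb _ rfl
  have hbase : ∀ b ∈ V, ∀ a ∈ V, a ∈ star dev (devExp dev x b) ∧
      devExp dev (devExp dev x b) a = devExp dev x a := fun b hb a ha =>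
    devExp_base_change hl hV hVs hb ha
  have hsub : Metric.ball (dev (devExp dev x (c n))) ρ ⊆ star dev (devExp dev x (c n)) := by
    rw [dev_devExp (hVs (hcV n))]
    exact fun a ha => (hbase _ (hcV n) a (hcball n ha)).1
  -- The short path of `Y`, lifted from the `n`-th centre, ends inside the disc around it, over the
  -- image of the `m`-th centre. The translation `a₀ - c m` is nonzero because `a₀` is closer than
  -- `ρ` to `c n` while `c m` is not.
  obtain ⟨a₀, ha₀, hay⟩ := hd.nhds_basis hsub le_rfl
    ((edist_toCopy_le_of_brokenGeodesic hb').trans_lt hℓ)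
  rw [dev_devExp (hVs (hcV n))] at ha₀
  have ha₀V := hcball n ha₀
  rw [(hbase _ (hcV n) a₀ ha₀V).2] at hay
  have hdy' : dev y' = a₀ := by rw [← hay, dev_devExp (hVs ha₀V)]
  have hdy : dev (devExp dev x (c m)) = c m := dev_devExp (hVs (hcV m))
  -- `F` takes the lift of `c m` to `y'` and `G` takes it back; they translate developed images by
  -- `τ` and `-τ`. Liftable segments and obstacles seen from these two points thus match, and both
  -- points lie in the same lifted copy of `V`.
  obtain ⟨F, hF0, hF⟩ := exists_deck hd hp hcov hy'
  obtain ⟨G, hG0, hG⟩ := exists_deck hd hp hcov hy'.symm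
  rw [hdy, hdy'] at hF hG
  set τ := a₀ - c m with hτ
  have hτ' : c m - a₀ = -τ := by rw [hτ]; abel
  rw [hτ'] at hG
  have hstar : ∀ a, a ∈ star dev (devExp dev x (c m)) ↔ a + τ ∈ star dev y' := by
    intro a
    constructor
    · intro h
      have := mem_star_map hF h
      rwa [hF0] at this
    · intro h
      have := mem_star_map hG h
      rwa [hG0, add_neg_cancel_right] at this
  have hlm : ∀ (a : Plane) (t : ℝ), lineMap (c m + τ) (a + τ) t = lineMap (c m) a t + τ := by
    intro a t
    simp only [AffineMap.lineMap_apply_module]; module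
  have hobst : ∀ a, a ∈ obst dev (devExp dev x (c m)) ↔ a + τ ∈ obst dev y' := by
    intro a
    rw [obst, obst, Set.mem_sdiff, Set.mem_sdiff, ← hstar]
    refine and_congr_left' ?_
    simp only [halfStar, mem_ofPred_eq, hdy, hdy']
    have e : a₀ = c m + τ := by rw [hτ]; abel
    rw [e]
    refine forall₂_congr fun t _ => ?_
    rw [hlm, hstar]
  have hbc1 : ∀ a ∈ closure V, (a ∈ obst dev (devExp dev x (c m)) ↔ a ∈ obst dev x) :=
    fun a ha => hd.obst_base_change hV hVo hVs hx (hcV m) ha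
  have hbc2 : ∀ a ∈ closure V, (a ∈ obst dev y' ↔ a ∈ obst dev x) := by
    intro a ha
    rw [← hay]
    exact hd.obst_base_change hV hVo hVs hx ha₀V ha
  have hVy : V ⊆ star dev (devExp dev x (c m)) := fun a ha => (hbase _ (hcV m) a ha).1
  have hVy' : V ⊆ star dev y' := by
    rw [← hay]; exact fun a ha => (hbase _ ha₀V a ha).1
  refine ⟨τ, ?_, ⟨c m, hcV m, by rwa [hτ, add_sub_cancel]⟩, fun a ha hao => ⟨⟨fun h => ?_, fun h => ?_⟩, fun h => ?_, fun h => ?_⟩⟩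
  · intro h0
    rw [hτ, sub_eq_zero] at h0
    rw [Metric.mem_ball, h0] at ha₀
    exact absurd ha₀ (not_lt.2 (hcd n m hnm))
  · exact ((hobst a).1 ((hbc1 a ha).2 hao)).2 (hVy' h)
  · have h1 := (hstar (a - τ)).1 (hVy h)
    rw [sub_add_cancel] at h1
    exact ((hbc2 a ha).2 hao).2 h1
  · exact (hbc2 _ h).1 ((hobst a).1 ((hbc1 a ha).2 hao))
  · rw [← hbc1 _ h, hobst, sub_add_cancel, hbc2 a ha]
    exact hao

end Covering

end TranslationSurface

namespace TranslationSurface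

open AffineMap (lineMap)

/-! ### Quadratic forms on the plane -/

section Forms

/-- The point at infinity `(v₁, v₂, 0)`. -/
def vec (v : Plane) : Fin 3 → ℝ := ![v 0, v 1, 0]

theorem hat_add_smul (a v : Plane) (t : ℝ) : hat (a + t • v) = hat a + t • vec v := by
  ext i; fin_cases i <;> simp [hat, vec]

theorem vec_add (u v : Plane) : vec (u + v) = vec u + vec v := by
  ext i; fin_cases i <;> simp [vec]

theorem vec_smul (t : ℝ) (v : Plane) : vec (t • v) = t • vec v := by
  ext i; fin_cases i <;> simp [vec]

theorem hat_sub_hat (a b : Plane) : hat a - hat b = vec (a - b) := by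
  ext i; fin_cases i <;> simp [hat, vec]

theorem eq_vec_or_smul_hat (w : Fin 3 → ℝ) :
    (∃ v, w = vec v) ∨ ∃ (a : Plane) (t : ℝ), w = t • hat a := by
  by_cases h : w 2 = 0
  · left
    refine ⟨!₂[w 0, w 1], ?_⟩
    ext i; fin_cases i <;> simp [vec, h]
  · right
    refine ⟨!₂[w 0 / w 2, w 1 / w 2], w 2, ?_⟩
    ext i; fin_cases i <;> simp [hat] <;> field_simp

variable (q : Q3)

theorem form_line (a v : Plane) (t : ℝ) : q (hat (a + t • v)) =
    q (hat a) + t * QuadraticMap.polar q (hat a) (vec v) + t ^ 2 * q (vec v) := by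
  rw [hat_add_smul, QuadraticMap.map_add q, QuadraticMap.polar_smul_right, QuadraticMap.map_smul]
  simp only [smul_eq_mul]; ring

theorem form_lineMap (a b : Plane) (t : ℝ) : q (hat (lineMap a b t)) =
    (1 - t) * q (hat a) + t * q (hat b) - t * (1 - t) * q (vec (b - a)) := by
  have h1 := form_line q a (b - a) t
  have h2 := form_line q a (b - a) 1
  rw [one_smul, add_sub_cancel] at h2
  have e : lineMap a b t = a + t • (b - a) := by
    rw [AffineMap.lineMap_apply, vsub_eq_sub, vadd_eq_add, add_comm]
  rw [e, h1, h2]; ring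

theorem form_ext {q q' : Q3} (h : ∀ a, q (hat a) = q' (hat a)) : q = q' := by
  ext w
  rcases eq_vec_or_smul_hat w with ⟨v, rfl⟩ | ⟨a, t, rfl⟩
  · have e : ∀ q : Q3, 2 * q (vec v) = q (hat (0 + (1 : ℝ) • v)) + q (hat (0 + (-1 : ℝ) • v)) -
        2 * q (hat 0) := by
      intro q; rw [form_line, form_line]; ring
    have := e q
    rw [h, h, h, ← e q'] at this
    linarith
  · rw [QuadraticMap.map_smul, QuadraticMap.map_smul, h]

/-- The restriction of `q` to the line at infinity is positive semidefinite, i.e. `x ↦ q (hat x)`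
is a convex function. -/
def IsPsd : Prop := ∀ v, 0 ≤ q (vec v)

variable {q}

/-- For a null vector `v`, the value on `u + t v` is an affine function of `t` that stays
nonnegative, so its slope vanishes. -/
theorem IsPsd.polar_eq_zero (h : IsPsd q) {v : Plane} (hv : q (vec v) = 0) (u : Plane) :
    QuadraticMap.polar q (vec u) (vec v) = 0 := by
  set b := QuadraticMap.polar q (vec u) (vec v) with hb
  have key : ∀ t : ℝ, 0 ≤ q (vec u) + t * b := by
    intro t
    have := h (u + t • v)
    rw [vec_add, vec_smul, QuadraticMap.map_add q, QuadraticMap.polar_smul_right,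
      QuadraticMap.map_smul, hv, ← hb] at this
    simpa using this
  by_contra hne
  have h1 := key (-(q (vec u) + 1) / b)
  rw [div_mul_cancel₀ _ hne] at h1
  linarith

theorem IsPsd.le_lineMap (h : IsPsd q) (a b : Plane) {t : ℝ} (ht : t ∈ Icc (0 : ℝ) 1) :
    q (hat (lineMap a b t)) ≤ (1 - t) * q (hat a) + t * q (hat b) := by
  rw [form_lineMap]
  have := mul_nonneg (mul_nonneg ht.1 (sub_nonneg.2 ht.2)) (h (b - a))
  linarith

theorem IsPsd.convexOn (h : IsPsd q) : ConvexOn ℝ univ fun x : Plane => q (hat x) := by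
  refine ⟨convex_univ, fun a _ b _ s t hs ht hst => ?_⟩
  have := h.le_lineMap a b (t := t) ⟨ht, by linarith⟩
  rw [AffineMap.lineMap_apply_module] at this
  have e : s = 1 - t := by linarith
  rw [e]
  exact this

theorem IsPsd.convex_sublevel (h : IsPsd q) : Convex ℝ (sublevel q) := by
  have := h.convexOn.convex_lt 0
  simpa [sublevel] using this

theorem IsPsd.convex_sublevel_le (h : IsPsd q) : Convex ℝ {x | q (hat x) ≤ 0} := by
  have := h.convexOn.convex_le 0
  simpa using this

/-! #### Topology of the space of forms -/

/-- Six values determine a form, with coefficients polynomial in the vector. This gives joint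
continuity in the form and the vector. -/
theorem form_apply (q : Q3) (w : Fin 3 → ℝ) : q w =
    w 0 ^ 2 * q ![1, 0, 0] + w 1 ^ 2 * q ![0, 1, 0] + w 2 ^ 2 * q ![0, 0, 1] +
    w 0 * w 1 * (q ![1, 1, 0] - q ![1, 0, 0] - q ![0, 1, 0]) +
    w 0 * w 2 * (q ![1, 0, 1] - q ![1, 0, 0] - q ![0, 0, 1]) +
    w 1 * w 2 * (q ![0, 1, 1] - q ![0, 1, 0] - q ![0, 0, 1]) := by
  have e : w = w 0 • ![1, 0, 0] + (w 1 • ![0, 1, 0] + w 2 • ![0, 0, 1]) := by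
    ext i; fin_cases i <;> simp
  have p1 : QuadraticMap.polar q ![1, 0, 0] ![0, 1, 0] =
      q ![1, 1, 0] - q ![1, 0, 0] - q ![0, 1, 0] := by simp [QuadraticMap.polar]
  have p2 : QuadraticMap.polar q ![1, 0, 0] ![0, 0, 1] =
      q ![1, 0, 1] - q ![1, 0, 0] - q ![0, 0, 1] := by simp [QuadraticMap.polar]
  have p3 : QuadraticMap.polar q ![0, 1, 0] ![0, 0, 1] =
      q ![0, 1, 1] - q ![0, 1, 0] - q ![0, 0, 1] := by simp [QuadraticMap.polar]
  conv_lhs => rw [e]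
  rw [QuadraticMap.map_add q, QuadraticMap.map_add q, QuadraticMap.polar_add_right]
  simp only [QuadraticMap.map_smul, QuadraticMap.polar_smul_right, QuadraticMap.polar_smul_left,
    p1, p2, p3, smul_eq_mul]
  ring

theorem continuous_form_apply (w : Fin 3 → ℝ) : Continuous fun q : Q3 => q w :=
  (continuous_apply w).comp continuous_induced_dom

theorem continuous_form_uncurry : Continuous fun r : Q3 × (Fin 3 → ℝ) => r.1 r.2 := by
  have h : ∀ w, Continuous fun r : Q3 × (Fin 3 → ℝ) => r.1 w := fun w =>
    (continuous_form_apply w).comp continuous_fst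
  simp_rw [fun r : Q3 × (Fin 3 → ℝ) => form_apply r.1 r.2]
  have h0 := h ![1, 0, 0]
  have h1 := h ![0, 1, 0]
  have h2 := h ![0, 0, 1]
  have h3 := h ![1, 1, 0]
  have h4 := h ![1, 0, 1]
  have h5 := h ![0, 1, 1]
  fun_prop

theorem continuous_hat : Continuous hat := by
  refine continuous_pi fun i => ?_
  fin_cases i <;> simp [hat] <;> fun_prop

theorem continuous_vec : Continuous vec := by
  refine continuous_pi fun i => ?_
  fin_cases i <;> simp [vec] <;> fun_prop

theorem continuous_form_hat_uncurry : Continuous fun r : Q3 × Plane => r.1 (hat r.2) :=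
  continuous_form_uncurry.comp (continuous_fst.prodMk (continuous_hat.comp continuous_snd))

theorem continuous_form_vec_uncurry : Continuous fun r : Q3 × Plane => r.1 (vec r.2) :=
  continuous_form_uncurry.comp (continuous_fst.prodMk (continuous_vec.comp continuous_snd))

theorem continuous_form_hat (q : Q3) : Continuous fun a : Plane => q (hat a) :=
  continuous_form_hat_uncurry.comp (Continuous.prodMk_right q)

theorem continuous_form_vec (q : Q3) : Continuous fun a : Plane => q (vec a) :=
  continuous_form_vec_uncurry.comp (Continuous.prodMk_right q)

theorem isOpen_sublevel (q : Q3) : IsOpen (sublevel q) :=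
  isOpen_lt (continuous_form_hat q) continuous_const

/-- The evaluation of forms, as a linear map. -/
def formEval : Q3 →ₗ[ℝ] ((Fin 3 → ℝ) → ℝ) where
  toFun q := q
  map_add' _ _ := rfl
  map_smul' _ _ := rfl

/-- The evaluation of forms at a point, as a linear form. -/
def evalAt (w : Fin 3 → ℝ) : Q3 →ₗ[ℝ] ℝ where
  toFun q := q w
  map_add' _ _ := rfl
  map_smul' _ _ := rfl

@[simp] theorem evalAt_apply (w : Fin 3 → ℝ) (q : Q3) : evalAt w q = q w := rfl

instance : IsTopologicalAddGroup Q3 := topologicalAddGroup_induced formEval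

instance : ContinuousSMul ℝ Q3 := continuousSMul_induced formEval

instance : LocallyConvexSpace ℝ Q3 := LocallyConvexSpace.induced formEval

theorem isEmbedding_formEval : IsEmbedding formEval :=
  ⟨⟨rfl⟩, fun q q' h => by
    ext w; exact congr_fun h w⟩

instance : T2Space Q3 := isEmbedding_formEval.t2Space

/-! #### Planar subconics -/

theorem exists_large_of_neg {c B A : ℝ} (hA : A < 0) :
    ∃ T > 0, c + T * B + T ^ 2 * A < 0 ∧ c - T * B + T ^ 2 * A < 0 := by
  refine ⟨(|c| + |B| + 1) / (-A) + 1, by have : 0 < -A := by linarith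
                                         positivity, ?_⟩
  set T := (|c| + |B| + 1) / (-A) + 1 with hT
  have hA' : 0 < -A := by linarith
  have h1 : 1 ≤ T := by
    rw [hT]
    have : 0 ≤ (|c| + |B| + 1) / (-A) := by positivity
    linarith
  have h2 : |c| + |B| + 1 ≤ T * (-A) := by
    rw [hT, add_mul, div_mul_cancel₀ _ hA'.ne']; linarith
  have h3 : T * (|c| + |B| + 1) ≤ T ^ 2 * (-A) := by nlinarith
  have h4 : |c| ≤ T * |c| := by nlinarith [abs_nonneg c]
  have h5 : T * B ≤ T * |B| := by nlinarith [le_abs_self B]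
  have h6 : -(T * B) ≤ T * |B| := by nlinarith [neg_abs_le B]
  constructor <;> nlinarith [le_abs_self c]

/-- If `q (vec v) < 0`, then `q` tends to `-∞` at both ends of every line of direction `v`. Each
point lies midway between two points of the sublevel, so convexity makes the sublevel the whole
plane. -/
theorem isPsd_of_convex_sublevel (hc : Convex ℝ (sublevel q)) (hu : sublevel q ≠ univ) :
    IsPsd q := by
  intro v
  by_contra! hv
  apply hu
  rw [eq_univ_iff_forall]
  intro a
  obtain ⟨T, hT, h1, h2⟩ := exists_large_of_neg (c := q (hat a))
    (B := QuadraticMap.polar q (hat a) (vec v)) hv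
  have h1' : a + T • v ∈ sublevel q := by
    rw [sublevel, mem_ofPred_eq, form_line]; exact h1
  have h2' : a + (-T) • v ∈ sublevel q := by
    rw [sublevel, mem_ofPred_eq, form_line]; linarith
  have := hc h1' h2' (a := 1 / 2) (b := 1 / 2) (by norm_num) (by norm_num) (by norm_num)
  convert this using 1
  module

/-- The rotation by a right angle. -/
noncomputable def rot (v : Plane) : Plane := !₂[-v 1, v 0]

theorem exists_add_rot {v : Plane} (hv : v ≠ 0) (a : Plane) : ∃ s t : ℝ, a = s • v + t • rot v := by
  have hn : v 0 ^ 2 + v 1 ^ 2 ≠ 0 := by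
    intro h0
    apply hv
    have h1 : v 0 = 0 := by nlinarith [sq_nonneg (v 0), sq_nonneg (v 1)]
    have h2 : v 1 = 0 := by nlinarith [sq_nonneg (v 0), sq_nonneg (v 1)]
    ext i; fin_cases i <;> simp [h1, h2]
  refine ⟨(v 0 * a 0 + v 1 * a 1) / (v 0 ^ 2 + v 1 ^ 2),
    (v 0 * a 1 - v 1 * a 0) / (v 0 ^ 2 + v 1 ^ 2), ?_⟩
  ext i
  fin_cases i <;> simp [rot] <;> field_simp <;> ring

/-- The form `q` is positive definite at infinity: its sublevel is an ellipse. -/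
def IsElliptic (q : Q3) : Prop := ∀ v : Plane, v ≠ 0 → 0 < q (vec v)

/-- The form `q` defines a strip of direction `v`. -/
def IsStripAlong (q : Q3) (v : Plane) : Prop :=
  v ≠ 0 ∧ (∀ a (t : ℝ), q (hat (a + t • v)) = q (hat a)) ∧ 0 < q (vec (rot v))

theorem IsElliptic.isPsd (h : IsElliptic q) : IsPsd q := by
  intro v
  by_cases hv : v = 0
  · have : vec v = 0 := by subst hv; ext i; fin_cases i <;> simp [vec]
    rw [this, QuadraticMap.map_zero]
  · exact (h v hv).le

/-- Along a null direction `q` is affine with a slope `L` that does not depend on the line. A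
nonzero slope would push `q` below zero on balls that are too large. -/
theorem IsPsd.invariant_of_bounded (h : IsPsd q) {C : ℝ}
    (hC : ∀ c R, Metric.ball c R ⊆ sublevel q → R ≤ C) {v : Plane} (hv : q (vec v) = 0) (a : Plane)
    (t : ℝ) : q (hat (a + t • v)) = q (hat a) := by
  set L := QuadraticMap.polar q (hat 0) (vec v) with hL
  have hLa : ∀ a, QuadraticMap.polar q (hat a) (vec v) = L := by
    intro a
    have h1 := h.polar_eq_zero hv (a - 0)
    rw [← hat_sub_hat, QuadraticMap.polar_sub_left] at h1
    linarith
  have hline : ∀ a (t : ℝ), q (hat (a + t • v)) = q (hat a) + t * L := by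
    intro a t
    rw [form_line, hLa, hv]; ring
  by_cases hL0 : L = 0
  · rw [hline, hL0]; ring
  exfalso
  obtain ⟨M, hM⟩ := ((isCompact_closedBall (0 : Plane) (C + 1)).image
    (continuous_form_hat q)).bddAbove
  -- Translating the ball of radius `C + 1` by this multiple of `v` subtracts `M + 1` from `q`,
  -- where `M` bounds `q` on the original ball.
  have := hC ((-(M + 1) / L) • v) (C + 1) fun y hy => by
    have e : y = (y - (-(M + 1) / L) • v) + (-(M + 1) / L) • v := by abel
    rw [sublevel, mem_ofPred_eq, e, hline, div_mul_cancel₀ _ hL0]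
    have : q (hat (y - (-(M + 1) / L) • v)) ≤ M := by
      refine hM ⟨_, ?_, rfl⟩
      rw [Metric.mem_closedBall, dist_zero_right]
      rw [Metric.mem_ball, dist_eq_norm] at hy
      exact hy.le
    linarith
  linarith

/-- A null direction leaves `q` invariant, by the bound on inscribed discs. If the perpendicular
direction were null too, `q` would be constant and its sublevel would be the plane. -/
theorem IsPsd.isElliptic_or_isStrip (h : IsPsd q) (hne : (sublevel q).Nonempty) {C : ℝ}
    (hC : ∀ c R, Metric.ball c R ⊆ sublevel q → R ≤ C) :
    IsElliptic q ∨ ∃ v, IsStripAlong q v := by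
  by_cases hel : IsElliptic q
  · exact Or.inl hel
  right
  simp only [IsElliptic, not_forall, not_lt] at hel
  obtain ⟨v, hv0, hv⟩ := hel
  have hv' : q (vec v) = 0 := le_antisymm hv (h v)
  refine ⟨v, hv0, h.invariant_of_bounded hC hv', ?_⟩
  rcases (h (rot v)).eq_or_lt with hr | hr
  · exfalso
    obtain ⟨b, hb⟩ := hne
    have huniv : ∀ a, a ∈ sublevel q := by
      intro a
      obtain ⟨s, t, hst⟩ := exists_add_rot hv0 (a - b)
      have e : a = (b + s • v) + t • rot v := by rw [add_assoc, ← hst]; abel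
      rw [sublevel, mem_ofPred_eq, e, h.invariant_of_bounded hC hr.symm,
        h.invariant_of_bounded hC hv']
      exact hb
    have := hC 0 (C + 1) fun a _ => huniv a
    linarith
  · exact hr

theorem exists_pos_dir (h : IsElliptic q ∨ ∃ v, IsStripAlong q v) : ∃ u, 0 < q (vec u) := by
  rcases h with h | ⟨v, -, -, hv⟩
  · refine ⟨!₂[1, 0], h _ fun h0 => ?_⟩
    have := congrFun (congrArg WithLp.ofLp h0) 0
    simp at this
  · exact ⟨_, hv⟩

theorem quadratic_roots {A B c : ℝ} (hA : 0 < A) (hc : c < 0) :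
    ∃ r s : ℝ, r < 0 ∧ 0 < s ∧ ∀ t, c + t * B + t ^ 2 * A = A * (t - r) * (t - s) := by
  set D := Real.sqrt (B ^ 2 - 4 * A * c) with hD
  have hpos : 0 ≤ B ^ 2 - 4 * A * c := by nlinarith [sq_nonneg B]
  have hDD : D ^ 2 = B ^ 2 - 4 * A * c := Real.sq_sqrt hpos
  have hlt : |B| < D := by
    rw [← Real.sqrt_sq_eq_abs]
    exact Real.sqrt_lt_sqrt (sq_nonneg B) (by nlinarith)
  refine ⟨(-B - D) / (2 * A), (-B + D) / (2 * A), ?_, ?_, fun t => ?_⟩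
  · apply div_neg_of_neg_of_pos _ (by linarith)
    linarith [neg_abs_le B]
  · apply div_pos _ (by linarith)
    linarith [le_abs_self B]
  · field_simp
    linear_combination hDD

/-- A planar subconic determines its form up to a factor. -/
theorem exists_smul_of_sublevel_eq {q q' : Q3} (hq : IsPsd q) (hu : ∃ u, 0 < q (vec u))
    (h : sublevel q = sublevel q') (hne : (sublevel q).Nonempty) :
    ∃ c : ℝ, 0 < c ∧ q' = c • q := by
  obtain ⟨p, hp⟩ := hne
  have hp' : p ∈ sublevel q' := h ▸ hp
  have hiff : ∀ a, q (hat a) < 0 ↔ q' (hat a) < 0 := fun a => Set.ext_iff.1 h a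
  have hp1 : q (hat p) < 0 := hp
  have hp2 : q' (hat p) < 0 := hp'
  -- On a line through `p` in a positive direction, the sublevel is an open interval whose ends are
  -- zeros of both forms. The two quadratic polynomials are proportional, with ratio given by the
  -- values at `p`.
  have key : ∀ v, 0 < q (vec v) → ∀ t : ℝ,
      q (hat p) * q' (hat (p + t • v)) = q' (hat p) * q (hat (p + t • v)) := by
    intro v hv
    obtain ⟨r, s, hr, hs, hrs⟩ := quadratic_roots (B := QuadraticMap.polar q (hat p) (vec v)) hv hp1
    have hq1 : ∀ t : ℝ, q (hat (p + t • v)) = q (vec v) * (t - r) * (t - s) := fun t => by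
      rw [form_line, hrs]
    have hcont : Continuous fun t : ℝ => q' (hat (p + t • v)) :=
      (continuous_form_hat q').comp (by fun_prop)
    have hneg : ∀ t ∈ Ioo r s, q' (hat (p + t • v)) < 0 := by
      intro t ht
      rw [← hiff, hq1]
      have := mul_neg_of_pos_of_neg (sub_pos.2 ht.1) (sub_neg.2 ht.2)
      nlinarith
    have hzero : ∀ t, (t = r ∨ t = s) → q' (hat (p + t • v)) = 0 := by
      intro t ht
      apply le_antisymm
      · have hcl : t ∈ closure (Ioo r s) := by
          rw [closure_Ioo (hr.trans hs).ne]
          rcases ht with rfl | rfl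
          · exact ⟨le_rfl, (hr.trans hs).le⟩
          · exact ⟨(hr.trans hs).le, le_rfl⟩
        exact closure_minimal (s := Ioo r s) (fun t ht => (hneg t ht).le)
          (isClosed_le hcont continuous_const) hcl
      · rw [← not_lt, ← hiff, hq1]
        rcases ht with rfl | rfl <;> simp
    have hr0 := hzero r (Or.inl rfl)
    have hs0 := hzero s (Or.inr rfl)
    intro t
    have h0 := hq1 0
    rw [zero_smul, add_zero] at h0
    rw [form_line] at hr0 hs0
    rw [hq1, form_line, h0]
    set b := QuadraticMap.polar q' (hat p) (vec v)
    set c := q' (hat p)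
    set A := q' (vec v)
    have e1 : b = -(r + s) * A := by
      have : (r - s) * (b + (r + s) * A) = 0 := by linear_combination hr0 - hs0
      rcases mul_eq_zero.1 this with h | h
      · linarith
      · linarith
    have e2 : c = r * s * A := by rw [e1] at hr0; linear_combination hr0
    rw [e1, e2]; ring
  have key2 : ∀ a, q (hat p) * q' (hat a) = q' (hat p) * q (hat a) := by
    intro a
    set v := a - p
    have ha : a = p + (1 : ℝ) • v := by simp [v]
    rcases (hq v).eq_or_lt with hv | hv
    -- A null direction is a limit of positive directions `v + ε u`.
    · obtain ⟨u, hu⟩ := hu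
      have hε : ∀ ε : ℝ, ε ≠ 0 → q (hat p) * q' (hat (a + ε • u)) = q' (hat p) * q (hat (a + ε • u)) := by
        intro ε hε
        have h1 : 0 < q (vec (v + ε • u)) := by
          rw [vec_add, vec_smul, QuadraticMap.map_add q, QuadraticMap.polar_smul_right,
            QuadraticMap.polar_comm, hq.polar_eq_zero hv.symm, ← hv, QuadraticMap.map_smul]
          simp only [smul_eq_mul]
          have := mul_self_pos.2 hε
          nlinarith
        have := key _ h1 1
        have e : p + (1 : ℝ) • (v + ε • u) = a + ε • u := by rw [ha]; module
        rwa [e] at this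
      have hc1 : Continuous fun ε : ℝ => q (hat p) * q' (hat (a + ε • u)) :=
        continuous_const.mul ((continuous_form_hat q').comp (by fun_prop))
      have hc2 : Continuous fun ε : ℝ => q' (hat p) * q (hat (a + ε • u)) :=
        continuous_const.mul ((continuous_form_hat q).comp (by fun_prop))
      have := Continuous.ext_on (dense_compl_singleton (0 : ℝ)) hc1 hc2 fun ε hε' => hε ε hε'
      have := congr_fun this 0
      simpa using this
    · rw [ha]; exact key v hv 1
  refine ⟨q' (hat p) / q (hat p), div_pos_of_neg_of_neg hp2 hp1, form_ext fun a => ?_⟩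
  rw [_root_.smul_apply, smul_eq_mul, div_mul_eq_mul_div, eq_div_iff hp1.ne, ← key2]
  ring

end Forms

end TranslationSurface

namespace TranslationSurface

open AffineMap (lineMap)

/-! ### Subconics and forms -/

/-- The planar subconic defined by a form. -/
def planeSubconic (q : {q : Q3 // (sublevel q).Nonempty ∧ sublevel q ≠ univ}) : PlaneSubconic :=
  ⟨sublevel q.1, q.1, rfl, q.2⟩

theorem continuous_planeSubconic : Continuous planeSubconic := continuous_coinduced_rng

theorem isOpen_planeSubconic_iff {S : Set PlaneSubconic} :
    IsOpen S ↔ IsOpen (planeSubconic ⁻¹' S) := isOpen_coinduced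

section SubconicForms

variable {X : Type*} [TopologicalSpace X] [ChartedSpace Plane X] {dev : X → Plane} {x : X}
  {q : Q3}

/-- The convex forms that are negative at `c` and nonnegative on `O`. -/
def adm (O : Set Plane) (c : Plane) : Set Q3 :=
  {q | IsPsd q ∧ q (hat c) < 0 ∧ ∀ a ∈ O, 0 ≤ q (hat a)}

/-- The convex forms that are negative at `x` and nonnegative at all cone points visible
from `x`. -/
abbrev admissible (dev : X → Plane) (x : X) : Set Q3 := adm (obst dev x) (dev x)

theorem IsPsd.closure_sublevel (h : IsPsd q) (hne : (sublevel q).Nonempty) :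
    closure (sublevel q) = {a | q (hat a) ≤ 0} := by
  obtain ⟨p, hp⟩ := hne
  apply subset_antisymm
  · exact closure_minimal (fun a ha => (show q (hat a) < 0 from ha).le)
      (isClosed_le (continuous_form_hat q) continuous_const)
  · intro a ha
    refine mem_closure_of_tendsto (tendsto_lineMap_one p a) ?_
    filter_upwards [eventually_mem_Ico] with t ht
    have h1 := h.le_lineMap p a ⟨ht.1, ht.2.le⟩
    have h2 := mul_neg_of_pos_of_neg (sub_pos.2 ht.2) (show q (hat p) < 0 from hp)
    have h3 := mul_nonpos_of_nonneg_of_nonpos ht.1 ha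
    show q _ < 0
    linarith

variable [T2Space X] (hd : IsDevelopingMap dev)
include hd

theorem IsDevelopingMap.isConvex_image {V : Set Plane} (hV : Convex ℝ V) (hVs : V ⊆ star dev x) :
    IsConvex (devExp dev x '' V) := by
  have hl := hd.isLocalHomeomorph
  rintro _ ⟨a, ha, rfl⟩ _ ⟨b, hb, rfl⟩
  obtain ⟨⟨γ, hγ⟩, h2⟩ := devExp_base_change hl hV hVs hb ha
  refine ⟨γ, _, hd.isGeodesic_of_isLiftSeg hγ, hγ.1, by rw [← hγ.devExp_eq hl, h2], ?_⟩
  rintro _ ⟨t, rfl⟩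
  have h3 : lineMap b a (t : ℝ) ∈ V :=
    hV.segment_subset hb ha (by rw [segment_eq_image_lineMap]; exact ⟨t, t.2, rfl⟩)
  refine ⟨_, h3, ?_⟩
  rw [← hγ.devExp_lineMap hl t, dev_devExp (hVs hb)]
  exact (devExp_base_change hl hV hVs hb h3).2.symm

theorem IsDevelopingMap.mem_of_isConvex {C : Set X} (hC : IsConvex C) {x y : X} (hx : x ∈ C)
    (hy : y ∈ C) : dev y ∈ star dev x ∧ devExp dev x (dev y) = y ∧
      segment ℝ (dev x) (dev y) ⊆ dev '' C := by
  obtain ⟨γ, v, hγ, h0, h1, hr⟩ := hC y hy x hx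
  have h2 := hd.lift_isGeodesic hγ 1
  have h3 := (hd.isGeodesic_iff.1 hγ).2
  have h4 : dev y = dev (γ 0) + ((1 : unitInterval) : ℝ) • v := by rw [← h3, h1]
  rw [← h4, h1, h0] at h2
  refine ⟨h2.1, h2.2, ?_⟩
  rw [segment_eq_image_lineMap]
  rintro _ ⟨t, ht, rfl⟩
  refine ⟨γ ⟨t, ht⟩, hr ⟨_, rfl⟩, ?_⟩
  rw [h3, h0, h4, h0, AffineMap.lineMap_apply]
  simp [add_comm]

theorem IsDevelopingMap.convex_dev_image {C : Set X} (hC : IsConvex C) : Convex ℝ (dev '' C) := by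
  rw [convex_iff_segment_subset]
  rintro _ ⟨y, hy, rfl⟩ _ ⟨z, hz, rfl⟩
  exact (hd.mem_of_isConvex hC hy hz).2.2

theorem IsDevelopingMap.eq_image_of_isConvex {C : Set X} (hC : IsConvex C) (hx : x ∈ C) :
    C = devExp dev x '' (dev '' C) := by
  rw [image_image]
  apply subset_antisymm
  · exact fun y hy => ⟨y, hy, (hd.mem_of_isConvex hC hx hy).2.1⟩
  · rintro _ ⟨y, hy, rfl⟩
    show devExp dev x (dev y) ∈ C
    rwa [(hd.mem_of_isConvex hC hx hy).2.1]

theorem IsDevelopingMap.subset_star_of_isConvex {C : Set X} (hC : IsConvex C) (hx : x ∈ C) :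
    dev '' C ⊆ star dev x := by
  rintro _ ⟨y, hy, rfl⟩
  exact (hd.mem_of_isConvex hC hx hy).1

/-- A convex set containing `x` develops into the star of `x`, which contains no obstacle by
definition. -/
theorem IsDevelopingMap.mem_admissible {U : Subconic dev} (hx : x ∈ U.1)
    (hq : dev '' U.1 = sublevel q) : q ∈ admissible dev x := by
  have hc := hd.convex_dev_image U.2.1
  have hs := hd.subset_star_of_isConvex U.2.1 hx
  obtain ⟨-, -, -, -, hu⟩ := U.2
  rw [hq] at hc hs hu
  refine ⟨isPsd_of_convex_sublevel hc hu, ?_, fun a ha => ?_⟩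
  · have : dev x ∈ sublevel q := hq ▸ mem_image_of_mem dev hx
    exact this
  · by_contra! h
    exact ha.2 (hs h)

theorem IsDevelopingMap.subconic_eq {U U' : Subconic dev} (hx : x ∈ U.1) (hx' : x ∈ U'.1)
    (h : dev '' U.1 = dev '' U'.1) : U = U' := by
  apply Subtype.ext
  rw [hd.eq_image_of_isConvex U.2.1 hx, hd.eq_image_of_isConvex U'.2.1 hx', h]

/-- This is the converse of `mem_admissible`: the forms of the subconics containing `x` are exactly
the admissible ones, apart from the requirement that the sublevel is not the plane. -/
theorem IsDevelopingMap.sublevel_subset_star (hq : q ∈ admissible dev x) :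
    sublevel q ⊆ star dev x :=
  hd.subset_star (hq.1.convex_sublevel.starConvex hq.2.1) fun a ha h =>
    not_lt.2 (hq.2.2 a ha) h

theorem IsDevelopingMap.dev_image_devExp {V : Set Plane} (hVs : V ⊆ star dev x) :
    dev '' (devExp dev x '' V) = V := by
  rw [image_image]
  exact (image_congr fun a ha => dev_devExp (hVs ha)).trans (image_id _)

theorem IsDevelopingMap.closure_sublevel_subset (hq : q ∈ admissible dev x) :
    {a | q (hat a) ≤ 0} ⊆ halfStar dev x := by
  rw [← hq.1.closure_sublevel ⟨_, hq.2.1⟩]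
  exact hd.closure_subset_halfStar hq.1.convex_sublevel (isOpen_sublevel q)
    (hd.sublevel_subset_star hq) hq.2.1

theorem IsDevelopingMap.injOn_barExp : InjOn (barExp dev x) (halfStar dev x) := by
  intro a ha b hb h
  rw [← hd.devBar_barExp ha, h, hd.devBar_barExp hb]

theorem IsDevelopingMap.closure_subconic {U : Subconic dev} (hx : x ∈ U.1)
    (hq : dev '' U.1 = sublevel q) :
    closure (toBar '' U.1) = barExp dev x '' {a | q (hat a) ≤ 0} := by
  have hadm := hd.mem_admissible hx hq
  rw [hd.eq_image_of_isConvex U.2.1 hx, hq, hd.closure_image_devExp hadm.1.convex_sublevel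
    (isOpen_sublevel q) (hd.sublevel_subset_star hadm) hadm.2.1,
    hadm.1.closure_sublevel ⟨_, hadm.2.1⟩]

theorem IsDevelopingMap.boundary_eq {U : Subconic dev} (hx : x ∈ U.1)
    (hq : dev '' U.1 = sublevel q) :
    U.boundary = barExp dev x '' {a | q (hat a) = 0} := by
  have hadm := hd.mem_admissible hx hq
  have hs := hd.sublevel_subset_star hadm
  have hU : toBar '' U.1 = barExp dev x '' sublevel q := by
    rw [hd.eq_image_of_isConvex U.2.1 hx, hq, image_image]
    exact image_congr fun a ha => (hd.barExp_eq (hs ha)).symm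
  have hUo : IsOpen (toBar '' U.1) := by
    refine hd.isOpenEmbedding_toBar.isOpenMap _ ?_
    rw [hd.eq_image_of_isConvex U.2.1 hx, hq]
    exact isOpen_image_devExp hd.isLocalHomeomorph (isOpen_sublevel q) hs
  rw [Subconic.boundary, hUo.frontier_eq, hd.closure_subconic hx hq, hU,
    ← (hd.injOn_barExp.mono (hd.closure_sublevel_subset hadm)).image_sdiff_subset
      (show sublevel q ⊆ {a | q (hat a) ≤ 0} from
        fun a ha => (show q (hat a) < 0 from ha).le)]
  congr 1
  ext a
  simp only [sublevel, Set.mem_sdiff, mem_ofPred_eq, not_lt]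
  exact ⟨fun h => le_antisymm h.1 h.2, fun h => ⟨h.le, h.ge⟩⟩

/-- The boundary is the `barExp` image of the zero set of `q`, and a point of that set goes to the
frontier of `X` exactly when it is an obstacle. From here on, incidences with cone points are
equations at obstacles. -/
theorem IsDevelopingMap.conePoints_eq {U : Subconic dev} (hx : x ∈ U.1)
    (hq : dev '' U.1 = sublevel q) :
    U.conePoints = barExp dev x '' {a | a ∈ obst dev x ∧ q (hat a) = 0} := by
  have hadm := hd.mem_admissible hx hq
  rw [Subconic.conePoints, hd.boundary_eq hx hq]
  ext u
  constructor
  · rintro ⟨⟨a, ha, rfl⟩, hb⟩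
    exact ⟨a, ⟨hd.mem_obst_iff.2 ⟨hd.closure_sublevel_subset hadm (le_of_eq ha), hb⟩, ha⟩, rfl⟩
  · rintro ⟨a, ⟨ha, ha'⟩, rfl⟩
    exact ⟨⟨a, ha', rfl⟩, (hd.mem_obst_iff.1 ha).2⟩

theorem IsDevelopingMap.devBar_conePoints {U : Subconic dev} (hx : x ∈ U.1)
    (hq : dev '' U.1 = sublevel q) :
    devBar dev '' U.conePoints = {a | a ∈ obst dev x ∧ q (hat a) = 0} := by
  rw [hd.conePoints_eq hx hq, image_image]
  exact (image_congr fun a ha => hd.devBar_barExp ha.1.1).trans (image_id _)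

theorem IsDevelopingMap.mem_conePoints_iff {U : Subconic dev} (hx : x ∈ U.1)
    (hq : dev '' U.1 = sublevel q) {a : Plane} (ha : a ∈ obst dev x) :
    barExp dev x a ∈ U.conePoints ↔ q (hat a) = 0 := by
  rw [hd.conePoints_eq hx hq]
  constructor
  · rintro ⟨b, hb, hab⟩
    rw [← hd.injOn_barExp hb.1.1 ha.1 hab]; exact hb.2
  · exact fun h => ⟨a, ⟨ha, h⟩, rfl⟩

theorem IsDevelopingMap.exists_form {U : Subconic dev} : ∃ q, dev '' U.1 = sublevel q := by
  obtain ⟨-, q, hq, -⟩ := U.2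
  exact ⟨q, hq⟩

theorem IsDevelopingMap.nonempty_subconic (U : Subconic dev) : U.1.Nonempty := by
  obtain ⟨-, q, hq, h, -⟩ := U.2
  exact h.of_image

theorem IsDevelopingMap.injOn_devBar_conePoints (U : Subconic dev) :
    InjOn (devBar dev) U.conePoints := by
  obtain ⟨x, hx⟩ := hd.nonempty_subconic U
  obtain ⟨q, hq⟩ := hd.exists_form (U := U)
  rw [hd.conePoints_eq hx hq]
  rintro _ ⟨a, ha, rfl⟩ _ ⟨b, hb, rfl⟩ h
  rw [hd.devBar_barExp ha.1.1, hd.devBar_barExp hb.1.1] at h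
  rw [h]

omit [ChartedSpace Plane X] hd in
theorem ball_radius_le {C : ℝ} (hl : IsLocalHomeomorph dev)
    (hC : ∀ (x : X) (R : ℝ), Metric.ball (dev x) R ⊆ star dev x → R ≤ C)
    {V : Set Plane} (hV : Convex ℝ V) (hVs : V ⊆ star dev x) (c : Plane) (R : ℝ)
    (hR : Metric.ball c R ⊆ V) : R ≤ max C 0 := by
  rcases le_or_gt R 0 with h | h
  · exact h.trans (le_max_right _ _)
  · refine le_trans (hC (devExp dev x c) R ?_) (le_max_left _ _)
    have hc := hR (Metric.mem_ball_self h)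
    rw [dev_devExp (hVs hc)]
    exact fun a ha => (devExp_base_change hl hV hVs hc (hR ha)).1

theorem IsDevelopingMap.admissible_cases {C : ℝ}
    (hC : ∀ (x : X) (R : ℝ), Metric.ball (dev x) R ⊆ star dev x → R ≤ C)
    (hq : q ∈ admissible dev x) : IsElliptic q ∨ ∃ v, IsStripAlong q v :=
  hq.1.isElliptic_or_isStrip ⟨_, hq.2.1⟩ fun c R hR => ball_radius_le hd.isLocalHomeomorph hC
    hq.1.convex_sublevel (hd.sublevel_subset_star hq) c R hR

theorem IsDevelopingMap.sublevel_ne_univ {C : ℝ}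
    (hC : ∀ (x : X) (R : ℝ), Metric.ball (dev x) R ⊆ star dev x → R ≤ C)
    (hq : q ∈ admissible dev x) : sublevel q ≠ univ := by
  intro h
  have := ball_radius_le hd.isLocalHomeomorph hC convex_univ
    (h ▸ hd.sublevel_subset_star hq) 0 (max C 0 + 1) (subset_univ _)
  linarith

/-- The subconic containing `x` that is defined by an admissible form. -/
noncomputable def toSubconic {C : ℝ}
    (hC : ∀ (x : X) (R : ℝ), Metric.ball (dev x) R ⊆ star dev x → R ≤ C)
    (x : X) (q : admissible dev x) : Subconic dev :=
  ⟨devExp dev x '' sublevel q, hd.isConvex_image q.2.1.convex_sublevel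
    (hd.sublevel_subset_star q.2), q, hd.dev_image_devExp (hd.sublevel_subset_star q.2),
    by rw [hd.dev_image_devExp (hd.sublevel_subset_star q.2)]; exact ⟨_, q.2.2.1⟩,
    by rw [hd.dev_image_devExp (hd.sublevel_subset_star q.2)]; exact hd.sublevel_ne_univ hC q.2⟩

section

variable {C : ℝ} (hC : ∀ (x : X) (R : ℝ), Metric.ball (dev x) R ⊆ star dev x → R ≤ C)

theorem mem_toSubconic (q : admissible dev x) : x ∈ (toSubconic hd hC x q).1 :=
  ⟨dev x, q.2.2.1, devExp_self hd.isLocalHomeomorph⟩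

theorem dev_toSubconic (q : admissible dev x) :
    dev '' (toSubconic hd hC x q).1 = sublevel q :=
  hd.dev_image_devExp (hd.sublevel_subset_star q.2)

/-- The topology has two sources. Continuity of the developed image comes from the quotient
topology. The condition that `y` belongs to the subconic is `q (hat (dev y)) < 0` if `y` is visible
from `x`, and impossible otherwise. -/
theorem continuous_toSubconic : Continuous (toSubconic hd hC x) := by
  refine (continuous_inf_rng (t₂ := TopologicalSpace.induced (develop dev) inferInstance)
    (t₃ := TopologicalSpace.generateFrom
      (range fun x : X => {U : Subconic dev | x ∈ U.1}))).2
    ⟨continuous_induced_rng.2 ?_, continuous_generateFrom_iff.2 ?_⟩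
  · have h2 : Continuous fun q : admissible dev x =>
        (⟨q.1, ⟨_, q.2.2.1⟩, hd.sublevel_ne_univ hC q.2⟩ :
          {q : Q3 // (sublevel q).Nonempty ∧ sublevel q ≠ univ}) :=
      continuous_subtype_val.subtype_mk _
    have h3 : develop dev ∘ toSubconic hd hC x = fun q => planeSubconic
        ⟨q.1, ⟨_, q.2.2.1⟩, hd.sublevel_ne_univ hC q.2⟩ :=
      funext fun q => Subtype.ext (dev_toSubconic hd hC q)
    rw [h3]
    exact continuous_planeSubconic.comp h2
  · rintro _ ⟨y, rfl⟩
    by_cases hy : dev y ∈ star dev x ∧ devExp dev x (dev y) = y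
    · have : toSubconic hd hC x ⁻¹' {U | y ∈ U.1} =
          {q : admissible dev x | (q : Q3) (hat (dev y)) < 0} := by
        ext q
        constructor
        · rintro ⟨a, ha, hay⟩
          have : dev y = a := by
            rw [← hay, dev_devExp (hd.sublevel_subset_star q.2 ha)]
          rw [mem_ofPred_eq, this]; exact ha
        · intro h
          exact ⟨dev y, h, hy.2⟩
      rw [this]
      exact isOpen_lt ((continuous_form_apply _).comp continuous_subtype_val) continuous_const
    · have : toSubconic hd hC x ⁻¹' {U | y ∈ U.1} = ∅ := by
        rw [eq_empty_iff_forall_notMem]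
        rintro q ⟨a, ha, hay⟩
        have h1 := hd.sublevel_subset_star q.2 ha
        have : dev y = a := by rw [← hay, dev_devExp h1]
        exact hy ⟨this ▸ h1, by rw [this, hay]⟩
      rw [this]
      exact isOpen_empty

end

omit [ChartedSpace Plane X] [T2Space X] hd in
theorem isOpen_setOf_mem_planeSubconic (a : Plane) : IsOpen {V : PlaneSubconic | a ∈ V.1} := by
  refine isOpen_planeSubconic_iff.2 ?_
  exact isOpen_lt ((continuous_form_apply (hat a)).comp continuous_subtype_val) continuous_const

omit [ChartedSpace Plane X] [T2Space X] hd in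
-- The form `q'` is nonnegative around `a`. If it vanished there, its restriction to the line
-- towards `b` would have a local minimum at `a`, hence no linear term and a nonnegative quadratic
-- term, against `q' (hat b) < 0`.
theorem form_pos_of_sublevel_eq {q q' : Q3} (h : sublevel q = sublevel q') {a b : Plane}
    (ha : 0 < q (hat a)) (hb : q (hat b) < 0) : 0 < q' (hat a) := by
  have hiff : ∀ c, q (hat c) < 0 ↔ q' (hat c) < 0 := fun c => Set.ext_iff.1 h c
  have hb' := (hiff b).1 hb
  have hnn : ∀ c, 0 ≤ q (hat c) → 0 ≤ q' (hat c) := fun c hc => by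
    rw [← not_lt, ← hiff]; exact not_lt.2 hc
  rcases (hnn a ha.le).eq_or_lt with h0 | h0
  swap
  · exact h0
  exfalso
  set B := QuadraticMap.polar q' (hat a) (vec (b - a))
  set A := q' (vec (b - a))
  have hline : ∀ t : ℝ, q' (hat (a + t • (b - a))) = t * B + t ^ 2 * A := fun t => by
    rw [form_line, ← h0, zero_add]
  have hnear : ∀ᶠ t in 𝓝 (0 : ℝ), 0 ≤ t * B + t ^ 2 * A := by
    have hc : Continuous fun t : ℝ => q (hat (a + t • (b - a))) :=
      (continuous_form_hat q).comp (by fun_prop)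
    have h1 : ∀ᶠ t in 𝓝 (0 : ℝ), 0 < q (hat (a + t • (b - a))) :=
      hc.continuousAt.eventually (lt_mem_nhds (by simpa using ha))
    filter_upwards [h1] with t ht
    rw [← hline]
    exact hnn _ ht.le
  obtain ⟨ε, hε, h2⟩ := Metric.eventually_nhds_iff.1 hnear
  have h3 := hline 1
  rw [one_smul, add_sub_cancel] at h3
  rw [h3] at hb'
  set s := min (ε / 2) 1
  have hs : 0 < s := lt_min (by linarith) one_pos
  have hs1 : s ≤ 1 := min_le_right _ _
  have hsε : s < ε := (min_le_left _ _).trans_lt (by linarith)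
  have k1 := h2 (y := s) (by rw [Real.dist_eq, sub_zero, abs_of_pos hs]; exact hsε)
  have k2 := h2 (y := -s) (by rw [Real.dist_eq, sub_zero, abs_neg, abs_of_pos hs]; exact hsε)
  have k3 : 0 ≤ B + s * A := by
    by_contra! h
    nlinarith
  have k4 : 0 ≤ -B + s * A := by
    by_contra! h
    nlinarith
  nlinarith

omit [ChartedSpace Plane X] [T2Space X] hd in
theorem isOpen_setOf_pos_planeSubconic (a b : Plane) :
    IsOpen {V : PlaneSubconic | b ∈ V.1 ∧ ∃ q, V.1 = sublevel q ∧ 0 < q (hat a)} := by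
  refine isOpen_planeSubconic_iff.2 ?_
  have : planeSubconic ⁻¹'
      {V : PlaneSubconic | b ∈ V.1 ∧ ∃ q, V.1 = sublevel q ∧ 0 < q (hat a)} =
      {q | q.1 (hat b) < 0} ∩ {q | 0 < q.1 (hat a)} := by
    ext q
    constructor
    · rintro ⟨hb, q', hq', ha⟩
      have hb' : b ∈ sublevel q' := hq' ▸ hb
      exact ⟨hb, form_pos_of_sublevel_eq hq'.symm ha hb'⟩
    · rintro ⟨hb, ha⟩
      exact ⟨hb, q.1, rfl, ha⟩
  rw [this]
  exact (isOpen_lt ((continuous_form_apply _).comp continuous_subtype_val) continuous_const).inter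
    (isOpen_lt continuous_const ((continuous_form_apply _).comp continuous_subtype_val))

omit [ChartedSpace Plane X] [T2Space X] hd in
-- Seen from a point `b` of the sublevel, the form is strictly positive just beyond a point that is
-- not in the sublevel, by convexity.
theorem exists_form_pos {q' : Q3} (hq' : IsPsd q') (hne : (sublevel q').Nonempty) {V : Set Plane}
    (hV : IsOpen V) {a : Plane} (ha : a ∈ V) (ha' : a ∉ sublevel q') :
    ∃ a ∈ V, 0 < q' (hat a) := by
  obtain ⟨b, hb⟩ := hne
  have hb0 : q' (hat b) < 0 := hb
  have ha0 : 0 ≤ q' (hat a) := not_lt.1 ha'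
  have hc : Continuous fun t : ℝ => lineMap b a t := by fun_prop
  have h1 : ∀ᶠ t in 𝓝 (1 : ℝ), lineMap b a t ∈ V :=
    hc.continuousAt.eventually (hV.mem_nhds (by simpa using ha))
  obtain ⟨t, ht, ht1⟩ := ((h1.filter_mono (nhdsWithin_le_nhds (s := Ioi 1))).and
    self_mem_nhdsWithin).exists
  have ht1' : (1 : ℝ) < t := ht1
  refine ⟨_, ht, ?_⟩
  have h2 := hq'.le_lineMap b (lineMap b a t) (t := t⁻¹)
    ⟨by positivity, inv_le_one_of_one_le₀ ht1'.le⟩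
  have e : lineMap b (lineMap b a t) t⁻¹ = a := by
    simp only [AffineMap.lineMap_apply, vsub_eq_sub, vadd_eq_add, add_sub_cancel_right, smul_smul]
    rw [inv_mul_cancel₀ (by linarith)]; simp
  rw [e] at h2
  have h3 : 0 < 1 - t⁻¹ := sub_pos.2 (inv_lt_one_of_one_lt₀ ht1')
  have h4 : 0 < t⁻¹ := by positivity
  by_contra! h5
  nlinarith [mul_neg_of_pos_of_neg h3 hb0, mul_nonpos_of_nonneg_of_nonpos h4.le h5]

omit [T2Space X] hd in
theorem continuous_develop : Continuous (develop dev) :=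
  continuous_iff_le_induced.2 inf_le_left

omit [T2Space X] hd in
theorem isOpen_setOf_mem_subconic (y : X) : IsOpen {U : Subconic dev | y ∈ U.1} := by
  have h : IsOpen[TopologicalSpace.generateFrom
      (range fun x : X => {U : Subconic dev | x ∈ U.1})] {U : Subconic dev | y ∈ U.1} :=
    TopologicalSpace.isOpen_generateFrom_of_mem ⟨y, rfl⟩
  exact h.mono inf_le_right

/-- If the developed images differ, a point inside one and strictly outside the other separates the
subconics. If the images agree, take `x` and `x'` in the two subconics over the same point of the
plane: a convex set containing both would force `x = x'`, and then the subconics coincide. -/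
theorem IsDevelopingMap.t2Space_subconic : T2Space (Subconic dev) := by
  have key : ∀ U U' : Subconic dev, ¬ dev '' U.1 ⊆ dev '' U'.1 →
      ∃ O O' : Set (Subconic dev), IsOpen O ∧ IsOpen O' ∧ U ∈ O ∧ U' ∈ O' ∧ Disjoint O O' := by
    intro U U' h
    obtain ⟨a₀, ha₀, ha₀'⟩ := not_subset.1 h
    obtain ⟨x, hx⟩ := hd.nonempty_subconic U
    obtain ⟨x', hx'⟩ := hd.nonempty_subconic U'
    obtain ⟨q, hq⟩ := hd.exists_form (U := U)
    obtain ⟨q', hq'⟩ := hd.exists_form (U := U')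
    have hadm := hd.mem_admissible hx' hq'
    rw [hq] at ha₀
    rw [hq'] at ha₀'
    obtain ⟨a, ha, ha'⟩ := exists_form_pos hadm.1 ⟨_, hadm.2.1⟩ (isOpen_sublevel q) ha₀ ha₀'
    refine ⟨develop dev ⁻¹' {V | a ∈ V.1}, develop dev ⁻¹'
      {V | dev x' ∈ V.1 ∧ ∃ q, V.1 = sublevel q ∧ 0 < q (hat a)},
      (isOpen_setOf_mem_planeSubconic a).preimage continuous_develop,
      (isOpen_setOf_pos_planeSubconic a _).preimage continuous_develop, ?_, ?_, ?_⟩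
    · show a ∈ dev '' U.1
      rw [hq]; exact ha
    · exact ⟨mem_image_of_mem dev hx', q', hq', ha'⟩
    · rw [Set.disjoint_left]
      rintro W h1 ⟨-, q'', h2, h3⟩
      rw [mem_preimage, mem_ofPred_eq, h2] at h1
      exact absurd h1 (not_lt.2 h3.le)
  refine ⟨fun U U' hne => ?_⟩
  by_cases h1 : dev '' U.1 ⊆ dev '' U'.1
  swap
  · exact key U U' h1
  by_cases h2 : dev '' U'.1 ⊆ dev '' U.1
  swap
  · obtain ⟨O, O', a, b, c, d, e⟩ := key U' U h2
    exact ⟨O', O, b, a, d, c, e.symm⟩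
  have h3 := subset_antisymm h1 h2
  obtain ⟨x, hx⟩ := hd.nonempty_subconic U
  obtain ⟨x', hx', hxx⟩ := h1 (mem_image_of_mem dev hx)
  refine ⟨_, _, isOpen_setOf_mem_subconic x, isOpen_setOf_mem_subconic x', hx, hx', ?_⟩
  rw [Set.disjoint_left]
  intro W hW hW'
  have h4 := (hd.mem_of_isConvex W.2.1 hW hW').2.1
  rw [hxx, devExp_self hd.isLocalHomeomorph] at h4
  rw [← h4] at hx'
  exact hne (hd.subconic_eq hx hx' h3)

end SubconicForms

end TranslationSurface

namespace TranslationSurface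

open AffineMap (lineMap)

/-! ### Convex forms and obstacles in the plane -/

theorem IsElliptic.exists_radius {q : Q3} (hq : IsElliptic q) (c : Plane) :
    ∃ R > 0, ∀ a, R ≤ dist a c → 0 < q (hat a) := by
  obtain ⟨m, hm, hm'⟩ : ∃ m > 0, ∀ u ∈ Metric.sphere (0 : Plane) 1, m ≤ q (vec u) := by
    obtain ⟨u₀, hu₀, h⟩ := (isCompact_sphere (0 : Plane) 1).exists_isMinOn
      (NormedSpace.sphere_nonempty.2 zero_le_one) (continuous_form_vec q).continuousOn
    refine ⟨_, hq u₀ ?_, fun u hu => h hu⟩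
    rintro rfl
    simp at hu₀
  obtain ⟨M, hM⟩ : ∃ M, ∀ u ∈ Metric.sphere (0 : Plane) 1,
      M ≤ QuadraticMap.polar q (hat c) (vec u) := by
    have hc : Continuous fun u : Plane => QuadraticMap.polar q (hat c) (vec u) := by
      have h1 : ∀ u : Plane, QuadraticMap.polar q (hat c) (vec u) =
          q (hat (c + u)) - q (hat c) - q (vec u) := by
        intro u
        have := form_line q c u 1
        rw [one_smul] at this
        rw [this]; ring
      simp only [h1]
      exact (((continuous_form_hat q).comp (by fun_prop)).sub continuous_const).sub
        (continuous_form_vec q)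
    obtain ⟨u₀, -, h⟩ := (isCompact_sphere (0 : Plane) 1).exists_isMinOn
      (NormedSpace.sphere_nonempty.2 zero_le_one) hc.continuousOn
    exact ⟨_, fun u hu => h hu⟩
  set b := q (hat c)
  refine ⟨(|M| + |b|) / m + 1, by positivity, fun a ha => ?_⟩
  set R := dist a c
  have hR : 0 < R := lt_of_lt_of_le (by positivity) ha
  have hu : R⁻¹ • (a - c) ∈ Metric.sphere (0 : Plane) 1 := by
    rw [mem_sphere_zero_iff_norm, norm_smul, norm_inv, Real.norm_of_nonneg hR.le, ← dist_eq_norm]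
    exact inv_mul_cancel₀ hR.ne'
  have e : a = c + R • (R⁻¹ • (a - c)) := by
    rw [smul_smul, mul_inv_cancel₀ hR.ne', one_smul, add_sub_cancel]
  rw [e, form_line]
  have h1 := hm' _ hu
  have h2 := hM _ hu
  have h3 : |M| + |b| ≤ (R - 1) * m := by
    rw [← div_le_iff₀ hm]; linarith
  have hR1 : 1 ≤ R := le_trans (by simp; positivity) ha
  have h4 := neg_abs_le M
  have h5 := neg_abs_le b
  have h6 : R * M ≤ R * QuadraticMap.polar q (hat c) (vec (R⁻¹ • (a - c))) := by gcongr
  have h7 : R ^ 2 * m ≤ R ^ 2 * q (vec (R⁻¹ • (a - c))) := by gcongr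
  have h8 : -(R * |M|) ≤ R * M := by nlinarith
  have h9 : |b| ≤ R * |b| := by nlinarith [abs_nonneg b]
  have h10 : R * (|M| + |b|) ≤ R * ((R - 1) * m) := by gcongr
  nlinarith

/-- Positivity on a large circle and on the directions at infinity is an open condition by
compactness. Convexity then keeps the closed sublevel of a nearby form inside the circle. -/
theorem IsElliptic.eventually {q : Q3} (hq : IsElliptic q) (c : Plane) :
    ∃ R, ∀ᶠ q' in 𝓝 q, IsElliptic q' ∧
      (q' (hat c) < 0 → ∀ a, q' (hat a) ≤ 0 → a ∈ Metric.closedBall c R) := by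
  obtain ⟨R, hR, h⟩ := hq.exists_radius c
  have h1 : ∀ᶠ q' in 𝓝 q, ∀ u ∈ Metric.sphere (0 : Plane) 1, 0 < q' (vec u) := by
    refine (isCompact_sphere (0 : Plane) 1).eventually_forall_of_forall_eventually fun u hu => ?_
    refine (continuous_form_vec_uncurry.continuousAt (x := (q, u))).eventually
      (lt_mem_nhds (hq u ?_))
    rintro rfl
    simp at hu
  have h2 : ∀ᶠ q' in 𝓝 q, ∀ a ∈ Metric.sphere c R, 0 < q' (hat a) := by
    refine (isCompact_sphere c R).eventually_forall_of_forall_eventually fun a ha => ?_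
    exact (continuous_form_hat_uncurry.continuousAt (x := (q, a))).eventually
      (lt_mem_nhds (h a (Metric.mem_sphere.1 ha).ge))
  refine ⟨R, ?_⟩
  filter_upwards [h1, h2] with q' h1 h2
  have hell : IsElliptic q' := by
    intro v hv
    have hn : 0 < ‖v‖ := norm_pos_iff.2 hv
    have h3 := h1 (‖v‖⁻¹ • v) (by
      rw [mem_sphere_zero_iff_norm, norm_smul, norm_inv, norm_norm, inv_mul_cancel₀ hn.ne'])
    rw [vec_smul, QuadraticMap.map_smul, smul_eq_mul] at h3
    exact (pos_iff_pos_of_mul_pos h3).1 (by positivity)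
  refine ⟨hell, fun hc a ha => ?_⟩
  by_contra! hout
  rw [Metric.mem_closedBall, not_le] at hout
  have hp : 0 < dist a c := hR.trans hout
  have h3 := hell.isPsd.le_lineMap c a (t := R / dist a c)
    ⟨by positivity, (div_le_one hp).2 hout.le⟩
  have h4 := h2 (lineMap c a (R / dist a c)) (by
    rw [Metric.mem_sphere, dist_lineMap_left, Real.norm_of_nonneg (by positivity), dist_comm c a,
      div_mul_cancel₀ _ hp.ne'])
  have h5 : 0 < 1 - R / dist a c := sub_pos.2 ((div_lt_one hp).2 hout)
  have h6 : 0 ≤ R / dist a c := by positivity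
  nlinarith [mul_neg_of_pos_of_neg h5 hc, mul_nonpos_of_nonneg_of_nonpos h6 ha]

/-! ### Admissible forms and the obstacles that constrain them -/

section Adm

variable {O : Set Plane} {c : Plane} {q q' q₀ : Q3}

theorem adm_smul (hq : q ∈ adm O c) {s : ℝ} (hs : 0 < s) : s • q ∈ adm O c :=
  ⟨fun v => mul_nonneg hs.le (hq.1 v), mul_neg_of_pos_of_neg hs hq.2.1,
    fun a ha => mul_nonneg hs.le (hq.2.2 a ha)⟩

theorem adm_add_smul (hq : q ∈ adm O c) (hq' : q' ∈ adm O c) {s : ℝ} (hs : 0 ≤ s) :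
    q + s • q' ∈ adm O c :=
  ⟨fun v => add_nonneg (hq.1 v) (mul_nonneg hs (hq'.1 v)),
    add_neg_of_neg_of_nonpos hq.2.1 (mul_nonpos_of_nonneg_of_nonpos hs hq'.2.1.le),
    fun a ha => add_nonneg (hq.2.2 a ha) (mul_nonneg hs (hq'.2.2 a ha))⟩

theorem convex_adm : Convex ℝ (adm O c) := by
  intro q hq q' hq' s t hs ht hst
  rcases hs.eq_or_lt with rfl | hs
  · have : t = 1 := by linarith
    rwa [this, zero_smul, one_smul, zero_add]
  · exact adm_add_smul (adm_smul hq hs) hq' ht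

/-- The points of `O` where `q` vanishes. -/
def zeros (O : Set Plane) (q : Q3) : Set Plane := {a | a ∈ O ∧ q (hat a) = 0}

variable (O c) in
/-- The properties of the set `O` of the obstacles visible from the point `c` of the plane: the
admissible forms define ellipses or strips, the obstacles are isolated in the corresponding closed
subconics, and the obstacles on the boundary of a strip are invariant under a translation. -/
structure Tame : Prop where
  cases : ∀ q ∈ adm O c, IsElliptic q ∨ ∃ v, IsStripAlong q v
  isolated : ∀ q ∈ adm O c, ∀ b, q (hat b) ≤ 0 → ∀ᶠ a in 𝓝 b, a ∈ O → a = b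
  strip : ∀ q ∈ adm O c, ∀ v, IsStripAlong q v →
    ∃ s : ℝ, 0 < s ∧ ∀ a ∈ zeros O q, a + s • v ∈ O ∧ a - s • v ∈ O

variable (hO : Tame O c)
include hO

/-- A point of `B` where `q₀` is positive stays harmless nearby. At a point `b` with `q₀ (hat b) ≤
0`, the only obstacle nearby can be `b` itself, and then `b` is a zero of `q₀`. Compactness of `B`
makes this uniform. -/
theorem Tame.eventually_nonneg (hq₀ : q₀ ∈ adm O c) {B : Set Plane} (hB : IsCompact B) :
    ∀ᶠ q in 𝓝 q₀, (∀ a ∈ zeros O q₀, 0 ≤ q (hat a)) →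
      (∀ a ∈ O, q (hat a) < 0 → a ∈ B) → ∀ a ∈ O, 0 ≤ q (hat a) := by
  have h : ∀ᶠ q in 𝓝 q₀, ∀ a ∈ B, a ∈ O → (q₀ (hat a) = 0 → 0 ≤ q (hat a)) →
      0 ≤ q (hat a) := by
    refine hB.eventually_forall_of_forall_eventually fun b _ => ?_
    have hc := continuous_form_hat_uncurry.continuousAt (x := (q₀, b))
    rcases le_or_gt (q₀ (hat b)) 0 with h | h
    · filter_upwards [(continuous_snd.continuousAt (x := (q₀, b))).eventually
        (hO.isolated q₀ hq₀ b h)] with z hz hz' hz''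
      refine hz'' (le_antisymm ?_ (hq₀.2.2 _ hz'))
      rw [hz hz']; exact h
    · filter_upwards [hc.eventually (lt_mem_nhds h)] with z hz _ _
      exact le_of_lt hz
  filter_upwards [h] with q hq h1 h2 a ha
  by_contra! hneg
  exact absurd (hq a (h2 a ha hneg) ha fun h => h1 a ⟨ha, h⟩) (not_le.2 hneg)

/-- The closed subconics of the forms near an elliptic form stay in a fixed disc, so only the
inequalities at its own zeros can fail. -/
theorem Tame.eventually_adm (hq : q ∈ adm O c) (he : IsElliptic q) :
    ∀ᶠ q' in 𝓝 q, (∀ a ∈ zeros O q, 0 ≤ q' (hat a)) → q' ∈ adm O c ∧ IsElliptic q' := by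
  obtain ⟨R, h1⟩ := he.eventually c
  have h2 : ∀ᶠ q' in 𝓝 q, q' (hat c) < 0 :=
    (continuous_form_apply _).continuousAt.eventually (gt_mem_nhds hq.2.1)
  filter_upwards [h1, h2, hO.eventually_nonneg hq (isCompact_closedBall c R)]
    with q' h1 h2 h3 h4
  exact ⟨⟨h1.1.isPsd, h2, h3 h4 fun a _ ha => h1.2 h2 a ha.le⟩, h1.1⟩

/-- Here `q` may be a strip. Far away both summands are nonnegative on the obstacles, since `q'` is
elliptic; in a disc, a large multiple of `q` dominates except at its zeros, where `q'` is
nonnegative. This produces ellipses touching prescribed obstacles of a strip. -/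
theorem Tame.exists_add_smul_adm (hq : q ∈ adm O c) (he : IsElliptic q')
    (h : ∀ a ∈ zeros O q, 0 ≤ q' (hat a)) : ∃ M : ℝ, 0 < M ∧ q' + M • q ∈ adm O c := by
  obtain ⟨R, hR, h1⟩ := he.exists_radius c
  have hc : Continuous fun t : ℝ => q + t • q' := by fun_prop
  have h0 : q + (0 : ℝ) • q' = q := by simp
  have h2 : ∀ᶠ q'' in 𝓝 q, q'' (hat c) < 0 :=
    (continuous_form_apply _).continuousAt.eventually (gt_mem_nhds hq.2.1)
  have h3 := (h2.and (hO.eventually_nonneg hq (isCompact_closedBall c R)))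
  rw [← h0] at h3
  have h4 := (hc.continuousAt.eventually h3).filter_mono (nhdsWithin_le_nhds (s := Ioi 0))
  obtain ⟨t, ⟨h5, h6⟩, ht⟩ := (h4.and self_mem_nhdsWithin).exists
  have ht : 0 < t := ht
  have h7 : q + t • q' ∈ adm O c := by
    refine ⟨fun v => add_nonneg (hq.1 v) (mul_nonneg ht.le (he.isPsd v)), h5, ?_⟩
    rw [h0] at h6
    refine h6 (fun a ha => add_nonneg ha.2.ge (mul_nonneg ht.le (h a ha))) fun a ha hneg => ?_
    by_contra! hout
    rw [Metric.mem_closedBall, not_le] at hout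
    exact absurd hneg (not_lt.2 (add_nonneg (hq.2.2 a ha) (mul_nonneg ht.le (h1 a hout.le).le)))
  refine ⟨t⁻¹, by positivity, ?_⟩
  have := adm_smul h7 (inv_pos.2 ht)
  rwa [smul_add, smul_smul, inv_mul_cancel₀ ht.ne', one_smul, add_comm] at this

end Adm

end TranslationSurface

namespace TranslationSurface

open AffineMap (lineMap)

/-! ### Forms vanishing at the vertices of a triangle -/

theorem linearIndependent_hat {w : Fin 3 → Plane} (hw : AffineIndependent ℝ w) :
    LinearIndependent ℝ (fun i => hat (w i)) := by
  rw [Fintype.linearIndependent_iff]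
  intro g hg
  have h0 := congrFun hg 0
  have h1 := congrFun hg 1
  have h2 := congrFun hg 2
  simp only [hat, Fin.sum_univ_three, Pi.add_apply, Pi.smul_apply, smul_eq_mul, Pi.zero_apply,
    Matrix.cons_val_zero, Matrix.cons_val_one, Matrix.cons_val, mul_one] at h0 h1 h2
  rw [affineIndependent_iff] at hw
  intro i
  refine hw Finset.univ g (by rw [Fin.sum_univ_three]; exact h2) ?_ i (Finset.mem_univ i)
  ext j
  fin_cases j <;> simp [Fin.sum_univ_three] <;> assumption

/-- The basis of `ℝ³` given by the vertices of a triangle. -/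
noncomputable def hatBasis {w : Fin 3 → Plane} (hw : AffineIndependent ℝ w) :
    Module.Basis (Fin 3) ℝ (Fin 3 → ℝ) :=
  basisOfLinearIndependentOfCardEqFinrank (linearIndependent_hat hw) (by simp)

/-- Barycentric coordinates with respect to a triangle. -/
noncomputable def bary {w : Fin 3 → Plane} (hw : AffineIndependent ℝ w) (i : Fin 3) :
    (Fin 3 → ℝ) →ₗ[ℝ] ℝ := (hatBasis hw).coord i

/-- The forms vanishing at the three vertices. -/
def vanishing (w : Fin 3 → Plane) : Submodule ℝ Q3 where
  carrier := {q | ∀ i, q (hat (w i)) = 0}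
  add_mem' h h' i := by
    show _ + _ = (0 : ℝ)
    rw [h i, h' i, add_zero]
  zero_mem' i := rfl
  smul_mem' t q h i := by
    show t * _ = (0 : ℝ)
    rw [h i, mul_zero]

theorem mem_vanishing {w : Fin 3 → Plane} {q : Q3} :
    q ∈ vanishing w ↔ ∀ i, q (hat (w i)) = 0 := Iff.rfl

/-- The coefficients of a form that vanishes at the vertices of a triangle. -/
def triCoef (w : Fin 3 → Plane) : Q3 →ₗ[ℝ] (Fin 3 → ℝ) where
  toFun q i := -QuadraticMap.polar q (hat (w (i + 1))) (hat (w (i + 2)))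
  map_add' q q' := by
    ext i
    simp only [FunLike.coe_add, QuadraticMap.polar_add, Pi.add_apply]
    ring
  map_smul' t q := by
    ext i
    simp only [FunLike.coe_smul, QuadraticMap.polar_smul, Pi.smul_apply, smul_eq_mul,
      RingHom.id_apply]
    ring

theorem continuous_triCoef (w : Fin 3 → Plane) : Continuous (triCoef w) := by
  refine continuous_pi fun i => ?_
  exact (((continuous_form_apply _).sub (continuous_form_apply _)).sub
    (continuous_form_apply _)).neg

variable {w : Fin 3 → Plane} (hw : AffineIndependent ℝ w)

theorem bary_hat (i j : Fin 3) : bary hw i (hat (w j)) = if i = j then 1 else 0 := by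
  have : hat (w j) = hatBasis hw j := by simp [hatBasis]
  rw [this, bary, Module.Basis.coord_apply, Module.Basis.repr_self, Finsupp.single_apply]
  simp [eq_comm]

theorem sum_bary (u : Fin 3 → ℝ) : bary hw 0 u • hat (w 0) + bary hw 1 u • hat (w 1) +
    bary hw 2 u • hat (w 2) = u := by
  have := (hatBasis hw).sum_repr u
  rw [Fin.sum_univ_three] at this
  simpa [hatBasis, bary] using this

theorem sum_bary_apply_two (u : Fin 3 → ℝ) :
    bary hw 0 u + bary hw 1 u + bary hw 2 u = u 2 := by
  have := congrFun (sum_bary hw u) 2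
  simpa [hat] using this

theorem bary_ext {u u' : Fin 3 → ℝ} (h : ∀ i, bary hw i u = bary hw i u') : u = u' := by
  rw [← sum_bary hw u, ← sum_bary hw u', h 0, h 1, h 2]

theorem hat_injective : Function.Injective hat := by
  intro a b h
  ext i
  fin_cases i
  · exact congrFun h 0
  · exact congrFun h 1

theorem bary_ext_hat {a a' : Plane} (h : ∀ i, bary hw i (hat a) = bary hw i (hat a')) : a = a' :=
  hat_injective (bary_ext hw h)

theorem sum_bary_hat (a : Plane) :
    bary hw 0 (hat a) + bary hw 1 (hat a) + bary hw 2 (hat a) = 1 := by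
  rw [sum_bary_apply_two]; rfl

theorem sum_bary_vec (a : Plane) :
    bary hw 0 (vec a) + bary hw 1 (vec a) + bary hw 2 (vec a) = 0 := by
  rw [sum_bary_apply_two]; rfl

/-- In barycentric coordinates, vanishing at the vertices kills the square terms and leaves three
mixed products. -/
theorem form_eq_triCoef {q : Q3} (hq : q ∈ vanishing w) (u : Fin 3 → ℝ) :
    q u = -(triCoef w q 0 * (bary hw 1 u * bary hw 2 u) +
      triCoef w q 1 * (bary hw 2 u * bary hw 0 u) +
      triCoef w q 2 * (bary hw 0 u * bary hw 1 u)) := by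
  conv_lhs => rw [← sum_bary hw u]
  rw [QuadraticMap.map_add q, QuadraticMap.map_add q, QuadraticMap.polar_add_left]
  simp only [QuadraticMap.polar_smul_left, QuadraticMap.polar_smul_right, QuadraticMap.map_smul,
    hq _, smul_eq_mul]
  have e0 : triCoef w q 0 = -QuadraticMap.polar q (hat (w 1)) (hat (w 2)) := rfl
  have e1 : triCoef w q 1 = -QuadraticMap.polar q (hat (w 2)) (hat (w 0)) := rfl
  have e2 : triCoef w q 2 = -QuadraticMap.polar q (hat (w 0)) (hat (w 1)) := rfl
  rw [e0, e1, e2, QuadraticMap.polar_comm q (hat (w 2)) (hat (w 0))]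
  ring

/-- The form vanishing at the vertices with given coefficients. -/
noncomputable def triForm : (Fin 3 → ℝ) →ₗ[ℝ] Q3 where
  toFun t := -(t 0 • QuadraticMap.linMulLin (bary hw 1) (bary hw 2) +
    t 1 • QuadraticMap.linMulLin (bary hw 2) (bary hw 0) +
    t 2 • QuadraticMap.linMulLin (bary hw 0) (bary hw 1))
  map_add' t t' := by
    simp only [Pi.add_apply, add_smul]; abel
  map_smul' s t := by
    simp only [Pi.smul_apply, smul_eq_mul, mul_smul, RingHom.id_apply, smul_neg, smul_add]

theorem triForm_apply (t : Fin 3 → ℝ) (u : Fin 3 → ℝ) :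
    triForm hw t u = -(t 0 * (bary hw 1 u * bary hw 2 u) +
      t 1 * (bary hw 2 u * bary hw 0 u) + t 2 * (bary hw 0 u * bary hw 1 u)) := by
  simp [triForm]

theorem triForm_mem (t : Fin 3 → ℝ) : triForm hw t ∈ vanishing w := by
  intro i
  rw [triForm_apply]
  fin_cases i <;> simp [bary_hat]

theorem triCoef_triForm (t : Fin 3 → ℝ) : triCoef w (triForm hw t) = t := by
  ext i
  show -(triForm hw t (hat (w (i + 1)) + hat (w (i + 2))) - triForm hw t (hat (w (i + 1))) -
    triForm hw t (hat (w (i + 2)))) = _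
  rw [triForm_mem hw t, triForm_mem hw t, triForm_apply]
  simp only [map_add, bary_hat]
  fin_cases i <;> simp [Fin.ext_iff]

theorem triForm_triCoef {q : Q3} (hq : q ∈ vanishing w) : triForm hw (triCoef w q) = q := by
  ext u
  rw [triForm_apply, form_eq_triCoef hw hq]

theorem continuous_triForm : Continuous (triForm hw) := by
  refine continuous_induced_rng.2 (continuous_pi fun u => ?_)
  show Continuous fun t => triForm hw t u
  simp only [triForm_apply]
  fun_prop

include hw in
theorem ext_triCoef {q q' : Q3} (hq : q ∈ vanishing w) (hq' : q' ∈ vanishing w)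
    (h : triCoef w q = triCoef w q') : q = q' := by
  rw [← triForm_triCoef hw hq, h, triForm_triCoef hw hq']

include hw in
theorem ne_of_affineIndependent {i j : Fin 3} (hij : i ≠ j) : w i ≠ w j :=
  fun h => hij (hw.injective h)

theorem polar_smul_eq (q : Q3) (a b : Plane) :
    QuadraticMap.polar q (hat a) (hat b) = q (hat a) + q (hat b) - q (vec (b - a)) := by
  have e : vec (b - a) = hat b + (-1 : ℝ) • hat a := by
    rw [← hat_sub_hat, neg_one_smul, sub_eq_add_neg]
  have h := QuadraticMap.map_add q (hat b) ((-1 : ℝ) • hat a)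
  rw [QuadraticMap.polar_smul_right, QuadraticMap.map_smul, ← e,
    QuadraticMap.polar_comm q (hat b) (hat a)] at h
  simp only [smul_eq_mul] at h
  linarith

/-- Each coefficient is the value of the form on the direction of the opposite side. Convexity and
ellipticity of the form therefore become signs of the coefficients. -/
theorem triCoef_eq {q : Q3} (hq : q ∈ vanishing w) (i : Fin 3) :
    triCoef w q i = q (vec (w (i + 2) - w (i + 1))) := by
  show -QuadraticMap.polar q (hat (w (i + 1))) (hat (w (i + 2))) = _
  rw [polar_smul_eq, hq, hq]
  ring

theorem triCoef_nonneg {q : Q3} (hq : q ∈ vanishing w) (h : IsPsd q) (i : Fin 3) :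
    0 ≤ triCoef w q i := by
  rw [triCoef_eq hq]
  exact h _

include hw in
theorem triCoef_pos {q : Q3} (hq : q ∈ vanishing w) (h : IsElliptic q) (i : Fin 3) :
    0 < triCoef w q i := by
  rw [triCoef_eq hq]
  refine h _ (sub_ne_zero.2 (ne_of_affineIndependent hw ?_))
  fin_cases i <;> decide

theorem vec_sub_bary (v : Plane) (i : Fin 3) (a : Plane) (s : ℝ) :
    bary hw i (hat (a + s • v)) = bary hw i (hat a) + s * bary hw i (vec v) := by
  rw [hat_add_smul, map_add, map_smul, smul_eq_mul]

theorem bary_vec_sub (i j k : Fin 3) : bary hw i (vec (w j - w k)) =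
    (if i = j then 1 else 0) - if i = k then 1 else 0 := by
  rw [← hat_sub_hat, map_sub, bary_hat, bary_hat]

/-- A criterion of ellipticity. -/
theorem isElliptic_triForm {t : Fin 3 → ℝ} (h0 : t 0 = 1)
    (h : 1 + (t 2 - t 1) ^ 2 = t 1 + t 2) : IsElliptic (triForm hw t) := by
  intro v hv
  rw [triForm_apply, h0]
  have h1 := sum_bary_vec hw v
  set y := bary hw 1 (vec v)
  set z := bary hw 2 (vec v)
  have h3 : bary hw 0 (vec v) = -(y + z) := by linarith
  rw [h3]
  have hne : y ≠ 0 ∨ z ≠ 0 := by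
    by_contra! hyz
    apply hv
    have h4 : vec v = 0 := by
      apply bary_ext hw
      intro i
      fin_cases i <;> simp only [map_zero] 
      · show bary hw 0 (vec v) = 0
        rw [h3, hyz.1, hyz.2]; simp
      · exact hyz.1
      · exact hyz.2
    ext i
    fin_cases i
    · exact congrFun h4 0
    · exact congrFun h4 1
  -- Given `t 0 = 1`, the hypothesis determines `t 1` and `t 2` in terms of `s`, and the form
  -- becomes half a sum of squares without common zero.
  set s := t 2 - t 1
  have h5 : t 2 = (1 + s ^ 2 + s) / 2 := by simp only [s] at *; linarith
  have h6 : t 1 = (1 + s ^ 2 - s) / 2 := by simp only [s] at *; linarith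
  rw [h5, h6]
  have e : -(1 * (y * z) + (1 + s ^ 2 - s) / 2 * (z * -(y + z)) +
      (1 + s ^ 2 + s) / 2 * (-(y + z) * y)) =
      ((s * (y + z) + (y - z) / 2) ^ 2 + (y - z) ^ 2 / 4 + (y + z) ^ 2 / 2) / 2 := by ring
  rw [e]
  by_contra! hle
  have k0 := sq_nonneg (s * (y + z) + (y - z) / 2)
  have k1 : y - z = 0 := by
    nlinarith [sq_nonneg (y - z), sq_nonneg (y + z)]
  have k2 : y + z = 0 := by
    nlinarith [sq_nonneg (y - z), sq_nonneg (y + z)]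
  rcases hne with h | h
  · exact h (by linarith)
  · exact h (by linarith)

theorem exists_least_pos {S : Set ℝ} (hS : ∀ b, ∀ᶠ s in 𝓝 b, s ∈ S → s = b)
    (hne : ∃ s ∈ S, 0 < s) : ∃ s ∈ S, 0 < s ∧ ∀ t ∈ S, 0 < t → s ≤ t := by
  set P := {s | s ∈ S ∧ 0 < s}
  have hP : P.Nonempty := hne
  have hb : BddBelow P := ⟨0, fun s hs => hs.2.le⟩
  obtain ⟨ε, hε, h⟩ := Metric.eventually_nhds_iff.1 (hS (sInf P))
  obtain ⟨s, hs, hs'⟩ := Real.lt_sInf_add_pos hP hε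
  have h1 : s = sInf P := h (by
    rw [Real.dist_eq, abs_of_nonneg (sub_nonneg.2 (csInf_le hb hs))]; linarith) hs.1
  exact ⟨s, hs.1, hs.2, fun t ht ht' => h1 ▸ csInf_le hb ⟨ht, ht'⟩⟩

theorem exists_perm : ∀ i j : Fin 3, i ≠ j → ∃ σ : Equiv.Perm (Fin 3), σ 1 = i ∧ σ 2 = j := by
  decide

/-! ### Strips through the vertices of a triangle -/

section StripNormalForm

variable {O : Set Plane} {c : Plane} {q r q₀ : Q3} (hO : Tame O c)
include hO hw

/-- The boundary of the strip consists of two parallel lines, so two of the three vertices share a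
line. The permutation calls them 1 and 2; the side joining them is then a null direction, which
kills the coefficient 0 and makes the other two equal. -/
theorem Tame.strip_normal_form (hq₀ : q₀ ∈ adm O c)
    (hv : q₀ ∈ vanishing w) (he : ¬ IsElliptic q₀) : ∃ σ : Equiv.Perm (Fin 3),
      triCoef (w ∘ σ) q₀ 0 = 0 ∧ triCoef (w ∘ σ) q₀ 1 = triCoef (w ∘ σ) q₀ 2 ∧
      0 < triCoef (w ∘ σ) q₀ 1 ∧ ∃ τ : ℝ, 0 < τ ∧ ∀ a ∈ zeros O q₀,
        a + τ • (w (σ 2) - w (σ 1)) ∈ O ∧ a - τ • (w (σ 2) - w (σ 1)) ∈ O := by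
  obtain ⟨v, hstrip⟩ := (hO.cases q₀ hq₀).resolve_left he
  obtain ⟨hv0, hinv, hpos⟩ := hstrip
  have hqv : q₀ (vec v) = 0 := by
    have h1 := hinv c 1
    have h2 := hinv c (-1)
    rw [form_line] at h1 h2
    linarith
  obtain ⟨s₁, hs₁, hs₁'⟩ := hO.strip q₀ hq₀ v ⟨hv0, hinv, hpos⟩
  -- The transverse coordinate of a vertex, measured from `w 0`, satisfies a quadratic equation with
  -- the root 0: the vertex is on the line of `w 0` or on the opposite one.
  have hdec : ∀ i, ∃ x y : ℝ, w i = w 0 + y • rot v + x • v ∧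
      (y = 0 ∨ y * q₀ (vec (rot v)) = -QuadraticMap.polar q₀ (hat (w 0)) (vec (rot v))) := by
    intro i
    obtain ⟨x, y, hxy⟩ := exists_add_rot hv0 (w i - w 0)
    have e : w i = w 0 + y • rot v + x • v := by
      rw [add_assoc, add_comm (y • rot v), ← hxy, add_sub_cancel]
    refine ⟨x, y, e, ?_⟩
    have h1 := hv i
    rw [e, hinv, form_line, hv 0] at h1
    have h2 : y * (QuadraticMap.polar q₀ (hat (w 0)) (vec (rot v)) + y * q₀ (vec (rot v))) = 0 := by
      linarith
    rcases mul_eq_zero.1 h2 with h | h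
    · exact Or.inl h
    · right; linarith
  have hpair : ∃ i j : Fin 3, i ≠ j ∧ ∃ s : ℝ, w j - w i = s • v := by
    obtain ⟨x₁, y₁, h₁, h₁'⟩ := hdec 1
    obtain ⟨x₂, y₂, h₂, h₂'⟩ := hdec 2
    rcases h₁' with h | h
    · exact ⟨0, 1, by decide, x₁, by rw [h₁, h]; simp⟩
    rcases h₂' with h' | h'
    · exact ⟨0, 2, by decide, x₂, by rw [h₂, h']; simp⟩
    refine ⟨1, 2, by decide, x₂ - x₁, ?_⟩
    have : y₁ = y₂ := mul_right_cancel₀ hpos.ne' (h.trans h'.symm)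
    rw [h₁, h₂, this, sub_smul]; abel
  obtain ⟨i, j, hij, s, hs⟩ := hpair
  obtain ⟨σ, rfl, rfl⟩ : ∃ σ : Equiv.Perm (Fin 3), σ 1 = i ∧ σ 2 = j :=
    exists_perm i j hij
  have hs0 : s ≠ 0 := by
    rintro rfl
    rw [zero_smul, sub_eq_zero] at hs
    exact hij (hw.injective hs.symm)
  have hv' : q₀ ∈ vanishing (w ∘ σ) := fun i => hv _
  have e0 : triCoef (w ∘ σ) q₀ 0 = 0 := by
    rw [triCoef_eq hv']
    show q₀ (vec (w (σ 2) - w (σ 1))) = 0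
    rw [hs, vec_smul, QuadraticMap.map_smul, hqv]; simp
  have e1 : triCoef (w ∘ σ) q₀ 1 = triCoef (w ∘ σ) q₀ 2 := by
    rw [triCoef_eq hv', triCoef_eq hv']
    show q₀ (vec (w (σ 0) - w (σ 2))) = q₀ (vec (w (σ 1) - w (σ 0)))
    have : w (σ 1) - w (σ 0) = (-1 : ℝ) • ((w (σ 0) - w (σ 2)) + s • v) := by
      rw [← hs]; module
    rw [this, vec_smul, QuadraticMap.map_smul, vec_add, QuadraticMap.map_add q₀, vec_smul,
      QuadraticMap.polar_smul_right, hq₀.1.polar_eq_zero hqv, QuadraticMap.map_smul, hqv]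
    simp
  refine ⟨σ, e0, e1, ?_, s₁ / |s|, by positivity, fun a ha => ?_⟩
  · refine (triCoef_nonneg hv' hq₀.1 1).lt_of_ne' fun h => ?_
    have hw' := hw.comp_embedding σ.toEmbedding
    have h3 := hq₀.2.1
    rw [form_eq_triCoef hw' hv', show triCoef (w ∘ σ.toEmbedding) = triCoef (w ∘ σ) from rfl,
      ← e1, h, e0] at h3
    simp at h3
  · rw [hs, smul_smul]
    rcases lt_or_gt_of_ne hs0 with h | h
    · rw [abs_of_neg h, show s₁ / -s * s = -s₁ by field_simp, neg_smul, sub_neg_eq_add,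
        ← sub_eq_add_neg]
      exact (hs₁' a ha).symm
    · rw [abs_of_pos h, show s₁ / s * s = s₁ by field_simp]
      exact hs₁' a ha

end StripNormalForm

section Normalized

variable {O : Set Plane} {c : Plane} {q r q₀ : Q3}
include hw

theorem form_line_zero (hr : r ∈ vanishing w) (s : ℝ) :
    r (hat (w 0 + s • (w 2 - w 1))) =
      triCoef w r 0 * s ^ 2 + (triCoef w r 2 - triCoef w r 1) * s := by
  rw [form_eq_triCoef hw hr]
  simp only [vec_sub_bary, bary_vec_sub, bary_hat]
  simp
  ring

theorem form_line_one (hr : r ∈ vanishing w) (y : ℝ) :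
    r (hat (w 1 + y • (w 2 - w 1))) = -(triCoef w r 0 * (y * (1 - y))) := by
  rw [form_eq_triCoef hw hr]
  simp only [vec_sub_bary, bary_vec_sub, bary_hat]
  simp
  left
  ring

theorem eq_smul_of_triCoef (hv : q₀ ∈ vanishing w) (h0 : triCoef w q₀ 0 = 0)
    (h1 : triCoef w q₀ 1 = triCoef w q₀ 2) (h2 : 0 < triCoef w q₀ 1) (hr : r ∈ vanishing w)
    (hr0 : triCoef w r 0 = 0) (hr1 : triCoef w r 1 = triCoef w r 2) :
    r = (triCoef w r 1 / triCoef w q₀ 1) • q₀ := by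
  refine ext_triCoef hw hr (Submodule.smul_mem _ _ hv) ?_
  rw [map_smul]
  ext i
  simp only [Pi.smul_apply, smul_eq_mul]
  fin_cases i
  · simp [hr0, h0]
  · show triCoef w r 1 = _
    simp only [Fin.mk_one]
    field_simp
  · show triCoef w r 2 = _ * triCoef w q₀ 2
    rw [← hr1, ← h1]
    field_simp

theorem eq_of_zero_strip (hv : q₀ ∈ vanishing w) (h0 : triCoef w q₀ 0 = 0)
    (h1 : triCoef w q₀ 1 = triCoef w q₀ 2) (h2 : 0 < triCoef w q₀ 1) {a : Plane}
    (ha : q₀ (hat a) = 0) : a = w 1 + (bary hw 2 (hat a)) • (w 2 - w 1) ∨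
      a = w 0 + (bary hw 2 (hat a)) • (w 2 - w 1) := by
  rw [form_eq_triCoef hw hv, h0, ← h1] at ha
  have hs := sum_bary_hat hw a
  have h3 : triCoef w q₀ 1 * (bary hw 0 (hat a) * (1 - bary hw 0 (hat a))) = 0 := by
    rw [← hs]; linarith
  have key : ∀ i, (∀ j, bary hw j (hat a) = (if j = i then 1 else 0) + bary hw 2 (hat a) *
      ((if j = 2 then 1 else 0) - if j = 1 then 1 else 0)) →
      a = w i + (bary hw 2 (hat a)) • (w 2 - w 1) := by
    intro i hi
    apply bary_ext_hat hw
    intro j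
    rw [vec_sub_bary, bary_vec_sub, bary_hat]
    exact hi j
  rcases mul_eq_zero.1 h3 with h | h
  · exact absurd h h2.ne'
  rcases mul_eq_zero.1 h with h | h
  · left
    apply key
    intro j
    fin_cases j
    · simpa using h
    · simp; linarith
    · simp
  · right
    apply key
    intro j
    fin_cases j
    · simp; linarith
    · simp; linarith
    · simp

/-- On the line of `w 1` and `w 2` the translate of `w 1` is a third zero of `r`, so the coefficient
0 of `r` vanishes. On the other line the translate of `w 0` then forces the remaining coefficients
to be equal. -/
theorem strip_rigid (hv : q₀ ∈ vanishing w) (h0 : triCoef w q₀ 0 = 0)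
    (h1 : triCoef w q₀ 1 = triCoef w q₀ 2) (h2 : 0 < triCoef w q₀ 1) (hwO : ∀ i, w i ∈ O)
    {τ : ℝ} (hτ : 0 < τ) (h : ∀ a ∈ zeros O q₀, a + τ • (w 2 - w 1) ∈ O ∧ a - τ • (w 2 - w 1) ∈ O)
    (hr : r ∈ vanishing w) (hr0 : ∀ a ∈ zeros O q₀, r (hat a) = 0) :
    r = (triCoef w r 1 / triCoef w q₀ 1) • q₀ := by
  have k1 := hr0 (w 1 + (-τ) • (w 2 - w 1)) ⟨by
    rw [neg_smul, ← sub_eq_add_neg]; exact (h _ ⟨hwO 1, hv 1⟩).2, by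
    rw [form_line_one hw hv, h0]; simp⟩
  have k2 := hr0 (w 0 + τ • (w 2 - w 1)) ⟨(h _ ⟨hwO 0, hv 0⟩).1, by
    rw [form_line_zero hw hv, h0, h1]; simp⟩
  rw [form_line_one hw hr] at k1
  rw [form_line_zero hw hr] at k2
  have k3 : triCoef w r 0 = 0 := by
    have h5 : triCoef w r 0 * (τ * (1 + τ)) = 0 := by linarith
    rcases mul_eq_zero.1 h5 with h | h
    · exact h
    · exact absurd h (by positivity)
  rw [k3] at k2
  have k4 : (triCoef w r 2 - triCoef w r 1) * τ = 0 := by linarith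
  have k5 : triCoef w r 1 = triCoef w r 2 := by
    rcases mul_eq_zero.1 k4 with h | h
    · linarith
    · exact absurd h hτ.ne'
  exact eq_smul_of_triCoef hw hv h0 h1 h2 hr k3 k5

theorem infinite_zeros_strip (hv : q₀ ∈ vanishing w) (h0 : triCoef w q₀ 0 = 0)
    (hwO : ∀ i, w i ∈ O)
    {τ : ℝ} (hτ : 0 < τ)
    (h : ∀ a ∈ zeros O q₀, a + τ • (w 2 - w 1) ∈ O ∧ a - τ • (w 2 - w 1) ∈ O) :
    (zeros O q₀).Infinite := by
  have hmem : ∀ n : ℕ, w 1 + (n * τ) • (w 2 - w 1) ∈ zeros O q₀ := by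
    intro n
    refine ⟨?_, by rw [form_line_one hw hv, h0]; simp⟩
    induction n with
    | zero => simpa using hwO 1
    | succ n ih =>
      have := (h _ ⟨ih, by rw [form_line_one hw hv, h0]; simp⟩).1
      rw [add_assoc, ← add_smul] at this
      push_cast
      rwa [add_mul, one_mul]
  refine infinite_of_injective_forall_mem (f := fun n : ℕ => w 1 + (n * τ) • (w 2 - w 1)) ?_ hmem
  intro m n hmn
  have h3 := add_left_cancel hmn
  have hne : w 2 - w 1 ≠ 0 := sub_ne_zero.2 (ne_of_affineIndependent hw (by decide))
  have h4 := smul_left_injective ℝ hne h3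
  have h5 := mul_right_cancel₀ hτ.ne' h4
  exact_mod_cast h5

end Normalized

end TranslationSurface

namespace TranslationSurface

open AffineMap (lineMap)

/-! ### The forms through the vertices of a triangle -/

section Extend

variable {w : Fin 3 → Plane} (hw : AffineIndependent ℝ w)
  {O : Set Plane} {c : Plane} {q r q₀ : Q3} (hO : Tame O c)
include hO hw

/-- Near a strip, either every admissible form through the vertices is a multiple of `q₀`, or every
such form is `α p + β p' + γ q₀` with `α, β ≥ 0`, `γ > 0` and two fixed admissible forms `p`, `p'`.
In the second case `ε = γ` works, since subtracting `γ q₀` still leaves a positive coefficient. -/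
theorem Tame.eventually_extend_strip (hwO : ∀ i, w i ∈ O) (hq₀ : q₀ ∈ adm O c)
    (hv : q₀ ∈ vanishing w) (h0 : triCoef w q₀ 0 = 0)
    (h1 : triCoef w q₀ 1 = triCoef w q₀ 2) (h2 : 0 < triCoef w q₀ 1)
    {τ : ℝ} (hτ : 0 < τ)
    (h : ∀ a ∈ zeros O q₀, a + τ • (w 2 - w 1) ∈ O ∧ a - τ • (w 2 - w 1) ∈ O) :
    ∀ᶠ q in 𝓝 q₀, q ∈ adm O c → q ∈ vanishing w →
      ∃ ε : ℝ, 0 < ε ∧ q + ε • (q - q₀) ∈ adm O c := by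
  set v := w 2 - w 1 with hvdef
  have hline : ∀ s : ℝ, q₀ (hat (w 0 + s • v)) = 0 := fun s => by
    rw [form_line_zero hw hv, h0, h1]; simp
  have hv0 : v ≠ 0 := sub_ne_zero.2 (ne_of_affineIndependent hw (by decide))
  have hiso : ∀ ρ : ℝ, ∀ b : ℝ, ∀ᶠ s in 𝓝 b, s ∈ {s : ℝ | w 0 + (ρ * s) • v ∈ O} →
      (ρ * s) = ρ * b := by
    intro ρ b
    have hc : Continuous fun s : ℝ => w 0 + (ρ * s) • v := by fun_prop
    filter_upwards [hc.continuousAt.eventually (hO.isolated q₀ hq₀ _ (hline (ρ * b)).le)] with s hs hs'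
    exact smul_left_injective ℝ hv0 (add_left_cancel (hs hs'))
  -- `sp` and `sm` locate the first obstacles after and before `w 0` on its boundary line. The
  -- inequalities at these two obstacles are the bounds `hup` and `hlo`.
  obtain ⟨sp, hsp, hsp0, hspm⟩ := exists_least_pos (S := {s : ℝ | w 0 + (1 * s) • v ∈ O})
    (fun b => (hiso 1 b).mono fun s hs hs' => by simpa using hs hs')
    ⟨τ, by rw [mem_ofPred_eq, one_mul]; exact (h _ ⟨hwO 0, hv 0⟩).1, hτ⟩
  obtain ⟨sm, hsm, hsm0, hsmm⟩ := exists_least_pos (S := {s : ℝ | w 0 + (-1 * s) • v ∈ O})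
    (fun b => (hiso (-1) b).mono fun s hs hs' => by simpa using hs hs')
    ⟨τ, by
      rw [mem_ofPred_eq, neg_one_mul, neg_smul, ← sub_eq_add_neg]
      exact (h _ ⟨hwO 0, hv 0⟩).2, hτ⟩
  simp only [one_mul, neg_one_mul, mem_ofPred_eq] at hsp hspm hsm hsmm
  set t := triCoef w with ht
  have hup : ∀ q ∈ adm O c, q ∈ vanishing w → t q 1 - t q 2 ≤ t q 0 * sp := by
    intro q hq hqv
    have := hq.2.2 _ hsp
    rw [form_line_zero hw hqv] at this
    nlinarith
  have hlo : ∀ q ∈ adm O c, q ∈ vanishing w → -(t q 0 * sm) ≤ t q 1 - t q 2 := by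
    intro q hq hqv
    have := hq.2.2 _ hsm
    rw [form_line_zero hw hqv] at this
    nlinarith
  have hct : ∀ i, Continuous fun q => t q i := fun i =>
    (continuous_apply i).comp (continuous_triCoef w)
  -- An obstacle strictly between `w 1` and `w 2` would be inside any ellipse through both. It
  -- forces the coefficient 0 to vanish, and the bounds then make `q` a multiple of `q₀`.
  by_cases hbetween : ∃ y : ℝ, 0 < y ∧ y < 1 ∧ w 1 + y • v ∈ O
  · obtain ⟨y, hy0, hy1, hy⟩ := hbetween
    filter_upwards [(hct 1).continuousAt.eventually (lt_mem_nhds h2)] with q hpos hq hqv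
    have k1 := hq.2.2 _ hy
    rw [form_line_one hw hqv] at k1
    have k2 := triCoef_nonneg hqv hq.1 0
    have k3 : t q 0 = 0 := by
      have : 0 < y * (1 - y) := mul_pos hy0 (by linarith)
      nlinarith
    have k4 := hup q hq hqv
    have k5 := hlo q hq hqv
    rw [k3, zero_mul] at k4 k5
    have k6 := eq_smul_of_triCoef hw hv h0 h1 h2 hqv k3 (by linarith)
    set κ := t q 1 / t q₀ 1
    have hκ : 0 < κ := div_pos hpos h2
    -- With `q = κ q₀` the choice `ε = κ` gives `κ² q₀`, positive whatever the size of `κ`.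
    refine ⟨κ, hκ, ?_⟩
    have e : q + κ • (q - q₀) = (κ * κ) • q₀ := by
      rw [k6]; module
    rw [e]
    exact adm_smul hq₀ (by positivity)
  · push Not at hbetween
    -- On the line of `w 0` such a form restricts to `x (x - s)`; with `s` equal to `sp` or `-sm` it
    -- is the ellipse that also passes through the neighbouring obstacle. The coefficients in `q'`
    -- are chosen to satisfy the criterion `isElliptic_triForm`.
    have hq : ∀ s : ℝ, (∀ x : ℝ, w 0 + x • v ∈ O → 0 ≤ x * (x - s)) → ∃ p : Q3, p ∈ adm O c ∧
        p ∈ vanishing w ∧ t p 0 = 1 ∧ t p 1 - t p 2 = s := by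
      intro s hs
      set q' := triForm hw ![1, (1 + s ^ 2 + s) / 2, (1 + s ^ 2 - s) / 2] with hq'
      have htq : t q' = ![1, (1 + s ^ 2 + s) / 2, (1 + s ^ 2 - s) / 2] := triCoef_triForm hw _
      have hq'v : q' ∈ vanishing w := triForm_mem hw _
      have hell : IsElliptic q' := isElliptic_triForm hw rfl (by simp; ring)
      obtain ⟨M, hM, hp⟩ := hO.exists_add_smul_adm hq₀ hell (by
        intro a ha
        rcases eq_of_zero_strip hw hv h0 h1 h2 ha.2 with h | h
        · have ha1 := ha.1
          rw [h] at ha1 ⊢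
          rw [form_line_one hw hq'v, show triCoef w q' 0 = 1 by rw [← ht, htq]; rfl]
          set y := bary hw 2 (hat a)
          have : y ≤ 0 ∨ 1 ≤ y := by
            by_contra! hy
            exact hbetween y hy.1 hy.2 ha1
          rcases this with h | h <;> nlinarith
        · have ha1 := ha.1
          rw [h] at ha1 ⊢
          have h3 := hs _ ha1
          rw [form_line_zero hw hq'v, ← ht, htq]
          simp
          linarith)
      refine ⟨_, hp, Submodule.add_mem _ hq'v (Submodule.smul_mem _ _ hv), ?_, ?_⟩
      · rw [map_add, map_smul, htq]; simp [show t q₀ 0 = 0 from h0]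
      · rw [map_add, map_smul, htq]; simp [show t q₀ 1 = t q₀ 2 from h1]; ring
    obtain ⟨p, hp, hpv, hp0, hp1⟩ := hq sp (by
      intro x hx
      rcases lt_trichotomy x 0 with h | h | h
      · nlinarith
      · simp [h]
      · nlinarith [hspm x hx h])
    obtain ⟨p', hp', hpv', hp0', hp1'⟩ := hq (-sm) (by
      intro x hx
      rcases lt_trichotomy x 0 with h | h | h
      · nlinarith [hsmm (-x) (by simpa using hx) (by linarith)]
      · simp [h]
      · nlinarith)
    have hss : 0 < sp + sm := by linarith
    -- `α` and `β` solve `α + β = t q 0` and `α sp - β sm = t q 1 - t q 2`; the bounds `hup` and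
    -- `hlo` are exactly their nonnegativity. `γ` absorbs the rest and is positive near `q₀`.
    set α : Q3 → ℝ := fun q => (t q 1 - t q 2 + sm * t q 0) / (sp + sm) with hα
    set β : Q3 → ℝ := fun q => (sp * t q 0 - (t q 1 - t q 2)) / (sp + sm) with hβ
    set γ : Q3 → ℝ := fun q => (t q 1 - α q * t p 1 - β q * t p' 1) / t q₀ 1 with hγ
    have hγc : Continuous γ := by
      simp only [hγ, hα, hβ]
      have := hct 0
      have := hct 1
      have := hct 2
      fun_prop
    have hγ0 : 0 < γ q₀ := by
      have h3 : 0 < t q₀ 2 := h1 ▸ h2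
      simp only [hγ, hα, hβ, show t q₀ 0 = 0 from h0, show t q₀ 1 = t q₀ 2 from h1]
      simp [h3.ne']
    filter_upwards [hγc.continuousAt.eventually (lt_mem_nhds hγ0)] with q hpos hq hqv
    have hα0 : 0 ≤ α q := div_nonneg (by linarith [hlo q hq hqv]) hss.le
    have hβ0 : 0 ≤ β q := div_nonneg (by linarith [hup q hq hqv]) hss.le
    have e : q = α q • p + β q • p' + γ q • q₀ := by
      refine ext_triCoef hw hqv (add_mem (add_mem (Submodule.smul_mem _ _ hpv)
        (Submodule.smul_mem _ _ hpv')) (Submodule.smul_mem _ _ hv)) ?_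
      rw [map_add, map_add, map_smul, map_smul, map_smul]
      have e1 : t q 0 = α q + β q := by
        simp only [hα, hβ]; field_simp; ring
      have e2 : t q 1 - t q 2 = α q * sp - β q * sm := by
        simp only [hα, hβ]; field_simp; ring
      have e3 : t q 1 = α q * t p 1 + β q * t p' 1 + γ q * t q₀ 1 := by
        simp only [hγ]
        rw [div_mul_cancel₀ _ h2.ne']; ring
      ext i
      simp only [Pi.add_apply, Pi.smul_apply, smul_eq_mul]
      fin_cases i
      · show t q 0 = α q * t p 0 + β q * t p' 0 + γ q * t q₀ 0
        rw [show t q₀ 0 = 0 from h0, hp0, hp0', e1]; ring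
      · exact e3
      · show t q 2 = α q * t p 2 + β q * t p' 2 + γ q * t q₀ 2
        rw [← show t q₀ 1 = t q₀ 2 from h1]
        linear_combination e3 - e2 + α q * hp1 + β q * hp1'
    refine ⟨γ q, hpos, ?_⟩
    have e' : q + γ q • (q - q₀) = (γ q * γ q) • q₀ + ((1 + γ q) * α q) • p +
        ((1 + γ q) * β q) • p' := by
      set g := γ q
      set x := α q
      set y := β q
      rw [e]; module
    rw [e']
    exact adm_add_smul (adm_add_smul (adm_smul hq₀ (by positivity)) hp (by positivity)) hp'
      (by positivity)

/-- Near `q₀` the admissible forms through the vertices look like a cone with apex `q₀`. For an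
ellipse, only its zeros matter, and there nonnegativity of `q` implies that of `2q - q₀`. Strips
need the finer analysis above. This rules out accumulation of extreme points. -/
theorem Tame.eventually_extend (hwO : ∀ i, w i ∈ O) (hq₀ : q₀ ∈ adm O c) (hv : q₀ ∈ vanishing w) :
    ∀ᶠ q in 𝓝 q₀, q ∈ adm O c → q ∈ vanishing w →
      ∃ ε : ℝ, 0 < ε ∧ q + ε • (q - q₀) ∈ adm O c := by
  by_cases he : IsElliptic q₀
  · have hc : Continuous fun q : Q3 => q + (1 : ℝ) • (q - q₀) := by fun_prop
    have h1 := hO.eventually_adm hq₀ he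
    have h2 := (hc.tendsto' q₀ q₀ (by simp)).eventually h1
    filter_upwards [h2] with q hq hqa _
    refine ⟨1, one_pos, (hq fun a ha => ?_).1⟩
    show 0 ≤ q (hat a) + 1 * (q (hat a) - q₀ (hat a))
    rw [ha.2]
    have := hqa.2.2 a ha.1
    linarith
  · obtain ⟨σ, h0, h1, h2, τ, hτ, h⟩ := hO.strip_normal_form hw hq₀ hv he
    exact (hO.eventually_extend_strip (hw.comp_embedding σ.toEmbedding) (fun i => hwO _) hq₀
      (fun i => hv _) h0 h1 h2 hτ h).mono fun q hq hqa hqv => hq hqa fun i => hqv _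

theorem Tame.infinite_zeros (hwO : ∀ i, w i ∈ O) (hq₀ : q₀ ∈ adm O c) (hv : q₀ ∈ vanishing w)
    (he : ¬ IsElliptic q₀) : (zeros O q₀).Infinite := by
  obtain ⟨σ, h0, h1, h2, τ, hτ, h⟩ := hO.strip_normal_form hw hq₀ hv he
  exact infinite_zeros_strip (hw.comp_embedding σ.toEmbedding) (fun i => hv _) h0 (fun i => hwO _)
    hτ h

theorem Tame.isElliptic_of_finite (hwO : ∀ i, w i ∈ O) (hq₀ : q₀ ∈ adm O c) (hv : q₀ ∈ vanishing w)
    (hf : (zeros O q₀).Finite) : IsElliptic q₀ := by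
  by_contra he
  exact hO.infinite_zeros hw hwO hq₀ hv he hf

omit hO in
-- An ellipse through the vertices meets the line of a side only at the two vertices on it.
theorem bary_ne_zero (hv : q ∈ vanishing w) (he : IsElliptic q) {a : Plane}
    (ha : q (hat a) = 0) (haw : ∀ i, a ≠ w i) (i : Fin 3) : bary hw i (hat a) ≠ 0 := by
  intro hi
  rw [form_eq_triCoef hw hv] at ha
  have h0 := triCoef_pos hw hv he 0
  have h1 := triCoef_pos hw hv he 1
  have h2 := triCoef_pos hw hv he 2
  have hs := sum_bary_hat hw a
  have key : ∀ j, (∀ k, k ≠ j → bary hw k (hat a) = 0) → False := by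
    intro j hj
    apply haw j
    apply bary_ext_hat hw
    intro k
    rw [bary_hat]
    split_ifs with h
    · subst h
      fin_cases k
      · have a1 := hj 1 (by decide); have a2 := hj 2 (by decide)
        simp only [Fin.zero_eta]; linarith
      · have a1 := hj 0 (by decide); have a2 := hj 2 (by decide)
        simp only [Fin.mk_one]; linarith
      · have a1 := hj 0 (by decide); have a2 := hj 1 (by decide)
        show bary hw 2 (hat a) = 1
        linarith
    · exact hj k h
  fin_cases i
  · have hi : bary hw 0 (hat a) = 0 := hi
    simp only [hi, mul_zero, zero_mul, add_zero, neg_eq_zero, mul_eq_zero, h0.ne', false_or] at ha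
    rcases ha with h | h
    · exact key 2 (by intro k hk; fin_cases k <;> simp_all)
    · exact key 1 (by intro k hk; fin_cases k <;> simp_all)
  · have hi : bary hw 1 (hat a) = 0 := hi
    simp only [hi, mul_zero, zero_mul, add_zero, zero_add, neg_eq_zero, mul_eq_zero, h1.ne',
      false_or] at ha
    rcases ha with h | h
    · exact key 0 (by intro k hk; fin_cases k <;> simp_all)
    · exact key 2 (by intro k hk; fin_cases k <;> simp_all)
  · have hi : bary hw 2 (hat a) = 0 := hi
    simp only [hi, mul_zero, zero_mul, zero_add, neg_eq_zero, mul_eq_zero, h2.ne', false_or] at ha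
    rcases ha with h | h
    · exact key 1 (by intro k hk; fin_cases k <;> simp_all)
    · exact key 0 (by intro k hk; fin_cases k <;> simp_all)

omit hO in
-- Five points determine an ellipse. After subtracting a multiple of `q` only two coefficients of
-- `r` remain, subject to two linear equations. If the determinant vanished, the equation of `q`
-- would make the barycentric coordinates of `a` and `b` proportional, hence `a = b`.
theorem eq_smul_of_two_zeros (hv : q ∈ vanishing w) (he : IsElliptic q) (hr : r ∈ vanishing w)
    {a b : Plane} (hab : a ≠ b) (ha : q (hat a) = 0) (hb : q (hat b) = 0) (haw : ∀ i, a ≠ w i)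
    (hbw : ∀ i, b ≠ w i) (hra : r (hat a) = 0) (hrb : r (hat b) = 0) : ∃ κ : ℝ, r = κ • q := by
  have x0 := bary_ne_zero hw hv he ha haw 0
  have x1 := bary_ne_zero hw hv he ha haw 1
  have x2 := bary_ne_zero hw hv he ha haw 2
  have y0 := bary_ne_zero hw hv he hb hbw 0
  have y1 := bary_ne_zero hw hv he hb hbw 1
  have y2 := bary_ne_zero hw hv he hb hbw 2
  have hsa := sum_bary_hat hw a
  have hsb := sum_bary_hat hw b
  have t0 := triCoef_pos hw hv he 0
  set κ := triCoef w r 0 / triCoef w q 0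
  have hs : r - κ • q ∈ vanishing w := sub_mem hr (Submodule.smul_mem _ _ hv)
  have hs0 : triCoef w (r - κ • q) 0 = 0 := by
    rw [map_sub, map_smul, Pi.sub_apply, Pi.smul_apply, smul_eq_mul, div_mul_cancel₀ _ t0.ne',
      sub_self]
  have hsa0 : (r - κ • q) (hat a) = 0 := by
    show r (hat a) - κ * q (hat a) = 0
    rw [hra, ha]; simp
  have hsb0 : (r - κ • q) (hat b) = 0 := by
    show r (hat b) - κ * q (hat b) = 0
    rw [hrb, hb]; simp
  refine ⟨κ, sub_eq_zero.1 ?_⟩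
  set s := r - κ • q
  rw [form_eq_triCoef hw hs, hs0] at hsa0 hsb0
  rw [form_eq_triCoef hw hv] at ha hb
  have hA : bary hw 0 (hat a) * (triCoef w s 1 * bary hw 2 (hat a) +
    triCoef w s 2 * bary hw 1 (hat a)) = 0 := by linarith
  have hB : bary hw 0 (hat b) * (triCoef w s 1 * bary hw 2 (hat b) +
    triCoef w s 2 * bary hw 1 (hat b)) = 0 := by linarith
  replace hA := (mul_eq_zero.1 hA).resolve_left x0
  replace hB := (mul_eq_zero.1 hB).resolve_left y0
  have key : triCoef w s 1 = 0 ∧ triCoef w s 2 = 0 := by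
    by_contra hne
    have hdet : bary hw 2 (hat a) * bary hw 1 (hat b) = bary hw 2 (hat b) * bary hw 1 (hat a) := by
      have d1 : triCoef w s 1 * (bary hw 2 (hat a) * bary hw 1 (hat b) -
        bary hw 2 (hat b) * bary hw 1 (hat a)) = 0 := by
        linear_combination bary hw 1 (hat b) * hA - bary hw 1 (hat a) * hB
      have d2 : triCoef w s 2 * (bary hw 2 (hat a) * bary hw 1 (hat b) -
        bary hw 2 (hat b) * bary hw 1 (hat a)) = 0 := by
        linear_combination bary hw 2 (hat a) * hB - bary hw 2 (hat b) * hA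
      rcases mul_eq_zero.1 d1 with h | h
      · rcases mul_eq_zero.1 d2 with h' | h'
        · exact absurd ⟨h, h'⟩ hne
        · linarith
      · linarith
    set ρ := bary hw 1 (hat b) / bary hw 1 (hat a)
    have r1 : bary hw 1 (hat b) = ρ * bary hw 1 (hat a) := by
      simp only [ρ]; field_simp
    have r2 : bary hw 2 (hat b) = ρ * bary hw 2 (hat a) := by
      simp only [ρ]; field_simp; linarith
    have hρ : ρ ≠ 0 := div_ne_zero y1 x1
    have r0 : bary hw 0 (hat b) = ρ * bary hw 0 (hat a) := by
      rw [r1, r2] at hb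
      have d3 : ρ * ((triCoef w q 0 * (bary hw 1 (hat a) * bary hw 2 (hat a))) *
          (bary hw 0 (hat b) - ρ * bary hw 0 (hat a))) = 0 := by
        linear_combination bary hw 0 (hat b) * ρ * (-ha) + bary hw 0 (hat a) * hb
      rcases mul_eq_zero.1 d3 with h | h
      · exact absurd h hρ
      rcases mul_eq_zero.1 h with h | h
      · exact absurd h (by simp [t0.ne', x1, x2])
      · linarith
    have hρ1 : ρ = 1 := by
      rw [r0, r1, r2] at hsb
      linear_combination hsb - ρ * hsa
    apply hab
    apply bary_ext_hat hw
    intro i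
    fin_cases i
    · simp [r0, hρ1]
    · simp [r1, hρ1]
    · simp [r2, hρ1]
  refine ext_triCoef hw hs (Submodule.zero_mem _) ?_
  rw [map_zero]
  ext i
  fin_cases i
  · exact hs0
  · exact key.1
  · exact key.2

/-- An ellipse with five zeros has two besides the vertices. A strip always has the translates of
the vertices among its zeros, which suffice by `strip_rigid`. -/
theorem Tame.rigid (hwO : ∀ i, w i ∈ O) (hq : q ∈ adm O c) (hv : q ∈ vanishing w)
    (h5 : 5 ≤ (zeros O q).encard) (hr : r ∈ vanishing w) (h : ∀ a ∈ zeros O q, r (hat a) = 0) :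
    ∃ κ : ℝ, r = κ • q := by
  by_cases he : IsElliptic q
  · have hcard : (range w).encard ≤ 3 := by
      rw [← image_univ]
      exact (encard_image_le _ _).trans (by simp)
    have h1 : 1 < (zeros O q \ range w).encard := by
      by_contra! hle
      have h2 := encard_le_encard_sdiff_add_encard (zeros O q) (range w)
      have h3 : (5 : ℕ∞) ≤ 1 + 3 := h5.trans (h2.trans (add_le_add hle hcard))
      exact absurd h3 (by norm_num)
    obtain ⟨a, b, ha, hb, hab⟩ := one_lt_encard_iff.1 h1
    exact eq_smul_of_two_zeros hw hv he hr hab ha.1.2 hb.1.2 (fun i hi => ha.2 ⟨i, hi.symm⟩)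
      (fun i hi => hb.2 ⟨i, hi.symm⟩) (h a ha.1) (h b hb.1)
  · obtain ⟨σ, h0, h1, h2, τ, hτ, h3⟩ := hO.strip_normal_form hw hq hv he
    exact ⟨_, strip_rigid (hw.comp_embedding σ.toEmbedding) (fun i => hv _) h0 h1 h2
      (fun i => hwO _) hτ h3 (fun i => hr _) h⟩

end Extend

end TranslationSurface

namespace TranslationSurface

open AffineMap (lineMap)

/-! ### The polygon of the admissible forms through the vertices of a triangle -/

section Zeros

variable {O : Set Plane} {c : Plane} {q q' : Q3}

/-- Both terms are nonnegative on `O`, so they vanish together. This is why zeros grow exactly when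
one passes to a smaller face. -/
theorem zeros_combination (hq : q ∈ adm O c) (hq' : q' ∈ adm O c) {s t : ℝ} (hs : 0 < s)
    (ht : 0 < t) : zeros O (s • q + t • q') = zeros O q ∩ zeros O q' := by
  ext a
  constructor
  · rintro ⟨ha, h⟩
    have h' : s * q (hat a) + t * q' (hat a) = 0 := h
    have h1 := mul_nonneg hs.le (hq.2.2 a ha)
    have h2 := mul_nonneg ht.le (hq'.2.2 a ha)
    have h3 : s * q (hat a) = 0 := by linarith
    have h4 : t * q' (hat a) = 0 := by linarith
    exact ⟨⟨ha, (mul_eq_zero.1 h3).resolve_left hs.ne'⟩,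
      ⟨ha, (mul_eq_zero.1 h4).resolve_left ht.ne'⟩⟩
  · rintro ⟨⟨ha, h⟩, ⟨-, h'⟩⟩
    refine ⟨ha, ?_⟩
    show s * q (hat a) + t * q' (hat a) = 0
    rw [h, h']; simp

end Zeros

/-- A weighted sum of the coefficients of a form. -/
noncomputable def lam (w : Fin 3 → Plane) (m : Fin 3 → ℝ) : Q3 →ₗ[ℝ] ℝ where
  toFun q := ∑ i, m i * triCoef w q i
  map_add' q q' := by simp [mul_add, Finset.sum_add_distrib]
  map_smul' s q := by
    simp only [map_smul, Pi.smul_apply, smul_eq_mul, RingHom.id_apply, Finset.mul_sum]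
    exact Finset.sum_congr rfl fun i _ => by ring

theorem lam_apply (w : Fin 3 → Plane) (m : Fin 3 → ℝ) (q : Q3) :
    lam w m q = ∑ i, m i * triCoef w q i := rfl

/-- The normalized admissible forms vanishing at the vertices of a triangle and on `A`. -/
def faceAt (w : Fin 3 → Plane) (m : Fin 3 → ℝ) (O : Set Plane) (c : Plane) (A : Set Plane) :
    Set Q3 :=
  {q | q ∈ adm O c ∧ q ∈ vanishing w ∧ lam w m q = 1 ∧ ∀ a ∈ A, q (hat a) = 0}

/-- The forms vanishing at the vertices of a triangle and on `A` whose weighted sum of coefficients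
is zero. -/
noncomputable def tangent (w : Fin 3 → Plane) (m : Fin 3 → ℝ) (A : Set Plane) : Submodule ℝ Q3 :=
  vanishing w ⊓ LinearMap.ker (lam w m) ⊓ ⨅ a ∈ A, LinearMap.ker (evalAt (hat a))

/-- The dimension of the cell of the subconics with `n` cone points. -/
noncomputable def cellDim (n : ℕ∞) : ℕ :=
  open Classical in if n = 3 then 2 else if n = 4 then 1 else 0

theorem mem_tangent {w : Fin 3 → Plane} {m : Fin 3 → ℝ} {A : Set Plane} {r : Q3} :
    r ∈ tangent w m A ↔ r ∈ vanishing w ∧ lam w m r = 0 ∧ ∀ a ∈ A, r (hat a) = 0 := by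
  simp [tangent, Submodule.mem_iInf, and_assoc]

/-! ### Faces, extreme points and dimensions of the polygon -/

section Slice

variable {w : Fin 3 → Plane} (hw : AffineIndependent ℝ w) {m : Fin 3 → ℝ} (hm : ∀ i, 0 < m i)
  {O : Set Plane} {c : Plane} (hO : Tame O c) (hwO : ∀ i, w i ∈ O)
  (hc : ∀ i, 0 < bary hw i (hat c)) {A : Set Plane} {q q' r : Q3}

theorem faceAt_subset : faceAt w m O c A ⊆ faceAt w m O c ∅ :=
  fun _ hq => ⟨hq.1, hq.2.1, hq.2.2.1, by simp⟩

theorem convex_faceAt : Convex ℝ (faceAt w m O c A) := by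
  rintro q ⟨h1, h2, h3, h4⟩ q' ⟨h1', h2', h3', h4'⟩ s t hs ht hst
  refine ⟨convex_adm h1 h1' hs ht hst, add_mem (Submodule.smul_mem _ _ h2)
    (Submodule.smul_mem _ _ h2'), ?_, fun a ha => ?_⟩
  · rw [map_add, map_smul, map_smul, h3, h3']; simpa using hst
  · show s * q (hat a) + t * q' (hat a) = 0
    rw [h4 a ha, h4' a ha]; simp

theorem isExtreme_faceAt (hA : A ⊆ O) :
    IsExtreme ℝ (faceAt w m O c ∅) (faceAt w m O c A) := by
  refine ⟨faceAt_subset, ?_⟩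
  rintro q hq q' hq' _ hx ⟨s, t, hs, ht, hst, rfl⟩
  refine ⟨hq.1, hq.2.1, hq.2.2.1, fun a ha => ?_⟩
  have h : a ∈ zeros O (s • q + t • q') := ⟨hA ha, hx.2.2.2 a ha⟩
  rw [zeros_combination hq.1 hq'.1 hs ht] at h
  exact h.1.2

theorem mem_faceAt_zeros (hq : q ∈ faceAt w m O c A) : q ∈ faceAt w m O c (zeros O q) :=
  ⟨hq.1, hq.2.1, hq.2.2.1, fun _ ha => ha.2⟩

theorem subset_zeros (hA : A ⊆ O) (hq : q ∈ faceAt w m O c A) : A ⊆ zeros O q :=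
  fun a ha => ⟨hA ha, hq.2.2.2 a ha⟩

include hw hm hc in
theorem lam_pos (hv : q ∈ vanishing w) (hq : q ∈ adm O c) : 0 < lam w m q := by
  have h1 := triCoef_nonneg hv hq.1
  rw [lam_apply]
  refine Finset.sum_pos' (fun i _ => mul_nonneg (hm i).le (h1 i)) ?_
  by_contra! h
  have h2 : ∀ i, triCoef w q i = 0 := fun i => by
    have := h i (Finset.mem_univ i)
    refine le_antisymm ?_ (h1 i)
    by_contra! h3
    exact absurd (mul_pos (hm i) h3) (not_lt.2 this)
  have h3 := hq.2.1
  rw [form_eq_triCoef hw hv, h2, h2, h2] at h3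
  simp at h3

include hw hm hc in
-- The coefficients range over a simplex, and all conditions are closed except `q (hat c) < 0`. That
-- one is automatic: `c` is inside the triangle and the nonnegative coefficients are not all zero.
theorem isCompact_faceAt : IsCompact (faceAt w m O c A) := by
  set S : Set (Fin 3 → ℝ) := {t | (∀ i, 0 ≤ t i) ∧ ∑ i, m i * t i = 1}
  have hS : IsCompact S := by
    refine (isCompact_Icc (a := (0 : Fin 3 → ℝ)) (b := fun i => 1 / m i)).of_isClosed_subset ?_ ?_
    · refine IsClosed.inter ?_ (isClosed_eq (by fun_prop) continuous_const)
      show IsClosed {t : Fin 3 → ℝ | ∀ i, 0 ≤ t i}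
      rw [ofPred_forall]
      exact isClosed_iInter fun i => isClosed_le continuous_const (continuous_apply i)
    · rintro t ⟨h1, h2⟩
      refine ⟨h1, fun i => ?_⟩
      rw [le_div_iff₀ (hm i), mul_comm, ← h2]
      exact Finset.single_le_sum (f := fun i => m i * t i)
        (fun j _ => mul_nonneg (hm j).le (h1 j)) (Finset.mem_univ i)
  have hcl : IsClosed {q : Q3 | (∀ v, 0 ≤ q (vec v)) ∧ (∀ a ∈ O, 0 ≤ q (hat a)) ∧
      ∀ a ∈ A, q (hat a) = 0} := by
    simp only [ofPred_and, ofPred_forall]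
    refine IsClosed.inter ?_ (IsClosed.inter ?_ ?_)
    · exact isClosed_iInter fun v => isClosed_le continuous_const (continuous_form_apply _)
    · exact isClosed_biInter fun v _ => isClosed_le continuous_const (continuous_form_apply _)
    · exact isClosed_biInter fun v _ => isClosed_eq (continuous_form_apply _) continuous_const
  have e : faceAt w m O c A = triForm hw '' S ∩ {q : Q3 | (∀ v, 0 ≤ q (vec v)) ∧
      (∀ a ∈ O, 0 ≤ q (hat a)) ∧ ∀ a ∈ A, q (hat a) = 0} := by
    ext q
    constructor
    · rintro ⟨h1, h2, h3, h4⟩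
      exact ⟨⟨triCoef w q, ⟨triCoef_nonneg h2 h1.1, h3⟩, triForm_triCoef hw h2⟩, h1.1, h1.2.2, h4⟩
    · rintro ⟨⟨t, ⟨ht, ht'⟩, rfl⟩, h1, h2, h3⟩
      refine ⟨⟨h1, ?_, h2⟩, triForm_mem hw t, by rw [lam_apply, triCoef_triForm, ht'], h3⟩
      have h5 : ∃ i, 0 < t i := by
        by_contra! h
        have h6 : ∀ i, t i = 0 := fun i => le_antisymm (h i) (ht i)
        simp [h6] at ht'
      have p0 := hc 0
      have p1 := hc 1
      have p2 := hc 2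
      have t0 := ht 0
      have t1 := ht 1
      have t2 := ht 2
      rw [triForm_apply, neg_lt_zero]
      obtain ⟨i, hi⟩ := h5
      fin_cases i
      · have hi : 0 < t 0 := hi
        positivity
      · have hi : 0 < t 1 := hi
        positivity
      · have hi : 0 < t 2 := hi
        positivity
  rw [e]
  exact (hS.image (continuous_triForm hw)).inter_right hcl

include hw hO hwO in
theorem eq_of_five_le (hq : q ∈ faceAt w m O c ∅) (h5 : 5 ≤ (zeros O q).encard)
    (hv : q' ∈ vanishing w) (hl : lam w m q' = 1) (h : ∀ a ∈ zeros O q, q' (hat a) = 0) :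
    q' = q := by
  obtain ⟨κ, rfl⟩ := hO.rigid hw hwO hq.1 hq.2.1 h5 hv h
  rw [map_smul, hq.2.2.1, smul_eq_mul, mul_one] at hl
  rw [hl, one_smul]

include hw hO hwO in
-- For an ellipse, keeping the zeros is enough to remain admissible nearby. A strip has infinitely
-- many zeros, so the linear conditions leave only `q` itself. Hence `q` is a relative interior
-- point of the face that its zeros define.
theorem eventually_mem_faceAt (hq : q ∈ faceAt w m O c ∅) :
    ∀ᶠ q' in 𝓝 q, q' ∈ vanishing w → lam w m q' = 1 → (∀ a ∈ zeros O q, q' (hat a) = 0) →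
      q' ∈ faceAt w m O c (zeros O q) := by
  by_cases he : IsElliptic q
  · filter_upwards [hO.eventually_adm hq.1 he] with q' h hv hl hz
    exact ⟨(h fun a ha => (hz a ha).ge).1, hv, hl, hz⟩
  · refine Eventually.of_forall fun q' hv hl hz => ?_
    have h5 : 5 ≤ (zeros O q).encard := by
      rw [(hO.infinite_zeros hw hwO hq.1 hq.2.1 he).encard_eq]; exact le_top
    rw [eq_of_five_le hw hO hwO hq h5 hv hl hz]
    exact mem_faceAt_zeros hq

include hw hO hwO in
theorem exists_add_smul_mem_faceAt (hq : q ∈ faceAt w m O c ∅) (hr : r ∈ tangent w m (zeros O q)) :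
    ∃ ε : ℝ, 0 < ε ∧ q + ε • r ∈ faceAt w m O c (zeros O q) := by
  rw [mem_tangent] at hr
  have hcont : Continuous fun t : ℝ => q + t • r := by fun_prop
  have h1 := (hcont.tendsto' 0 q (by simp)).eventually (eventually_mem_faceAt hw hO hwO hq)
  obtain ⟨ε, h2, hε⟩ := ((h1.filter_mono (nhdsWithin_le_nhds (s := Ioi 0))).and
    self_mem_nhdsWithin).exists
  refine ⟨ε, hε, h2 (add_mem hq.2.1 (Submodule.smul_mem _ _ hr.1)) ?_ fun a ha => ?_⟩
  · rw [map_add, map_smul, hq.2.2.1, hr.2.1]; simp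
  · show q (hat a) + ε * r (hat a) = 0
    rw [ha.2, hr.2.2 a ha]; simp

theorem sub_mem_tangent (hq : q ∈ faceAt w m O c A) (hq' : q' ∈ faceAt w m O c A) :
    q' - q ∈ tangent w m A := by
  rw [mem_tangent]
  refine ⟨sub_mem hq'.2.1 hq.2.1, by rw [map_sub, hq.2.2.1, hq'.2.2.1, sub_self], fun a ha => ?_⟩
  show q' (hat a) - q (hat a) = 0
  rw [hq.2.2.2 a ha, hq'.2.2.2 a ha, sub_self]

include hw hO hwO in
theorem vectorSpan_faceAt (hq : q ∈ faceAt w m O c ∅) :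
    vectorSpan ℝ (faceAt w m O c (zeros O q)) = tangent w m (zeros O q) := by
  apply le_antisymm
  · rw [vectorSpan_def, Submodule.span_le]
    rintro _ ⟨q₁, h₁, q₂, h₂, rfl⟩
    exact sub_mem_tangent h₂ h₁
  · intro r hr
    obtain ⟨ε, hε, h⟩ := exists_add_smul_mem_faceAt hw hO hwO hq hr
    have h2 := vsub_mem_vectorSpan ℝ h (mem_faceAt_zeros hq)
    rw [vsub_eq_sub, add_sub_cancel_left] at h2
    have h3 := Submodule.smul_mem _ ε⁻¹ h2
    rwa [smul_smul, inv_mul_cancel₀ hε.ne', one_smul] at h3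

include hw hO hwO in
-- Infinitely many extreme points would accumulate at some `q₀` of the compact set. An extreme point
-- `q` close to `q₀` would then lie strictly between `q₀` and a member beyond `q` given by
-- `eventually_extend`.
theorem finite_extremePoints_faceAt (hm : ∀ i, 0 < m i) (hc : ∀ i, 0 < bary hw i (hat c)) :
    (extremePoints ℝ (faceAt w m O c ∅)).Finite := by
  by_contra hinf
  obtain ⟨q₀, hq₀, hacc⟩ := Set.Infinite.exists_accPt_of_subset_isCompact hinf
    (isCompact_faceAt hw hm hc) extremePoints_subset
  rw [accPt_iff_frequently] at hacc
  obtain ⟨q, ⟨hne, hq⟩, hext⟩ := (hacc.and_eventually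
    (hO.eventually_extend hw hwO hq₀.1 hq₀.2.1)).exists
  have hqK := extremePoints_subset hq
  obtain ⟨ε, hε, h⟩ := hext hqK.1 hqK.2.1
  have h' : q + ε • (q - q₀) ∈ faceAt w m O c ∅ := by
    refine ⟨h, add_mem hqK.2.1 (Submodule.smul_mem _ _ (sub_mem hqK.2.1 hq₀.2.1)), ?_, by simp⟩
    rw [map_add, map_smul, map_sub, hqK.2.2.1, hq₀.2.2.1]; simp
  refine hne ((mem_extremePoints.1 hq).2 q₀ hq₀ _ h' ?_).1.symm
  refine ⟨ε / (1 + ε), 1 / (1 + ε), by positivity, by positivity, by field_simp; ring, ?_⟩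
  have e : (1 + ε) • ((ε / (1 + ε)) • q₀ + (1 / (1 + ε)) • (q + ε • (q - q₀))) = (1 + ε) • q := by
    rw [smul_add, smul_smul, smul_smul, mul_div_cancel₀ _ (by positivity),
      mul_div_cancel₀ _ (by positivity)]
    module
  exact smul_right_injective _ (by positivity : (1 + ε) ≠ 0) e

include hw hO hwO in
theorem isPolytope_faceAt (hm : ∀ i, 0 < m i) (hc : ∀ i, 0 < bary hw i (hat c)) (hA : A ⊆ O) :
    (extremePoints ℝ (faceAt w m O c A)).Finite ∧
    faceAt w m O c A = convexHull ℝ (extremePoints ℝ (faceAt w m O c A)) := by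
  have hfin : (extremePoints ℝ (faceAt w m O c A)).Finite :=
    (finite_extremePoints_faceAt hw hO hwO hm hc).subset
      (isExtreme_faceAt hA).extremePoints_subset_extremePoints
  refine ⟨hfin, ?_⟩
  rw [← (hfin.isCompact_convexHull ℝ).isClosed.closure_eq]
  exact (closure_convexHull_extremePoints (isCompact_faceAt hw hm hc) convex_faceAt).symm

include hw hO hwO in
theorem tangent_eq_bot (hq : q ∈ faceAt w m O c ∅) (h5 : 5 ≤ (zeros O q).encard) :
    tangent w m (zeros O q) = ⊥ := by
  rw [eq_bot_iff]
  intro r hr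
  rw [mem_tangent] at hr
  have := eq_of_five_le hw hO hwO hq h5 (q' := q + r) (add_mem hq.2.1 hr.1)
    (by rw [map_add, hq.2.2.1, hr.2.1, add_zero]) (fun a ha => by
      show q (hat a) + r (hat a) = 0
      rw [ha.2, hr.2.2 a ha, add_zero])
  simpa using this

include hw hO hwO in
-- The normalization cuts the three coefficients down to dimension 2. A fourth zero adds an
-- independent equation, and five zeros leave nothing by rigidity.
theorem finrank_tangent (hm : ∀ i, 0 < m i) (hq : q ∈ faceAt w m O c ∅) :
    3 ≤ (zeros O q).encard ∧
    Module.finrank ℝ (tangent w m (zeros O q)) = cellDim (zeros O q).encard := by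
  have hwz : range w ⊆ zeros O q := by
    rintro _ ⟨i, rfl⟩
    exact ⟨hwO i, hq.2.1 i⟩
  have hcard : (range w).encard = 3 := by
    rw [← image_univ, hw.injective.encard_image]; simp
  have h3 : 3 ≤ (zeros O q).encard := hcard ▸ encard_le_encard hwz
  refine ⟨h3, ?_⟩
  set ℓ : (Fin 3 → ℝ) →ₗ[ℝ] ℝ := lam w m ∘ₗ triForm hw with hℓ
  have hℓa : ∀ t, ℓ t = ∑ i, m i * t i := fun t => by
    rw [hℓ, LinearMap.comp_apply, lam_apply, triCoef_triForm]
  have hinj : Function.Injective (triForm hw) :=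
    Function.LeftInverse.injective (triCoef_triForm hw)
  have hmap : ∀ (N : Submodule ℝ (Fin 3 → ℝ)), (∀ t, t ∈ N ↔ triForm hw t ∈
      tangent w m (zeros O q)) → Module.finrank ℝ (tangent w m (zeros O q)) =
      Module.finrank ℝ N := by
    intro N hN
    have : tangent w m (zeros O q) = N.map (triForm hw) := by
      ext r
      constructor
      · intro hr
        have e := triForm_triCoef hw (mem_tangent.1 hr).1
        exact ⟨triCoef w r, (hN _).2 (by rwa [e]), e⟩
      · rintro ⟨t, ht, rfl⟩
        exact (hN t).1 ht
    rw [this]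
    exact (Submodule.equivMapOfInjective _ hinj N).finrank_eq.symm
  by_cases h3' : (zeros O q).encard = 3
  · have hz : range w = zeros O q :=
      (finite_range w).eq_of_subset_of_encard_le hwz (by rw [h3', hcard])
    rw [cellDim, if_pos h3', hmap (LinearMap.ker ℓ) fun t => ?_]
    · have hne : ℓ ≠ 0 := by
        intro h
        have := hℓa (Pi.single 0 1)
        rw [h] at this
        simp [Fin.sum_univ_three] at this
        exact (hm 0).ne this
      have := Module.Dual.finrank_ker_add_one_of_ne_zero (f := ℓ) hne
      simp at this
      omega
    · rw [mem_tangent, ← hz]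
      refine ⟨fun h => ⟨triForm_mem hw t, h, ?_⟩, fun h => h.2.1⟩
      rintro _ ⟨i, rfl⟩
      exact triForm_mem hw t i
  rw [cellDim, if_neg h3']
  split_ifs with h4
  · have hfin : (zeros O q).Finite := finite_of_encard_eq_coe (k := 4) (by rw [h4]; rfl)
    have he := hO.isElliptic_of_finite hw hwO hq.1 hq.2.1 hfin
    have h1 : (zeros O q \ range w).encard = 1 := by
      have := encard_sdiff_add_encard_of_subset hwz
      rw [hcard, h4] at this
      have h5 : (zeros O q \ range w).encard + 3 = 1 + 3 := by rw [this]; rfl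
      exact WithTop.add_right_cancel (by simp : (3 : ℕ∞) ≠ ⊤) h5
    obtain ⟨u, hu⟩ := encard_eq_one.1 h1
    have huz : u ∈ zeros O q \ range w := by rw [hu]; rfl
    have hzu : ∀ a ∈ zeros O q, a = u ∨ a ∈ range w := by
      intro a ha
      by_cases haw : a ∈ range w
      · exact Or.inr haw
      · left
        have : a ∈ zeros O q \ range w := ⟨ha, haw⟩
        rwa [hu] at this
    set e : (Fin 3 → ℝ) →ₗ[ℝ] ℝ := evalAt (hat u) ∘ₗ triForm hw with he'
    rw [hmap (LinearMap.ker (ℓ.prod e)) fun t => ?_]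
    -- Independence of the two equations: the coefficients of `q` satisfy `ℓ = 1` and `e = 0`,
    -- whereas `e` is nonzero on the first basis vector because `u` is off the sides of the
    -- triangle.
    · have hsurj : Function.Surjective (ℓ.prod e) := by
        have hne : e (Pi.single 0 1) ≠ 0 := by
          have b1 := bary_ne_zero hw hq.2.1 he huz.1.2 (fun i h => huz.2 ⟨i, h.symm⟩) 1
          have b2 := bary_ne_zero hw hq.2.1 he huz.1.2 (fun i h => huz.2 ⟨i, h.symm⟩) 2
          rw [he', LinearMap.comp_apply, evalAt_apply, triForm_apply]
          simp [b1, b2]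
        set t₁ := triCoef w q
        have k1 : ℓ t₁ = 1 := by rw [hℓa]; exact hq.2.2.1
        have k2 : e t₁ = 0 := by
          rw [he', LinearMap.comp_apply, triForm_triCoef hw hq.2.1]; exact huz.1.2
        set t₂ : Fin 3 → ℝ := Pi.single 0 1
        rintro ⟨x, y⟩
        refine ⟨x • t₁ + (y / e t₂) • (t₂ - ℓ t₂ • t₁), ?_⟩
        refine Prod.ext ?_ ?_
        · show ℓ (x • t₁ + (y / e t₂) • (t₂ - ℓ t₂ • t₁)) = x
          simp only [map_add, map_smul, map_sub, smul_eq_mul, k1]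
          simp
        · show e (x • t₁ + (y / e t₂) • (t₂ - ℓ t₂ • t₁)) = y
          simp only [map_add, map_smul, map_sub, smul_eq_mul, k2]
          field_simp
          simp
      have h6 := LinearMap.finrank_range_add_finrank_ker (ℓ.prod e)
      rw [LinearMap.range_eq_top.2 hsurj] at h6
      simp at h6
      omega
    · rw [mem_tangent, LinearMap.mem_ker]
      show (ℓ t, e t) = 0 ↔ _
      rw [Prod.mk_eq_zero]
      refine ⟨fun h => ⟨triForm_mem hw t, h.1, fun a ha => ?_⟩, fun h => ⟨h.2.1, h.2.2 u huz.1⟩⟩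
      rcases hzu a ha with rfl | ⟨i, rfl⟩
      · exact h.2
      · exact triForm_mem hw t i
  · have h5 : 5 ≤ (zeros O q).encard := by
      have h4' : 4 ≤ (zeros O q).encard := by
        have := Order.add_one_le_of_lt (h3.lt_of_ne' h3')
        exact this
      have := Order.add_one_le_of_lt (h4'.lt_of_ne' h4)
      exact this
    rw [tangent_eq_bot hw hO hwO hq h5]
    simp

include hw hO hwO in
-- At an extreme point no tangent direction can exist, since one could move both ways along it; the
-- dimension count then gives five zeros. Conversely five zeros make the face a single form.
theorem extremePoints_faceAt (hm : ∀ i, 0 < m i) : extremePoints ℝ (faceAt w m O c ∅) =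
    {q | q ∈ faceAt w m O c ∅ ∧ 5 ≤ (zeros O q).encard} := by
  ext q
  constructor
  · intro hq
    have hqK := extremePoints_subset hq
    refine ⟨hqK, ?_⟩
    obtain ⟨h3, hd⟩ := finrank_tangent hw hO hwO hm hqK
    have hbot : tangent w m (zeros O q) = ⊥ := by
      rw [eq_bot_iff]
      intro r hr
      obtain ⟨ε, hε, h⟩ := exists_add_smul_mem_faceAt hw hO hwO hqK hr
      obtain ⟨ε', hε', h'⟩ := exists_add_smul_mem_faceAt hw hO hwO hqK (neg_mem hr)
      have h1 := (mem_extremePoints.1 hq).2 _ (faceAt_subset h) _ (faceAt_subset h')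
        ⟨ε' / (ε + ε'), ε / (ε + ε'), by positivity, by positivity, by field_simp; ring, by
          refine smul_right_injective _ (by positivity : (ε + ε') ≠ 0) ?_
          show (ε + ε') • _ = (ε + ε') • q
          rw [smul_add, smul_smul, smul_smul, mul_div_cancel₀ _ (by positivity),
            mul_div_cancel₀ _ (by positivity)]
          module⟩
      have h2 : ε • r = 0 := by simpa using h1.1
      exact (smul_eq_zero.1 h2).resolve_left hε.ne'
    rw [hbot, finrank_bot] at hd
    by_contra! hlt
    have h4 : (zeros O q).encard ≤ 4 := Order.le_of_lt_add_one hlt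
    rw [cellDim] at hd
    split_ifs at hd with a b
    have h4' : (zeros O q).encard < 4 := h4.lt_of_ne b
    have h3' : (zeros O q).encard ≤ 3 := Order.le_of_lt_add_one h4'
    exact a (le_antisymm h3' h3)
  · rintro ⟨hq, h5⟩
    have : faceAt w m O c (zeros O q) = {q} := by
      ext q'
      refine ⟨fun h => eq_of_five_le hw hO hwO hq h5 h.2.1 h.2.2.1 h.2.2.2, ?_⟩
      rintro rfl
      exact mem_faceAt_zeros hq
    rw [← isExtreme_singleton, ← this]
    exact isExtreme_faceAt fun a ha => ha.1

include hw hO hwO in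
/-- The faces of the polygon are determined by the cone points. -/
theorem exists_eq_faceAt (hm : ∀ i, 0 < m i) {G : Set Q3} (hGne : G.Nonempty) (hG : Convex ℝ G)
    (hGe : IsExtreme ℝ (faceAt w m O c ∅) G) :
    ∃ q ∈ G, G = faceAt w m O c (zeros O q) := by
  -- A form of `G` with the fewest zeros is generic in `G`. The zeros of its midpoint with `q'` are
  -- the common zeros, so by minimality those of `q` are all zeros of `q'`.
  obtain ⟨q, hq, hmin⟩ : ∃ q ∈ G, ∀ q' ∈ G, (zeros O q).encard ≤ (zeros O q').encard := by
    obtain ⟨n, ⟨q, hq, hn⟩, h⟩ := WellFounded.has_min (wellFounded_lt (α := ℕ∞))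
      ((fun q => (zeros O q).encard) '' G) (hGne.image _)
    refine ⟨q, hq, fun q' hq' => ?_⟩
    have := h _ (mem_image_of_mem _ hq')
    rw [← hn] at this
    exact not_lt.1 this
  have hqK := hGe.1 hq
  have hsub : ∀ q' ∈ G, zeros O q ⊆ zeros O q' := by
    intro q' hq'
    -- The zeros may be infinite in number, and counting is then useless. But with at least five
    -- zeros everywhere on `G` the midpoint is an extreme point, so `q = q'`.
    by_cases h5 : 5 ≤ (zeros O q).encard
    · have hmG : (1 / 2 : ℝ) • q + (1 / 2 : ℝ) • q' ∈ G :=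
        hG hq hq' (by norm_num) (by norm_num) (by norm_num)
      have hext : (1 / 2 : ℝ) • q + (1 / 2 : ℝ) • q' ∈ extremePoints ℝ (faceAt w m O c ∅) := by
        rw [extremePoints_faceAt hw hO hwO hm]
        exact ⟨hGe.1 hmG, h5.trans (hmin _ hmG)⟩
      have h1 := (mem_extremePoints.1 hext).2 q hqK q' (hGe.1 hq')
        ⟨1 / 2, 1 / 2, by norm_num, by norm_num, by norm_num, rfl⟩
      rw [h1.1.trans h1.2.symm]
    · have hfin : (zeros O q).Finite := by
        rw [← encard_lt_top_iff]
        exact (not_le.1 h5).trans_le le_top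
      have hmG : (1 / 2 : ℝ) • q + (1 / 2 : ℝ) • q' ∈ G :=
        hG hq hq' (by norm_num) (by norm_num) (by norm_num)
      have hz := zeros_combination hqK.1 (hGe.1 hq').1 (s := 1 / 2) (t := 1 / 2)
        (by norm_num) (by norm_num)
      have h1 := hmin _ hmG
      rw [hz] at h1
      have h2 := (hfin.subset inter_subset_left).eq_of_subset_of_encard_le
        inter_subset_left h1
      exact inter_eq_left.1 h2
  refine ⟨q, hq, subset_antisymm (fun q' hq' => ?_) fun q' hq' => ?_⟩
  · have := hGe.1 hq'
    exact ⟨this.1, this.2.1, this.2.2.1, fun a ha => (hsub q' hq' ha).2⟩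
  · obtain ⟨ε, hε, h⟩ := exists_add_smul_mem_faceAt hw hO hwO hqK
      (sub_mem_tangent hq' (mem_faceAt_zeros hqK))
    refine hGe.2 (faceAt_subset hq') (faceAt_subset h) hq
      ⟨ε / (1 + ε), 1 / (1 + ε), by positivity, by positivity, by field_simp; ring, ?_⟩
    refine smul_right_injective _ (by positivity : (1 + ε) ≠ 0) ?_
    show (1 + ε) • _ = (1 + ε) • q
    rw [smul_add, smul_smul, smul_smul, mul_div_cancel₀ _ (by positivity),
      mul_div_cancel₀ _ (by positivity)]
    module

/-- At an obstacle where `q` vanishes but `q₀` is positive, the form prolonged beyond `q` would be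
negative. Hence interior forms of a face have no extra zeros. -/
theorem zeros_eq_of_extension (hA : A ⊆ O) {q₀ : Q3} (hq₀ : q₀ ∈ adm O c) (h₀ : zeros O q₀ = A)
    (hq : q ∈ faceAt w m O c A) {ε : ℝ} (hε : 0 < ε) (h : q + ε • (q - q₀) ∈ adm O c) :
    zeros O q = A := by
  refine subset_antisymm (fun a ha => ?_) (subset_zeros hA hq)
  have h1 : 0 ≤ q (hat a) + ε * (q (hat a) - q₀ (hat a)) := h.2.2 a ha.1
  rw [ha.2] at h1
  rw [← h₀]
  refine ⟨ha.1, le_antisymm ?_ (hq₀.2.2 a ha.1)⟩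
  by_contra! h2
  nlinarith

end Slice

end TranslationSurface

namespace TranslationSurface

open AffineMap (lineMap)

/-! ### The obstacles visible from a point of the surface -/

section TameObst

variable {X Y : Type*} [TopologicalSpace X] [T2Space X] [ChartedSpace Plane X]
  [TopologicalSpace Y] [ChartedSpace Plane Y] {p : X → Y} {dev : X → Plane}

/-- Compare `β`, the transverse part of the translation, with the width of the strip. A boundary
point that is not moved inside in either direction gives `β = 0` or `|β|` at least the width; an
interior point that stays inside gives `|β|` less than the width. -/
theorem smul_rot_eq_zero_of_strip {q : Q3} {a b v u : Plane} {β : ℝ} (hA : 0 < q (vec u))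
    (hinv : ∀ a (t : ℝ), q (hat (a + t • v)) = q (hat a)) (ha : q (hat a) = 0)
    {s : ℝ} (h₁ : 0 ≤ q (hat (a + (s • v + β • u)))) (h₂ : 0 ≤ q (hat (a - (s • v + β • u))))
    {x y : ℝ} (hb : b = a + (x • v + y • u)) (hb₁ : q (hat b) < 0)
    (hb₂ : q (hat (b + (s • v + β • u))) < 0) : β = 0 := by
  set A := q (vec u)
  set B := QuadraticMap.polar q (hat a) (vec u)
  have key : ∀ r t : ℝ, q (hat (a + (t • v + r • u))) = r * B + r ^ 2 * A := by
    intro r t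
    rw [show a + (t • v + r • u) = a + r • u + t • v by abel, hinv, form_line, ha, zero_add]
  have e₂ : a - (s • v + β • u) = a + ((-s) • v + (-β) • u) := by module
  have e₃ : b + (s • v + β • u) = a + ((x + s) • v + (y + β) • u) := by rw [hb]; module
  rw [key] at h₁
  rw [e₂, key] at h₂
  rw [hb, key] at hb₁
  rw [e₃, key] at hb₂
  have f1 : y * (B + y * A) < 0 := by linarith
  have f2 : (y + β) * (B + (y + β) * A) < 0 := by linarith
  have f3 : 0 ≤ β * (B + β * A) := by linarith
  have f4 : 0 ≤ β * (-B + β * A) := by linarith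
  by_contra hβ
  rcases lt_or_gt_of_ne hβ with h | h
  · have g3 : B + β * A ≤ 0 := by
      by_contra! g; nlinarith
    have g4 : -B + β * A ≤ 0 := by
      by_contra! g; nlinarith
    rcases lt_trichotomy y 0 with hy | hy | hy
    · have g1 : 0 < B + y * A := by
        by_contra! g; nlinarith
      have g2 : 0 < B + (y + β) * A := by
        by_contra! g; nlinarith
      nlinarith
    · rw [hy] at f1; simp at f1
    · have g1 : B + y * A < 0 := by
        by_contra! g; nlinarith
      have : 0 < y + β := by
        by_contra! g
        have : 0 < B + (y + β) * A := by
          by_contra! g'; nlinarith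
        nlinarith
      nlinarith
  · have g3 : 0 ≤ B + β * A := by
      by_contra! g; nlinarith
    have g4 : 0 ≤ -B + β * A := by
      by_contra! g; nlinarith
    rcases lt_trichotomy y 0 with hy | hy | hy
    · have g1 : 0 < B + y * A := by
        by_contra! g; nlinarith
      have : y + β < 0 := by
        by_contra! g
        have : B + (y + β) * A < 0 := by
          by_contra! g'; nlinarith
        nlinarith
      nlinarith
    · rw [hy] at f1; simp at f1
    · have g1 : B + y * A < 0 := by
        by_contra! g; nlinarith
      have g2 : B + (y + β) * A < 0 := by
        by_contra! g; nlinarith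
      nlinarith

/-- The three clauses come from the bound on immersed discs, from discreteness of the frontier, and
from recurrence in `Y`. In the last one, a translation matching the obstacles must be parallel to
the strip by `smul_rot_eq_zero_of_strip`. -/
theorem tame_obst [SimplyConnectedSpace X] (hd : IsDevelopingMap dev)
    (hp : IsTranslationMap p) (hcov : IsCoveringMap p) (hY : Precompact Y)
    (hdisc : DiscreteTopology (bdry X)) {C : ℝ}
    (hC : ∀ (x : X) (R : ℝ), Metric.ball (dev x) R ⊆ star dev x → R ≤ C) (x : X) :
    Tame (obst dev x) (dev x) := by
  refine ⟨fun q hq => hd.admissible_cases hC hq,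
    fun q hq b hb => hd.eventually_obst_eq hdisc (hd.closure_sublevel_subset hq hb),
    fun q hq v hv => ?_⟩
  obtain ⟨hv0, hinv, hpos⟩ := hv
  by_cases hne : ∃ a, a ∈ zeros (obst dev x) q
  swap
  · exact ⟨1, one_pos, fun a ha => absurd ⟨a, ha⟩ hne⟩
  obtain ⟨a₀, ha₀⟩ := hne
  obtain ⟨τ, hτ0, ⟨b, hb, hbτ⟩, hτ⟩ := exists_symmetry hd hp hcov hY hq.1.convex_sublevel
    (isOpen_sublevel q) (hd.sublevel_subset_star hq) hq.2.1 hv0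
    (fun a ha t => by
      show q _ < 0
      rw [hinv]; exact ha)
  rw [hq.1.closure_sublevel ⟨_, hq.2.1⟩] at hτ
  obtain ⟨s, β, rfl⟩ := exists_add_rot hv0 τ
  obtain ⟨x₁, y₁, hxy⟩ := exists_add_rot hv0 (b - a₀)
  have h1 := (hτ a₀ (le_of_eq ha₀.2) ha₀.1).1
  have hβ : β = 0 := smul_rot_eq_zero_of_strip hpos hinv ha₀.2 (not_lt.1 h1.1) (not_lt.1 h1.2)
    (by rw [← hxy, add_sub_cancel]) hb hbτ
  subst hβ
  simp only [zero_smul, add_zero] at hτ hτ0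
  have hs : s ≠ 0 := by
    rintro rfl
    simp at hτ0
  have key : ∀ a ∈ zeros (obst dev x) q, a + s • v ∈ obst dev x ∧ a - s • v ∈ obst dev x := by
    intro a ha
    have h2 := (hτ a (le_of_eq ha.2) ha.1).2
    refine ⟨h2.1 ?_, h2.2 ?_⟩
    · show q _ ≤ 0
      rw [hinv, ha.2]
    · show q _ ≤ 0
      rw [sub_eq_add_neg, ← neg_smul, hinv, ha.2]
  rcases lt_or_gt_of_ne hs with h | h
  · refine ⟨-s, by linarith, fun a ha => ?_⟩
    rw [neg_smul, sub_neg_eq_add, ← sub_eq_add_neg]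
    exact (key a ha).symm
  · exact ⟨s, h, key⟩

end TameObst

/-! ### Boundary components -/

theorem continuous_polar_vec (q : Q3) (c : Plane) :
    Continuous fun u : Plane => QuadraticMap.polar q (hat c) (vec u) := by
  have h1 : ∀ u : Plane, QuadraticMap.polar q (hat c) (vec u) =
      q (hat (c + u)) - q (hat c) - q (vec u) := by
    intro u
    have := form_line q c u 1
    rw [one_smul] at this
    rw [this]; ring
  simp only [h1]
  exact (((continuous_form_hat q).comp (by fun_prop)).sub continuous_const).sub
    (continuous_form_vec q)

/-- Each ray from the interior point `c` meets the ellipse once, at the positive root of a quadratic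
equation. The ellipse is therefore a continuous image of the unit circle. -/
theorem IsElliptic.isPreconnected_zeros {q : Q3} (he : IsElliptic q) {c : Plane}
    (hc : q (hat c) < 0) : IsPreconnected {a : Plane | q (hat a) = 0} := by
  set D : Plane → ℝ := fun u => (QuadraticMap.polar q (hat c) (vec u)) ^ 2 -
    4 * q (vec u) * q (hat c) with hD
  set f : Plane → Plane := fun u => c + ((-QuadraticMap.polar q (hat c) (vec u) +
    Real.sqrt (D u)) / (2 * q (vec u))) • u with hf
  have hne : ∀ u ∈ Metric.sphere (0 : Plane) 1, 0 < q (vec u) := by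
    intro u hu
    refine he u ?_
    rintro rfl
    simp at hu
  have hB := continuous_polar_vec q c
  have hA := continuous_form_vec q
  have hcont : ContinuousOn f (Metric.sphere 0 1) := by
    have h1 : Continuous fun u => -QuadraticMap.polar q (hat c) (vec u) + Real.sqrt (D u) := by
      exact hB.neg.add (Real.continuous_sqrt.comp
        ((hB.pow 2).sub ((continuous_const.mul hA).mul continuous_const)))
    have h2 : ContinuousOn (fun u => (-QuadraticMap.polar q (hat c) (vec u) +
        Real.sqrt (D u)) / (2 * q (vec u))) (Metric.sphere 0 1) :=
      h1.continuousOn.div (continuous_const.mul hA).continuousOn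
        fun u hu => by have := hne u hu; positivity
    exact continuousOn_const.add (h2.smul continuousOn_id)
  have himage : {a : Plane | q (hat a) = 0} = f '' Metric.sphere 0 1 := by
    ext a
    constructor
    · intro ha
      have ha : q (hat a) = 0 := ha
      have hac : a - c ≠ 0 := by
        rw [sub_ne_zero]
        rintro rfl
        exact absurd ha hc.ne
      have ht : 0 < ‖a - c‖ := norm_pos_iff.2 hac
      have hu : ‖a - c‖⁻¹ • (a - c) ∈ Metric.sphere (0 : Plane) 1 := by
        rw [mem_sphere_zero_iff_norm, norm_smul, norm_inv, norm_norm, inv_mul_cancel₀ ht.ne']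
      refine ⟨_, hu, ?_⟩
      have hApos := hne _ hu
      have e : a = c + ‖a - c‖ • (‖a - c‖⁻¹ • (a - c)) := by
        rw [smul_smul, mul_inv_cancel₀ ht.ne', one_smul, add_sub_cancel]
      set u := ‖a - c‖⁻¹ • (a - c)
      set t := ‖a - c‖
      have h1 : q (hat (c + t • u)) = 0 := e ▸ ha
      rw [form_line] at h1
      set A := q (vec u)
      set B := QuadraticMap.polar q (hat c) (vec u)
      have h2 : D u = (2 * A * t + B) ^ 2 := by
        show B ^ 2 - 4 * A * q (hat c) = _
        linear_combination -4 * A * h1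
      have h3 : 0 ≤ 2 * A * t + B := by
        by_contra! h
        nlinarith [mul_pos ht hApos]
      show c + ((-B + Real.sqrt (D u)) / (2 * A)) • u = a
      rw [h2, Real.sqrt_sq h3, e]
      congr 2
      field_simp
      ring
    · rintro ⟨u, hu, rfl⟩
      have hApos := hne _ hu
      show q (hat (c + _ • u)) = 0
      rw [form_line]
      set A := q (vec u)
      set B := QuadraticMap.polar q (hat c) (vec u)
      have h2 : 0 ≤ D u := by
        show 0 ≤ B ^ 2 - 4 * A * q (hat c)
        nlinarith [sq_nonneg B]
      have h3 := Real.sq_sqrt h2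
      have h4 : D u = B ^ 2 - 4 * A * q (hat c) := rfl
      rw [h4] at h3 ⊢
      generalize Real.sqrt (B ^ 2 - 4 * A * q (hat c)) = S at h3 ⊢
      field_simp
      linear_combination h3
  rw [himage]
  refine (isPreconnected_sphere ?_ _ _).image f hcont
  rw [← Module.finrank_eq_rank]
  simp

theorem affineIndependent_of_isElliptic {q : Q3} (he : IsElliptic q) {a b c : Plane}
    (hab : a ≠ b) (hac : a ≠ c) (hbc : b ≠ c) (ha : q (hat a) = 0) (hb : q (hat b) = 0)
    (hc : q (hat c) = 0) : AffineIndependent ℝ ![a, b, c] := by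
  rw [affineIndependent_iff_not_collinear_set]
  intro hcol
  rw [collinear_iff_of_mem (p₀ := a) (by simp)] at hcol
  obtain ⟨v, hv⟩ := hcol
  obtain ⟨s, hs⟩ := hv b (by simp)
  obtain ⟨t, ht⟩ := hv c (by simp)
  simp only [vadd_eq_add] at hs ht
  have hs0 : s ≠ 0 := by
    rintro rfl
    simp at hs
    exact hab hs.symm
  have ht0 : t ≠ 0 := by
    rintro rfl
    simp at ht
    exact hac ht.symm
  have hv0 : v ≠ 0 := by
    rintro rfl
    simp at hs
    exact hab hs.symm
  have hst : s ≠ t := by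
    rintro rfl
    exact hbc (hs.trans ht.symm)
  rw [hs, add_comm, form_line, ha] at hb
  rw [ht, add_comm, form_line, ha] at hc
  have h1 : s * (QuadraticMap.polar q (hat a) (vec v) + s * q (vec v)) = 0 := by linarith
  have h2 : t * (QuadraticMap.polar q (hat a) (vec v) + t * q (vec v)) = 0 := by linarith
  replace h1 := (mul_eq_zero.1 h1).resolve_left hs0
  replace h2 := (mul_eq_zero.1 h2).resolve_left ht0
  have h3 : (s - t) * q (vec v) = 0 := by linarith
  rcases mul_eq_zero.1 h3 with h | h
  · exact hst (sub_eq_zero.1 h)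
  · exact (he v hv0).ne' h

section Components

variable {X : Type*} [TopologicalSpace X] [T2Space X] [ChartedSpace Plane X] {dev : X → Plane}
  (hd : IsDevelopingMap dev) (hT : ∀ x, Tame (obst dev x) (dev x))
include hd hT

/-- The cone points of `U` do not lie on a line. -/
def Subconic.HasTriangle (U : Subconic dev) : Prop :=
  ∃ z : Fin 3 → Bar X, (∀ i, z i ∈ U.conePoints) ∧ AffineIndependent ℝ (devBar dev ∘ z)

omit hT in
theorem IsDevelopingMap.mem_obst_of_mem_conePoints {U : Subconic dev} {x : X} {q : Q3}
    (hx : x ∈ U.1) (hq : dev '' U.1 = sublevel q) {z : Bar X} (hz : z ∈ U.conePoints) :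
    devBar dev z ∈ zeros (obst dev x) q ∧ barExp dev x (devBar dev z) = z := by
  rw [hd.conePoints_eq hx hq] at hz
  obtain ⟨a, ha, rfl⟩ := hz
  rw [hd.devBar_barExp ha.1.1]
  exact ⟨ha, rfl⟩

omit hT in
theorem IsDevelopingMap.isPreconnected_barExp_image {U : Subconic dev} {x : X} {q : Q3}
    (hx : x ∈ U.1) (hq : dev '' U.1 = sublevel q) {S : Set Plane} (hS : IsPreconnected S)
    (hSq : ∀ a ∈ S, q (hat a) = 0) :
    IsPreconnected (barExp dev x '' S) ∧ barExp dev x '' S ⊆ U.boundary := by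
  have hadm := hd.mem_admissible hx hq
  refine ⟨hS.image _ (hd.continuousOn_barExp.mono fun a ha =>
    hd.closure_sublevel_subset hadm (hSq a ha).le), ?_⟩
  rw [hd.boundary_eq hx hq]
  exact image_mono hSq

/-- The boundary of an ellipse is connected. That of a strip consists of two lines, and each of them
contains a vertex of the triangle by the normal form. -/
theorem mem_cell_of_hasTriangle {U : Subconic dev} (hU : U.HasTriangle) :
    U ∈ cell dev U.conePoints := by
  refine ⟨rfl, fun b hb => ?_⟩
  obtain ⟨x, hx⟩ := hd.nonempty_subconic U
  obtain ⟨q, hq⟩ := hd.exists_form (U := U)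
  have hadm := hd.mem_admissible hx hq
  obtain ⟨z, hz, hw⟩ := hU
  have hzw := fun i => hd.mem_obst_of_mem_conePoints hx hq (hz i)
  have hv : q ∈ vanishing (devBar dev ∘ z) := fun i => (hzw i).1.2
  have hline : ∃ S : Set Plane, IsPreconnected S ∧ (∀ a ∈ S, q (hat a) = 0) ∧
      b ∈ barExp dev x '' S ∧ ∃ i, devBar dev (z i) ∈ S := by
    have hb' := hb
    rw [hd.boundary_eq hx hq] at hb'
    by_cases he : IsElliptic q
    · exact ⟨_, he.isPreconnected_zeros hadm.2.1, fun a ha => ha, hb', 0, (hzw 0).1.2⟩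
    · obtain ⟨σ, h0, h1, h2, -⟩ := (hT x).strip_normal_form hw hadm hv he
      have hw' := hw.comp_embedding σ.toEmbedding
      have hv' : q ∈ vanishing ((devBar dev ∘ z) ∘ σ) := fun i => hv _
      obtain ⟨a, ha, rfl⟩ := hb'
      have hpre : ∀ e v : Plane, IsPreconnected (range fun t : ℝ => e + t • v) := fun e v =>
        isPreconnected_range (by fun_prop)
      rcases eq_of_zero_strip hw' hv' h0 h1 h2 ha with h | h
      · refine ⟨_, hpre ((devBar dev ∘ z) (σ 1))
          ((devBar dev ∘ z) (σ 2) - (devBar dev ∘ z) (σ 1)), ?_, ⟨a, ⟨_, h.symm⟩, rfl⟩, σ 1,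
            ⟨0, by simp⟩⟩
        rintro _ ⟨t, rfl⟩
        have := form_line_one hw' hv' t
        rw [show triCoef ((devBar dev ∘ z) ∘ σ.toEmbedding) q 0 = 0 from h0] at this
        simpa using this
      · refine ⟨_, hpre ((devBar dev ∘ z) (σ 0))
          ((devBar dev ∘ z) (σ 2) - (devBar dev ∘ z) (σ 1)), ?_, ⟨a, ⟨_, h.symm⟩, rfl⟩, σ 0,
            ⟨0, by simp⟩⟩
        rintro _ ⟨t, rfl⟩
        have := form_line_zero hw' hv' t
        rw [show triCoef ((devBar dev ∘ z) ∘ σ.toEmbedding) q 0 = 0 from h0,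
          show triCoef ((devBar dev ∘ z) ∘ σ.toEmbedding) q 1 =
            triCoef ((devBar dev ∘ z) ∘ σ.toEmbedding) q 2 from h1] at this
        simpa using this
  obtain ⟨S, hS, hSq, hbS, i, hi⟩ := hline
  have h := hd.isPreconnected_barExp_image hx hq hS hSq
  exact ⟨z i, h.1.subset_connectedComponentIn hbS h.2 ⟨_, hi, (hzw i).2⟩, hz i⟩

omit hT in
theorem hasTriangle_of_isElliptic {U : Subconic dev} {x : X} {q : Q3} (hx : x ∈ U.1)
    (hq : dev '' U.1 = sublevel q) (he : IsElliptic q) (h3 : 3 ≤ U.conePoints.encard) :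
    U.HasTriangle := by
  have hmem := fun z (hz : z ∈ U.conePoints) => hd.mem_obst_of_mem_conePoints hx hq hz
  have hinj := hd.injOn_devBar_conePoints U
  obtain ⟨T, hTZ, hT3⟩ := exists_subset_encard_eq h3
  obtain ⟨a, b, c, hab, hac, hbc, rfl⟩ := encard_eq_three.1 hT3
  have ha : a ∈ U.conePoints := hTZ (by simp)
  have hb : b ∈ U.conePoints := hTZ (by simp)
  have hc : c ∈ U.conePoints := hTZ (by simp)
  refine ⟨![a, b, c], ?_, ?_⟩
  · intro i; fin_cases i <;> assumption
  · convert affineIndependent_of_isElliptic he (hinj.ne ha hb hab) (hinj.ne ha hc hac)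
      (hinj.ne hb hc hbc) (hmem a ha).1.2 (hmem b hb).1.2 (hmem c hc).1.2 using 1
    ext i j
    fin_cases i <;> rfl

/-- Three points of an ellipse are never collinear. On a strip, the condition on components gives a
cone point on each line, and the symmetry of the strip adds a second one on one of them. -/
theorem hasTriangle_of_mem_cell {U : Subconic dev} {Z : Set (Bar X)} (hU : U ∈ cell dev Z)
    (h3 : 3 ≤ Z.encard) : U.HasTriangle := by
  obtain ⟨rfl, hcomp⟩ := hU
  obtain ⟨x, hx⟩ := hd.nonempty_subconic U
  obtain ⟨q, hq⟩ := hd.exists_form (U := U)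
  have hadm := hd.mem_admissible hx hq
  have hmem := fun z (hz : z ∈ U.conePoints) => hd.mem_obst_of_mem_conePoints hx hq hz
  rcases (hT x).cases q hadm with he | ⟨v, hv⟩
  · exact hasTriangle_of_isElliptic hd hx hq he h3
  · obtain ⟨s, hs, hsym⟩ := (hT x).strip q hadm v hv
    obtain ⟨hv0, hinv, hpos⟩ := hv
    obtain ⟨r₁, r₂, hr₁, hr₂, hr⟩ := quadratic_roots (B := QuadraticMap.polar q (hat (dev x))
      (vec (rot v))) hpos hadm.2.1
    have hsd : ∀ t y : ℝ, side v (dev x) (dev x + (t • v + y • rot v)) = y * (v 0 ^ 2 + v 1 ^ 2) := by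
      intro t y
      simp [side, rot]
      ring
    have hn : 0 < v 0 ^ 2 + v 1 ^ 2 := by
      have : v 0 ≠ 0 ∨ v 1 ≠ 0 := by
        by_contra! h
        exact hv0 (by ext i; fin_cases i <;> simp [h.1, h.2])
      rcases this with h | h <;> positivity
    have hform : ∀ t y : ℝ, q (hat (dev x + (t • v + y • rot v))) =
        q (vec (rot v)) * (y - r₁) * (y - r₂) := by
      intro t y
      rw [show dev x + (t • v + y • rot v) = dev x + y • rot v + t • v by abel, hinv, form_line, hr]
    have htouch : ∀ r, r = r₁ ∨ r = r₂ → ∃ z ∈ U.conePoints, ∃ t : ℝ,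
        devBar dev z = dev x + (t • v + r • rot v) := by
      intro r hrr
      have hb : barExp dev x (dev x + ((0 : ℝ) • v + r • rot v)) ∈ U.boundary := by
        rw [hd.boundary_eq hx hq]
        refine ⟨_, ?_, rfl⟩
        show q _ = 0
        rw [hform]
        rcases hrr with rfl | rfl <;> simp
      obtain ⟨z, hz, hzZ⟩ := hcomp _ hb
      refine ⟨z, hzZ, ?_⟩
      set b := barExp dev x (dev x + ((0 : ℝ) • v + r • rot v)) with hbdef
      -- The side function takes only two values on the boundary, of opposite signs, so a component
      -- of the boundary stays over one of the two lines.
      have hpre : IsPreconnected ((fun y => side v (dev x) (devBar dev y)) ''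
          connectedComponentIn U.boundary b) :=
        isPreconnected_connectedComponentIn.image _
          ((continuous_side v (dev x)).comp continuous_devBar).continuousOn
      have hbq : ∀ y ∈ U.boundary, q (hat (devBar dev y)) = 0 := by
        intro y hy
        rw [hd.boundary_eq hx hq] at hy
        obtain ⟨a, ha, rfl⟩ := hy
        rw [hd.devBar_barExp (hd.closure_sublevel_subset hadm (le_of_eq ha))]
        exact ha
      have hsb : side v (dev x) (devBar dev b) = r * (v 0 ^ 2 + v 1 ^ 2) := by
        rw [hbdef, hd.devBar_barExp (hd.closure_sublevel_subset hadm ?_), hsd]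
        show q _ ≤ 0
        rw [hform]
        rcases hrr with rfl | rfl <;> simp
      have hdec : ∀ y ∈ U.boundary, ∃ t r' : ℝ, devBar dev y = dev x + (t • v + r' • rot v) ∧
          (r' = r₁ ∨ r' = r₂) := by
        intro y hy
        obtain ⟨t, r', h⟩ := exists_add_rot hv0 (devBar dev y - dev x)
        have e : devBar dev y = dev x + (t • v + r' • rot v) := by rw [← h, add_sub_cancel]
        refine ⟨t, r', e, ?_⟩
        have h1 := hbq y hy
        rw [e, hform, mul_assoc, mul_eq_zero, mul_eq_zero, sub_eq_zero, sub_eq_zero] at h1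
        exact h1.resolve_left hpos.ne'
      have hno : (0 : ℝ) ∉ (fun y => side v (dev x) (devBar dev y)) ''
          connectedComponentIn U.boundary b := by
        rintro ⟨y, hy, hy0⟩
        obtain ⟨t, r', e, hr'⟩ := hdec y (connectedComponentIn_subset _ _ hy)
        simp only [e, hsd] at hy0
        have h2 : r' = 0 := (mul_eq_zero.1 hy0).resolve_right hn.ne'
        rcases hr' with h | h <;> linarith
      obtain ⟨t, r', e, hr'⟩ := hdec z (connectedComponentIn_subset _ _ hz)
      have h1 : side v (dev x) (devBar dev z) = r' * (v 0 ^ 2 + v 1 ^ 2) := by rw [e, hsd]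
      have hbm := mem_image_of_mem (fun y => side v (dev x) (devBar dev y))
        (mem_connectedComponentIn hb)
      have hzm := mem_image_of_mem (fun y => side v (dev x) (devBar dev y)) hz
      simp only [hsb, h1] at hbm hzm
      have hoc := hpre.ordConnected
      have : r' = r := by
        by_contra hne
        rcases hrr with rfl | rfl <;> rcases hr' with rfl | rfl
        · exact hne rfl
        · exact hno (hoc.out hbm hzm ⟨by nlinarith, by nlinarith⟩)
        · exact hno (hoc.out hzm hbm ⟨by nlinarith, by nlinarith⟩)
        · exact hne rfl
      exact ⟨t, by rw [e, this]⟩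
    obtain ⟨z₁, hz₁, t₁, e₁⟩ := htouch r₁ (Or.inl rfl)
    obtain ⟨z₂, hz₂, t₂, e₂⟩ := htouch r₂ (Or.inr rfl)
    have hz3 : devBar dev z₁ + s • v ∈ zeros (obst dev x) q :=
      ⟨(hsym _ (hmem z₁ hz₁).1).1, by rw [hinv]; exact (hmem z₁ hz₁).1.2⟩
    set z₃ := barExp dev x (devBar dev z₁ + s • v)
    have hz₃ : z₃ ∈ U.conePoints := (hd.mem_conePoints_iff hx hq hz3.1).2 hz3.2
    have e₃ : devBar dev z₃ = devBar dev z₁ + s • v := hd.devBar_barExp hz3.1.1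
    refine ⟨![z₁, z₃, z₂], ?_, ?_⟩
    · intro i; fin_cases i <;> assumption
    · have e : devBar dev ∘ ![z₁, z₃, z₂] = ![devBar dev z₁, devBar dev z₃, devBar dev z₂] := by
        ext i j; fin_cases i <;> rfl
      rw [e, affineIndependent_iff_not_collinear_set]
      intro hcol
      rw [collinear_iff_of_mem (p₀ := devBar dev z₁) (by simp)] at hcol
      obtain ⟨u, hu⟩ := hcol
      obtain ⟨k, hk⟩ := hu (devBar dev z₃) (by simp)
      obtain ⟨l, hl⟩ := hu (devBar dev z₂) (by simp)
      rw [e₃, vadd_eq_add, add_comm, add_left_inj] at hk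
      have hk0 : k ≠ 0 := by
        rintro rfl
        rw [zero_smul] at hk
        exact (smul_ne_zero hs.ne' hv0) hk
      have hu' : u = (k⁻¹ * s) • v := by
        rw [mul_smul, hk, smul_smul, inv_mul_cancel₀ hk0, one_smul]
      rw [vadd_eq_add, hu', e₁, e₂] at hl
      have h1 := congrArg (side v (dev x)) hl
      rw [hsd, show (l • (k⁻¹ * s) • v + (dev x + (t₁ • v + r₁ • rot v))) =
        dev x + ((l * (k⁻¹ * s) + t₁) • v + r₁ • rot v) by module, hsd] at h1
      have := mul_right_cancel₀ hn.ne' h1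
      linarith

end Components

end TranslationSurface

namespace TranslationSurface

open AffineMap (lineMap)

/-! ### The subconics through the vertices of a triangle -/

theorem exists_bary_pos {w : Fin 3 → Plane} (hw : AffineIndependent ℝ w) :
    ∃ a : Plane, ∀ i, 0 < bary hw i (hat a) := by
  refine ⟨w 0 + (1 / 3 : ℝ) • (w 1 - w 0) + (1 / 3 : ℝ) • (w 2 - w 0), fun i => ?_⟩
  simp only [vec_sub_bary, bary_vec_sub, bary_hat]
  fin_cases i
  all_goals
    simp [Fin.ext_iff]
    try norm_num

theorem form_neg_of_bary_pos {w : Fin 3 → Plane} (hw : AffineIndependent ℝ w) {O : Set Plane}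
    {c a : Plane} {q : Q3} (hv : q ∈ vanishing w) (hq : q ∈ adm O c)
    (ha : ∀ i, 0 < bary hw i (hat a)) : q (hat a) < 0 := by
  have t0 := triCoef_nonneg hv hq.1 0
  have t1 := triCoef_nonneg hv hq.1 1
  have t2 := triCoef_nonneg hv hq.1 2
  have p0 := ha 0
  have p1 := ha 1
  have p2 := ha 2
  have h5 : 0 < triCoef w q 0 ∨ 0 < triCoef w q 1 ∨ 0 < triCoef w q 2 := by
    by_contra! h
    have h3 := hq.2.1
    rw [form_eq_triCoef hw hv, le_antisymm h.1 t0, le_antisymm h.2.1 t1,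
      le_antisymm h.2.2 t2] at h3
    simp at h3
  rw [form_eq_triCoef hw hv, neg_lt_zero]
  rcases h5 with h | h | h <;> positivity

theorem side_eq_sum {w : Fin 3 → Plane} (hw : AffineIndependent ℝ w) (v c a : Plane) :
    side v c a = bary hw 0 (hat a) * side v c (w 0) + bary hw 1 (hat a) * side v c (w 1) +
      bary hw 2 (hat a) * side v c (w 2) := by
  have h := sum_bary hw (hat a)
  have h0 := congrFun h 0
  have h1 := congrFun h 1
  have h2 := congrFun h 2
  simp [hat] at h0 h1 h2
  simp only [side]
  rw [show ![a.ofLp 0, a.ofLp 1, 1] = hat a from rfl] at h0 h1 h2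
  linear_combination (v 1) * h0 - (v 0) * h1 + (v 0 * c 1 - v 1 * c 0) * h2

section Through

variable {X : Type*} [TopologicalSpace X] [T2Space X] [ChartedSpace Plane X] {dev : X → Plane}
  (hd : IsDevelopingMap dev)
include hd

theorem IsDevelopingMap.exists_center {z : Fin 3 → Bar X}
    (hw : AffineIndependent ℝ (devBar dev ∘ z)) {U : Subconic dev}
    (hz : ∀ i, z i ∈ U.conePoints) : ∃ x ∈ U.1, ∀ i, 0 < bary hw i (hat (dev x)) := by
  obtain ⟨x, hx⟩ := hd.nonempty_subconic U
  obtain ⟨q, hq⟩ := hd.exists_form (U := U)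
  have hadm := hd.mem_admissible hx hq
  have hv : q ∈ vanishing (devBar dev ∘ z) := fun i =>
    (hd.mem_obst_of_mem_conePoints hx hq (hz i)).1.2
  set w := devBar dev ∘ z
  obtain ⟨a, ha⟩ := exists_bary_pos hw
  have h : a ∈ dev '' U.1 := by
    rw [hq]
    exact form_neg_of_bary_pos hw hv hadm ha
  obtain ⟨y, hy, hya⟩ := h
  exact ⟨y, hy, by rw [hya]; exact ha⟩

/-- `U'` has some point `x'` over `dev x`. The line from `dev x` to one vertex separates the other
two, and these two common boundary points force `x' = x` by `eq_of_mem_closure`. -/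
theorem IsDevelopingMap.mem_of_conePoints [SimplyConnectedSpace X] {z : Fin 3 → Bar X}
    (hw : AffineIndependent ℝ (devBar dev ∘ z)) {U U' : Subconic dev} {x : X} (hx : x ∈ U.1)
    (hc : ∀ i, 0 < bary hw i (hat (dev x)))
    (hz : ∀ i, z i ∈ U.conePoints) (hz' : ∀ i, z i ∈ U'.conePoints) : x ∈ U'.1 := by
  obtain ⟨q, hq⟩ := hd.exists_form (U := U)
  obtain ⟨q', hq'⟩ := hd.exists_form (U := U')
  obtain ⟨y, hy⟩ := hd.nonempty_subconic U'
  have hv' : q' ∈ vanishing (devBar dev ∘ z) := fun i =>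
    (hd.mem_obst_of_mem_conePoints hy hq' (hz' i)).1.2
  have h : dev x ∈ dev '' U'.1 := by
    rw [hq']
    exact form_neg_of_bary_pos hw hv' (hd.mem_admissible hy hq') hc
  obtain ⟨x', hx', hxx⟩ := h
  set w := devBar dev ∘ z with hwdef
  set v := w 0 - dev x with hv
  have hadm := hd.mem_admissible hx hq
  have hadm' := hd.mem_admissible hx' hq'
  have hside := fun a => side_eq_sum hw v (dev x) a
  have h0 : side v (dev x) (w 0) = 0 := by simp [side, hv]; ring
  have hsum := hside (dev x)
  rw [side_self, h0] at hsum
  have hne : side v (dev x) (w 1) ≠ 0 := by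
    intro h1
    rw [h1] at hsum
    have h2 : side v (dev x) (w 2) = 0 := by
      have h3 : bary hw 2 (hat (dev x)) * side v (dev x) (w 2) = 0 := by linarith
      exact (mul_eq_zero.1 h3).resolve_left (hc 2).ne'
    have h3 := hside (dev x + rot v)
    rw [h0, h1, h2] at h3
    have h4 : v 0 ^ 2 + v 1 ^ 2 = 0 := by
      have : side v (dev x) (dev x + rot v) = v 0 ^ 2 + v 1 ^ 2 := by simp [side, rot]; ring
      rw [← this, h3]; ring
    have hv0 : v = 0 := by
      ext i
      fin_cases i
      · show v 0 = 0
        nlinarith [sq_nonneg (v 0), sq_nonneg (v 1)]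
      · show v 1 = 0
        nlinarith [sq_nonneg (v 0), sq_nonneg (v 1)]
    have h5 := hc 1
    have h6 : w 0 = dev x := sub_eq_zero.1 (hv.symm.trans hv0)
    rw [← h6, bary_hat] at h5
    simp at h5
  have hcl : ∀ i, z i ∈ closure (toBar '' (devExp dev x '' sublevel q)) := by
    intro i
    rw [← hq, ← hd.eq_image_of_isConvex U.2.1 hx]
    exact frontier_subset_closure (hz i).1
  have hcl' : ∀ i, z i ∈ closure (toBar '' (devExp dev x' '' sublevel q')) := by
    intro i
    rw [← hq', ← hd.eq_image_of_isConvex U'.2.1 hx']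
    exact frontier_subset_closure (hz' i).1
  have key := fun i j => hd.eq_of_mem_closure hxx hadm.1.convex_sublevel hadm'.1.convex_sublevel
    (hd.sublevel_subset_star hadm) (hd.sublevel_subset_star hadm') hadm.2.1
    (by rw [← hxx]; exact hadm'.2.1) (hcl i) (hcl' i) (hcl j) (hcl' j) (v := v)
  have p1 := hc 1
  have p2 := hc 2
  have : x' = x := by
    rcases lt_or_gt_of_ne hne with h | h
    · refine key 1 2 h ?_
      show 0 < side v (dev x) (w 2)
      by_contra! h2
      nlinarith
    · refine key 2 1 ?_ h
      show side v (dev x) (w 2) < 0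
      by_contra! h2
      nlinarith
  rwa [← this]

variable {C : ℝ} (hC : ∀ (x : X) (R : ℝ), Metric.ball (dev x) R ⊆ star dev x → R ≤ C)
  (hT : ∀ x, Tame (obst dev x) (dev x))
include hC hT

omit hT in
/-- The space of the subconics through a set `Z` of cone points that contains the vertices of a
triangle is homeomorphic to a set of forms. -/
theorem exists_homeomorph_faceAt [SimplyConnectedSpace X] {z : Fin 3 → Bar X}
    (hw : AffineIndependent ℝ (devBar dev ∘ z)) {m : Fin 3 → ℝ} (hm : ∀ i, 0 < m i)
    {U₀ : Subconic dev} {x : X} (hx : x ∈ U₀.1) (hc : ∀ i, 0 < bary hw i (hat (dev x)))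
    {Z : Set (Bar X)} (hzZ : ∀ i, z i ∈ Z) (hZ : Z ⊆ U₀.conePoints) :
    ∃ φ : {U : Subconic dev // Z ⊆ U.conePoints} ≃ₜ
        faceAt (devBar dev ∘ z) m (obst dev x) (dev x) (devBar dev '' Z),
      ∀ U, x ∈ U.1.1 ∧ dev '' U.1.1 = sublevel (φ U).1 := by
  -- One base point serves for all subconics through `Z`, which makes a single space of forms
  -- sufficient.
  have hmem : ∀ U : Subconic dev, Z ⊆ U.conePoints → x ∈ U.1 := fun U hU =>
    hd.mem_of_conePoints hw hx hc (fun i => hZ (hzZ i)) fun i => hU (hzZ i)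
  obtain ⟨q₀, hq₀⟩ := hd.exists_form (U := U₀)
  have hZ' := fun y (hy : y ∈ Z) => hd.mem_obst_of_mem_conePoints hx hq₀ (hZ hy)
  set K := faceAt (devBar dev ∘ z) m (obst dev x) (dev x) (devBar dev '' Z) with hK
  have hg : ∀ q : K, Z ⊆ (toSubconic hd hC x ⟨q.1, q.2.1⟩).conePoints := by
    intro q y hy
    obtain ⟨h1, h2⟩ := hZ' y hy
    rw [← h2]
    exact (hd.mem_conePoints_iff (mem_toSubconic hd hC _) (dev_toSubconic hd hC _) h1.1).2
      (q.2.2.2.2 _ (mem_image_of_mem _ hy))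
  set g : K → {U : Subconic dev // Z ⊆ U.conePoints} := fun q =>
    ⟨toSubconic hd hC x ⟨q.1, q.2.1⟩, hg q⟩ with hgdef
  have hgc : Continuous g :=
    ((continuous_toSubconic hd hC).comp (continuous_subtype_val.subtype_mk _)).subtype_mk _
  have hdev : ∀ q : K, dev '' (g q).1.1 = sublevel q.1 := fun q => dev_toSubconic hd hC _
  have hbij : Function.Bijective g := by
    constructor
    · intro q q' h
      have h1 : sublevel q.1 = sublevel q'.1 := by rw [← hdev, ← hdev, h]
      obtain ⟨k, hk, h2⟩ := exists_smul_of_sublevel_eq q.2.1.1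
        (exists_pos_dir (hd.admissible_cases hC q.2.1)) h1 ⟨_, q.2.1.2.1⟩
      have h3 := q'.2.2.2.1
      rw [h2, map_smul, q.2.2.2.1, smul_eq_mul, mul_one] at h3
      rw [h3, one_smul] at h2
      exact Subtype.ext h2.symm
    · rintro ⟨U, hU⟩
      obtain ⟨q, hq⟩ := hd.exists_form (U := U)
      have hxU := hmem U hU
      have hadm := hd.mem_admissible hxU hq
      have hv : q ∈ vanishing (devBar dev ∘ z) := fun i =>
        (hd.mem_obst_of_mem_conePoints hxU hq (hU (hzZ i))).1.2
      have hl := lam_pos hw hm hc hv hadm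
      set k := (lam (devBar dev ∘ z) m q)⁻¹
      have hk : 0 < k := inv_pos.2 hl
      have hmemK : k • q ∈ K := by
        refine ⟨adm_smul hadm hk, Submodule.smul_mem _ _ hv, ?_, ?_⟩
        · rw [map_smul, smul_eq_mul, inv_mul_cancel₀ hl.ne']
        · rintro _ ⟨y, hy, rfl⟩
          show k * q _ = 0
          rw [(hd.mem_obst_of_mem_conePoints hxU hq (hU hy)).1.2, mul_zero]
      refine ⟨⟨k • q, hmemK⟩, Subtype.ext ?_⟩
      refine hd.subconic_eq (mem_toSubconic hd hC _) hxU ?_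
      show dev '' (toSubconic hd hC x ⟨k • q, _⟩).1 = dev '' U.1
      rw [dev_toSubconic hd hC, hq]
      ext a
      show k * q (hat a) < 0 ↔ q (hat a) < 0
      rw [mul_neg_iff]
      simp [hk, not_lt.2 hk.le]
  have : CompactSpace K := isCompact_iff_compactSpace.1 (isCompact_faceAt hw hm hc)
  have : T2Space (Subconic dev) := hd.t2Space_subconic
  set ψ := Continuous.homeoOfEquivCompactToT2 (f := Equiv.ofBijective g hbij) hgc
  refine ⟨ψ.symm, fun U => ⟨hmem U.1 U.2, ?_⟩⟩
  have h1 : g (ψ.symm U) = U := ψ.apply_symm_apply U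
  rw [← hdev, h1]

omit hT in
theorem isClosed_through [SimplyConnectedSpace X] {Z : Set (Bar X)} {U₀ : Subconic dev}
    (hZ : Z ⊆ U₀.conePoints) {z : Fin 3 → Bar X} (hzZ : ∀ i, z i ∈ Z)
    (hw : AffineIndependent ℝ (devBar dev ∘ z)) :
    IsClosed {U : Subconic dev | Z ⊆ U.conePoints} := by
  obtain ⟨x, hx, hc⟩ := hd.exists_center hw fun i => hZ (hzZ i)
  obtain ⟨φ, -⟩ := exists_homeomorph_faceAt hd hC hw (m := fun _ => 1) (fun _ => one_pos) hx hc
    hzZ hZ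
  have : CompactSpace (faceAt (devBar dev ∘ z) (fun _ => 1) (obst dev x) (dev x)
    (devBar dev '' Z)) := isCompact_iff_compactSpace.1 (isCompact_faceAt hw (fun _ => one_pos) hc)
  have : T2Space (Subconic dev) := hd.t2Space_subconic
  have : IsCompact {U : Subconic dev | Z ⊆ U.conePoints} :=
    isCompact_iff_compactSpace.2 φ.symm.compactSpace
  exact this.isClosed

omit hC hT in
theorem IsDevelopingMap.zeros_subset_iff {U : Subconic dev} {x : X} {q : Q3} (hx : x ∈ U.1)
    (hq : dev '' U.1 = sublevel q) {Z : Set (Bar X)}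
    (hZ : ∀ y ∈ Z, devBar dev y ∈ obst dev x ∧ barExp dev x (devBar dev y) = y) :
    (Z ⊆ U.conePoints ↔ ∀ a ∈ devBar dev '' Z, q (hat a) = 0) ∧
      (U.conePoints = Z ↔ zeros (obst dev x) q = devBar dev '' Z) := by
  have h1 : ∀ y ∈ Z, (y ∈ U.conePoints ↔ q (hat (devBar dev y)) = 0) := by
    intro y hy
    have := hd.mem_conePoints_iff hx hq (hZ y hy).1
    rwa [(hZ y hy).2] at this
  have h2 := hd.devBar_conePoints hx hq
  refine ⟨⟨?_, fun h y hy => (h1 y hy).2 (h _ (mem_image_of_mem _ hy))⟩, ?_, ?_⟩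
  · rintro h _ ⟨y, hy, rfl⟩
    exact (h1 y hy).1 (h hy)
  · rintro rfl
    exact h2.symm
  · intro h
    have h3 : U.conePoints = barExp dev x '' zeros (obst dev x) q := hd.conePoints_eq hx hq
    rw [h3, h, image_image]
    exact (image_congr fun y hy => (hZ y hy).2).trans (image_id _)

omit hC hT in
theorem IsDevelopingMap.encard_conePoints {U : Subconic dev} {x : X} {q : Q3} (hx : x ∈ U.1)
    (hq : dev '' U.1 = sublevel q) :
    U.conePoints.encard = (zeros (obst dev x) q).encard := by
  rw [hd.conePoints_eq hx hq]
  exact (hd.injOn_barExp.mono fun a ha => ha.1.1).encard_image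

/-- For a subconic whose cone points contain `Z`, move its form along the segment towards the form
of a member of the cell. As soon as the parameter is positive, the zeros are exactly those given by
`Z`. -/
theorem closure_cell [SimplyConnectedSpace X] {Z : Set (Bar X)} (hne : (cell dev Z).Nonempty)
    {z : Fin 3 → Bar X} (hzZ : ∀ i, z i ∈ Z) (hw : AffineIndependent ℝ (devBar dev ∘ z)) :
    cell dev Z = {U | U.conePoints = Z} ∧ closure (cell dev Z) = {U | Z ⊆ U.conePoints} := by
  have hcell : cell dev Z = {U | U.conePoints = Z} := by
    ext U
    refine ⟨fun h => h.1, ?_⟩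
    rintro rfl
    exact mem_cell_of_hasTriangle hd hT ⟨z, hzZ, hw⟩
  refine ⟨hcell, ?_⟩
  obtain ⟨U₀, hU₀⟩ := hne
  have hZ : U₀.conePoints = Z := hU₀.1
  apply subset_antisymm
  · refine closure_minimal ?_ (isClosed_through hd hC hZ.ge hzZ hw)
    intro U hU
    exact hU.1.ge
  · intro U hU
    have hU : Z ⊆ U.conePoints := hU
    obtain ⟨x, hx, hc⟩ := hd.exists_center hw fun i => hZ.ge (hzZ i)
    obtain ⟨φ, hφ⟩ := exists_homeomorph_faceAt hd hC hw (m := fun _ => 1) (fun _ => one_pos) hx hc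
      hzZ hZ.ge
    obtain ⟨q₀, hq₀⟩ := hd.exists_form (U := U₀)
    have hZ' : ∀ y ∈ Z, devBar dev y ∈ obst dev x ∧ barExp dev x (devBar dev y) = y :=
      fun y hy => by
        have := hd.mem_obst_of_mem_conePoints hx hq₀ (hZ.ge hy)
        exact ⟨this.1.1, this.2⟩
    set p := φ ⟨U, hU⟩ with hp
    set p₀ := φ ⟨U₀, hZ.ge⟩ with hp₀
    have hz₀ : zeros (obst dev x) p₀.1 = devBar dev '' Z :=
      (hd.zeros_subset_iff hx (hφ ⟨U₀, hZ.ge⟩).2 hZ').2.1 hZ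
    have hpath : ∀ t : unitInterval, (1 - (t : ℝ)) • p.1 + (t : ℝ) • p₀.1 ∈
        faceAt (devBar dev ∘ z) (fun _ => 1) (obst dev x) (dev x) (devBar dev '' Z) := fun t =>
      convex_faceAt p.2 p₀.2 (sub_nonneg.2 t.2.2) t.2.1 (by ring)
    set γ : unitInterval → {U : Subconic dev // Z ⊆ U.conePoints} := fun t =>
      φ.symm ⟨_, hpath t⟩ with hγ
    have hγc : Continuous γ := by
      refine φ.symm.continuous.comp (Continuous.subtype_mk ?_ _)
      fun_prop
    have hγ0 : (γ 0).1 = U := by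
      have : (⟨_, hpath 0⟩ : faceAt (devBar dev ∘ z) (fun _ => 1) (obst dev x) (dev x)
          (devBar dev '' Z)) = p := by
        apply Subtype.ext; simp
      simp only [hγ]
      rw [this, hp, φ.symm_apply_apply]
    rw [← hγ0]
    have h01 : (0 : unitInterval) ∈ closure (Ioi (0 : unitInterval)) := by
      rw [closure_Ioi' ⟨1, by simp⟩]; simp
    refine map_mem_closure (f := fun t => (γ t).1) (continuous_subtype_val.comp hγc) h01 fun t ht => ?_
    have ht0 : 0 < (t : ℝ) := ht
    show (γ t).1 ∈ cell dev Z
    rw [hcell]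
    have h1 := hφ (γ t)
    have h2 : (φ (γ t)).1 = (1 - (t : ℝ)) • p.1 + (t : ℝ) • p₀.1 := by
      simp only [hγ, φ.apply_symm_apply]
    refine (hd.zeros_subset_iff h1.1 h1.2 hZ').2.2 ?_
    rw [h2]
    rcases t.2.2.eq_or_lt with h | h
    · rw [h, sub_self, zero_smul, zero_add, one_smul, hz₀]
    · rw [zeros_combination p.2.1 p₀.2.1 (sub_pos.2 h) ht0, hz₀, inter_eq_right]
      exact subset_zeros (by rintro _ ⟨y, hy, rfl⟩; exact (hZ' y hy).1) p.2

end Through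

end TranslationSurface

namespace TranslationSurface

open AffineMap (lineMap)

/-! ### Existence of subconics with exactly three cone points -/

/-- The form `λ |a - c|² + ⟨l, a - c⟩ - 1`. -/
noncomputable def circ (c : Plane) (p : ℝ × ℝ × ℝ) : Q3 :=
  let Y₀ : (Fin 3 → ℝ) →ₗ[ℝ] ℝ := LinearMap.proj 0 - c 0 • LinearMap.proj 2
  let Y₁ : (Fin 3 → ℝ) →ₗ[ℝ] ℝ := LinearMap.proj 1 - c 1 • LinearMap.proj 2
  p.1 • (QuadraticMap.linMulLin Y₀ Y₀ + QuadraticMap.linMulLin Y₁ Y₁) +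
    (p.2.1 • QuadraticMap.linMulLin Y₀ (LinearMap.proj 2) +
      p.2.2 • QuadraticMap.linMulLin Y₁ (LinearMap.proj 2)) -
    QuadraticMap.linMulLin (LinearMap.proj 2) (LinearMap.proj 2)

variable {c : Plane} {O : Set Plane}

theorem circ_hat (p : ℝ × ℝ × ℝ) (a : Plane) : circ c p (hat a) =
    p.1 * ((a 0 - c 0) ^ 2 + (a 1 - c 1) ^ 2) + (p.2.1 * (a 0 - c 0) + p.2.2 * (a 1 - c 1)) - 1 := by
  simp [circ, hat]
  ring

theorem circ_vec (p : ℝ × ℝ × ℝ) (v : Plane) : circ c p (vec v) =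
    p.1 * (v 0 ^ 2 + v 1 ^ 2) := by
  simp [circ, vec]
  ring

theorem circ_apply (p : ℝ × ℝ × ℝ) (u : Fin 3 → ℝ) : circ c p u =
    p.1 * ((u 0 - c 0 * u 2) ^ 2 + (u 1 - c 1 * u 2) ^ 2) +
      (p.2.1 * (u 0 - c 0 * u 2) + p.2.2 * (u 1 - c 1 * u 2)) * u 2 - u 2 ^ 2 := by
  simp [circ]
  ring

theorem continuous_circ : Continuous (circ c) := by
  refine continuous_induced_rng.2 (continuous_pi fun u => ?_)
  show Continuous fun p => circ c p u
  simp only [circ_apply]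
  fun_prop

theorem sq_add_sq_pos {v : Plane} (hv : v ≠ 0) : 0 < v 0 ^ 2 + v 1 ^ 2 := by
  have : v 0 ≠ 0 ∨ v 1 ≠ 0 := by
    by_contra! h
    exact hv (by ext i; fin_cases i <;> simp [h.1, h.2])
  rcases this with h | h <;> positivity

theorem isElliptic_circ {p : ℝ × ℝ × ℝ} (hp : 0 < p.1) : IsElliptic (circ c p) := fun v hv => by
  rw [circ_vec]
  exact mul_pos hp (sq_add_sq_pos hv)

theorem Tame.circ_pos (hO : Tame O c) {p : ℝ × ℝ × ℝ} (hp : circ c p ∈ adm O c) : 0 < p.1 := by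
  obtain ⟨u, hu⟩ := exists_pos_dir (hO.cases _ hp)
  rw [circ_vec] at hu
  by_contra! h
  nlinarith [sq_nonneg (u 0), sq_nonneg (u 1)]

theorem Tame.finite_zeros (hO : Tame O c) {q : Q3} (hq : q ∈ adm O c) (he : IsElliptic q) :
    (zeros O q).Finite := by
  by_contra hinf
  obtain ⟨R, -, hR⟩ := he.exists_radius c
  have hcomp : IsCompact (Metric.closedBall c R ∩ {a | q (hat a) ≤ 0}) :=
    (isCompact_closedBall c R).inter_right (isClosed_le (continuous_form_hat q) continuous_const)
  obtain ⟨b, hb, hacc⟩ := Set.Infinite.exists_accPt_of_subset_isCompact hinf hcomp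
    (fun a ha => ⟨by
      rw [Metric.mem_closedBall]
      by_contra! h
      exact (hR a h.le).ne' ha.2, le_of_eq ha.2⟩)
  rw [accPt_iff_frequently] at hacc
  obtain ⟨a, ⟨hne, ha⟩, h⟩ := (hacc.and_eventually (hO.isolated q hq b hb.2)).exists
  exact hne (h ha.1)

/-- The sublevel of `circ` is a disc with centre `c - l / (2λ)` and radius larger than `|l| / (2λ)`;
the bound on inscribed discs applies to it. -/
theorem circ_bound {B : ℝ} (hB : ∀ q ∈ adm O c, ∀ b R, Metric.ball b R ⊆ sublevel q → R ≤ B)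
    {p : ℝ × ℝ × ℝ} (hp : circ c p ∈ adm O c) (hpos : 0 < p.1) :
    p.2.1 ^ 2 + p.2.2 ^ 2 ≤ 4 * p.1 ^ 2 * B ^ 2 := by
  obtain ⟨l, x, y⟩ := p
  simp only at hpos ⊢
  set R := Real.sqrt ((x ^ 2 + y ^ 2) / (4 * l ^ 2)) with hRdef
  have hR2 : R ^ 2 = (x ^ 2 + y ^ 2) / (4 * l ^ 2) := Real.sq_sqrt (by positivity)
  have hR0 : 0 ≤ R := Real.sqrt_nonneg _
  have h := hB _ hp !₂[c 0 - x / (2 * l), c 1 - y / (2 * l)] R (by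
    intro a ha
    have h1 : dist a !₂[c 0 - x / (2 * l), c 1 - y / (2 * l)] ^ 2 < R ^ 2 := by
      have := Metric.mem_ball.1 ha
      have h0 := dist_nonneg (x := a) (y := !₂[c 0 - x / (2 * l), c 1 - y / (2 * l)])
      nlinarith
    rw [EuclideanSpace.dist_eq, Real.sq_sqrt (by positivity), Fin.sum_univ_two] at h1
    simp only [Real.dist_eq, sq_abs] at h1
    show circ c _ (hat a) < 0
    rw [circ_hat]
    simp at h1 ⊢
    rw [hR2, lt_div_iff₀ (by positivity)] at h1
    have e : ((a 0 - (c 0 - x / (2 * l))) ^ 2 + (a 1 - (c 1 - y / (2 * l))) ^ 2) * (4 * l ^ 2) =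
        4 * l * (l * ((a 0 - c 0) ^ 2 + (a 1 - c 1) ^ 2) + (x * (a 0 - c 0) + y * (a 1 - c 1))) +
          (x ^ 2 + y ^ 2) := by
      field_simp
      ring
    rw [e] at h1
    by_contra! h2
    nlinarith)
  have h3 : R ^ 2 ≤ B ^ 2 := by nlinarith
  rw [hR2, div_le_iff₀ (by positivity)] at h3
  linarith

theorem Tame.circ_perturb (hO : Tame O c) {p : ℝ × ℝ × ℝ} (hp : circ c p ∈ adm O c)
    (d : ℝ × ℝ × ℝ) (hd : ∀ a ∈ zeros O (circ c p), 0 ≤ d.1 * ((a 0 - c 0) ^ 2 + (a 1 - c 1) ^ 2) +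
      (d.2.1 * (a 0 - c 0) + d.2.2 * (a 1 - c 1))) :
    ∀ᶠ ε : ℝ in 𝓝[>] 0, circ c (p + ε • d) ∈ adm O c := by
  have hcont : Continuous fun ε : ℝ => circ c (p + ε • d) := continuous_circ.comp (by fun_prop)
  have h1 := (hcont.tendsto' 0 (circ c p) (by simp)).eventually
    (hO.eventually_adm hp (isElliptic_circ (hO.circ_pos hp)))
  filter_upwards [h1.filter_mono nhdsWithin_le_nhds, self_mem_nhdsWithin] with ε h hε
  refine (h fun a ha => ?_).1
  have h2 := mul_nonneg (le_of_lt (show (0 : ℝ) < ε from hε)) (hd a ha)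
  have h3 := ha.2
  rw [circ_hat] at h3 ⊢
  simp only [Prod.fst_add, Prod.snd_add, Prod.smul_fst, Prod.smul_snd, smul_eq_mul]
  linarith

/-- Among the admissible circles, minimize `λ` and then maximize `|l|` among the minimizers. If
there were at most two obstacles on the circle, one could either lower `λ` or increase `|l|` with
`λ` fixed. -/
theorem Tame.exists_circle (hO : Tame O c) {B : ℝ}
    (hB : ∀ q ∈ adm O c, ∀ b R, Metric.ball b R ⊆ sublevel q → R ≤ B)
    {ρ : ℝ} (hρ : 0 < ρ) (hρO : ∀ a ∈ O, ρ ≤ dist a c) :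
    ∃ q ∈ adm O c, IsElliptic q ∧ 3 ≤ (zeros O q).encard := by
  have hO2 : ∀ a ∈ O, ρ ^ 2 ≤ (a 0 - c 0) ^ 2 + (a 1 - c 1) ^ 2 := by
    intro a ha
    have h1 := hρO a ha
    rw [EuclideanSpace.dist_eq, Fin.sum_univ_two, Real.le_sqrt hρ.le (by positivity)] at h1
    simpa [Real.dist_eq, sq_abs] using h1
  set S : Set (ℝ × ℝ × ℝ) := {p | circ c p ∈ adm O c} with hS
  have hSiff : ∀ p, p ∈ S ↔ (∀ v, 0 ≤ circ c p (vec v)) ∧ ∀ a ∈ O, 0 ≤ circ c p (hat a) := by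
    intro p
    refine ⟨fun h => ⟨h.1, h.2.2⟩, fun h => ⟨h.1, ?_, h.2⟩⟩
    rw [circ_hat]; simp
  have hSc : IsClosed S := by
    have : S = {p | (∀ v, 0 ≤ circ c p (vec v)) ∧ ∀ a ∈ O, 0 ≤ circ c p (hat a)} := ext hSiff
    rw [this]
    simp only [ofPred_and, ofPred_forall]
    refine IsClosed.inter ?_ ?_
    · exact isClosed_iInter fun v =>
        isClosed_le continuous_const ((continuous_form_apply _).comp continuous_circ)
    · exact isClosed_biInter fun v _ =>
        isClosed_le continuous_const ((continuous_form_apply _).comp continuous_circ)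
  set l₀ := 1 / ρ ^ 2 with hl₀
  have hp₀ : (l₀, (0 : ℝ), (0 : ℝ)) ∈ S := by
    rw [hSiff]
    refine ⟨fun v => ?_, fun a ha => ?_⟩
    · rw [circ_vec]; positivity
    · rw [circ_hat]
      have := hO2 a ha
      simp only [hl₀]
      rw [one_div, zero_mul, zero_mul, add_zero, add_zero, sub_nonneg, ← div_eq_inv_mul,
        one_le_div (by positivity)]
      exact this
  -- An upper bound on `λ` bounds `l` too, by `circ_bound`. The value `l₀` is that of the circle of
  -- radius `ρ` about `c`, which contains no obstacle in its interior.
  have hcpt : ∀ l : ℝ, l ≤ l₀ → IsCompact {p | p ∈ S ∧ p.1 ≤ l} := by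
    intro l hl
    set D := 2 * l₀ * |B|
    refine (isCompact_Icc (a := ((0 : ℝ), (-D, -D))) (b := (l₀, (D, D)))).of_isClosed_subset
      (hSc.inter (isClosed_le continuous_fst continuous_const)) ?_
    rintro p ⟨hp, hpl⟩
    have hpos := hO.circ_pos hp
    have h1 := circ_bound hB hp hpos
    have h2 : 4 * p.1 ^ 2 * B ^ 2 ≤ D ^ 2 := by
      simp only [D, mul_pow, sq_abs]
      have : p.1 ^ 2 ≤ l₀ ^ 2 := by nlinarith [hpl.trans hl]
      nlinarith [sq_nonneg B]
    have hD : 0 ≤ D := by positivity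
    have h3 := abs_le_of_sq_le_sq' (by nlinarith [sq_nonneg p.2.2] : p.2.1 ^ 2 ≤ D ^ 2) hD
    have h4 := abs_le_of_sq_le_sq' (by nlinarith [sq_nonneg p.2.1] : p.2.2 ^ 2 ≤ D ^ 2) hD
    exact ⟨⟨hpos.le, h3.1, h4.1⟩, ⟨hpl.trans hl, h3.2, h4.2⟩⟩
  obtain ⟨p₁, hp₁, hmin⟩ := (hcpt l₀ le_rfl).exists_isMinOn ⟨_, hp₀, le_rfl⟩
    continuous_fst.continuousOn
  have hmin' : ∀ p ∈ S, p₁.1 ≤ p.1 := by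
    intro p hp
    rcases le_or_gt p.1 l₀ with h | h
    · exact hmin ⟨hp, h⟩
    · exact hp₁.2.trans h.le
  obtain ⟨p, hp, hmax⟩ := (hcpt p₁.1 hp₁.2).exists_isMaxOn ⟨p₁, hp₁.1, le_rfl⟩
    (f := fun p : ℝ × ℝ × ℝ => p.2.1 ^ 2 + p.2.2 ^ 2) (by fun_prop)
  have hpS : circ c p ∈ adm O c := hp.1
  refine ⟨circ c p, hpS, isElliptic_circ (hO.circ_pos hpS), ?_⟩
  by_contra! hlt
  have h2 : (zeros O (circ c p)).encard ≤ 2 := Order.le_of_lt_add_one hlt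
  -- If all contacts were strictly on one side of a line through `c`, a large linear term in the
  -- direction `u` would compensate for a decrease of `λ`.
  have hnot : ∀ u : Plane, ¬ ∀ a ∈ zeros O (circ c p),
      0 < u 0 * (a 0 - c 0) + u 1 * (a 1 - c 1) := by
    intro u hu
    have hfin := hO.finite_zeros hpS (isElliptic_circ (hO.circ_pos hpS))
    obtain ⟨k, hk⟩ : ∃ k : ℝ, ∀ a ∈ zeros O (circ c p), (a 0 - c 0) ^ 2 + (a 1 - c 1) ^ 2 ≤
        k * (u 0 * (a 0 - c 0) + u 1 * (a 1 - c 1)) := by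
      obtain ⟨k, hk⟩ := (hfin.image fun a => ((a 0 - c 0) ^ 2 + (a 1 - c 1) ^ 2) /
        (u 0 * (a 0 - c 0) + u 1 * (a 1 - c 1))).bddAbove
      refine ⟨k, fun a ha => ?_⟩
      have := hk (mem_image_of_mem _ ha)
      rwa [div_le_iff₀ (hu a ha)] at this
    obtain ⟨ε, hε, hε0⟩ := ((hO.circ_perturb hpS (-1, k * u 0, k * u 1) fun a ha => by
      have := hk a ha
      simp only
      linarith).and self_mem_nhdsWithin).exists
    have h3 := hmin' _ hε
    have hε0 : 0 < ε := hε0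
    simp at h3
    linarith [hp.2]
  -- If all contacts were on the line through `c` orthogonal to `u`, both `l + ε u` and `l - ε u`
  -- would be allowed, and one of them is longer than `l`.
  have hnot' : ∀ u : Plane, u ≠ 0 → ¬ ∀ a ∈ zeros O (circ c p),
      u 0 * (a 0 - c 0) + u 1 * (a 1 - c 1) = 0 := by
    intro u hu hz
    have e₁ := hO.circ_perturb hpS (0, u 0, u 1) fun a ha => by
      have := hz a ha
      simp only
      linarith
    have e₂ := hO.circ_perturb hpS (0, -u 0, -u 1) fun a ha => by
      have := hz a ha
      simp only
      linarith
    obtain ⟨ε, ⟨h3, h4⟩, hε0⟩ := ((e₁.and e₂).and self_mem_nhdsWithin).exists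
    have hε0 : 0 < ε := hε0
    have h5 := hmax ⟨h3, by simpa using hp.2⟩
    have h6 := hmax ⟨h4, by simpa using hp.2⟩
    simp at h5 h6
    have := sq_add_sq_pos hu
    nlinarith [mul_pos (mul_pos hε0 hε0) this]
  obtain ⟨a₁, a₂, hsub⟩ : ∃ a₁ a₂, zeros O (circ c p) ⊆ {a₁, a₂} := by
    rcases h2.lt_or_eq with h | h
    · have h1 : (zeros O (circ c p)).encard ≤ 1 := Order.le_of_lt_add_one h
      rcases encard_le_one_iff_eq.1 h1 with h | ⟨x, h⟩
      · exact ⟨0, 0, by rw [h]; simp⟩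
      · exact ⟨x, x, by rw [h]; simp⟩
    · obtain ⟨x, y, -, h⟩ := encard_eq_two.1 h
      exact ⟨x, y, h.le⟩
  by_cases h1 : a₁ = c
  · refine hnot (a₂ - c) fun a ha => ?_
    have hne : a ≠ c := by
      rintro rfl
      have := hρO _ ha.1
      rw [dist_self] at this
      linarith
    rcases hsub ha with h | h
    · exact absurd (h.trans h1) hne
    · rw [mem_singleton_iff] at h
      subst h
      have := sq_add_sq_pos (sub_ne_zero.2 hne)
      simp only [PiLp.sub_apply] at this ⊢
      nlinarith
  · set y := a₁ - c with hy
    have hy0 : y ≠ 0 := sub_ne_zero.2 h1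
    have hypos := sq_add_sq_pos hy0
    have ey0 : a₁ 0 - c 0 = y 0 := rfl
    have ey1 : a₁ 1 - c 1 = y 1 := rfl
    -- The determinant of the two contacts seen from `c`. If it vanishes, both are orthogonal to
    -- `rot y`. Otherwise `u = y + t • rot y`, with `t` chosen so that the scalar product of `u`
    -- with `a₂ - c` is 1, is positive on both.
    set s := -y 1 * (a₂ 0 - c 0) + y 0 * (a₂ 1 - c 1) with hs
    by_cases hs0 : s = 0
    · refine hnot' (rot y) ?_ fun a ha => ?_
      · intro h
        apply hy0
        have g0 := congrArg (fun v : Plane => v 0) h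
        have g1 := congrArg (fun v : Plane => v 1) h
        simp [rot] at g0 g1
        ext i; fin_cases i <;> simp [g0, g1]
      · rcases hsub ha with h | h
        · subst h
          rw [ey0, ey1]; simp [rot]; ring
        · rw [mem_singleton_iff] at h
          subst h
          simp [rot]; linarith
    · set t := (1 - (y 0 * (a₂ 0 - c 0) + y 1 * (a₂ 1 - c 1))) / s with ht
      have hts : t * s = 1 - (y 0 * (a₂ 0 - c 0) + y 1 * (a₂ 1 - c 1)) := div_mul_cancel₀ _ hs0
      refine hnot !₂[y 0 - t * y 1, y 1 + t * y 0] fun a ha => ?_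
      rcases hsub ha with h | h
      · subst h
        rw [ey0, ey1]; simp; nlinarith
      · rw [mem_singleton_iff] at h
        subst h
        simp
        have : (y 0 - t * y 1) * (a 0 - c 0) + (y 1 + t * y 0) * (a 1 - c 1) = 1 := by
          rw [hs] at hts
          linear_combination hts
        linarith

/-! ### From at least three cone points to exactly three -/

theorem triForm_single (w : Fin 3 → Plane) (hw : AffineIndependent ℝ w) (u : Fin 3 → ℝ) :
    triForm hw (Pi.single 0 (-1)) u = bary hw 1 u * bary hw 2 u := by
  rw [triForm_apply]; simp

/-- Seen from a point `a₀` of the ellipse, the other points lie in an angle. Taking its extreme rays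
as two sides of the triangle, all remaining points are strictly inside the angle, so their
coordinates 1 and 2 are positive. -/
theorem exists_adjacent {q : Q3} (he : IsElliptic q) {A : Set Plane} (hA : A.Finite)
    (hAq : ∀ a ∈ A, q (hat a) = 0) (h3 : 3 ≤ A.encard) : ∃ w : Fin 3 → Plane,
      (∀ i, w i ∈ A) ∧ ∃ hw : AffineIndependent ℝ w, ∀ a ∈ A, a ∉ range w →
        0 < bary hw 1 (hat a) * bary hw 2 (hat a) := by
  obtain ⟨a₀, ha₀⟩ : A.Nonempty := by
    rw [← encard_pos]; exact lt_of_lt_of_le (by norm_num) h3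
  set A' := A \ {a₀} with hA'
  have hA'f : A'.Finite := hA.subset sdiff_subset
  have h2 : 1 < A'.encard := by
    have := encard_sdiff_singleton_add_one ha₀
    rw [← this] at h3
    have h4 : (2 : ℕ∞) + 1 ≤ A'.encard + 1 := h3
    have h5 : (2 : ℕ∞) ≤ A'.encard := (ENat.add_le_add_iff_right (by simp)).1 h4
    exact lt_of_lt_of_le (by norm_num) h5
  have hA'n : A'.Nonempty := by
    rw [← encard_pos]; exact lt_trans (by norm_num) h2
  -- `N` measures the position relative to the tangent at `a₀`; it is positive on the ellipse. The
  -- quotient `f / N` is a projective coordinate on the rays from `a₀`, which orders the points;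
  -- equal values would put two of them on a line with `a₀`.
  set N : Plane → ℝ := fun a => -QuadraticMap.polar q (hat a₀) (vec (a - a₀)) with hN
  have hNpos : ∀ a ∈ A', 0 < N a := by
    intro a ha
    have h := form_line q a₀ (a - a₀) 1
    rw [one_smul, add_sub_cancel, hAq a ha.1, hAq a₀ ha₀] at h
    have := he (a - a₀) (sub_ne_zero.2 ha.2)
    simp only [hN]
    linarith
  have hNlin : ∀ a b e : Plane, ∀ s t : ℝ, a - a₀ = s • (b - a₀) + t • (e - a₀) →
      N a = s * N b + t * N e := by
    intro a b e s t h
    simp only [hN]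
    rw [h, vec_add, vec_smul, vec_smul, QuadraticMap.polar_add_right, QuadraticMap.polar_smul_right,
      QuadraticMap.polar_smul_right]
    simp only [smul_eq_mul]
    ring
  have hne : ∀ {a b}, a ∈ A' → b ∈ A' → a ≠ b → AffineIndependent ℝ ![a₀, a, b] :=
    fun {a b} ha hb hab => affineIndependent_of_isElliptic he (Ne.symm ha.2) (Ne.symm hb.2) hab
      (hAq _ ha₀) (hAq _ ha.1) (hAq _ hb.1)
  obtain ⟨a₁, ha₁⟩ := hA'n
  set v := a₁ - a₀ with hv
  have hv0 : v ≠ 0 := sub_ne_zero.2 ha₁.2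
  set f : Plane → ℝ := side v a₀ with hf
  have hflin : ∀ a b e : Plane, ∀ s t : ℝ, a - a₀ = s • (b - a₀) + t • (e - a₀) →
      f a = s * f b + t * f e := by
    intro a b e s t h
    have h0 := congrArg (fun v : Plane => v 0) h
    have h1 := congrArg (fun v : Plane => v 1) h
    simp at h0 h1
    simp only [hf, side, h0, h1]
    ring
  have hratio : ∀ b ∈ A', ∀ e ∈ A', b ≠ e → f b / N b ≠ f e / N e := by
    intro b hb e he' hbe h
    rw [div_eq_div_iff (hNpos b hb).ne' (hNpos e he').ne'] at h
    set y := N e • (b - a₀) + (-N b) • (e - a₀) with hy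
    have hya : a₀ + y - a₀ = N e • (b - a₀) + (-N b) • (e - a₀) := by rw [add_sub_cancel_left]
    have hfy : f (a₀ + y) = 0 := by
      rw [hflin _ _ _ _ _ hya]; linarith
    have hNy : N (a₀ + y) = 0 := by
      rw [hNlin _ _ _ _ _ hya]; ring
    obtain ⟨k, t, hkt⟩ := exists_add_rot hv0 y
    have ht : t = 0 := by
      have : f (a₀ + y) = t * (v 0 ^ 2 + v 1 ^ 2) := by
        rw [hkt]; simp [hf, side, rot]; ring
      rw [this] at hfy
      exact (mul_eq_zero.1 hfy).resolve_right (sq_add_sq_pos hv0).ne'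
    have hNk := hNlin (a₀ + y) a₁ a₁ k 0 (by rw [add_sub_cancel_left, hkt, ht]; simp [hv])
    rw [hNy, zero_mul, add_zero] at hNk
    have hk : k = 0 := (mul_eq_zero.1 hNk.symm).resolve_right (hNpos a₁ ha₁).ne'
    have hy0 : y = 0 := by rw [hkt, hk, ht]; simp
    have hw := hne hb he' hbe
    have h1 := congrArg (fun u => bary hw 1 (vec u)) (hy.symm.trans hy0)
    have e1 := bary_vec_sub hw 1 1 0
    have e2 := bary_vec_sub hw 1 2 0
    simp only [Matrix.cons_val_zero, Matrix.cons_val_one, Matrix.cons_val] at e1 e2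
    simp only [vec_add, vec_smul, map_add, map_smul, smul_eq_mul, e1, e2] at h1
    have e3 : vec (0 : Plane) = 0 := by ext i; fin_cases i <;> simp [vec]
    rw [e3, map_zero] at h1
    simp at h1
    exact (hNpos e he').ne' h1
  obtain ⟨b, hb, hbmin⟩ := hA'f.exists_minimalFor (fun a => f a / N a) _ ⟨a₁, ha₁⟩
  obtain ⟨e, he', hemax⟩ := hA'f.exists_maximalFor (fun a => f a / N a) _ ⟨a₁, ha₁⟩
  have hlt₁ : ∀ a ∈ A', a ≠ b → f b / N b < f a / N a := by
    intro a ha hab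
    refine lt_of_le_of_ne ?_ (hratio b hb a ha (Ne.symm hab))
    by_contra! h
    exact absurd (hbmin ha h.le) (not_le.2 h)
  have hlt₂ : ∀ a ∈ A', a ≠ e → f a / N a < f e / N e := by
    intro a ha hae
    refine lt_of_le_of_ne ?_ (hratio a ha e he' hae)
    by_contra! h
    exact absurd (hemax ha h.le) (not_le.2 h)
  have hbe : b ≠ e := by
    rintro rfl
    obtain ⟨x, y, hx, hy, hxy⟩ := one_lt_encard_iff.1 h2
    have : ∃ x ∈ A', x ≠ b := by
      by_cases h : x = b
      · exact ⟨y, hy, fun h' => hxy (h.trans h'.symm)⟩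
      · exact ⟨x, hx, h⟩
    obtain ⟨x, hx, hxb⟩ := this
    exact lt_asymm (hlt₁ x hx hxb) (hlt₂ x hx hxb)
  refine ⟨![a₀, b, e], ?_, hne hb he' hbe, fun a ha har => ?_⟩
  · intro i
    fin_cases i
    · exact ha₀
    · exact hb.1
    · exact he'.1
  · have hw := hne hb he' hbe
    have haA' : a ∈ A' := ⟨ha, fun h => har ⟨0, by simpa using h.symm⟩⟩
    have l₁ := hlt₁ a haA' fun h => har ⟨1, by simpa using h.symm⟩
    have l₂ := hlt₂ a haA' fun h => har ⟨2, by simpa using h.symm⟩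
    have hs := sum_bary hw (hat a)
    have hs1 := sum_bary_hat hw a
    set x := bary hw 1 (hat a)
    set y := bary hw 2 (hat a)
    have hdec : a - a₀ = x • (b - a₀) + y • (e - a₀) := by
      have k0 := congrFun hs 0
      have k1 := congrFun hs 1
      simp [hat] at k0 k1
      rw [show ![a.ofLp 0, a.ofLp 1, 1] = hat a from rfl] at k0 k1
      ext i
      fin_cases i
      · simp
        linear_combination -k0 + a₀ 0 * hs1
      · simp
        linear_combination -k1 + a₀ 1 * hs1
    have hfa := hflin _ _ _ _ _ hdec
    have hNa := hNlin _ _ _ _ _ hdec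
    have pa := hNpos a haA'
    have pb := hNpos b hb
    have pe := hNpos e he'
    rw [div_lt_div_iff₀ (by assumption) (by assumption)] at l₁ l₂
    rw [hfa, hNa] at l₁ l₂
    have hD : 0 < f e * N b - f b * N e := by
      by_contra! hD
      have g1 : 0 < y * (f e * N b - f b * N e) := by linarith
      have g2 : 0 < x * (f e * N b - f b * N e) := by linarith
      have hx : x < 0 := by
        by_contra! h; nlinarith
      have hy : y < 0 := by
        by_contra! h; nlinarith
      rw [hNa] at pa
      nlinarith
    have g1 : 0 < y * (f e * N b - f b * N e) := by linarith
    have g2 : 0 < x * (f e * N b - f b * N e) := by linarith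
    exact mul_pos ((pos_iff_pos_of_mul_pos g2).2 hD) ((pos_iff_pos_of_mul_pos g1).2 hD)

/-- A small multiple of `r` removes the contacts outside `A` and keeps those of `A`; near an ellipse
no other obstacle interferes. The midpoint with `q` makes `zeros_combination` applicable. -/
theorem Tame.exists_zeros_eq (hO : Tame O c) {q r : Q3} (hq : q ∈ adm O c) (he : IsElliptic q)
    {A : Set Plane} (hA : A ⊆ zeros O q) (hr : ∀ a ∈ A, r (hat a) = 0)
    (hpos : ∀ a ∈ zeros O q, a ∉ A → 0 < r (hat a)) :
    ∃ q' ∈ adm O c, IsElliptic q' ∧ zeros O q' = A ∧ ∃ ε : ℝ, q' = q + ε • r := by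
  have hr0 : ∀ a ∈ zeros O q, 0 ≤ r (hat a) := by
    intro a ha
    by_cases haA : a ∈ A
    · exact (hr a haA).ge
    · exact (hpos a ha haA).le
  have hcont : Continuous fun t : ℝ => q + t • r := by fun_prop
  have h1 := (hcont.tendsto' 0 q (by simp)).eventually (hO.eventually_adm hq he)
  obtain ⟨ε, h2, hε⟩ := ((h1.filter_mono (nhdsWithin_le_nhds (s := Ioi 0))).and
    self_mem_nhdsWithin).exists
  have hε : 0 < ε := hε
  obtain ⟨h4, h5⟩ := h2 fun a ha => by
    show 0 ≤ q (hat a) + ε * r (hat a)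
    rw [ha.2, zero_add]
    exact mul_nonneg hε.le (hr0 a ha)
  refine ⟨(1 / 2 : ℝ) • q + (1 / 2 : ℝ) • (q + ε • r), convex_adm hq h4 (by norm_num)
    (by norm_num) (by norm_num), fun v hv => ?_, ?_, ε / 2, by module⟩
  · have e1 := he v hv
    have e2 := h5 v hv
    show 0 < 1 / 2 * q (vec v) + 1 / 2 * (q + ε • r) (vec v)
    linarith
  · rw [zeros_combination hq h4 (by norm_num) (by norm_num)]
    ext a
    constructor
    · rintro ⟨ha, ha'⟩
      by_contra haA
      have k2 : q (hat a) + ε * r (hat a) = 0 := ha'.2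
      rw [ha.2] at k2
      have := mul_pos hε (hpos a ha haA)
      linarith
    · intro ha
      refine ⟨hA ha, (hA ha).1, ?_⟩
      show q _ + ε * r _ = 0
      rw [(hA ha).2, hr a ha]; simp

theorem Tame.exists_encard_zeros_eq_three (hO : Tame O c) {B : ℝ}
    (hB : ∀ q ∈ adm O c, ∀ b R, Metric.ball b R ⊆ sublevel q → R ≤ B)
    {ρ : ℝ} (hρ : 0 < ρ) (hρO : ∀ a ∈ O, ρ ≤ dist a c) :
    ∃ q ∈ adm O c, IsElliptic q ∧ (zeros O q).encard = 3 := by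
  obtain ⟨q, hq, he, h3⟩ := hO.exists_circle hB hρ hρO
  obtain ⟨w, hwA, hw, hpos⟩ := exists_adjacent he (hO.finite_zeros hq he) (fun a ha => ha.2) h3
  obtain ⟨q', h1, h2, h3, -⟩ := hO.exists_zeros_eq (r := triForm hw (Pi.single 0 (-1))) hq he
    (range_subset_iff.2 hwA) (forall_mem_range.2 (triForm_mem hw _)) fun a ha haw => by
      rw [triForm_single]
      exact hpos a ha haw
  refine ⟨q', h1, h2, ?_⟩
  rw [h3, ← image_univ, hw.injective.encard_image]
  simp

end TranslationSurface

namespace TranslationSurface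

open AffineMap (lineMap)

/-! ### The faces of the polygon of admissible forms -/

theorem cellDim_coe (n : ℕ) : cellDim n = if n = 3 then 2 else if n = 4 then 1 else 0 := by
  unfold cellDim
  norm_cast

theorem cellDim_top : cellDim ⊤ = 0 := by
  simp [cellDim]

theorem cellDim_eq_one {n : ℕ∞} : cellDim n = 1 ↔ n = 4 := by
  induction n using ENat.recTopCoe with
  | top => simp [cellDim_top]
  | coe n => rw [cellDim_coe]; norm_cast; grind

theorem cellDim_eq_zero {n : ℕ∞} (h : 3 ≤ n) : cellDim n = 0 ↔ 5 ≤ n := by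
  induction n using ENat.recTopCoe with
  | top => simp [cellDim_top]
  | coe n => rw [cellDim_coe]; norm_cast at *; grind

theorem cellDim_le_one {n : ℕ∞} (h : 3 ≤ n) : cellDim n ≤ 1 ↔ 4 ≤ n := by
  induction n using ENat.recTopCoe with
  | top => simp [cellDim_top]
  | coe n => rw [cellDim_coe]; norm_cast at *; grind

theorem cellDim_le_two (n : ℕ∞) : cellDim n ≤ 2 := by
  unfold cellDim
  split_ifs <;> simp

/-- The normalized forms vanishing at the vertices of a triangle and on `A`. -/
theorem affineSpan_faceAt {w : Fin 3 → Plane} (hw : AffineIndependent ℝ w) {m : Fin 3 → ℝ}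
    {O : Set Plane} {c : Plane} (hO : Tame O c) (hwO : ∀ i, w i ∈ O) {q₀ : Q3}
    (hq₀ : q₀ ∈ faceAt w m O c ∅) :
    (affineSpan ℝ (faceAt w m O c (zeros O q₀)) : Set Q3) =
      {q | q ∈ vanishing w ∧ lam w m q = 1 ∧ ∀ a ∈ zeros O q₀, q (hat a) = 0} := by
  ext q
  have h0 := subset_affineSpan ℝ _ (mem_faceAt_zeros hq₀)
  rw [SetLike.mem_coe, ← AffineSubspace.vsub_right_mem_direction_iff_mem h0,
    direction_affineSpan, vectorSpan_faceAt hw hO hwO hq₀, vsub_eq_sub, mem_tangent,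
    Submodule.sub_mem_iff_left _ hq₀.2.1, map_sub, hq₀.2.2.1, sub_eq_zero]
  refine and_congr_right fun _ => and_congr_right fun _ => forall₂_congr fun a ha => ?_
  rw [show (q - q₀) (hat a) = q (hat a) - q₀ (hat a) from rfl, ha.2, sub_zero]

section Faces

variable {w : Fin 3 → Plane} (hw : AffineIndependent ℝ w) {m : Fin 3 → ℝ} (hm : ∀ i, 0 < m i)
  {O : Set Plane} {c : Plane} (hO : Tame O c) (hwO : ∀ i, w i ∈ O)
  (hc : ∀ i, 0 < bary hw i (hat c)) {A : Set Plane}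
include hw hO hwO

theorem isFace_faceAt_iff (hm : ∀ i, 0 < m i) (hA : A ⊆ O) {k : ℕ} {G : Set Q3} :
    IsFace k (faceAt w m O c A) G ↔ ∃ q ∈ faceAt w m O c A,
      G = faceAt w m O c (zeros O q) ∧ cellDim (zeros O q).encard = k := by
  constructor
  · rintro ⟨h1, h2, h3, h4⟩
    obtain ⟨q, hq, rfl⟩ := exists_eq_faceAt hw hO hwO hm h1 h2 ((isExtreme_faceAt hA).trans h3)
    have hq' := faceAt_subset hq
    refine ⟨q, h3.1 hq, rfl, ?_⟩
    rw [← (finrank_tangent hw hO hwO hm hq').2, ← vectorSpan_faceAt hw hO hwO hq', h4]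
  · rintro ⟨q, hq, rfl, h⟩
    have hq' := faceAt_subset hq
    refine ⟨⟨q, mem_faceAt_zeros hq'⟩, convex_faceAt, ?_, ?_⟩
    · refine (isExtreme_faceAt (A := zeros O q) fun a ha => ha.1).mono faceAt_subset fun r hr => ?_
      exact ⟨hr.1, hr.2.1, hr.2.2.1, fun a ha => hr.2.2.2 a (subset_zeros hA hq ha)⟩
    · rw [vectorSpan_faceAt hw hO hwO hq', (finrank_tangent hw hO hwO hm hq').2, h]

theorem finite_isFace_faceAt (hm : ∀ i, 0 < m i) (hc : ∀ i, 0 < bary hw i (hat c)) (k : ℕ) :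
    {G | IsFace k (faceAt w m O c ∅) G}.Finite := by
  refine ((finite_extremePoints_faceAt hw hO hwO hm hc).finite_subsets.image
    (convexHull ℝ)).subset fun G hG => ?_
  refine ⟨extremePoints ℝ G, hG.2.2.1.extremePoints_subset_extremePoints, ?_⟩
  obtain ⟨q, -, rfl, -⟩ := (isFace_faceAt_iff hw hO hwO hm (empty_subset O)).1 hG
  exact (isPolytope_faceAt hw hO hwO hm hc fun a ha => ha.1).2.symm

/-- The origin of the chart corresponds to `q₀`, whose zeros are the minimal ones. From an interior
point one can move on away from the origin, so `zeros_eq_of_extension` applies; the converse is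
`eventually_mem_faceAt`. -/
theorem zeros_eq_iff_of_chart {S : Type*} [AddCommGroup S] [Module ℝ S] [TopologicalSpace S]
    [ContinuousAdd S] [ContinuousSMul ℝ S] {L : S →ₗ[ℝ] Q3} (hL : Continuous L) {q₀ : Q3}
    (hq₀ : q₀ ∈ faceAt w m O c ∅) (hLT : ∀ y, L y ∈ tangent w m (zeros O q₀)) (y : S) :
    y ∈ interior ((fun y => q₀ + L y) ⁻¹' faceAt w m O c (zeros O q₀)) ↔
      q₀ + L y ∈ faceAt w m O c (zeros O q₀) ∧ zeros O (q₀ + L y) = zeros O q₀ := by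
  have hψ : Continuous fun y => q₀ + L y := by fun_prop
  constructor
  · intro hy
    have hy' : q₀ + L y ∈ faceAt w m O c (zeros O q₀) := interior_subset (s := (fun y => q₀ + L y) ⁻¹' _) hy
    refine ⟨hy', ?_⟩
    have hcont : Continuous fun t : ℝ => y + t • y := by fun_prop
    have h1 := (hcont.tendsto' 0 y (by simp)).eventually (mem_interior_iff_mem_nhds.1 hy)
    obtain ⟨ε, h2, hε⟩ := ((h1.filter_mono (nhdsWithin_le_nhds (s := Ioi 0))).and
      self_mem_nhdsWithin).exists
    refine zeros_eq_of_extension (w := w) (m := m) (fun a ha => ha.1) hq₀.1 rfl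
      hy' hε ?_
    have h3 : q₀ + L (y + ε • y) ∈ faceAt w m O c (zeros O q₀) := h2
    rw [map_add, map_smul] at h3
    convert h3.1 using 1
    rw [add_sub_cancel_left, add_assoc]
  · rintro ⟨h1, h2⟩
    rw [mem_interior_iff_mem_nhds]
    filter_upwards [hψ.continuousAt.eventually
      (eventually_mem_faceAt hw hO hwO (faceAt_subset h1))] with y' hy'
    rw [h2] at hy'
    obtain ⟨t1, t2, t3⟩ := mem_tangent.1 (hLT y')
    refine hy' (add_mem hq₀.2.1 t1) (by rw [map_add, hq₀.2.2.1, t2, add_zero]) fun a ha => ?_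
    show q₀ (hat a) + L y' (hat a) = 0
    rw [ha.2, t3 a ha, zero_add]

/-- This follows the pattern of `zeros_eq_iff_of_chart`, now in the affine span, where prolonging
the segment from `q₀` is possible from every relative interior point. -/
theorem intrinsicInterior_faceAt {q₀ : Q3} (hq₀ : q₀ ∈ faceAt w m O c ∅) :
    intrinsicInterior ℝ (faceAt w m O c (zeros O q₀)) =
      {q | q ∈ faceAt w m O c (zeros O q₀) ∧ zeros O q = zeros O q₀} := by
  set A := zeros O q₀
  have hspan := affineSpan_faceAt hw (m := m) hO hwO hq₀
  ext q
  rw [mem_intrinsicInterior]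
  constructor
  · rintro ⟨⟨y, hy⟩, hyi, rfl⟩
    have hyA : y ∈ faceAt w m O c A := interior_subset (s := Subtype.val ⁻¹' _) hyi
    refine ⟨hyA, ?_⟩
    have hmem : ∀ t : ℝ, y + t • (y - q₀) ∈ affineSpan ℝ (faceAt w m O c A) := by
      intro t
      have h0 := subset_affineSpan ℝ _ (mem_faceAt_zeros hq₀)
      have := AffineMap.lineMap_mem (1 + t) h0 hy
      convert this using 1
      rw [AffineMap.lineMap_apply, vsub_eq_sub, vadd_eq_add]
      module
    have hcont : Continuous fun t : ℝ => (⟨_, hmem t⟩ : affineSpan ℝ (faceAt w m O c A)) :=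
      Continuous.subtype_mk (by fun_prop) _
    have h1 := (hcont.tendsto' 0 ⟨y, hy⟩ (by simp)).eventually (mem_interior_iff_mem_nhds.1 hyi)
    obtain ⟨ε, h2, hε⟩ := ((h1.filter_mono (nhdsWithin_le_nhds (s := Ioi 0))).and
      self_mem_nhdsWithin).exists
    have h2 : y + ε • (y - q₀) ∈ faceAt w m O c A := h2
    exact zeros_eq_of_extension (w := w) (m := m) (fun a ha => ha.1) hq₀.1 rfl hyA hε h2.1
  · rintro ⟨h1, h2⟩
    refine ⟨⟨q, subset_affineSpan ℝ _ h1⟩, ?_, rfl⟩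
    rw [mem_interior_iff_mem_nhds]
    filter_upwards [continuous_subtype_val.continuousAt.eventually
      (eventually_mem_faceAt hw hO hwO (faceAt_subset h1))] with y' hy'
    rw [h2] at hy'
    have h3 : y'.1 ∈ (affineSpan ℝ (faceAt w m O c A) : Set Q3) := y'.2
    rw [hspan] at h3
    exact hy' h3.1 h3.2.1 h3.2.2

end Faces

end TranslationSurface

namespace TranslationSurface

open AffineMap (lineMap)

/-! ### Natural bases -/

theorem mem_interior_convexHull_of_bary {w : Fin 3 → Plane} (hw : AffineIndependent ℝ w)
    {a : Plane} (ha : ∀ i, 0 < bary hw i (hat a)) : a ∈ interior (convexHull ℝ (range w)) := by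
  have hopen : IsOpen {a : Plane | ∀ i, 0 < bary hw i (hat a)} := by
    rw [ofPred_forall]
    refine isOpen_iInter_of_finite fun i => isOpen_lt continuous_const ?_
    exact (LinearMap.continuous_of_finiteDimensional _).comp continuous_hat
  refine interior_maximal (fun b hb => ?_) hopen ha
  have h1 := sum_bary_hat hw b
  have h2 : b = bary hw 0 (hat b) • w 0 + bary hw 1 (hat b) • w 1 + bary hw 2 (hat b) • w 2 := by
    apply hat_injective
    have h := sum_bary hw (hat b)
    conv_lhs => rw [← h]
    ext i
    fin_cases i <;> simp [hat]
    exact h1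
  have hmem := fun i => subset_convexHull ℝ (range w) (mem_range_self i)
  rw [h2]
  have := (convex_convexHull ℝ (range w)).sum_mem (t := Finset.univ)
    (w := fun i => bary hw i (hat b)) (z := w) (fun i _ => (hb i).le)
    (by rw [Fin.sum_univ_three]; exact h1) fun i _ => hmem i
  rwa [Fin.sum_univ_three] at this

/-- Every coefficient of `d i` except the `i`-th is a polar value involving `hat (w i)`, which lies
in the radical. Negativity inside the triangle gives the sign of the remaining one. -/
theorem IsNegativeNaturalBasis.exists_coef {w : Fin 3 → Plane} (hw : AffineIndependent ℝ w)
    {d : Fin 3 → Q3} (h : IsNegativeNaturalBasis w d) :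
    ∃ k : Fin 3 → ℝ, (∀ i, 0 < k i) ∧ ∀ i, d i = triForm hw (Pi.single i (k i)) := by
  have hv : ∀ i, d i ∈ vanishing w := fun i => mem_vanishing.2 (h i).1
  have hcoef : ∀ i, triCoef w (d i) = Pi.single i (triCoef w (d i) i) := by
    intro i
    ext j
    by_cases hij : j = i
    · subst hij; simp
    · rw [Pi.single_eq_of_ne hij]
      show -QuadraticMap.polar (d i) (hat (w (j + 1))) (hat (w (j + 2))) = 0
      have : j + 1 = i ∨ j + 2 = i := by
        revert hij; revert i j; decide
      rcases this with e | e
      · rw [e, (h i).2.1, neg_zero]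
      · rw [e, QuadraticMap.polar_comm, (h i).2.1, neg_zero]
  refine ⟨fun i => triCoef w (d i) i, fun i => ?_, fun i => ?_⟩
  · obtain ⟨a, ha⟩ := exists_bary_pos hw
    have h1 := (h i).2.2 a (mem_interior_convexHull_of_bary hw ha)
    have h0 := ha 0
    have h1' := ha 1
    have h2 := ha 2
    rw [form_eq_triCoef hw (hv i), hcoef i] at h1
    by_contra! hneg
    revert h1
    rw [imp_false, not_lt]
    have p1 := mul_pos h1' h2
    have p2 := mul_pos h2 h0
    have p3 := mul_pos h0 h1'
    fin_cases i <;> simp at hneg ⊢ <;> nlinarith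
  · rw [← hcoef i, triForm_triCoef hw (hv i)]

/-- The weights are the inverses of the coefficients of the `d i`, so `lam` equals 1 on each of
them. This links the plane of the theorem to the normalization in `faceAt`. -/
theorem mem_formPlane_iff {w : Fin 3 → Plane} (hw : AffineIndependent ℝ w) {d : Fin 3 → Q3}
    {k : Fin 3 → ℝ} (hk : ∀ i, 0 < k i) (hd : ∀ i, d i = triForm hw (Pi.single i (k i))) {q : Q3} :
    q ∈ formPlane d ↔ q ∈ vanishing w ∧ lam w (fun i => (k i)⁻¹) q = 1 := by
  have hl : ∀ i, lam w (fun i => (k i)⁻¹) (d i) = 1 := by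
    intro i
    rw [lam_apply, hd, triCoef_triForm, Finset.sum_eq_single i]
    · rw [Pi.single_eq_same, inv_mul_cancel₀ (hk i).ne']
    · intro j _ hj
      rw [Pi.single_eq_of_ne hj, mul_zero]
    · simp
  constructor
  · intro h
    obtain ⟨t, ht, rfl⟩ := eq_affineCombination_of_mem_affineSpan_of_fintype h
    rw [Finset.affineCombination_eq_linear_combination _ _ _ ht]
    refine ⟨sum_mem fun i _ => Submodule.smul_mem _ _ ?_, ?_⟩
    · rw [hd]; exact triForm_mem hw _
    · rw [map_sum]
      simp only [map_smul, hl, smul_eq_mul, mul_one, ht]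
  · rintro ⟨hv, h1⟩
    rw [lam_apply] at h1
    have h2 : q = ∑ i, ((k i)⁻¹ * triCoef w q i) • d i := by
      refine ext_triCoef hw hv (sum_mem fun i _ => Submodule.smul_mem _ _ ?_) ?_
      · rw [hd]; exact triForm_mem hw _
      · rw [map_sum]
        ext j
        simp only [map_smul, hd, triCoef_triForm, Finset.sum_apply, Pi.smul_apply, smul_eq_mul]
        rw [Finset.sum_eq_single j]
        · rw [Pi.single_eq_same]
          field_simp [(hk j).ne']
        · intro i _ hi
          rw [Pi.single_eq_of_ne hi.symm, mul_zero]
        · simp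
    rw [h2, ← Finset.affineCombination_eq_linear_combination Finset.univ d
      (fun i => (k i)⁻¹ * triCoef w q i) h1]
    exact affineCombination_mem_affineSpan h1 d

/-! ### Polygons with three or four vertices -/

/-- An ellipse is strictly convex: `q` is strictly below its chord on a nondegenerate segment, so a
point with `q = 0` cannot be inside a segment on which `q ≤ 0`. -/
theorem extremePoints_convexHull_of_isElliptic {q : Q3} (he : IsElliptic q) {A : Set Plane}
    (hA : ∀ a ∈ A, q (hat a) = 0) : extremePoints ℝ (convexHull ℝ A) = A := by
  refine extremePoints_convexHull_subset.antisymm fun a ha => ?_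
  have hsub : convexHull ℝ A ⊆ {a | q (hat a) ≤ 0} :=
    convexHull_min (fun b hb => (hA b hb).le) he.isPsd.convex_sublevel_le
  refine ⟨subset_convexHull ℝ A ha, ?_⟩
  intro x hx y hy hxy
  obtain ⟨t, ⟨ht0, ht1⟩, rfl⟩ : ∃ t ∈ Ioo (0 : ℝ) 1, lineMap x y t = a := by
    rwa [openSegment_eq_image_lineMap] at hxy
  have h := hA _ ha
  rw [form_lineMap] at h
  have hx' : q (hat x) ≤ 0 := hsub hx
  have hy' : q (hat y) ≤ 0 := hsub hy
  have hxy' : y - x = 0 := by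
    by_contra hne
    have h3 := mul_pos (mul_pos ht0 (sub_pos.2 ht1)) (he _ hne)
    have h4 := mul_nonneg_of_nonpos_of_nonpos (neg_nonpos.2 (sub_pos.2 ht1).le) hx'
    have h5 := mul_nonneg_of_nonpos_of_nonpos (neg_nonpos.2 ht0.le) hy'
    linarith
  rw [sub_eq_zero.1 hxy']
  simp

theorem affineIndependent_of_encard_extremePoints {w : Fin 3 → Plane}
    (h : (extremePoints ℝ (convexHull ℝ (range w))).encard = 3) : AffineIndependent ℝ w := by
  have hfin : (range w).Finite := finite_range w
  have hle : (range w).encard ≤ 3 := by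
    rw [← image_univ]
    exact (encard_image_le _ _).trans (by simp)
  have heq : extremePoints ℝ (convexHull ℝ (range w)) = range w :=
    (hfin.subset extremePoints_convexHull_subset).eq_of_subset_of_encard_le
      extremePoints_convexHull_subset (by rw [h]; exact hle)
  have hinj : Function.Injective w := by
    have h3 : (range w).encard = 3 := by rw [← heq, h]
    have h4 : InjOn w univ := by
      refine finite_univ.injOn_of_encard_image_eq ?_
      rw [image_univ, h3]; simp
    exact injOn_univ.1 h4
  rw [affineIndependent_iff_not_collinear]
  intro hcol
  have hext : ∀ i j k : Fin 3, i ≠ j → k ≠ j → ¬ Wbtw ℝ (w i) (w j) (w k) := by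
    intro i j k hij hkj hbt
    have hj : w j ∈ extremePoints ℝ (convexHull ℝ (range w)) := by
      rw [heq]; exact mem_range_self j
    have hs : Sbtw ℝ (w i) (w j) (w k) := ⟨hbt, hinj.ne hij.symm, hinj.ne hkj.symm⟩
    have ho : w j ∈ openSegment ℝ (w i) (w k) := by
      obtain ⟨⟨t, ⟨h0, h1⟩, ht⟩, hn1, hn2⟩ := hs
      rw [openSegment_eq_image_lineMap]
      refine ⟨t, ⟨lt_of_le_of_ne h0 ?_, lt_of_le_of_ne h1 ?_⟩, ht⟩
      · rintro rfl; rw [AffineMap.lineMap_apply_zero] at ht; exact hn1 ht.symm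
      · rintro rfl; rw [AffineMap.lineMap_apply_one] at ht; exact hn2 ht.symm
    have := hj.2 (subset_convexHull ℝ _ (mem_range_self i))
      (subset_convexHull ℝ _ (mem_range_self k)) ho
    exact hij (hinj this)
  have hcol' : Collinear ℝ {w 0, w 1, w 2} := by
    convert hcol using 1
    ext a
    simp [Fin.exists_fin_succ, eq_comm]
  rcases hcol'.wbtw_or_wbtw_or_wbtw with h | h | h
  · exact hext _ _ _ (by decide) (by decide) h
  · exact hext _ _ _ (by decide) (by decide) h
  · exact hext _ _ _ (by decide) (by decide) h

/-! ### Polygons and strata on the surface -/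

section Surface

variable {X : Type*} [TopologicalSpace X] [T2Space X] [ChartedSpace Plane X] {dev : X → Plane}
  (hd : IsDevelopingMap dev)

theorem DefinesNGon.affineIndependent {w : Fin 3 → Bar X} (h : DefinesNGon dev 3 (range w)) :
    AffineIndependent ℝ (devBar dev ∘ w) := by
  refine affineIndependent_of_encard_extremePoints ?_
  rw [range_comp]
  exact h.2.2

include hd

/-- The polygon is the part of the closed subconic over the convex hull of the developed cone
points; the closure of `U` itself witnesses its convexity. -/
theorem definesNGon_conePoints {U : Subconic dev} (hU : U.HasTriangle) {x : X} (hx : x ∈ U.1)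
    {q : Q3} (hq : dev '' U.1 = sublevel q) (he : IsElliptic q) {n : ℕ}
    (hn : U.conePoints.encard = n) : DefinesNGon dev n U.conePoints := by
  have hadm := hd.mem_admissible hx hq
  set A := devBar dev '' U.conePoints with hA
  have hAq : ∀ a ∈ A, q (hat a) = 0 := by
    rintro _ ⟨y, hy, rfl⟩
    exact (hd.mem_obst_of_mem_conePoints hx hq hy).1.2
  have hsub : convexHull ℝ A ⊆ {a : Plane | q (hat a) ≤ 0} :=
    convexHull_min (fun b hb => (hAq b hb).le) he.isPsd.convex_sublevel_le
  refine ⟨⟨inter_subset_right, closure (toBar '' U.1) ∩ devBar dev ⁻¹' convexHull ℝ A,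
    fun y hy y' hy' => ⟨U.1, U.2.1, hy.1, hy'.1⟩, ?_, ?_⟩, hn, ?_⟩
  · obtain ⟨z, hz, hw⟩ := hU
    obtain ⟨y, hy, hpos⟩ := hd.exists_center hw hz
    have hopen : IsOpen (toBar '' (U.1 ∩ dev ⁻¹' interior (convexHull ℝ A))) := by
      refine hd.isOpenEmbedding_toBar.isOpenMap _ (IsOpen.inter ?_ ?_)
      · rw [hd.eq_image_of_isConvex U.2.1 hx, hq]
        exact isOpen_image_devExp hd.isLocalHomeomorph (isOpen_sublevel q)
          (hd.sublevel_subset_star hadm)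
      · exact isOpen_interior.preimage hd.isLocalHomeomorph.continuous
    refine ⟨toBar y, interior_maximal ?_ hopen ⟨y, ⟨hy, ?_⟩, rfl⟩⟩
    · rintro _ ⟨b, hb, rfl⟩
      refine ⟨subset_closure ⟨b, hb.1, rfl⟩, ?_⟩
      show devBar dev (toBar b) ∈ convexHull ℝ A
      rw [hd.devBar_toBar]
      exact interior_subset hb.2
    · refine interior_mono (convexHull_mono ?_) (mem_interior_convexHull_of_bary hw hpos)
      rintro _ ⟨i, rfl⟩
      exact ⟨z i, hz i, rfl⟩
  · rw [hd.closure_subconic hx hq]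
    apply subset_antisymm
    · rintro _ ⟨y, hy, rfl⟩
      exact hy.2
    · intro a ha
      have hb := hd.devBar_barExp (hd.closure_sublevel_subset hadm (hsub ha))
      exact ⟨barExp dev x a, ⟨⟨a, hsub ha, rfl⟩, by rwa [mem_preimage, hb]⟩, hb⟩
  · rw [extremePoints_convexHull_of_isElliptic he hAq, hA,
      (hd.injOn_devBar_conePoints U).encard_image, hn]

/-- The subconics of maximal span are those through the vertices of a triangle. -/
theorem mem_stratum_iff {U : Subconic dev} {n : ℕ} (hn : 3 ≤ n) :
    U ∈ stratum dev n ↔ U.HasTriangle ∧ (n : ℕ∞) ≤ U.conePoints.encard := by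
  constructor
  · rintro ⟨h1, B, hBA, h2⟩
    refine ⟨?_, h1⟩
    have h3 : 2 ≤ Module.finrank ℝ (vectorSpan ℝ B) := by
      rcases h2 with h2 | h2
      · exact h2
      · rw [(hd.injOn_devBar_conePoints U).encard_image] at h2
        have h4 : ((3 : ℕ) : ℕ∞) ≤ (Module.finrank ℝ (vectorSpan ℝ B) : ℕ∞) + 1 :=
          (Nat.cast_le.2 hn).trans (h1.trans h2)
        norm_cast at h4
        omega
    have hnc : ¬ Collinear ℝ B := fun h => by
      have := collinear_iff_finrank_le_one.1 h
      omega
    have hp : ∃ b ∈ B, ∃ b' ∈ B, b ≠ b' := by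
      by_contra! h
      have hs : B.Subsingleton := fun b hb b' hb' => h b hb b' hb'
      rcases hs.eq_empty_or_singleton with rfl | ⟨b, rfl⟩
      · exact hnc (collinear_empty ℝ Plane)
      · exact hnc (collinear_singleton ℝ b)
    obtain ⟨b, hb, b', hb', hbb⟩ := hp
    obtain ⟨e, he, hce⟩ : ∃ e ∈ B, ¬ Collinear ℝ {b, b', e} := by
      by_contra! h
      have hline : Collinear ℝ (line[ℝ, b, b'] : Set Plane) := by
        have := collinear_pair ℝ b b'
        rwa [Collinear, ← direction_affineSpan, AffineSubspace.affineSpan_coe,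
          direction_affineSpan]
      refine hnc (hline.subset fun e he => ?_)
      exact (h e he).mem_affineSpan_of_mem_of_ne (by simp) (by simp)
        (by simp) hbb
    obtain ⟨z, hz, rfl⟩ := hBA hb
    obtain ⟨z', hz', rfl⟩ := hBA hb'
    obtain ⟨z'', hz'', rfl⟩ := hBA he
    refine ⟨![z, z', z''], fun i => by fin_cases i <;> assumption, ?_⟩
    have e : devBar dev ∘ ![z, z', z''] = ![devBar dev z, devBar dev z', devBar dev z''] := by
      funext i
      fin_cases i <;> rfl
    rw [e, affineIndependent_iff_not_collinear_set]
    exact hce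
  · rintro ⟨⟨z, hz, hw⟩, h⟩
    refine ⟨h, _, subset_rfl, Or.inl ?_⟩
    refine (hw.finrank_vectorSpan (n := 2) (by simp)).ge.trans
      (Submodule.finrank_mono (vectorSpan_mono ℝ ?_))
    rintro _ ⟨i, rfl⟩
    exact ⟨z i, hz i, rfl⟩

end Surface

end TranslationSurface

namespace TranslationSurface

open AffineMap (lineMap)

/-! ### The closed cell of a triangle -/

section Polygon

variable {X : Type*} [TopologicalSpace X] [T2Space X] [ChartedSpace Plane X]
  [SimplyConnectedSpace X] {dev : X → Plane} (hd : IsDevelopingMap dev)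
  {C : ℝ} (hC : ∀ (x : X) (R : ℝ), Metric.ball (dev x) R ⊆ star dev x → R ≤ C)
  (hT : ∀ x, Tame (obst dev x) (dev x))
include hd hC hT

omit hT in
-- This collects the dictionary between subconics through `Z` and forms: equality or inclusion of
-- sets of cone points becomes equality or inclusion of zeros.
theorem exists_chart {z : Fin 3 → Bar X}
    (hw : AffineIndependent ℝ (devBar dev ∘ z)) {m : Fin 3 → ℝ} (hm : ∀ i, 0 < m i)
    {U₀ : Subconic dev} {Z : Set (Bar X)} (hzZ : ∀ i, z i ∈ Z) (hZ : Z ⊆ U₀.conePoints) :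
    ∃ (x : X) (φ : {U : Subconic dev // Z ⊆ U.conePoints} ≃ₜ
        faceAt (devBar dev ∘ z) m (obst dev x) (dev x) (devBar dev '' Z)),
      (∀ i, 0 < bary hw i (hat (dev x))) ∧ devBar dev '' Z ⊆ obst dev x ∧
      (∀ U, x ∈ U.1.1 ∧ dev '' U.1.1 = sublevel (φ U).1 ∧
        U.1.conePoints.encard = (zeros (obst dev x) (φ U).1).encard ∧
        (U.1.conePoints = Z ↔ zeros (obst dev x) (φ U).1 = devBar dev '' Z)) ∧
      ∀ U V, (V.1.conePoints ⊆ U.1.conePoints ↔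
          ∀ a ∈ zeros (obst dev x) (φ V).1, (φ U).1 (hat a) = 0) ∧
        (U.1.conePoints = V.1.conePoints ↔
          zeros (obst dev x) (φ U).1 = zeros (obst dev x) (φ V).1) := by
  obtain ⟨x, hx, hc⟩ := hd.exists_center hw fun i => hZ (hzZ i)
  obtain ⟨φ, hφ⟩ := exists_homeomorph_faceAt hd hC hw hm hx hc hzZ hZ
  obtain ⟨q₀, hq₀⟩ := hd.exists_form (U := U₀)
  have hZ' : ∀ y ∈ Z, devBar dev y ∈ obst dev x ∧ barExp dev x (devBar dev y) = y :=
    fun y hy => by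
      have := hd.mem_obst_of_mem_conePoints hx hq₀ (hZ hy)
      exact ⟨this.1.1, this.2⟩
  refine ⟨x, φ, hc, ?_, fun U => ⟨(hφ U).1, (hφ U).2, hd.encard_conePoints (hφ U).1 (hφ U).2,
    (hd.zeros_subset_iff (hφ U).1 (hφ U).2 hZ').2⟩, fun U V => ?_⟩
  · rintro _ ⟨y, hy, rfl⟩
    exact (hZ' y hy).1
  · have hV : ∀ y ∈ V.1.conePoints, devBar dev y ∈ obst dev x ∧
        barExp dev x (devBar dev y) = y := fun y hy => by
      have := hd.mem_obst_of_mem_conePoints (hφ V).1 (hφ V).2 hy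
      exact ⟨this.1.1, this.2⟩
    have h := hd.zeros_subset_iff (hφ U).1 (hφ U).2 hV
    have e : devBar dev '' V.1.conePoints = zeros (obst dev x) (φ V).1 :=
      hd.devBar_conePoints (hφ V).1 (hφ V).2
    rwa [e] at h

/-- Four zeros are finitely many, so the subconic is elliptic and can be pushed off the fourth point
while keeping the other three. It shows that no side can exist when the open cell of the triangle is
empty. -/
theorem cell_nonempty_of_encard_eq_four {z : Fin 3 → Bar X}
    (hw : AffineIndependent ℝ (devBar dev ∘ z)) {V : Subconic dev}
    (hz : range z ⊆ V.conePoints) (h4 : V.conePoints.encard = 4) :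
    (cell dev (range z)).Nonempty := by
  obtain ⟨x, hx, hc⟩ := hd.exists_center hw fun i => hz (mem_range_self i)
  obtain ⟨q, hq⟩ := hd.exists_form (U := V)
  have hadm := hd.mem_admissible hx hq
  have hzw := fun i => hd.mem_obst_of_mem_conePoints hx hq (hz (mem_range_self i))
  have hv : q ∈ vanishing (devBar dev ∘ z) := fun i => (hzw i).1.2
  have hcard : (zeros (obst dev x) q).encard = 4 := by rw [← hd.encard_conePoints hx hq, h4]
  have hfin : (zeros (obst dev x) q).Finite := finite_of_encard_eq_coe (k := 4) hcard
  have he := (hT x).isElliptic_of_finite hw (fun i => (hzw i).1.1) hadm hv hfin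
  have hsub : range (devBar dev ∘ z) ⊆ zeros (obst dev x) q := by
    rintro _ ⟨i, rfl⟩
    exact (hzw i).1
  have h3 : (range (devBar dev ∘ z)).encard = 3 := by
    rw [← image_univ, hw.injective.encard_image]; simp
  obtain ⟨u, hu⟩ : ∃ u, zeros (obst dev x) q \ range (devBar dev ∘ z) = {u} := by
    rw [← encard_eq_one]
    have := encard_sdiff_add_encard_of_subset hsub
    rw [h3, hcard, show (4 : ℕ∞) = 1 + 3 by norm_num] at this
    exact (ENat.addLECancellable_of_ne_top (by simp)).injective_left this
  have hu' : u ∈ zeros (obst dev x) q \ range (devBar dev ∘ z) := hu ▸ rfl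
  have hne := bary_ne_zero hw hv he hu'.1.2 fun i h => hu'.2 ⟨i, h.symm⟩
  -- The sign of this product is unknown. The perturbation with coefficient `-β` takes the value `β
  -- * β > 0` at `u`.
  set β := bary hw 1 (hat u) * bary hw 2 (hat u)
  have hβ : β ≠ 0 := mul_ne_zero (hne 1) (hne 2)
  obtain ⟨q', h1, -, h2, -⟩ := (hT x).exists_zeros_eq (r := triForm hw (Pi.single 0 (-β))) hadm he
    hsub (forall_mem_range.2 (triForm_mem hw _)) fun a ha haw => by
      have : a = u := by
        have h : a ∈ zeros (obst dev x) q \ range (devBar dev ∘ z) := ⟨ha, haw⟩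
        rwa [hu] at h
      rw [this, triForm_apply]
      simp only [Pi.single_eq_same]
      rw [Pi.single_eq_of_ne (by decide), Pi.single_eq_of_ne (by decide)]
      have := mul_self_pos.2 hβ
      simp only [β] at this ⊢
      linarith
  set U := toSubconic hd hC x ⟨q', h1⟩
  have hU : U.conePoints = range z := by
    refine (hd.zeros_subset_iff (mem_toSubconic hd hC _) (dev_toSubconic hd hC _) ?_).2.2 ?_
    · rintro _ ⟨i, rfl⟩
      exact ⟨(hzw i).1.1, (hzw i).2⟩
    · rw [h2, range_comp]
  refine ⟨U, ?_⟩
  rw [← hU]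
  exact mem_cell_of_hasTriangle hd hT ⟨z, fun i => hU ▸ mem_range_self i, hw⟩

omit hT in
-- The choice made by `invFunOn` is no choice: a subconic determines its form up to a factor, and
-- the normalization fixes the factor.
theorem cellMap_eq {w : Fin 3 → Plane} (hw : AffineIndependent ℝ w) {d : Fin 3 → Q3}
    {k : Fin 3 → ℝ} (hk : ∀ i, 0 < k i) (hdk : ∀ i, d i = triForm hw (Pi.single i (k i)))
    {x : X} {A : Set Plane} {q : Q3}
    (hq : q ∈ faceAt w (fun i => (k i)⁻¹) (obst dev x) (dev x) A) {U : Subconic dev}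
    (hU : dev '' U.1 = sublevel q) : cellMap dev d U = q := by
  have hmem : q ∈ formPlane d := (mem_formPlane_iff hw hk hdk).2 ⟨hq.2.1, hq.2.2.1⟩
  have hex : ∃ q ∈ (formPlane d : Set Q3), sublevel q = dev '' U.1 := ⟨q, hmem, hU.symm⟩
  have h1 : cellMap dev d U ∈ formPlane d := Function.invFunOn_mem hex
  have h2 : sublevel (cellMap dev d U) = dev '' U.1 := Function.invFunOn_eq hex
  obtain ⟨s, -, h3⟩ := exists_smul_of_sublevel_eq hq.1.1
    (exists_pos_dir (hd.admissible_cases hC hq.1)) (hU.symm.trans h2.symm) ⟨_, hq.1.2.1⟩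
  have h4 := ((mem_formPlane_iff hw hk hdk).1 h1).2
  rw [h3, map_smul, hq.2.2.1, smul_eq_mul, mul_one] at h4
  rw [h3, h4, one_smul]

/-- All claims are read in one chart `φ`, with weights taken from the natural basis so that `f` is
`φ` itself. Sides are the faces with four zeros, vertices those with at least five. -/
theorem isPolygon_closure_cell {w : Fin 3 → Bar X} (h3 : DefinesNGon dev 3 (range w))
    {d : Fin 3 → Q3} (hnb : IsNegativeNaturalBasis (fun i => devBar dev (w i)) d)
    {Z : Set (Bar X)} (hwZ : range w = Z) {f : Subconic dev → Q3} (hfd : f = cellMap dev d)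
    (hne : (cell dev Z).Nonempty) :
    (∀ U ∈ closure (cell dev Z), f U ∈ formPlane d ∧ sublevel (f U) = dev '' U.1) ∧
    IsEmbedding (fun U : closure (cell dev Z) => f U) ∧
    (IsPolytope (f '' closure (cell dev Z)) ∧ IsCompact (f '' closure (cell dev Z)) ∧
      Convex ℝ (f '' closure (cell dev Z)) ∧
      {E | IsFace 1 (f '' closure (cell dev Z)) E}.Finite) ∧
    (affineSpan ℝ (f '' closure (cell dev Z)) = formPlane d ∧
      intrinsicInterior ℝ (f '' closure (cell dev Z)) = f '' cell dev Z ∧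
      closure (cell dev Z) = {U | Z ⊆ U.conePoints}) ∧
    (∀ E : Set Q3, IsFace 1 (f '' closure (cell dev Z)) E ↔
      ∃ Z' : Set (Bar X), Z ⊆ Z' ∧ DefinesNGon dev 4 Z' ∧ (cell dev Z').Nonempty ∧
        E = f '' closure (cell dev Z')) ∧
    extremePoints ℝ (f '' closure (cell dev Z)) =
      f '' {U | U ∈ closure (cell dev Z) ∧ IsRigid dev U ∧ Z ⊆ U.conePoints} ∧
    ∀ U ∈ closure (cell dev Z),
      ∀ Z' : Set (Bar X), Z ⊆ Z' → (cell dev Z').Nonempty →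
        (f U ∈ f '' closure (cell dev Z') ↔ Z' ⊆ U.conePoints) := by
  have hw := h3.affineIndependent
  obtain ⟨k, hk, hdk⟩ := hnb.exists_coef hw
  have hm : ∀ i, 0 < (k i)⁻¹ := fun i => inv_pos.2 (hk i)
  have hzZ : ∀ i, w i ∈ Z := fun i => hwZ ▸ mem_range_self i
  have hclosure := fun {Z'} (hZ' : Z ⊆ Z') (hne : (cell dev Z').Nonempty) =>
    closure_cell hd hC hT hne (fun i => hZ' (hzZ i)) hw
  obtain ⟨U₀, hU₀⟩ := hne
  obtain ⟨x, φ, hc, hO, hφ, hφ'⟩ := exists_chart hd hC hw hm hzZ hU₀.1.ge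
  have hO' : ∀ i, (devBar dev ∘ w) i ∈ obst dev x := fun i => hO (mem_image_of_mem _ (hzZ i))
  have hTx := hT x
  have hWZ : devBar dev '' Z = range (devBar dev ∘ w) := by rw [← hwZ, ← range_comp]
  have hf : ∀ U, f U.1 = (φ U).1 := fun U => by
    rw [hfd]; exact cellMap_eq hd hC hw hk hdk (φ U).2 (hφ U).2.1
  have hinj : ∀ {U V}, Z ⊆ U.conePoints → Z ⊆ V.conePoints → f U = f V → U = V :=
    fun {U V} hU hV h => by
      rw [hf ⟨U, hU⟩, hf ⟨V, hV⟩] at h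
      exact congrArg Subtype.val (φ.injective (Subtype.ext h))
  obtain ⟨hcell, hcl⟩ := hclosure subset_rfl ⟨U₀, hU₀⟩
  -- The images of `Z` are the vertices themselves, so vanishing there is no additional condition.
  have hK : faceAt (devBar dev ∘ w) (fun i => (k i)⁻¹) (obst dev x) (dev x) (devBar dev '' Z) = faceAt (devBar dev ∘ w) (fun i => (k i)⁻¹) (obst dev x) (dev x) ∅ := by
    refine faceAt_subset.antisymm fun q hq => ⟨hq.1, hq.2.1, hq.2.2.1, ?_⟩
    rw [hWZ]
    exact forall_mem_range.2 hq.2.1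
  have himg : f '' closure (cell dev Z) = faceAt (devBar dev ∘ w) (fun i => (k i)⁻¹) (obst dev x) (dev x) ∅ := by
    rw [hcl, ← hK]
    apply subset_antisymm
    · rintro _ ⟨U, hU, rfl⟩
      rw [hf ⟨U, hU⟩]
      exact (φ _).2
    · intro q hq
      exact ⟨_, (φ.symm ⟨q, hq⟩).2, by rw [hf, φ.apply_symm_apply]⟩
  have himg' : ∀ V, f '' closure (cell dev V.1.conePoints) =
      faceAt (devBar dev ∘ w) (fun i => (k i)⁻¹) (obst dev x) (dev x) (zeros (obst dev x) (φ V).1) := by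
    intro V
    rw [(hclosure V.2 ⟨V.1, mem_cell_of_hasTriangle hd hT ⟨w, fun i => V.2 (hzZ i), hw⟩⟩).2]
    apply subset_antisymm
    · rintro _ ⟨U, hU, rfl⟩
      have hU : V.1.conePoints ⊆ U.conePoints := hU
      rw [hf ⟨U, V.2.trans hU⟩]
      exact ⟨(φ _).2.1, (φ _).2.2.1, (φ _).2.2.2.1, (hφ' ⟨U, V.2.trans hU⟩ V).1.1 hU⟩
    · intro q hq
      have hq' : q ∈ faceAt (devBar dev ∘ w) (fun i => (k i)⁻¹) (obst dev x) (dev x) (devBar dev '' Z) := hK ▸ faceAt_subset hq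
      refine ⟨(φ.symm ⟨q, hq'⟩).1, (hφ' _ V).1.2 ?_, by rw [hf, φ.apply_symm_apply]⟩
      rw [φ.apply_symm_apply]
      exact hq.2.2.2
  have hz₀ : zeros (obst dev x) (φ ⟨U₀, hU₀.1.ge⟩).1 = devBar dev '' Z := (hφ ⟨U₀, hU₀.1.ge⟩).2.2.2.1 hU₀.1
  set q₀ := (φ ⟨U₀, hU₀.1.ge⟩).1
  have hq₀ : q₀ ∈ faceAt (devBar dev ∘ w) (fun i => (k i)⁻¹) (obst dev x) (dev x) ∅ := faceAt_subset (φ ⟨U₀, hU₀.1.ge⟩).2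
  have hpoly := isPolytope_faceAt hw hTx hO' hm hc (empty_subset (obst dev x))
  rw [himg]
  refine ⟨fun U hU => ?_, ?_, ⟨⟨_, hpoly⟩, isCompact_faceAt hw hm hc, convex_faceAt,
    finite_isFace_faceAt hw hTx hO' hm hc 1⟩, ⟨?_, ?_, hcl⟩, fun E => ?_, ?_, ?_⟩
  · rw [hcl] at hU
    rw [hf ⟨U, hU⟩, (hφ ⟨U, hU⟩).2.1]
    exact ⟨(mem_formPlane_iff hw hk hdk).2 ⟨(φ _).2.2.1, (φ _).2.2.2.1⟩, rfl⟩
  · have : (fun U : closure (cell dev Z) => f U) =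
        Subtype.val ∘ φ ∘ Homeomorph.setCongr hcl := by
      funext U
      exact hf (Homeomorph.setCongr hcl U)
    rw [this]
    exact IsEmbedding.subtypeVal.comp (φ.isEmbedding.comp (Homeomorph.isEmbedding _))
  · apply SetLike.coe_injective
    rw [← hK, ← hz₀, affineSpan_faceAt hw hTx hO' hq₀]
    ext q
    rw [SetLike.mem_coe, mem_formPlane_iff hw hk hdk, hz₀, hWZ]
    exact ⟨fun h => ⟨h.1, h.2.1⟩, fun h => ⟨h.1, h.2, forall_mem_range.2 h.1⟩⟩
  · rw [← hK, ← hz₀, intrinsicInterior_faceAt hw hTx hO' hq₀, hz₀, hcell]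
    apply subset_antisymm
    · rintro q ⟨hq, h⟩
      refine ⟨(φ.symm ⟨q, hq⟩).1, (hφ _).2.2.2.2 ?_, by rw [hf, φ.apply_symm_apply]⟩
      rwa [φ.apply_symm_apply]
    · rintro _ ⟨U, hU, rfl⟩
      have hU : U.conePoints = Z := hU
      rw [hf ⟨U, hU.ge⟩]
      exact ⟨(φ _).2, (hφ ⟨U, hU.ge⟩).2.2.2.1 hU⟩
  · rw [isFace_faceAt_iff hw hTx hO' hm (empty_subset (obst dev x)), ← hK]
    constructor
    · rintro ⟨q, hq, rfl, h4⟩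
      rw [cellDim_eq_one] at h4
      obtain ⟨V, hV⟩ := φ.surjective ⟨q, hq⟩
      have hVq : (φ V).1 = q := by rw [hV]
      have hVt : V.1.HasTriangle := ⟨w, fun i => V.2 (hzZ i), hw⟩
      have hfin : (zeros (obst dev x) q).Finite := finite_of_encard_eq_coe (k := 4) h4
      have hVx := hφ V
      rw [hVq] at hVx
      refine ⟨V.1.conePoints, V.2, definesNGon_conePoints hd hVt hVx.1 hVx.2.1
        (hTx.isElliptic_of_finite hw hO' hq.1 hq.2.1 hfin) (hVx.2.2.1.trans h4),
        ⟨V.1, mem_cell_of_hasTriangle hd hT hVt⟩, ?_⟩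
      rw [himg', hVq]
    · rintro ⟨Z', hZ', h4, ⟨V, hV⟩, rfl⟩
      obtain rfl : V.conePoints = Z' := hV.1
      refine ⟨(φ ⟨V, hZ'⟩).1, (φ _).2, himg' ⟨V, hZ'⟩, ?_⟩
      rw [cellDim_eq_one, ← (hφ ⟨V, hZ'⟩).2.2.1]
      exact h4.2.1
  · rw [extremePoints_faceAt hw hTx hO' hm, ← hK]
    apply subset_antisymm
    · rintro q ⟨hq, h5⟩
      obtain ⟨V, hV⟩ := φ.surjective ⟨q, hq⟩
      have hVq : (φ V).1 = q := by rw [hV]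
      refine ⟨V.1, ⟨by rw [hcl]; exact V.2, (mem_stratum_iff hd (by norm_num)).2
        ⟨⟨w, fun i => V.2 (hzZ i), hw⟩, ?_⟩, V.2⟩, by rw [hf, hVq]⟩
      rw [(hφ V).2.2.1, hVq]
      exact h5
    · rintro _ ⟨U, ⟨-, hr, hU⟩, rfl⟩
      rw [hf ⟨U, hU⟩]
      refine ⟨(φ _).2, ?_⟩
      rw [← (hφ ⟨U, hU⟩).2.2.1]
      exact ((mem_stratum_iff hd (by norm_num)).1 hr).2
  · intro U hU Z' hZ' hne'
    rw [hcl] at hU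
    rw [(hclosure hZ' hne').2]
    refine ⟨?_, fun h => ⟨U, h, rfl⟩⟩
    rintro ⟨U', hU', h⟩
    have hU' : Z' ⊆ U'.conePoints := hU'
    rwa [← hinj (hZ'.trans hU') hU h]

end Polygon

end TranslationSurface

namespace TranslationSurface

open AffineMap (lineMap)

/-! ### Polytopes and affine maps -/

section AffineImage

variable {V V' : Type*} [AddCommGroup V] [Module ℝ V] [AddCommGroup V'] [Module ℝ V']
  {ψ : V →ᵃ[ℝ] V'} (hψ : Function.Injective ψ) {P : Set V}
include hψ

theorem IsFace.image {G : Set V} {k : ℕ} (h : IsFace k P G) : IsFace k (ψ '' P) (ψ '' G) := by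
  obtain ⟨h1, h2, h3, h4⟩ := h
  refine ⟨h1.image _, h2.affine_image ψ, ⟨image_mono h3.1, ?_⟩, ?_⟩
  · rintro _ ⟨x, hx, rfl⟩ _ ⟨y, hy, rfl⟩ _ ⟨z, hz, rfl⟩ hxy
    rw [← image_openSegment] at hxy
    obtain ⟨z', hz', h⟩ := hxy
    rw [hψ h] at hz'
    exact ⟨x, h3.2 hx hy hz hz', rfl⟩
  · rw [← AffineMap.map_vectorSpan, ← h4]
    exact ((vectorSpan ℝ G).equivMapOfInjective ψ.linear
      (ψ.linear_injective_iff.2 hψ)).finrank_eq.symm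

theorem IsPolytope.of_image (h : IsPolytope (ψ '' P)) : IsPolytope P := by
  obtain ⟨F, hF, h⟩ := h
  refine ⟨ψ ⁻¹' F, hF.preimage hψ.injOn, hψ.image_injective ?_⟩
  have hFr : F ⊆ range ψ :=
    ((subset_convexHull ℝ F).trans h.ge).trans (image_subset_range _ _)
  rw [AffineMap.image_convexHull, image_preimage_eq_of_subset hFr, h]

end AffineImage

/-! ### The polygonal cell complex of the subconics of maximal span -/

/-- The forms through the vertices of a triangle and `A` constitute a polytope. -/
theorem exists_polytope_faceAt {w : Fin 3 → Plane} (hw : AffineIndependent ℝ w) {m : Fin 3 → ℝ}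
    (hm : ∀ i, 0 < m i) {O : Set Plane} {c : Plane} (hO : Tame O c) (hwO : ∀ i, w i ∈ O)
    (hc : ∀ i, 0 < bary hw i (hat c)) {q₀ : Q3} (hq₀ : q₀ ∈ faceAt w m O c ∅) {A : Set Plane}
    (hA : zeros O q₀ = A) {n : ℕ} (hn : n = cellDim A.encard) :
    ∃ (P : Set (EuclideanSpace ℝ (Fin n))) (Ψ : faceAt w m O c A ≃ₜ P),
      IsPolytope P ∧ (interior P).Nonempty ∧
      (∀ q, zeros O q.1 = A ↔ (Ψ q : EuclideanSpace ℝ (Fin n)) ∈ interior P) ∧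
      ∀ (k : ℕ) (G : Set (EuclideanSpace ℝ (Fin n))), IsFace k P G →
        ∃ q : faceAt w m O c A, cellDim (zeros O q.1).encard = k ∧
          ∀ r, (Ψ r : EuclideanSpace ℝ (Fin n)) ∈ G ↔ r.1 ∈ faceAt w m O c (zeros O q.1) := by
  subst hA
  have hAO : zeros O q₀ ⊆ O := fun a ha => ha.1
  -- The coefficients embed the tangent space of the face in `ℝ³`. The chart of the face is affine,
  -- with origin at `q₀`, a relative interior point.
  set f := (triCoef w).domRestrict (tangent w m (zeros O q₀))
  have hf : Function.Injective f := fun r r' h =>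
    Subtype.ext (ext_triCoef hw (mem_tangent.1 r.2).1 (mem_tangent.1 r'.2).1 h)
  have hrank : Module.finrank ℝ (EuclideanSpace ℝ (Fin n)) =
      Module.finrank ℝ (LinearMap.range f) := by
    rw [finrank_euclideanSpace_fin, hn, LinearMap.finrank_range_of_inj hf,
      (finrank_tangent hw hO hwO hm hq₀).2]
  let L : EuclideanSpace ℝ (Fin n) ≃L[ℝ] LinearMap.range f := ContinuousLinearEquiv.ofFinrankEq hrank
  set L' : EuclideanSpace ℝ (Fin n) →ₗ[ℝ] Q3 :=
    triForm hw ∘ₗ (LinearMap.range f).subtype ∘ₗ L.toLinearMap with hL'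
  have hL'c : Continuous L' :=
    (continuous_triForm hw).comp (continuous_subtype_val.comp L.continuous)
  have hL'T : ∀ y, L' y ∈ tangent w m (zeros O q₀) := fun y => by
    obtain ⟨r, hr⟩ := (L y).2
    have : L' y = r.1 := by
      show triForm hw (L y).1 = r.1
      rw [← hr]
      exact triForm_triCoef hw (mem_tangent.1 r.2).1
    rw [this]
    exact r.2
  set ψ : EuclideanSpace ℝ (Fin n) →ᵃ[ℝ] Q3 := AffineMap.const ℝ _ q₀ + L'.toAffineMap with hψdef
  have hψ : ∀ y, ψ y = q₀ + L' y := fun y => rfl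
  have hψinj : Function.Injective ψ := by
    intro y y' h
    rw [hψ, hψ, add_right_inj] at h
    refine L.injective (Subtype.ext ?_)
    rw [← triCoef_triForm hw (L y).1, ← triCoef_triForm hw (L y').1]
    exact congrArg (triCoef w) h
  have hq₀A := mem_faceAt_zeros hq₀
  let diff : faceAt w m O c (zeros O q₀) → LinearMap.range f := fun q =>
    ⟨triCoef w (q.1 - q₀), ⟨q.1 - q₀, sub_mem_tangent hq₀A q.2⟩, rfl⟩
  set P := ψ ⁻¹' faceAt w m O c (zeros O q₀) with hP
  have hinv : ∀ q : faceAt w m O c (zeros O q₀),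
      ψ (L.symm (diff q)) = q.1 := by
    intro q
    rw [hψ]
    show q₀ + triForm hw (L (L.symm (diff q))).1 = q.1
    rw [L.apply_symm_apply, triForm_triCoef hw (sub_mem q.2.2.1 hq₀.2.1), add_sub_cancel]
  have himg : ψ '' P = faceAt w m O c (zeros O q₀) :=
    image_preimage_eq_of_subset fun q hq => ⟨_, hinv ⟨q, hq⟩⟩
  let Ψ : faceAt w m O c (zeros O q₀) ≃ₜ P :=
    { toFun := fun q => ⟨L.symm (diff q), by
        rw [hP, mem_preimage, hinv]; exact q.2⟩
      invFun := fun y => ⟨ψ y.1, y.2⟩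
      left_inv := fun q => Subtype.ext (hinv q)
      right_inv := fun y => Subtype.ext (hψinj (hinv ⟨ψ y.1, y.2⟩))
      continuous_toFun := by
        refine Continuous.subtype_mk (L.symm.continuous.comp (Continuous.subtype_mk ?_ _)) _
        exact (continuous_triCoef w).comp (by fun_prop)
      continuous_invFun := by
        refine Continuous.subtype_mk ?_ _
        show Continuous fun y : P => q₀ + L' y.1
        fun_prop }
  have hψΨ : ∀ q, ψ (Ψ q).1 = q.1 := hinv
  have hint := fun y => zeros_eq_iff_of_chart hw hO hwO hL'c hq₀ hL'T y
  refine ⟨P, Ψ, IsPolytope.of_image hψinj ?_, ⟨0, (hint 0).2 ?_⟩, fun q => ?_, fun k G hG => ?_⟩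
  · rw [himg]
    exact ⟨_, isPolytope_faceAt hw hO hwO hm hc hAO⟩
  · rw [map_zero, add_zero]
    exact ⟨hq₀A, rfl⟩
  · have h := hint (Ψ q).1
    rw [← hψ, hψΨ] at h
    exact ⟨fun hz => h.2 ⟨q.2, hz⟩, fun hz => (h.1 hz).2⟩
  · have hface := hG.image hψinj
    rw [himg, isFace_faceAt_iff hw hO hwO hm hAO] at hface
    obtain ⟨q, hq, hGq, hk⟩ := hface
    refine ⟨⟨q, hq⟩, hk, fun r => ?_⟩
    rw [← hGq, ← hψΨ r, hψinj.mem_set_image]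

/-! ### Gluing the closed cells -/

section Complex

variable {X : Type*} [TopologicalSpace X] [T2Space X] [ChartedSpace Plane X] {dev : X → Plane}

/-- The subconics of maximal span with the same cone points as `u`. -/
def openCell (u : stratum dev 3) : Set (stratum dev 3) :=
  {v | v.1.conePoints = u.1.conePoints}

open Classical in
/-- The dimension of a cell. -/
noncomputable def openCellDim (e : Set (stratum dev 3)) : ℕ :=
  if h : e.Nonempty then cellDim h.some.1.conePoints.encard else 0

theorem openCellDim_openCell (u : stratum dev 3) :
    openCellDim (openCell u) = cellDim u.1.conePoints.encard := by
  have h : (openCell u).Nonempty := ⟨u, rfl⟩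
  have h' : h.some.1.conePoints = u.1.conePoints := h.some_mem
  rw [openCellDim, dif_pos h, h']

variable [SimplyConnectedSpace X] (hd : IsDevelopingMap dev)
  {C : ℝ} (hC : ∀ (x : X) (R : ℝ), Metric.ball (dev x) R ⊆ star dev x → R ≤ C)
  (hT : ∀ x, Tame (obst dev x) (dev x))

include hd

omit [SimplyConnectedSpace X] in
theorem hasTriangle_of_stratum (u : stratum dev 3) : u.1.HasTriangle :=
  ((mem_stratum_iff hd le_rfl).1 u.2).1

omit [SimplyConnectedSpace X] in
theorem mem_stratum_of_triangle {z : Fin 3 → Bar X} (hw : AffineIndependent ℝ (devBar dev ∘ z))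
    {U : Subconic dev} (hz : ∀ i, z i ∈ U.conePoints) : U ∈ stratum dev 3 := by
  refine (mem_stratum_iff hd le_rfl).2 ⟨⟨z, hz, hw⟩, ?_⟩
  have h3 : (range z).encard = 3 := by
    rw [← image_univ, (Function.Injective.of_comp hw.injective).encard_image]; simp
  rw [Nat.cast_ofNat, ← h3]
  exact encard_le_encard (range_subset_iff.2 hz)

include hT

omit [SimplyConnectedSpace X] in
theorem setOf_cell_eq_range_openCell :
    {e : Set (stratum dev 3) | ∃ Z ⊆ bdry X, 3 ≤ Z.encard ∧ (cell dev Z).Nonempty ∧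
      e = (↑) ⁻¹' cell dev Z} = range openCell := by
  have key : ∀ U : Subconic dev, U.HasTriangle →
      cell dev U.conePoints = {V | V.conePoints = U.conePoints} := by
    rintro U ⟨z, hz, hw⟩
    ext V
    refine ⟨fun h => h.1, fun h => ?_⟩
    have h : V.conePoints = U.conePoints := h
    rw [← h] at hz ⊢
    exact mem_cell_of_hasTriangle hd hT ⟨z, hz, hw⟩
  ext e
  constructor
  · rintro ⟨Z, -, h3, ⟨U, hU⟩, rfl⟩
    have hUt := hasTriangle_of_mem_cell hd hT hU h3
    obtain rfl : U.conePoints = Z := hU.1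
    refine ⟨⟨U, (mem_stratum_iff hd le_rfl).2 ⟨hUt, h3⟩⟩, ?_⟩
    rw [key U hUt]
    rfl
  · rintro ⟨u, rfl⟩
    have hUt := hasTriangle_of_stratum hd u
    refine ⟨u.1.conePoints, inter_subset_right, u.2.1,
      ⟨u.1, mem_cell_of_hasTriangle hd hT hUt⟩, ?_⟩
    rw [key u.1 hUt]
    rfl

include hC

theorem closure_openCell (u : stratum dev 3) :
    closure (openCell u) = {v | u.1.conePoints ⊆ v.1.conePoints} := by
  have hUt := hasTriangle_of_stratum hd u
  obtain ⟨z, hz, hw⟩ := hUt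
  obtain ⟨h1, h2⟩ := closure_cell hd hC hT
    ⟨u.1, mem_cell_of_hasTriangle hd hT ⟨z, hz, hw⟩⟩ hz hw
  have h3 : (↑) '' openCell u = cell dev u.1.conePoints := by
    rw [h1]
    ext V
    constructor
    · rintro ⟨v, hv, rfl⟩
      exact hv
    · intro hV
      have hV : V.conePoints = u.1.conePoints := hV
      exact ⟨⟨V, mem_stratum_of_triangle hd hw fun i => hV.ge (hz i)⟩, hV, rfl⟩
  rw [IsEmbedding.subtypeVal.closure_eq_preimage_closure_image, h3, h2]
  rfl

/-- The intersection consists of the subconics through the union of the two sets of cone points. In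
a chart this is a nonempty extreme convex set, hence the face of a form with the fewest zeros; the
cell of that form is the one sought. -/
theorem exists_openCell_inter {u u' : stratum dev 3}
    (h : (closure (openCell u) ∩ closure (openCell u')).Nonempty) :
    ∃ v, closure (openCell u) ∩ closure (openCell u') = closure (openCell v) := by
  obtain ⟨v₀, h1, h2⟩ := h
  simp only [closure_openCell hd hC hT] at h1 h2 ⊢
  obtain ⟨z, hz, hw⟩ := hasTriangle_of_stratum hd u
  set Z := u.1.conePoints ∪ u'.1.conePoints with hZ
  have hzZ : ∀ i, z i ∈ Z := fun i => Or.inl (hz i)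
  have hm : ∀ i : Fin 3, 0 < (fun _ => 1 : Fin 3 → ℝ) i := fun _ => one_pos
  obtain ⟨x, φ, hc, hO, hφ, hφ'⟩ := exists_chart hd hC hw hm hzZ (union_subset h1 h2)
  have hO' : ∀ i, (devBar dev ∘ z) i ∈ obst dev x := fun i => hO (mem_image_of_mem _ (hzZ i))
  obtain ⟨q, hq, hqe⟩ := exists_eq_faceAt hw (hT x) hO' hm
    ⟨_, (φ ⟨v₀.1, union_subset h1 h2⟩).2⟩ convex_faceAt (isExtreme_faceAt hO)
  obtain ⟨V, hV⟩ := φ.surjective ⟨q, hq⟩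
  have hVq : (φ V).1 = q := by rw [hV]
  refine ⟨⟨V.1, mem_stratum_of_triangle hd hw fun i => V.2 (hzZ i)⟩, ?_⟩
  ext v
  constructor
  · rintro ⟨k1, k2⟩
    have hv : Z ⊆ v.1.conePoints := union_subset k1 k2
    refine (hφ' ⟨v.1, hv⟩ V).1.2 ?_
    rw [hVq]
    exact (hqe.le (φ ⟨v.1, hv⟩).2).2.2.2
  · intro hv
    exact union_subset_iff.1 (V.2.trans hv)

/-- A closed cell is homeomorphic to a polytope whose faces are closed cells. -/
theorem exists_polytope_openCell (u : stratum dev 3) {n : ℕ}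
    (hn : n = cellDim u.1.conePoints.encard) :
    ∃ (P : Set (EuclideanSpace ℝ (Fin n))) (Φ : closure (openCell u) ≃ₜ P),
      IsPolytope P ∧ (interior P).Nonempty ∧
      (∀ v : closure (openCell u), (v : stratum dev 3) ∈ openCell u ↔
        (Φ v : EuclideanSpace ℝ (Fin n)) ∈ interior P) ∧
      ∀ (k : ℕ) (G : Set (EuclideanSpace ℝ (Fin n))), IsFace k P G →
        ∃ v : stratum dev 3, cellDim v.1.conePoints.encard = k ∧
          closure (openCell v) =
            (↑) '' {v : closure (openCell u) | (Φ v : EuclideanSpace ℝ (Fin n)) ∈ G} := by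
  obtain ⟨z, hz, hw⟩ := hasTriangle_of_stratum hd u
  have hm : ∀ i : Fin 3, 0 < (fun _ => 1 : Fin 3 → ℝ) i := fun _ => one_pos
  obtain ⟨x, φ, hc, hO, hφ, hφ'⟩ := exists_chart hd hC hw hm hz (subset_refl u.1.conePoints)
  have hO' : ∀ i, (devBar dev ∘ z) i ∈ obst dev x := fun i => hO (mem_image_of_mem _ (hz i))
  have hz₀ := (hφ ⟨u.1, subset_rfl⟩).2.2.2.1 rfl
  have hcard : (devBar dev '' u.1.conePoints).encard = u.1.conePoints.encard :=
    (hd.injOn_devBar_conePoints u.1).encard_image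
  obtain ⟨P, Ψ, hP, hPi, hΨ, hface⟩ := exists_polytope_faceAt hw hm (hT x) hO' hc
    (faceAt_subset (φ ⟨u.1, subset_rfl⟩).2) hz₀ (hcard ▸ hn)
  have hcl := closure_openCell hd hC hT u
  let θ : closure (openCell u) ≃ₜ {U : Subconic dev // u.1.conePoints ⊆ U.conePoints} :=
    { toFun := fun v => ⟨v.1.1, hcl.le v.2⟩
      invFun := fun U => ⟨⟨U.1, mem_stratum_of_triangle hd hw fun i => U.2 (hz i)⟩, hcl.ge U.2⟩
      left_inv := fun v => rfl
      right_inv := fun U => rfl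
      continuous_toFun := by fun_prop
      continuous_invFun := by fun_prop }
  refine ⟨P, (θ.trans φ).trans Ψ, hP, hPi, fun v => ?_, fun k G hG => ?_⟩
  · exact (hφ (θ v)).2.2.2.trans (hΨ (φ (θ v)))
  · obtain ⟨q, hq, hG'⟩ := hface k G hG
    obtain ⟨V, rfl⟩ := φ.surjective q
    have hVu : V.1 ∈ stratum dev 3 := mem_stratum_of_triangle hd hw fun i => V.2 (hz i)
    refine ⟨⟨V.1, hVu⟩, by rw [← hq, ← (hφ V).2.2.1], ?_⟩
    rw [closure_openCell hd hC hT]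
    ext v
    constructor
    · intro hv
      have hv : V.1.conePoints ⊆ v.1.conePoints := hv
      have hvu : u.1.conePoints ⊆ v.1.conePoints := V.2.trans hv
      refine ⟨⟨v, hcl.ge hvu⟩, (hG' (φ ⟨v.1, hvu⟩)).2 ?_, rfl⟩
      have h := (φ ⟨v.1, hvu⟩).2
      exact ⟨h.1, h.2.1, h.2.2.1, (hφ' ⟨v.1, hvu⟩ V).1.1 hv⟩
    · rintro ⟨v, hv, rfl⟩
      exact (hφ' (θ v) V).1.2 ((hG' (φ (θ v))).1 hv).2.2.2

/-- This supplies the cell of dimension 2. The disc required by the planar existence result is a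
small immersed disc around any point. -/
theorem exists_encard_conePoints_eq_three :
    ∃ u : stratum dev 3, u.1.conePoints.encard = 3 := by
  obtain ⟨x⟩ := (inferInstance : Nonempty X)
  obtain ⟨ρ, hρ, hρx⟩ := exists_ball_subset_star hd.isLocalHomeomorph x
  obtain ⟨q, hq, he, h3⟩ := (hT x).exists_encard_zeros_eq_three
    (fun q hq b R hR => ball_radius_le hd.isLocalHomeomorph hC hq.1.convex_sublevel
      (hd.sublevel_subset_star hq) b R hR) hρ fun a ha => by
        by_contra! h
        exact ha.2 (hρx h)
  have hx := mem_toSubconic hd hC (x := x) ⟨q, hq⟩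
  have hdev := dev_toSubconic hd hC (x := x) ⟨q, hq⟩
  have h3' : (toSubconic hd hC x ⟨q, hq⟩).conePoints.encard = 3 := by
    rw [hd.encard_conePoints hx hdev, h3]
  exact ⟨⟨_, (mem_stratum_iff hd le_rfl).2
    ⟨hasTriangle_of_isElliptic hd hx hdev he h3'.ge, h3'.ge⟩⟩, h3'⟩

theorem exists_polygonalComplex : ∃ K : PolygonalComplex (stratum dev 3),
    K.cells = {e | ∃ Z ⊆ bdry X, 3 ≤ Z.encard ∧ (cell dev Z).Nonempty ∧
      e = (↑) ⁻¹' cell dev Z} ∧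
    K.skeleton 1 = (↑) ⁻¹' stratum dev 4 ∧
    K.skeleton 0 = (↑) ⁻¹' stratum dev 5 := by
  have hT2 : T2Space (Subconic dev) := hd.t2Space_subconic
  let K : PolygonalComplex (stratum dev 3) :=
    { cells := range openCell
      dim := openCellDim
      t2 := inferInstance
      cell_nonempty := forall_mem_range.2 fun u => ⟨u, rfl⟩
      pairwiseDisjoint := by
        rintro _ ⟨u, rfl⟩ _ ⟨v, rfl⟩ h
        refine disjoint_left.2 fun w hu hv => h ?_
        have hu : w.1.conePoints = u.1.conePoints := hu
        have hv : w.1.conePoints = v.1.conePoints := hv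
        rw [openCell, openCell, ← hu, hv]
      cover := eq_univ_of_forall fun u => ⟨_, ⟨u, rfl⟩, rfl⟩
      dim_le := forall_mem_range.2 fun u => by
        rw [openCellDim_openCell]; exact cellDim_le_two _
      exists_dim := by
        obtain ⟨u, hu⟩ := exists_encard_conePoints_eq_three hd hC hT
        refine ⟨_, ⟨u, rfl⟩, ?_⟩
        rw [openCellDim_openCell, hu]
        simp [cellDim]
      polytope := forall_mem_range.2 fun u => by
        obtain ⟨P, Φ, h1, h2, h3, h4⟩ :=
          exists_polytope_openCell hd hC hT u (openCellDim_openCell u)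
        refine ⟨P, Φ, h1, h2, h3, fun k G hG => ?_⟩
        obtain ⟨v, hv, h⟩ := h4 k G hG
        exact ⟨_, ⟨v, rfl⟩, by rw [openCellDim_openCell, hv], h⟩
      inter := by
        rintro _ ⟨u, rfl⟩ _ ⟨v, rfl⟩ h
        obtain ⟨w, hw⟩ := exists_openCell_inter hd hC hT h
        exact ⟨_, ⟨w, rfl⟩, hw⟩ }
  have hskel : ∀ k (u : stratum dev 3),
      u ∈ K.skeleton k ↔ cellDim u.1.conePoints.encard ≤ k := by
    intro k u
    constructor
    · rintro ⟨_, ⟨⟨v, rfl⟩, hk⟩, hu⟩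
      have hk : openCellDim (openCell v) ≤ k := hk
      have hu : u.1.conePoints = v.1.conePoints := hu
      rwa [openCellDim_openCell, ← hu] at hk
    · intro h
      refine ⟨openCell u, ⟨⟨u, rfl⟩, ?_⟩, rfl⟩
      show openCellDim (openCell u) ≤ k
      rwa [openCellDim_openCell]
  refine ⟨K, (setOf_cell_eq_range_openCell hd hT).symm, ?_, ?_⟩
  · ext u
    rw [hskel, cellDim_le_one u.2.1, mem_preimage, mem_stratum_iff hd (by norm_num)]
    exact ⟨fun h => ⟨hasTriangle_of_stratum hd u, h⟩, fun h => h.2⟩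
  · ext u
    rw [hskel, nonpos_iff_eq_zero, cellDim_eq_zero u.2.1, mem_preimage,
      mem_stratum_iff hd (by norm_num)]
    exact ⟨fun h => ⟨hasTriangle_of_stratum hd u, h⟩, fun h => h.2⟩

end Complex

end TranslationSurface

/-! ### The theorem -/

open TranslationSurface in
theorem mainTheorem3 {X Y : Type*}
    [TopologicalSpace X] [T2Space X] [SimplyConnectedSpace X]
    [ChartedSpace Plane X] [TranslationAtlas X]
    [TopologicalSpace Y] [T2Space Y] [ChartedSpace Plane Y] [TranslationAtlas Y]
    (p : X → Y) (hp_cov : IsCoveringMap p) (hp_surj : Function.Surjective p)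
    (hp_trans : IsTranslationMap p)
    (hY_precompact : Precompact Y) (hY_finite : (bdry Y).Finite) (hY_nonempty : (bdry Y).Nonempty)
    (hX_discrete : DiscreteTopology (bdry X))
    (dev : X → Plane) (hdev : IsDevelopingMap dev) :
    (∀ Z : Set (Bar X), DefinesNGon dev 3 Z →
      ∀ w : Fin 3 → Bar X, range w = Z →
      ∀ d : Fin 3 → Q3, IsNegativeNaturalBasis (fun i => devBar dev (w i)) d →
      let f : Subconic dev → Q3 := cellMap dev d
      let P : Set Q3 := f '' closure (cell dev Z)
      -- `f` is well defined and is a homeomorphism onto its image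
      (∀ U ∈ closure (cell dev Z), f U ∈ formPlane d ∧ sublevel (f U) = dev '' U.1) ∧
      IsEmbedding (fun U : closure (cell dev Z) => f U) ∧
      -- the image is a compact convex polygon with finitely many sides
      IsPolytope P ∧ IsCompact P ∧ Convex ℝ P ∧ {E | IsFace 1 P E}.Finite ∧
      -- nondegeneracy of the polygon, and the meaning of the closure
      ((cell dev Z).Nonempty →
        affineSpan ℝ P = formPlane d ∧
        intrinsicInterior ℝ P = f '' cell dev Z ∧
        closure (cell dev Z) = {U | Z ⊆ U.conePoints}) ∧
      -- the sides
      (∀ E : Set Q3, IsFace 1 P E ↔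
        ∃ Z' : Set (Bar X), Z ⊆ Z' ∧ DefinesNGon dev 4 Z' ∧ (cell dev Z').Nonempty ∧
          E = f '' closure (cell dev Z')) ∧
      -- the vertices
      extremePoints ℝ P =
        f '' {U | U ∈ closure (cell dev Z) ∧ IsRigid dev U ∧ Z ⊆ U.conePoints} ∧
      -- incidence of vertices and sides
      (∀ U ∈ closure (cell dev Z), IsRigid dev U →
        ∀ Z' : Set (Bar X), Z ⊆ Z' → DefinesNGon dev 4 Z' → (cell dev Z').Nonempty →
          (f U ∈ f '' closure (cell dev Z') ↔ Z' ⊆ U.conePoints))) ∧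
    ∃ C : PolygonalComplex (stratum dev 3),
      C.cells = {e | ∃ Z ⊆ bdry X, 3 ≤ Z.encard ∧ (cell dev Z).Nonempty ∧
        e = (↑) ⁻¹' cell dev Z} ∧
      C.skeleton 1 = (↑) ⁻¹' stratum dev 4 ∧
      C.skeleton 0 = (↑) ⁻¹' stratum dev 5 := by
  obtain ⟨C, hC⟩ := exists_radius_bound hdev hp_trans hp_cov hp_surj hY_precompact hY_nonempty
  have hT := tame_obst hdev hp_trans hp_cov hY_precompact hX_discrete hC
  refine ⟨fun Z h3 w hwZ d hnb => ?_, exists_polygonalComplex hdev hC hT⟩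
  intro f P
  have h3' : DefinesNGon dev 3 (range w) := hwZ.symm ▸ h3
  by_cases hne : (cell dev Z).Nonempty
  · obtain ⟨h1, h2, ⟨p1, p2, p3, p4⟩, h4, h5, h6, h7⟩ :=
      isPolygon_closure_cell hdev hC hT h3' hnb hwZ rfl hne
    exact ⟨h1, h2, p1, p2, p3, p4, fun _ => h4, h5, h6,
      fun U hU _ Z' hZ' _ hne' => h7 U hU Z' hZ' hne'⟩
  -- With an empty open cell the polygon is empty, and the claims about faces must be seen to be
  -- vacuous.
  · have hempty : cell dev Z = ∅ := not_nonempty_iff_eq_empty.1 hne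
    have hcl : closure (cell dev Z) = ∅ := by rw [hempty, closure_empty]
    have hP : P = ∅ := by
      show f '' closure (cell dev Z) = ∅
      rw [hcl, image_empty]
    have hface : ∀ E, ¬ IsFace 1 (∅ : Set Q3) E := fun E hE =>
      (hE.1.mono hE.2.2.1.1).ne_empty rfl
    have : IsEmpty (closure (cell dev Z)) := by rw [hcl]; infer_instance
    rw [hP]
    refine ⟨fun U hU => (hcl.le hU).elim, ⟨⟨Subsingleton.elim _ _⟩, fun U => isEmptyElim U⟩,
      ⟨∅, finite_empty, by simp⟩, isCompact_empty, convex_empty, ?_, fun h => (hne h).elim,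
      fun E => ⟨fun hE => (hface E hE).elim, ?_⟩, ?_, fun U hU => (hcl.le hU).elim⟩
    · simp [hface]
    -- A subconic with four cone points including the triangle could be perturbed into the empty
    -- cell.
    · rintro ⟨Z', hZ', h4, ⟨V, hV⟩, -⟩
      obtain rfl : V.conePoints = Z' := hV.1
      exact (hne (hwZ ▸ cell_nonempty_of_encard_eq_four hdev hC hT h3'.affineIndependent
        (hwZ.symm ▸ hZ') h4.2.1)).elim
    · simp [hcl]
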